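/- Let $M$ be a finite-dimensional smooth (Hausdorff) manifold with a smooth affine connection $\nabla$ with torsion $T(X,Y)=\nabla_XY-\nabla_YX-[X,Y]$, let $o\in M$, let $\tau>0$, and let $u_t$, $t\in[0,\tau]$, be a smooth time-dependent vector field on $M$. Let $\mathfrak e\subseteq T_oM$ be a linear subspace with an inner product such that every element of the holonomy group of $\nabla$ at $o$ maps $\mathfrak e$ into itself and preserves this inner product. Let $E$ be the subbundle of $TM$ obtained from $\mathfrak e$ by parallel transport (along piecewise smooth curves from $o$). Let $\sigma_{1,t},\dots,\sigma_{J,t}\in\mathfrak e$, $t\in[0,\tau]$, be smooth in $t$, and assume that for every $t$ the map $\Sigma_t:\mathfrak e\to\mathfrak e$, $\Sigma_tv=\sum_j\langle\sigma_{j,t},v\rangle\sigma_{j,t}$, has image $\mathfrak e$; let $\Sigma_t^{1/2}$ be its positive square root. Let $\mathbb H$ be the Cameron–Martin Hilbert space of absolutely continuous curves $\omega:[0,\tau]\to\mathfrak e$ with $\omega_0=0$ and $\dot\omega\in L^2$, with inner product $\int_0^\tau\langle\dot\omega_t,\dot k_t\rangle\,dt$. For $\omega\in\mathbb H$ consider the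 equation $$\dot\gamma_t=/\!/_t\Sigma_t^{1/2}\dot\omega_t+u_t(\gamma_t)\ \text{ for almost every } t\in[0,\tau],\qquad\gamma_0=o,\qquad(*)$$ where $/\!/_t:T_oM\to T_{\gamma_t}M$ is parallel transport along $\gamma$, and let $\Pi(\omega)=\gamma_\tau$ be the endpoint map, defined for those $\omega\in\mathbb H$ for which $(*)$ has a solution on all of $[0,\tau]$ (all of $\mathbb H$ under the usual completeness assumptions). Call $\omega$ regular if $\Pi$ is differentiable at $\omega$ with surjective differential $\mathbb H\to T_{\Pi(\omega)}M$, and singular otherwise. A curve $\gamma$ is called singular if it is the solution of $(*)$ for a singular $\omega$. Let $\gamma:[0,\tau]\to M$ be an absolutely continuous curve with square-integrable derivative and $\gamma_0=o$. Then $\gamma$ is singular if and only if both of the following hold: 1. $\dot\gamma_t-u_t(\gamma_t)\in E_{\gamma_t}$ for almost every $t\in[0,\tau]$; 2. there is an absolutely continuous one-form $\lambda_t\in T^*_{\gamma_t}M$ along $\gamma$ with $\lambda_t\neq0$ and $\lambda_t|_{E_{\gamma_t}}=0$ for every $t\in[0,\tau]$, such that for almost every $t\in[0,\tau]$ $$\frac{D}{dt}\lambda_t+\lambda_t(\nabla_{\,\cdot\,}u_t)+\lambda_t\big(T(\dot\gamma_t,\cdot)\big)=0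 .$$ -/

import Mathlib

open Set MeasureTheory Filter Topology Bundle
open scoped Manifold ContDiff

noncomputable section

namespace AffineDev

/-! ### The Cameron-Martin space -/

section CameronMartin

variable {𝔢 : Type*} [NormedAddCommGroup 𝔢] [InnerProductSpace ℝ 𝔢]

/-- The Cameron-Martin Hilbert space of absolutely continuous curves `ω : [0, T] → 𝔢` with `ω 0 = 0`
and square integrable derivative, with `⟨ω, k⟩ = ∫₀ᵀ ⟨ω' t, k' t⟩ dt`. A curve `ω` is represented by
its derivative `η = ω'`, an element of `L²([0, T]; 𝔢)`; the curve itself is `path η`. -/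
abbrev CameronMartin (T : ℝ) (𝔢 : Type*) [NormedAddCommGroup 𝔢] [InnerProductSpace ℝ 𝔢] : Type _ :=
  Lp 𝔢 2 (volume.restrict (Icc (0 : ℝ) T))

/-- The curve `ω` represented by `η = ω'`. -/
def CameronMartin.path {T : ℝ} (η : CameronMartin T 𝔢) (t : ℝ) : 𝔢 := ∫ s in (0 : ℝ)..t, η s

theorem CameronMartin.intervalIntegrable {T : ℝ} (hT : 0 ≤ T) (η : CameronMartin T 𝔢) :
    IntervalIntegrable η volume 0 T := by
  rw [intervalIntegrable_iff_integrableOn_Icc_of_le hT]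
  exact (Lp.memLp η).integrable (by norm_num)

theorem absolutelyContinuous_integral {f : ℝ → 𝔢} {T : ℝ} (hi : IntervalIntegrable f volume 0 T) :
    AbsolutelyContinuousOnInterval (fun t ↦ ∫ s in (0 : ℝ)..t, f s) 0 T := by
  have h1 := hi.norm.absolutelyContinuousOnInterval_intervalIntegral (c := 0) (by simp)
  rw [absolutelyContinuousOnInterval_iff] at h1 ⊢
  intro ε hε
  obtain ⟨δ, hδ, h⟩ := h1 ε hε
  refine ⟨δ, hδ, fun E hE hlen ↦ (Finset.sum_le_sum fun i hi' ↦ ?_).trans_lt (h E hE hlen)⟩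
  obtain ⟨ha, hb⟩ := hE.1 i hi'
  have sub : ∀ x ∈ uIcc 0 T, IntervalIntegrable f volume 0 x := fun x hx ↦
    hi.mono_set (uIcc_subset_uIcc_left hx)
  rw [dist_eq_norm, Real.dist_eq,
    intervalIntegral.integral_interval_sub_left (sub _ ha) (sub _ hb),
    intervalIntegral.integral_interval_sub_left (sub _ ha).norm (sub _ hb).norm]
  exact intervalIntegral.norm_integral_le_abs_integral_norm

/-- The curves represented by `CameronMartin T 𝔢` are exactly the absolutely continuous curves that
start at `0` and have a square integrable derivative. -/
theorem CameronMartin.exists_path_iff [FiniteDimensional ℝ 𝔢] {T : ℝ} (hT : 0 ≤ T) (f : ℝ → 𝔢) :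
    (∃ η : CameronMartin T 𝔢, EqOn f η.path (Icc 0 T)) ↔
      AbsolutelyContinuousOnInterval f 0 T ∧ f 0 = 0 ∧
        MemLp (deriv f) 2 (volume.restrict (Icc 0 T)) := by
  constructor
  · rintro ⟨η, hη⟩
    have hi := η.intervalIntegrable hT
    have hac : AbsolutelyContinuousOnInterval f 0 T := by
      have h1 := absolutelyContinuous_integral hi
      rw [absolutelyContinuousOnInterval_iff] at h1 ⊢
      intro ε hε
      obtain ⟨δ, hδ, h⟩ := h1 ε hε
      refine ⟨δ, hδ, fun E hE hlen ↦ (Finset.sum_le_sum fun i hi' ↦ ?_).trans_lt (h E hE hlen)⟩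
      obtain ⟨ha, hb⟩ := hE.1 i hi'
      rw [uIcc_of_le hT] at ha hb
      rw [hη ha, hη hb]
      rfl
    refine ⟨hac, by rw [hη ⟨le_rfl, hT⟩]; simp [CameronMartin.path], ?_⟩
    refine (Lp.memLp η).ae_eq ?_
    rw [Filter.EventuallyEq, ae_restrict_iff' measurableSet_Icc]
    filter_upwards [hi.ae_hasDerivAt_integral, Measure.ae_ne volume 0, Measure.ae_ne volume T]
      with t ht ht0 htT htm'
    have htm : t ∈ Ioo 0 T := ⟨htm'.1.lt_of_ne' ht0, htm'.2.lt_of_ne htT⟩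
    have h2 := ht (by rw [uIcc_of_le hT]; exact Ioo_subset_Icc_self htm) 0 (by simp)
    refine ((h2.congr_of_eventuallyEq ?_).deriv).symm
    filter_upwards [Ioo_mem_nhds htm.1 htm.2] with s hs
    exact hη (Ioo_subset_Icc_self hs)
  · rintro ⟨hac, h0, hL⟩
    have hi : IntervalIntegrable (deriv f) volume 0 T := by
      rw [intervalIntegrable_iff_integrableOn_Icc_of_le hT]
      exact hL.integrable (by norm_num)
    let η : CameronMartin T 𝔢 := hL.toLp _
    have hcongr : ∀ t ∈ Icc 0 T, η.path t = ∫ s in (0 : ℝ)..t, deriv f s := by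
      intro t ht
      refine intervalIntegral.integral_congr_ae ?_
      have := (ae_restrict_iff' measurableSet_Icc).1 hL.coeFn_toLp
      filter_upwards [this] with s hs hsm
      rw [uIoc_of_le ht.1] at hsm
      exact hs ⟨hsm.1.le, hsm.2.trans ht.2⟩
    obtain ⟨C, hC⟩ := (hac.sub (absolutelyContinuous_integral hi)).const_of_ae_hasDerivAt_zero (by
      filter_upwards [hi.ae_hasDerivAt_integral,
        hac.boundedVariationOn.ae_differentiableAt_of_mem_uIcc] with t ht hd htm
      simpa using (hd htm).hasDerivAt.sub (ht htm 0 (by simp)))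
    have hC0 := hC 0 (by simp)
    simp only [Pi.sub_apply, h0, intervalIntegral.integral_same, sub_zero] at hC0
    refine ⟨η, fun t ht ↦ ?_⟩
    have := hC t (by rwa [uIcc_of_le hT])
    rw [hcongr t ht]
    rw [← hC0] at this
    simpa [sub_eq_zero] using this

end CameronMartin

/-! ### The square root of the covariance -/

section SquareRoot

variable {𝔢 : Type*} [NormedAddCommGroup 𝔢] [InnerProductSpace ℝ 𝔢]

/-- The covariance operator `Σ_t v = ∑ j, ⟨σ_{j,t}, v⟩ σ_{j,t}`. -/
def covariance {J : ℕ} (σ : Fin J → ℝ → 𝔢) (t : ℝ) : 𝔢 →L[ℝ] 𝔢 :=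
  ∑ j, InnerProductSpace.rankOne ℝ (σ j t) (σ j t)

theorem covariance_isPositive {J : ℕ} (σ : Fin J → ℝ → 𝔢) (t : ℝ) : (covariance σ t).IsPositive :=
  ContinuousLinearMap.isPositive_sum _ fun _ _ ↦ InnerProductSpace.isPositive_rankOne_self _

variable [FiniteDimensional ℝ 𝔢]

/-- The positive square root of a positive operator. -/
def posSqrt {A : 𝔢 →L[ℝ] 𝔢} (hA : A.IsPositive) : 𝔢 →L[ℝ] 𝔢 :=
  ∑ i, √(hA.isSymmetric.eigenvalues rfl i) •
    InnerProductSpace.rankOne ℝ (hA.isSymmetric.eigenvectorBasis rfl i)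
      (hA.isSymmetric.eigenvectorBasis rfl i)

theorem posSqrt_isPositive {A : 𝔢 →L[ℝ] 𝔢} (hA : A.IsPositive) : (posSqrt hA).IsPositive :=
  ContinuousLinearMap.isPositive_sum _ fun _ _ ↦
    (InnerProductSpace.isPositive_rankOne_self _).smul_of_nonneg (Real.sqrt_nonneg _)

theorem posSqrt_comp_self {A : 𝔢 →L[ℝ] 𝔢} (hA : A.IsPositive) :
    posSqrt hA ∘L posSqrt hA = A := by
  set b := hA.isSymmetric.eigenvectorBasis rfl with hb
  have key : ∀ i, posSqrt hA (b i) = √(hA.isSymmetric.eigenvalues rfl i) • b i := by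
    intro i
    simp only [posSqrt, _root_.sum_apply, _root_.smul_apply, InnerProductSpace.rankOne_apply]
    rw [Finset.sum_eq_single i]
    · simp [← hb]
    · intro j _ hji
      simp [← hb, b.inner_eq_zero hji]
    · simp
  refine ContinuousLinearMap.coe_injective (b.toBasis.ext fun i ↦ ?_)
  have := hA.isSymmetric.apply_eigenvectorBasis rfl i
  simp only [OrthonormalBasis.coe_toBasis, ContinuousLinearMap.coe_coe,
    ContinuousLinearMap.comp_apply, key, map_smul, smul_smul]
  rw [Real.mul_self_sqrt (hA.toLinearMap.nonneg_eigenvalues rfl i)]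
  exact this.symm

/-- `Σ_t^{1/2}`. -/
def sqrtCovariance {J : ℕ} (σ : Fin J → ℝ → 𝔢) (t : ℝ) : 𝔢 →L[ℝ] 𝔢 :=
  posSqrt (covariance_isPositive σ t)

end SquareRoot

/-! ### Curves and parallel transport -/

section Curves

variable {F : Type*} [NormedAddCommGroup F] [NormedSpace ℝ F]
  {M : Type*} [TopologicalSpace M] [ChartedSpace F M]

/-- The velocity `γ'(t)`. -/
def velocity (γ : ℝ → M) (t : ℝ) : TangentSpace 𝓘(ℝ, F) (γ t) :=
  mfderiv 𝓘(ℝ, ℝ) 𝓘(ℝ, F) γ t (1 : ℝ)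

variable (F) in
/-- `γ` restricted to `[a, b]` is an absolutely continuous curve with square integrable derivative:
this holds in each chart, on each subinterval that `γ` maps into the domain of the chart. -/
def IsH1Curve (γ : ℝ → M) (a b : ℝ) : Prop :=
  ContinuousOn γ (Icc a b) ∧
    ∀ (x₀ : M) (c d : ℝ), c ≤ d → Icc c d ⊆ Icc a b → MapsTo γ (Icc c d) (chartAt F x₀).source →
      AbsolutelyContinuousOnInterval (fun t ↦ chartAt F x₀ (γ t)) c d ∧
        MemLp (deriv fun t ↦ chartAt F x₀ (γ t)) 2 (volume.restrict (Icc c d))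

variable (F) in
/-- `γ` restricted to `[a, b]` is a piecewise smooth curve. -/
def IsPiecewiseSmooth (γ : ℝ → M) (a b : ℝ) : Prop :=
  ∃ (n : ℕ) (τ : Fin (n + 1) → ℝ), Monotone τ ∧ τ 0 = a ∧ τ (Fin.last n) = b ∧
    ∀ i : Fin n, ContMDiffOn 𝓘(ℝ, ℝ) 𝓘(ℝ, F) ∞ γ (Icc (τ i.castSucc) (τ i.succ))

variable [IsManifold 𝓘(ℝ, F) ∞ M]
  (cov : CovariantDerivative 𝓘(ℝ, F) F (TangentSpace 𝓘(ℝ, F) : M → Type _))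

/-- The vector field `V` along `γ` is parallel on `[a, b]`. In the trivialization of `TM` over a
chart, with `w = ∑ wⁱ ∂ᵢ` the coordinate expression of `V`, this says that `w` is absolutely
continuous and that `dw/dt + ∑ wⁱ ∇_{γ'} ∂ᵢ = 0` almost everywhere. -/
def IsParallelAlong (γ : ℝ → M) (a b : ℝ) (V : ∀ t, TangentSpace 𝓘(ℝ, F) (γ t)) : Prop :=
  ∀ (x₀ : M) (c d : ℝ), c ≤ d → Icc c d ⊆ Icc a b → MapsTo γ (Icc c d) (chartAt F x₀).source →
    let e := trivializationAt F (TangentSpace 𝓘(ℝ, F)) x₀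
    let w : ℝ → F := fun t ↦ e.continuousLinearMapAt ℝ (γ t) (V t)
    AbsolutelyContinuousOnInterval w c d ∧
      ∀ᵐ t ∂(volume.restrict (Icc c d)),
        HasDerivAt w
          (-e.continuousLinearMapAt ℝ (γ t)
            (cov (fun x ↦ e.symmL ℝ x (w t)) (γ t) (velocity γ t))) t

/-- `γ 0 = o`, and `P t : T_o M → T_{γ t} M`, `t ∈ [0, T]`, is the parallel transport along `γ`. -/
def IsParallelTransport (o : M) (T : ℝ) (γ : ℝ → M)
    (P : ∀ t, TangentSpace 𝓘(ℝ, F) o →L[ℝ] TangentSpace 𝓘(ℝ, F) (γ t)) : Prop :=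
  γ 0 = o ∧
    ∀ v, (⟨γ 0, P 0 v⟩ : TangentBundle 𝓘(ℝ, F) M) = ⟨o, v⟩ ∧
      IsParallelAlong cov γ 0 T fun t ↦ P t v

/-- `h` is an element of the holonomy group of `∇` at `o`: the parallel transport along a
piecewise smooth loop based at `o`. -/
def IsHolonomy (o : M) (h : TangentSpace 𝓘(ℝ, F) o →L[ℝ] TangentSpace 𝓘(ℝ, F) o) : Prop :=
  ∃ (c : ℝ → M) (P : ∀ t, TangentSpace 𝓘(ℝ, F) o →L[ℝ] TangentSpace 𝓘(ℝ, F) (c t)),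
    IsPiecewiseSmooth F c 0 1 ∧ IsParallelTransport cov o 1 c P ∧
      ∀ v, (⟨c 1, P 1 v⟩ : TangentBundle 𝓘(ℝ, F) M) = ⟨o, h v⟩

/-- The one-form `lam` along `γ : [0, T] → M` is absolutely continuous with covariant derivative
`D lam / dt = Dlam` almost everywhere: in a parallel frame along `γ`, the components of `lam` are
absolutely continuous and their derivatives are the components of `Dlam`. -/
def HasCovariantDerivAlong (o : M) (T : ℝ) (γ : ℝ → M)
    (lam Dlam : ∀ t, TangentSpace 𝓘(ℝ, F) (γ t) →L[ℝ] ℝ) : Prop :=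
  ∃ P : ∀ t, TangentSpace 𝓘(ℝ, F) o →L[ℝ] TangentSpace 𝓘(ℝ, F) (γ t),
    IsParallelTransport cov o T γ P ∧
      ∀ v, AbsolutelyContinuousOnInterval (fun t ↦ lam t (P t v)) 0 T ∧
        ∀ᵐ t ∂(volume.restrict (Icc 0 T)),
          HasDerivAt (fun s ↦ lam s (P s v)) (Dlam t (P t v)) t

/-! ### The subbundle `E`, affine development and singular curves -/

variable {𝔢 : Type*} [NormedAddCommGroup 𝔢] [InnerProductSpace ℝ 𝔢]
  {o : M} (ι : 𝔢 →L[ℝ] TangentSpace 𝓘(ℝ, F) o)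

/-- Every element of the holonomy group at `o` maps the subspace `ι(𝔢)` of `T_o M` into itself and
preserves its inner product. -/
def HolonomyPreserves : Prop :=
  ∀ h, IsHolonomy cov o h → ∃ L : 𝔢 →ₗᵢ[ℝ] 𝔢, ∀ v, h (ι v) = ι (L v)

/-- The fiber `E_x` of the subbundle obtained from `ι(𝔢)` by parallel transport along piecewise
smooth curves from `o` to `x`. -/
def fiberE (x : M) : Set (TangentSpace 𝓘(ℝ, F) x) :=
  {z | ∃ (c : ℝ → M) (P : ∀ t, TangentSpace 𝓘(ℝ, F) o →L[ℝ] TangentSpace 𝓘(ℝ, F) (c t)) (v : 𝔢),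
    IsPiecewiseSmooth F c 0 1 ∧ IsParallelTransport cov o 1 c P ∧
      (⟨c 1, P 1 (ι v)⟩ : TangentBundle 𝓘(ℝ, F) M) = ⟨x, z⟩}

variable [FiniteDimensional ℝ 𝔢] {J : ℕ} (σ : Fin J → ℝ → 𝔢)
  (u : ℝ → ∀ x : M, TangentSpace 𝓘(ℝ, F) x) (T : ℝ)

/-- `γ : [0, T] → M` is the solution of `γ' = //_t Σ_t^{1/2} ω'_t + u_t(γ)`, `γ 0 = o`, where `//_t`
is the parallel transport along `γ` and `η = ω'`. -/
def IsSolution (η : CameronMartin T 𝔢) (γ : ℝ → M) : Prop :=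
  IsH1Curve F γ 0 T ∧
    ∃ P : ∀ t, TangentSpace 𝓘(ℝ, F) o →L[ℝ] TangentSpace 𝓘(ℝ, F) (γ t),
      IsParallelTransport cov o T γ P ∧
        ∀ᵐ t ∂(volume.restrict (Icc 0 T)),
          velocity γ t = P t (ι (sqrtCovariance σ t (η t))) + u t (γ t)

open Classical in
/-- The endpoint map `Π(ω) = γ_T`. Its domain is the set of all `ω` for which the solution `γ`
exists on all of `[0, T]` (the whole Cameron-Martin space under the usual completeness
assumptions); the value elsewhere is irrelevant. -/
def endpointMap (η : CameronMartin T 𝔢) : M :=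
  if h : ∃ γ, IsSolution cov ι σ u T η γ then h.choose T else o

/-- `ω` is a regular point of the endpoint map. -/
def IsRegularPoint (η : CameronMartin T 𝔢) : Prop :=
  MDifferentiableAt 𝓘(ℝ, CameronMartin T 𝔢) 𝓘(ℝ, F) (endpointMap cov ι σ u T) η ∧
    Function.Surjective (mfderiv 𝓘(ℝ, CameronMartin T 𝔢) 𝓘(ℝ, F) (endpointMap cov ι σ u T) η)

/-- The curve `γ` is singular: it is the solution for a singular (that is, not regular) `ω`. -/
def IsSingularCurve (γ : ℝ → M) : Prop :=
  ∃ η : CameronMartin T 𝔢, IsSolution cov ι σ u T η γ ∧ ¬ IsRegularPoint cov ι σ u T η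

end Curves

end AffineDev

end

/-! Everything is read in a parallel frame. Let `γ` solve the equation for `ω`, let `P` be the
parallel transport along `γ`, and vary `ω` in the direction `k`. Write the variation of the curve as
`P z` and the covariant variation of the frame as `P K`. Then `z' = ι Σ^{1/2} k' + K ι Σ^{1/2} ω' +
B z` and `K' = C z` with zero initial values, where `P B = (∇u + T(γ', ·)) P` and `P C z = R(γ', P
z) P`. Up to the isomorphism `P_T`, the differential of the endpoint map is `k ↦ z_T`.

The holonomy hypothesis tames `K`. For every control the frame carries `𝔢` into `E`. Hence for `s ∈
𝔢`, at a fixed time, the vectors `P s` belonging to the controls `ω + r k` form a section of `E`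
along a curve in `M`. Since `E` is invariant under parallel transport, the covariant derivative `P K
s` of this section is in `E`, so `K` maps `𝔢` into itself (`IsVariation.apply_mem`). As `Σ^{1/2}` is
invertible on `𝔢`, the image of the differential is the reachable space of the linear control system
`z' = v + B z` with `v` an arbitrary square integrable function into `𝔢`.

Duality finishes the argument. If `μ' = -μ B`, then `d/dt μ(z) = μ(v)`. A covector therefore
annihilates the reachable space exactly when its backward transport `μ` annihilates `𝔢` at all times
(`exists_covector` and `IsVariation.covector_apply_eq_zero`). In terms of `λ = μ P⁻¹` this is the
adjoint equation with torsion, and a solution of that linear equation that is nonzero at one time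
never vanishes. The first condition of the theorem says that `γ` solves the equation for some
control, which is found by reading `γ' - u` in the frame and applying `Σ^{-1/2}`
(`exists_isDevelopment`).

The analytic work comes from the low regularity of the controls. The system for `(γ, P)` has
coefficients that are only integrable in time; its flow on short intervals is differentiated by the
implicit function theorem in spaces of continuous functions, with the control in `L¹`
(`exists_local_flow`), and the derivatives are chained through charts (`FlowDeriv.step`,
`exists_transportsVariation`). Moreover `E` is defined by piecewise smooth curves while solutions
are only absolutely continuous; `MapsToE.transport` bridges this by approximating velocities in `L¹`
by smooth ones and using that fibers of `E` are closed. -/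

noncomputable section

namespace AffineDev

/-! ### Absolutely continuous functions with a prescribed derivative -/

section ACDeriv

variable {G H : Type*} [NormedAddCommGroup G] [NormedSpace ℝ G]
  [NormedAddCommGroup H] [NormedSpace ℝ H]

/-- A property of intervals that holds for all short intervals and is stable under concatenation
holds for every interval. -/
theorem interval_induction {p : ℝ → ℝ → Prop} {a b : ℝ} (hab : a ≤ b)
    (hloc : ∀ t ∈ Icc a b, ∃ ε > 0, ∀ c d, c ≤ d → c ∈ Icc a b → d ∈ Icc a b →
      |c - t| < ε → |d - t| < ε → p c d)
    (hglue : ∀ c m d, c ≤ m → m ≤ d → c ∈ Icc a b → d ∈ Icc a b → p c m → p m d → p c d) :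
    p a b := by
  choose! ε hε h using hloc
  obtain ⟨t, h0, hmono, ⟨n, hn⟩, hsub⟩ := exists_monotone_Icc_subset_open_cover_Icc hab
    (c := fun i : Icc a b ↦ {s : Icc a b | |(s : ℝ) - i| < ε i})
    (fun i ↦ isOpen_lt (by fun_prop) continuous_const)
    (fun s _ ↦ mem_iUnion.2 ⟨s, by simpa using hε s s.2⟩)
  have key : ∀ k, p a (t k) := by
    intro k
    induction k with
    | zero =>
      rw [h0]
      exact h a ⟨le_rfl, hab⟩ a a le_rfl ⟨le_rfl, hab⟩ ⟨le_rfl, hab⟩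
        (by simpa using hε a ⟨le_rfl, hab⟩) (by simpa using hε a ⟨le_rfl, hab⟩)
    | succ k ih =>
      obtain ⟨i, hi⟩ := hsub k
      have hk := hmono (Nat.le_succ k)
      exact hglue _ _ _ (t k).2.1 hk ⟨le_rfl, hab⟩ (t (k + 1)).2 ih
        (h i i.2 _ _ hk (t k).2 (t (k + 1)).2 (hi ⟨le_rfl, hk⟩) (hi ⟨hk, le_rfl⟩))
  have := key n
  rwa [hn n le_rfl] at this

/-- `f` is a primitive of the integrable function `f'` on `[a, b]`. -/
def HasACDeriv (f f' : ℝ → G) (a b : ℝ) : Prop :=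
  IntervalIntegrable f' volume a b ∧ ∀ t ∈ Icc a b, f t = f a + ∫ s in a..t, f' s

/-- Increments of the vector-valued primitive are dominated by those of the primitive of the norm,
which reduces the claim to real-valued functions. -/
theorem absolutelyContinuous_primitive {f : ℝ → G} {a b c : ℝ} (hc : c ∈ uIcc a b)
    (hi : IntervalIntegrable f volume a b) :
    AbsolutelyContinuousOnInterval (fun t ↦ ∫ s in c..t, f s) a b := by
  have h1 := hi.norm.absolutelyContinuousOnInterval_intervalIntegral (c := c) hc
  rw [absolutelyContinuousOnInterval_iff] at h1 ⊢
  intro ε hε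
  obtain ⟨δ, hδ, h⟩ := h1 ε hε
  refine ⟨δ, hδ, fun E hE hlen ↦ (Finset.sum_le_sum fun i hi' ↦ ?_).trans_lt (h E hE hlen)⟩
  obtain ⟨ha, hb⟩ := hE.1 i hi'
  have sub : ∀ x ∈ uIcc a b, IntervalIntegrable f volume c x := fun x hx ↦
    hi.mono_set (uIcc_subset_uIcc hc hx)
  rw [dist_eq_norm, Real.dist_eq,
    intervalIntegral.integral_interval_sub_left (sub _ ha) (sub _ hb),
    intervalIntegral.integral_interval_sub_left (sub _ ha).norm (sub _ hb).norm]
  exact intervalIntegral.norm_integral_le_abs_integral_norm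

theorem ac_congr {X : Type*} [PseudoMetricSpace X] {f g : ℝ → X}
    {a b : ℝ} (hf : AbsolutelyContinuousOnInterval f a b) (h : EqOn f g (uIcc a b)) :
    AbsolutelyContinuousOnInterval g a b := by
  rw [absolutelyContinuousOnInterval_iff] at hf ⊢
  intro ε hε
  obtain ⟨δ, hδ, h1⟩ := hf ε hε
  refine ⟨δ, hδ, fun E hE hlen ↦ lt_of_eq_of_lt (Finset.sum_congr rfl fun i hi ↦ ?_) (h1 E hE hlen)⟩
  rw [h (hE.1 i hi).1, h (hE.1 i hi).2]

theorem ac_lipschitz_comp {X Y : Type*} [PseudoMetricSpace X]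
    [PseudoMetricSpace Y] {f : ℝ → X} {Θ : X → Y} {K : NNReal} {s : Set X} {a b : ℝ}
    (hf : AbsolutelyContinuousOnInterval f a b) (hΘ : LipschitzOnWith K Θ s)
    (hs : ∀ t ∈ uIcc a b, f t ∈ s) : AbsolutelyContinuousOnInterval (fun t ↦ Θ (f t)) a b := by
  rw [absolutelyContinuousOnInterval_iff] at hf ⊢
  intro ε hε
  obtain ⟨δ, hδ, h1⟩ := hf (ε / (K + 1)) (by positivity)
  refine ⟨δ, hδ, fun E hE hlen ↦ ?_⟩
  have h2 := h1 E hE hlen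
  calc _ ≤ ∑ i ∈ Finset.range E.1, (K + 1) * dist (f (E.2 i).1) (f (E.2 i).2) := by
        refine Finset.sum_le_sum fun i hi ↦ ?_
        refine (hΘ.dist_le_mul _ (hs _ (hE.1 i hi).1) _ (hs _ (hE.1 i hi).2)).trans ?_
        gcongr
        simp
    _ < ε := by
        rw [← Finset.mul_sum]
        calc _ < ((K : ℝ) + 1) * (ε / (K + 1)) := by gcongr
          _ = ε := by field_simp

theorem ae_Icc_iff_ae_uIcc {p : ℝ → Prop} {a b : ℝ} (hab : a ≤ b) :
    (∀ᵐ t ∂(volume.restrict (Icc a b)), p t) ↔ ∀ᵐ t, t ∈ uIcc a b → p t := by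
  rw [uIcc_of_le hab, ae_restrict_iff' measurableSet_Icc]

namespace HasACDeriv

variable {f f' g g' : ℝ → G} {a b c d : ℝ}

theorem ac (h : HasACDeriv f f' a b) (hab : a ≤ b) : AbsolutelyContinuousOnInterval f a b := by
  refine ac_congr (f := fun t ↦ f a + ∫ s in a..t, f' s) ?_
    fun t ht ↦ (h.2 t (by rwa [uIcc_of_le hab] at ht)).symm
  have h0 : AbsolutelyContinuousOnInterval (fun _ : ℝ ↦ f a) a b :=
    ((LipschitzWith.const (f a)).lipschitzOnWith (s := uIcc a b)).absolutelyContinuousOnInterval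
  exact h0.add (absolutelyContinuous_primitive left_mem_uIcc h.1)

theorem continuousOn (h : HasACDeriv f f' a b) (hab : a ≤ b) : ContinuousOn f (Icc a b) := by
  have := (h.ac hab).continuousOn
  rwa [uIcc_of_le hab] at this

theorem intervalIntegrable_sub (h : HasACDeriv f f' a b) (hc : c ∈ Icc a b) (hd : d ∈ Icc a b) :
    IntervalIntegrable f' volume c d :=
  h.1.mono_set (uIcc_subset_uIcc (Icc_subset_uIcc hc) (Icc_subset_uIcc hd))

theorem eq_add_integral (h : HasACDeriv f f' a b) {s t : ℝ} (hs : s ∈ Icc a b) (ht : t ∈ Icc a b) :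
    f t = f s + ∫ r in s..t, f' r := by
  have ha : a ∈ Icc a b := ⟨le_rfl, hs.1.trans hs.2⟩
  rw [h.2 t ht, h.2 s hs, add_assoc, intervalIntegral.integral_add_adjacent_intervals
    (h.intervalIntegrable_sub ha hs) (h.intervalIntegrable_sub hs ht)]

theorem mono (h : HasACDeriv f f' a b) (hc : c ∈ Icc a b) (hd : d ∈ Icc a b) :
    HasACDeriv f f' c d :=
  ⟨h.intervalIntegrable_sub hc hd, fun _ ht ↦
    h.eq_add_integral hc ⟨hc.1.trans ht.1, ht.2.trans hd.2⟩⟩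

theorem congr (h : HasACDeriv f f' a b) (hab : a ≤ b) (hfg : EqOn f g (Icc a b))
    (hfg' : ∀ᵐ t ∂(volume.restrict (Icc a b)), f' t = g' t) : HasACDeriv g g' a b := by
  rw [ae_restrict_iff' measurableSet_Icc] at hfg'
  refine ⟨h.1.congr_ae ?_, fun t ht ↦ ?_⟩
  · rw [EventuallyEq, ae_restrict_iff' measurableSet_uIoc]
    filter_upwards [hfg'] with t ht htm
    rw [uIoc_of_le hab] at htm
    exact ht (Ioc_subset_Icc_self htm)
  · rw [← hfg ht, ← hfg ⟨le_rfl, hab⟩, h.2 t ht]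
    congr 1
    refine intervalIntegral.integral_congr_ae ?_
    filter_upwards [hfg'] with s hs hsm
    rw [uIoc_of_le ht.1] at hsm
    exact hs ⟨hsm.1.le, hsm.2.trans ht.2⟩

theorem congr_fun (h : HasACDeriv f f' a b) (hab : a ≤ b) (hfg : EqOn f g (Icc a b))
    (hfg' : EqOn f' g' (Icc a b)) : HasACDeriv g g' a b :=
  h.congr hab hfg ((ae_restrict_iff' measurableSet_Icc).2 (.of_forall hfg'))

theorem ae_hasDerivAt [CompleteSpace G] (h : HasACDeriv f f' a b) :
    ∀ᵐ t ∂(volume.restrict (Icc a b)), HasDerivAt f (f' t) t := by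
  rw [ae_restrict_iff' measurableSet_Icc]
  filter_upwards [h.1.ae_hasDerivAt_integral, Measure.ae_ne volume a, Measure.ae_ne volume b]
    with t ht hta htb htm
  have h2 := (ht (Icc_subset_uIcc htm) a (by simp)).const_add (f a)
  refine h2.congr_of_eventuallyEq ?_
  filter_upwards [Ioo_mem_nhds (htm.1.lt_of_ne' hta) (htm.2.lt_of_ne htb)] with s hs
  exact h.2 s (Ioo_subset_Icc_self hs)

/-- The difference of `f` and the primitive of `f'` is absolutely continuous with zero derivative
almost everywhere, hence constant. -/
theorem of_ac [CompleteSpace G] (hab : a ≤ b) (h : AbsolutelyContinuousOnInterval f a b)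
    (hi : IntervalIntegrable f' volume a b)
    (hd : ∀ᵐ t ∂(volume.restrict (Icc a b)), HasDerivAt f (f' t) t) : HasACDeriv f f' a b := by
  refine ⟨hi, fun t ht ↦ ?_⟩
  rw [ae_Icc_iff_ae_uIcc hab] at hd
  obtain ⟨C, hC⟩ := (h.sub (absolutelyContinuous_primitive left_mem_uIcc hi)
    ).const_of_ae_hasDerivAt_zero (by
      filter_upwards [hi.ae_hasDerivAt_integral, hd] with t ht hd htm
      simpa using (hd htm).sub (ht htm a (by simp)))
  have h1 := hC a (by simp)
  have h2 := hC t (Icc_subset_uIcc ht)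
  simp only [Pi.sub_apply, intervalIntegral.integral_same, sub_zero] at h1 h2
  rw [h1, ← h2]
  simp

theorem glue {m : ℝ} (h1 : HasACDeriv f f' a m) (h2 : HasACDeriv f f' m b) (ham : a ≤ m)
    (hmb : m ≤ b) : HasACDeriv f f' a b := by
  refine ⟨h1.1.trans h2.1, fun t ht ↦ ?_⟩
  rcases le_total t m with htm | htm
  · exact h1.2 t ⟨ht.1, htm⟩
  · rw [h2.2 t ⟨htm, ht.2⟩, h1.2 m ⟨ham, le_rfl⟩, add_assoc,
      intervalIntegral.integral_add_adjacent_intervals h1.1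
        (h2.intervalIntegrable_sub ⟨le_rfl, hmb⟩ ⟨htm, ht.2⟩)]

theorem clm_comp [CompleteSpace G] [CompleteSpace H] (h : HasACDeriv f f' a b) (L : G →L[ℝ] H) :
    HasACDeriv (fun t ↦ L (f t)) (fun t ↦ L (f' t)) a b := by
  refine ⟨⟨L.integrable_comp h.1.1, L.integrable_comp h.1.2⟩, fun t ht ↦ ?_⟩
  have hi : IntervalIntegrable f' volume a t :=
    h.intervalIntegrable_sub ⟨le_rfl, ht.1.trans ht.2⟩ ht
  change L (f t) = L (f a) + ∫ s in a..t, L (f' s)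
  rw [h.2 t ht, map_add, L.intervalIntegral_comp_comm hi]

theorem prodMk {k k' : ℝ → H} [CompleteSpace G] [CompleteSpace H] (h : HasACDeriv f f' a b)
    (hk : HasACDeriv k k' a b) :
    HasACDeriv (fun t ↦ (f t, k t)) (fun t ↦ (f' t, k' t)) a b := by
  have hi : IntervalIntegrable (fun t ↦ (f' t, k' t)) volume a b :=
    ⟨h.1.1.prodMk hk.1.1, h.1.2.prodMk hk.1.2⟩
  refine ⟨hi, fun t ht ↦ ?_⟩
  have hi' : IntervalIntegrable (fun t ↦ (f' t, k' t)) volume a t :=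
    hi.mono_set (uIcc_subset_uIcc_left (Icc_subset_uIcc ht))
  have e1 := (ContinuousLinearMap.fst ℝ G H).intervalIntegral_comp_comm hi'
  have e2 := (ContinuousLinearMap.snd ℝ G H).intervalIntegral_comp_comm hi'
  simp only [ContinuousLinearMap.coe_fst', ContinuousLinearMap.coe_snd'] at e1 e2
  ext
  · simp [h.2 t ht, ← e1]
  · simp [hk.2 t ht, ← e2]

/-- The chain rule for the composition with a continuously differentiable map. -/
theorem comp_contDiffOn [CompleteSpace G] [CompleteSpace H] (hab : a ≤ b)
    (h : HasACDeriv f f' a b) {Θ : G → H} {U : Set G} (hU : IsOpen U) (hΘ : ContDiffOn ℝ 1 Θ U)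
    (hf : ∀ t ∈ Icc a b, f t ∈ U) :
    HasACDeriv (fun t ↦ Θ (f t)) (fun t ↦ fderiv ℝ Θ (f t) (f' t)) a b := by
  have hcont : ContinuousOn f (Icc a b) := h.continuousOn hab
  have hint : IntervalIntegrable (fun t ↦ fderiv ℝ Θ (f t) (f' t)) volume a b := by
    have hc : ContinuousOn (fun t ↦ fderiv ℝ Θ (f t)) (uIcc a b) := by
      rw [uIcc_of_le hab]
      exact (hΘ.continuousOn_fderiv_of_isOpen hU le_rfl).comp hcont hf
    obtain ⟨C, hC⟩ := isCompact_uIcc.exists_bound_of_continuousOn hc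
    refine (h.1.norm.const_mul C).mono_fun ?_ ?_
    · have h1 : AEStronglyMeasurable (fun t ↦ fderiv ℝ Θ (f t)) (volume.restrict (uIoc a b)) :=
        (hc.mono uIoc_subset_uIcc).aestronglyMeasurable measurableSet_uIoc
      exact (ContinuousLinearMap.apply ℝ H : G →L[ℝ] (G →L[ℝ] H) →L[ℝ] H).flip
        |>.aestronglyMeasurable_comp₂ h1 h.1.def'.aestronglyMeasurable
    · filter_upwards [ae_restrict_mem measurableSet_uIoc] with t ht
      have := hC t (uIoc_subset_uIcc ht)
      refine ((fderiv ℝ Θ (f t)).le_opNorm _).trans ?_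
      simp only [norm_mul, Real.norm_eq_abs, abs_norm]
      gcongr
      exact this.trans (le_abs_self C)
  -- `Θ` is Lipschitz only near each point, so absolute continuity of the composition is obtained on
  -- short intervals and then concatenated.
  refine interval_induction (p := fun c d ↦ HasACDeriv (fun t ↦ Θ (f t))
    (fun t ↦ fderiv ℝ Θ (f t) (f' t)) c d) hab (fun t ht ↦ ?_)
    fun c m d hcm hmd _ _ h1 h2 ↦ h1.glue h2 hcm hmd
  obtain ⟨K, s, hs, hK⟩ := ((hΘ.contDiffAt (hU.mem_nhds (hf t ht))).exists_lipschitzOnWith)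
  obtain ⟨ε, hε, hεs⟩ := Metric.mem_nhdsWithin_iff.1 (hcont t ht (inter_mem hs (hU.mem_nhds (hf t ht))))
  refine ⟨ε, hε, fun c d hcd hc hd hct hdt ↦ ?_⟩
  have hsub : ∀ r ∈ Icc c d, r ∈ Icc a b ∧ f r ∈ s := fun r hr ↦ by
    have hr' : r ∈ Icc a b := ⟨hc.1.trans hr.1, hr.2.trans hd.2⟩
    refine ⟨hr', (hεs ⟨?_, hr'⟩).1⟩
    rw [Metric.mem_ball, Real.dist_eq]
    rw [abs_lt] at *
    constructor <;> linarith [hr.1, hr.2]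
  have h' := h.mono hc hd
  refine of_ac hcd (ac_lipschitz_comp (h'.ac hcd) hK fun r hr ↦ ?_)
    (hint.mono_set (uIcc_subset_uIcc (Icc_subset_uIcc hc) (Icc_subset_uIcc hd))) ?_
  · rw [uIcc_of_le hcd] at hr
    exact (hsub r hr).2
  · filter_upwards [h'.ae_hasDerivAt, ae_restrict_mem measurableSet_Icc] with r hr hrm
    have hd := (hΘ.contDiffAt (hU.mem_nhds (hf r (hsub r hrm).1))).differentiableAt one_ne_zero
    exact hd.hasFDerivAt.comp_hasDerivAt r hr

end HasACDeriv

end ACDeriv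

/-! ### Linear and nonlinear equations with integrable coefficients -/

section Flow

set_option linter.unusedSectionVars false

variable {G V W : Type*} [NormedAddCommGroup G] [NormedSpace ℝ G]
  [NormedAddCommGroup V] [NormedSpace ℝ V] [NormedAddCommGroup W] [NormedSpace ℝ W]

/-- Continuity of the primitive of `‖f‖`. With merely integrable coefficients, contraction arguments
need the integral of the coefficient to be small, not the length of the interval. -/
theorem exists_integral_norm_lt {f : ℝ → G} {a b : ℝ} (hf : IntervalIntegrable f volume a b)
    {δ : ℝ} (hδ : 0 < δ) {t : ℝ} (ht : t ∈ Icc a b) :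
    ∃ ε > 0, ∀ c d, c ≤ d → c ∈ Icc a b → d ∈ Icc a b → |c - t| < ε → |d - t| < ε →
      ∫ s in c..d, ‖f s‖ < δ := by
  have hab : a ≤ b := ht.1.trans ht.2
  have h1 := intervalIntegral.continuousOn_primitive_interval' hf.norm left_mem_uIcc
  rw [uIcc_of_le hab] at h1
  obtain ⟨ε, hε, h2⟩ := Metric.continuousOn_iff.1 h1 t ht (δ / 2) (by positivity)
  refine ⟨ε, hε, fun c d _ hc hd hct hdt ↦ ?_⟩
  have h3 := h2 c hc (by rwa [Real.dist_eq])
  have h4 := h2 d hd (by rwa [Real.dist_eq])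
  have ha : a ∈ Icc a b := ⟨le_rfl, hab⟩
  have sub : ∀ x ∈ Icc a b, IntervalIntegrable (fun s ↦ ‖f s‖) volume a x := fun x hx ↦
    hf.norm.mono_set (uIcc_subset_uIcc_left (Icc_subset_uIcc hx))
  rw [← intervalIntegral.integral_interval_sub_left (sub d hd) (sub c hc)]
  rw [Real.dist_eq, abs_lt] at h3 h4
  linarith

/-- This takes the place of Grönwall's inequality. Where `∫ ‖m‖ < 1 / 2`, the maximum of `‖w‖` is at
most half of itself as soon as `w` has a zero there; short intervals are then concatenated. The zero
may be at any time, so uniqueness holds both forwards and backwards. -/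
theorem eq_zero_of_norm_deriv_le {w w' : ℝ → G} {m : ℝ → ℝ} {a b : ℝ} (hab : a ≤ b)
    (h : HasACDeriv w w' a b) (hm : IntervalIntegrable m volume a b)
    (hle : ∀ᵐ t ∂(volume.restrict (Icc a b)), ‖w' t‖ ≤ m t * ‖w t‖) {t₀ : ℝ}
    (ht₀ : t₀ ∈ Icc a b) (h0 : w t₀ = 0) : ∀ t ∈ Icc a b, w t = 0 := by
  -- The zero becomes part of the property, so that after a subdivision it may lie in either half.
  suffices (∃ t₀ ∈ Icc a b, w t₀ = 0) → ∀ t ∈ Icc a b, w t = 0 from this ⟨t₀, ht₀, h0⟩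
  refine interval_induction (p := fun c d ↦ (∃ t₀ ∈ Icc c d, w t₀ = 0) → ∀ t ∈ Icc c d, w t = 0)
    hab (fun t ht ↦ ?_) fun c n d hcn hnd _ _ h1 h2 ⟨t₀, ht₀, h0⟩ ↦ ?_
  · obtain ⟨ε, hε, h1⟩ := exists_integral_norm_lt hm (δ := 1 / 2) (by norm_num) ht
    refine ⟨ε, hε, fun c d hcd hc hd hct hdt ⟨t₀, ht₀, h0⟩ ↦ ?_⟩
    have hint := h1 c d hcd hc hd hct hdt
    have h' := h.mono hc hd
    obtain ⟨t₁, ht₁, hmax⟩ := isCompact_Icc.exists_isMaxOn ⟨c, le_rfl, hcd⟩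
      (h'.continuousOn hcd).norm
    have hm' : IntervalIntegrable (fun s ↦ ‖m s‖ * ‖w t₁‖) volume c d :=
      (hm.mono_set (uIcc_subset_uIcc (Icc_subset_uIcc hc) (Icc_subset_uIcc hd))).norm.mul_const _
    have hsub : uIoc t₀ t₁ ⊆ uIoc c d := by
      rw [uIoc_of_le hcd]
      intro s hs
      rw [mem_uIoc] at hs
      rcases hs with hs | hs
      · exact ⟨ht₀.1.trans_lt hs.1, hs.2.trans ht₁.2⟩
      · exact ⟨ht₁.1.trans_lt hs.1, hs.2.trans ht₀.2⟩
    have hsub' : uIcc t₀ t₁ ⊆ uIcc c d :=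
      uIcc_subset_uIcc (Icc_subset_uIcc ht₀) (Icc_subset_uIcc ht₁)
    have e1 : ‖w t₁‖ ≤ |∫ s in t₀..t₁, ‖m s‖ * ‖w t₁‖| := by
      have e0 : w t₁ = ∫ s in t₀..t₁, w' s := by rw [h'.eq_add_integral ht₀ ht₁, h0, zero_add]
      nth_rewrite 1 [e0]
      refine intervalIntegral.norm_integral_le_abs_of_norm_le ?_ (hm'.mono_set hsub')
      rw [ae_restrict_iff' measurableSet_Icc] at hle
      rw [ae_restrict_iff' measurableSet_uIoc]
      filter_upwards [hle] with s hs hsm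
      have hs' := hsub hsm
      rw [uIoc_of_le hcd] at hs'
      have hs'' : s ∈ Icc c d := Ioc_subset_Icc_self hs'
      refine (hs ⟨hc.1.trans hs''.1, hs''.2.trans hd.2⟩).trans ?_
      have := hmax hs''
      simp only [mem_ofPred_eq] at this
      gcongr
      exact le_abs_self _
    have e2 : |∫ s in t₀..t₁, ‖m s‖ * ‖w t₁‖| ≤ |∫ s in c..d, ‖m s‖ * ‖w t₁‖| :=
      intervalIntegral.abs_integral_mono_interval hsub (.of_forall fun s ↦ by positivity) hm'
    rw [intervalIntegral.integral_mul_const (a := c), abs_of_nonneg (mul_nonneg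
      (intervalIntegral.integral_nonneg hcd fun _ _ ↦ norm_nonneg _) (norm_nonneg _))] at e2
    have e3 : ‖w t₁‖ ≤ 0 := by nlinarith [norm_nonneg (w t₁)]
    intro s hs
    exact norm_le_zero_iff.1 ((hmax hs).trans e3)
  · rcases le_total t₀ n with hn | hn
    · have e1 := h1 ⟨t₀, ⟨ht₀.1, hn⟩, h0⟩
      have e2 := h2 ⟨n, ⟨le_rfl, hnd⟩, e1 n ⟨hcn, le_rfl⟩⟩
      exact fun s hs ↦ (le_total s n).elim (fun h ↦ e1 s ⟨hs.1, h⟩) fun h ↦ e2 s ⟨h, hs.2⟩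
    · have e2 := h2 ⟨t₀, ⟨hn, ht₀.2⟩, h0⟩
      have e1 := h1 ⟨n, ⟨hcn, le_rfl⟩, e2 n ⟨le_rfl, hnd⟩⟩
      exact fun s hs ↦ (le_total s n).elim (fun h ↦ e1 s ⟨hs.1, h⟩) fun h ↦ e2 s ⟨h, hs.2⟩

/-- Superposition operators on continuous functions inherit strict differentiability: over the
compact space `K` the derivative `A'` varies little on a uniform tube around the graph of `y`, and
the mean value inequality on balls bounds the remainder. The bound on `N'` later makes a Volterra
operator a contraction. -/
theorem hasStrictFDerivAt_nemytskii {K : Type*} [TopologicalSpace K] [CompactSpace K]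
    {A : K → G → W} {A' : K → G → G →L[ℝ] W} {Ω : Set G} (hΩ : IsOpen Ω)
    (hA : ContinuousOn (fun q : K × G ↦ A q.1 q.2) (univ ×ˢ Ω))
    (hA' : ContinuousOn (fun q : K × G ↦ A' q.1 q.2) (univ ×ˢ Ω))
    (hd : ∀ k, ∀ z ∈ Ω, HasFDerivAt (A k) (A' k z) z) {y : C(K, G)} (hy : ∀ k, y k ∈ Ω)
    {C : ℝ} (hC₀ : 0 ≤ C) (hC : ∀ k, ‖A' k (y k)‖ ≤ C) :
    ∃ (N : C(K, G) → C(K, W)) (N' : C(K, G) →L[ℝ] C(K, W)),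
      (∀ᶠ z in 𝓝 y, ∀ k, z k ∈ Ω ∧ N z k = A k (z k)) ∧ HasStrictFDerivAt N N' y ∧
      ‖N'‖ ≤ C ∧ ∀ δ k, N' δ k = A' k (y k) (δ k) := by
  classical
  have hcont : ∀ z : C(K, G), (∀ k, z k ∈ Ω) → Continuous fun k ↦ A k (z k) := fun z hz ↦
    hA.comp_continuous (f := fun k ↦ (k, z k)) (by fun_prop) fun k ↦ ⟨mem_univ _, hz k⟩
  have hcont' : Continuous fun k ↦ A' k (y k) :=
    hA'.comp_continuous (f := fun k ↦ (k, y k)) (by fun_prop) fun k ↦ ⟨mem_univ _, hy k⟩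
  -- The value zero for functions leaving `Ω` is harmless: only the germ of `N` at `y` matters.
  let N : C(K, G) → C(K, W) := fun z ↦ if h : ∀ k, z k ∈ Ω then ⟨_, hcont z h⟩ else 0
  have hN : ∀ z : C(K, G), (∀ k, z k ∈ Ω) → ∀ k, N z k = A k (z k) := fun z hz k ↦ by
    simp only [N, hz, implies_true, ↓reduceDIte, ContinuousMap.coe_mk]
  let N₀ : C(K, G) →ₗ[ℝ] C(K, W) :=
    { toFun := fun δ ↦ ⟨fun k ↦ A' k (y k) (δ k), hcont'.clm_apply δ.continuous⟩
      map_add' := fun _ _ ↦ by ext; simp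
      map_smul' := fun _ _ ↦ by ext; simp }
  have hN₀ : ∀ δ, ‖N₀ δ‖ ≤ C * ‖δ‖ := fun δ ↦ by
    rw [ContinuousMap.norm_le _ (by positivity)]
    intro k
    refine ((A' k (y k)).le_opNorm _).trans ?_
    gcongr
    · exact hC k
    · exact δ.norm_coe_le_norm k
  have huni : ∀ ε > 0, ∃ ρ > 0, ∀ k, ∀ z ∈ Metric.ball (y k) ρ,
      z ∈ Ω ∧ ‖A' k z - A' k (y k)‖ ≤ ε := by
    intro ε hε
    have h1 : ∀ᶠ v in 𝓝 (0 : G), ∀ k ∈ (univ : Set K),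
        y k + v ∈ Ω ∧ ‖A' k (y k + v) - A' k (y k)‖ ≤ ε := by
      refine isCompact_univ.eventually_forall_of_forall_eventually fun k _ ↦ ?_
      have hc : ContinuousAt (fun z : G × K ↦ y z.2 + z.1) (0, k) := by fun_prop
      have e1 : ∀ᶠ z : G × K in 𝓝 (0, k), y z.2 + z.1 ∈ Ω :=
        hc.eventually_mem (by simpa using hΩ.mem_nhds (hy k))
      have h2 : ContinuousAt (fun q : K × G ↦ A' q.1 q.2) (k, y k + 0) :=
        hA'.continuousAt ((isOpen_univ.prod hΩ).mem_nhds ⟨mem_univ _, by simpa using hy k⟩)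
      have h3 : ContinuousAt (fun z : G × K ↦ A' z.2 (y z.2 + z.1)) (0, k) :=
        ContinuousAt.comp (g := fun q : K × G ↦ A' q.1 q.2)
          (f := fun z : G × K ↦ (z.2, y z.2 + z.1)) h2 (by fun_prop)
      have h4 : ContinuousAt (fun z : G × K ↦ ‖A' z.2 (y z.2 + z.1) - A' z.2 (y z.2)‖) (0, k) :=
        (h3.sub (hcont'.continuousAt.comp (f := fun z : G × K ↦ z.2) continuousAt_snd)).norm
      have e2 := h4.eventually (eventually_lt_nhds (b := ε) (by simpa using hε))
      filter_upwards [e1, e2] with z h1 h2 using ⟨h1, h2.le⟩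
    obtain ⟨ρ, hρ, h2⟩ := Metric.eventually_nhds_iff_ball.1 h1
    refine ⟨ρ, hρ, fun k z hz ↦ ?_⟩
    have := h2 (z - y k) (by simpa [dist_eq_norm] using hz) k (mem_univ _)
    simpa using this
  have hball : ∀ ρ > 0, ∀ᶠ z in 𝓝 y, ∀ k, z k ∈ Metric.ball (y k) ρ := fun ρ hρ ↦ by
    filter_upwards [Metric.ball_mem_nhds y hρ] with z hz k
    exact (ContinuousMap.dist_apply_le_dist k).trans_lt hz
  have hΩev : ∀ᶠ z in 𝓝 y, ∀ k, z k ∈ Ω := by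
    obtain ⟨ρ, hρ, h⟩ := huni 1 one_pos
    filter_upwards [hball ρ hρ] with z hz k using (h k _ (hz k)).1
  refine ⟨N, N₀.mkContinuous C hN₀, ?_, ?_, N₀.mkContinuous_norm_le hC₀ hN₀, fun _ _ ↦ rfl⟩
  · filter_upwards [hΩev] with z hz k using ⟨hz k, hN z hz k⟩
  · refine .of_isLittleO (Asymptotics.isLittleO_iff.2 fun ε hε ↦ ?_)
    obtain ⟨ρ, hρ, h⟩ := huni ε hε
    have := (hball ρ hρ).prod_nhds (hball ρ hρ)
    filter_upwards [this] with q hq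
    rw [ContinuousMap.norm_le _ (by positivity)]
    intro k
    have e1 := Convex.norm_image_sub_le_of_norm_hasFDerivWithin_le' (f := A k) (f' := A' k)
      (φ := A' k (y k)) (C := ε) (s := Metric.ball (y k) ρ) (x := q.2 k) (y := q.1 k)
      (fun z hz ↦ (hd k z (h k z hz).1).hasFDerivWithinAt) (fun z hz ↦ (h k z hz).2)
      (convex_ball _ _) (hq.2 k) (hq.1 k)
    have e2 : (N q.1 - N q.2 - N₀.mkContinuous C hN₀ (q.1 - q.2)) k =
        A k (q.1 k) - A k (q.2 k) - A' k (y k) (q.1 k - q.2 k) := by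
      simp only [ContinuousMap.sub_apply, hN q.1 fun k ↦ (h k _ (hq.1 k)).1,
        hN q.2 fun k ↦ (h k _ (hq.2 k)).1]
      rfl
    rw [e2]
    refine e1.trans ?_
    gcongr
    exact (q.1 - q.2).norm_coe_le_norm k

/-! ### Volterra integrals of continuous operators against integrable controls -/

section Volterra

variable {c d : ℝ}

theorem integrable_Lp_one (hcd : c ≤ d) (α : Lp V 1 (volume.restrict (Icc c d))) :
    IntervalIntegrable α volume c d := by
  rw [intervalIntegrable_iff_integrableOn_Icc_of_le hcd]
  exact L1.integrable_coeFn α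

theorem integral_norm_Lp_one (hcd : c ≤ d) (α : Lp V 1 (volume.restrict (Icc c d))) :
    ∫ s in c..d, ‖α s‖ = ‖α‖ := by
  rw [L1.norm_eq_integral_norm, intervalIntegral.integral_of_le hcd, integral_Icc_eq_integral_Ioc]

theorem intervalIntegrable_clm_apply {B : ℝ → V →L[ℝ] G} {α : ℝ → V} (hcd : c ≤ d)
    (hB : ContinuousOn B (Icc c d)) (hα : IntervalIntegrable α volume c d) :
    IntervalIntegrable (fun t ↦ B t (α t)) volume c d := by
  rw [← uIcc_of_le hcd] at hB
  obtain ⟨C, hC⟩ := isCompact_uIcc.exists_bound_of_continuousOn hB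
  refine (hα.norm.const_mul C).mono_fun ?_ ?_
  · have h1 : AEStronglyMeasurable B (volume.restrict (uIoc c d)) :=
      (hB.mono uIoc_subset_uIcc).aestronglyMeasurable measurableSet_uIoc
    exact (ContinuousLinearMap.apply ℝ G : V →L[ℝ] (V →L[ℝ] G) →L[ℝ] G).flip
      |>.aestronglyMeasurable_comp₂ h1 hα.def'.aestronglyMeasurable
  · filter_upwards [ae_restrict_mem measurableSet_uIoc] with t ht
    have := hC t (uIoc_subset_uIcc ht)
    refine ((B t).le_opNorm _).trans ?_
    simp only [norm_mul, Real.norm_eq_abs, abs_norm]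
    gcongr
    exact this.trans (le_abs_self C)

theorem continuousOn_projIcc_comp (hcd : c ≤ d) (B : C(Icc c d, W)) :
    ContinuousOn (fun s ↦ B (projIcc c d hcd s)) (Icc c d) :=
  (B.continuous.comp continuous_projIcc).continuousOn

noncomputable instance : NormedAddCommGroup C(Icc c d, V →L[ℝ] G) :=
  ContinuousMap.instNormedAddCommGroup

noncomputable instance : NormedSpace ℝ C(Icc c d, V →L[ℝ] G) :=
  ContinuousMap.normedSpace

theorem intervalIntegrable_projIcc_apply (hcd : c ≤ d) (B : C(Icc c d, V →L[ℝ] G))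
    (α : Lp V 1 (volume.restrict (Icc c d))) :
    IntervalIntegrable (fun s ↦ B (projIcc c d hcd s) (α s)) volume c d :=
  intervalIntegrable_clm_apply hcd (continuousOn_projIcc_comp hcd B) (integrable_Lp_one hcd α)

theorem intervalIntegrable_projIcc_apply' (hcd : c ≤ d) (B : C(Icc c d, V →L[ℝ] G))
    (α : Lp V 1 (volume.restrict (Icc c d))) (t : Icc c d) :
    IntervalIntegrable (fun s ↦ B (projIcc c d hcd s) (α s)) volume c t :=
  (intervalIntegrable_projIcc_apply hcd B α).mono_set
    (uIcc_subset_uIcc_left (Icc_subset_uIcc t.2))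

/-- The function `∫_c^· B α`. -/
noncomputable def volterraFun (hcd : c ≤ d) (B : C(Icc c d, V →L[ℝ] G))
    (α : Lp V 1 (volume.restrict (Icc c d))) : C(Icc c d, G) where
  toFun t := ∫ s in c..t, B (projIcc c d hcd s) (α s)
  continuous_toFun := by
    have := intervalIntegral.continuousOn_primitive_interval'
      (intervalIntegrable_projIcc_apply hcd B α) left_mem_uIcc
    rw [uIcc_of_le hcd] at this
    exact continuousOn_iff_continuous_domRestrict.1 this

theorem volterraFun_apply (hcd : c ≤ d) (B : C(Icc c d, V →L[ℝ] G))
    (α : Lp V 1 (volume.restrict (Icc c d))) (t : Icc c d) :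
    volterraFun hcd B α t = ∫ s in c..t, B (projIcc c d hcd s) (α s) := rfl

theorem norm_volterraFun_le (hcd : c ≤ d) (B : C(Icc c d, V →L[ℝ] G))
    (α : Lp V 1 (volume.restrict (Icc c d))) : ‖volterraFun hcd B α‖ ≤ ‖B‖ * ‖α‖ := by
  rw [ContinuousMap.norm_le _ (by positivity)]
  intro t
  rw [volterraFun_apply]
  have hα := (integrable_Lp_one hcd α).norm
  have hα' : IntervalIntegrable (fun s ↦ ‖α s‖) volume c t :=
    hα.mono_set (uIcc_subset_uIcc_left (Icc_subset_uIcc t.2))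
  calc _ ≤ ∫ s in c..t, ‖B‖ * ‖α s‖ := by
        refine intervalIntegral.norm_integral_le_of_norm_le t.2.1 (.of_forall fun s _ ↦ ?_)
          (hα'.const_mul _)
        refine ((B _).le_opNorm _).trans ?_
        gcongr
        exact B.norm_coe_le_norm _
    _ = ‖B‖ * ∫ s in c..t, ‖α s‖ := intervalIntegral.integral_const_mul _ _
    _ ≤ ‖B‖ * ∫ s in c..d, ‖α s‖ := by
        gcongr
        exact intervalIntegral.integral_mono_interval le_rfl t.2.1 t.2.2
          (.of_forall fun _ ↦ norm_nonneg _) hα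
    _ = ‖B‖ * ‖α‖ := by rw [integral_norm_Lp_one hcd]

/-- The continuous bilinear map `(B, α) ↦ ∫_c^· B α`. -/
noncomputable def volterra (G V : Type*) [NormedAddCommGroup G] [NormedSpace ℝ G]
    [NormedAddCommGroup V] [NormedSpace ℝ V] {c d : ℝ} (hcd : c ≤ d) :
    C(Icc c d, V →L[ℝ] G) →L[ℝ] Lp V 1 (volume.restrict (Icc c d)) →L[ℝ] C(Icc c d, G) :=
  LinearMap.mkContinuous₂
    (LinearMap.mk₂ ℝ (volterraFun hcd)
      (fun B₁ B₂ α ↦ by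
        ext t
        simp only [volterraFun_apply, ContinuousMap.add_apply, _root_.add_apply]
        exact intervalIntegral.integral_add (intervalIntegrable_projIcc_apply' hcd B₁ α t)
          (intervalIntegrable_projIcc_apply' hcd B₂ α t))
      (fun r B α ↦ by
        ext t
        simp [volterraFun_apply])
      (fun B α₁ α₂ ↦ by
        ext t
        simp only [volterraFun_apply, ContinuousMap.add_apply]
        rw [← intervalIntegral.integral_add (intervalIntegrable_projIcc_apply' hcd B α₁ t)
          (intervalIntegrable_projIcc_apply' hcd B α₂ t)]
        refine intervalIntegral.integral_congr_ae ?_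
        filter_upwards [(ae_restrict_iff' measurableSet_Icc).1 (Lp.coeFn_add α₁ α₂)] with s hs hsm
        rw [uIoc_of_le t.2.1] at hsm
        rw [hs ⟨hsm.1.le, hsm.2.trans t.2.2⟩, Pi.add_apply, map_add])
      (fun r B α ↦ by
        ext t
        simp only [volterraFun_apply, ContinuousMap.smul_apply]
        rw [← intervalIntegral.integral_smul]
        refine intervalIntegral.integral_congr_ae ?_
        filter_upwards [(ae_restrict_iff' measurableSet_Icc).1 (Lp.coeFn_smul r α)] with s hs hsm
        rw [uIoc_of_le t.2.1] at hsm
        rw [hs ⟨hsm.1.le, hsm.2.trans t.2.2⟩, Pi.smul_apply, map_smul]))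
    1 fun B α ↦ by
      rw [one_mul]
      exact norm_volterraFun_le hcd B α

theorem volterra_apply (hcd : c ≤ d) (B : C(Icc c d, V →L[ℝ] G))
    (α : Lp V 1 (volume.restrict (Icc c d))) : volterra G V hcd B α = volterraFun hcd B α := rfl

end Volterra

end Flow

/-! ### Differentiability of the flow in the initial value and the control -/

section LocalFlow

set_option linter.unusedSectionVars false
set_option synthInstance.maxHeartbeats 200000

variable {G V : Type*} [NormedAddCommGroup G] [NormedSpace ℝ G] [CompleteSpace G]
  [NormedAddCommGroup V] [NormedSpace ℝ V] [CompleteSpace V]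

theorem isInvertible_id_sub {X : Type*} [NormedAddCommGroup X] [NormedSpace ℝ X] [CompleteSpace X]
    {L : X →L[ℝ] X} (hL : ‖L‖ < 1) :
    (ContinuousLinearMap.id ℝ X - L).IsInvertible := by
  obtain ⟨v, hv⟩ := isUnit_one_sub_of_norm_lt_one hL
  exact ⟨ContinuousLinearEquiv.ofUnit v, hv⟩

/-- By the Neumann series this makes the linearization of the integral equation in the unknown curve
invertible, as the implicit function theorem requires. -/
theorem norm_volterra_comp_lt {c d : ℝ} (hcd : c ≤ d) {C : ℝ}
    (N' : C(Icc c d, G) →L[ℝ] C(Icc c d, V →L[ℝ] G)) (hN' : ‖N'‖ ≤ C)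
    (α : Lp V 1 (volume.restrict (Icc c d))) (hsmall : C * ‖α‖ < 1) :
    ‖((volterra G V hcd).flip α).comp N'‖ < 1 := by
  refine lt_of_le_of_lt (ContinuousLinearMap.opNorm_le_bound _ (by positivity) fun δ ↦ ?_)
    ((mul_le_mul_of_nonneg_right hN' (norm_nonneg α)).trans_lt hsmall)
  calc _ ≤ ‖N' δ‖ * ‖α‖ := norm_volterraFun_le hcd (N' δ) α
    _ ≤ (‖N'‖ * ‖δ‖) * ‖α‖ := by gcongr; exact N'.le_opNorm δ
    _ = ‖N'‖ * ‖α‖ * ‖δ‖ := by ring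

/-- The flow of `y' = A(t, y) α(t)` on a short interval depends differentiably on the initial
value and on the control `α ∈ L¹`, and its derivative solves the linearized equation. -/
theorem exists_local_flow {c d : ℝ} (hcd : c ≤ d) {A : ℝ → G → V →L[ℝ] G}
    {A' : ℝ → G → G →L[ℝ] V →L[ℝ] G} {Ω : Set G} (hΩ : IsOpen Ω)
    (hA : ContinuousOn (fun q : ℝ × G ↦ A q.1 q.2) (Icc c d ×ˢ Ω))
    (hA' : ContinuousOn (fun q : ℝ × G ↦ A' q.1 q.2) (Icc c d ×ˢ Ω))
    (hderiv : ∀ t ∈ Icc c d, ∀ z ∈ Ω, HasFDerivAt (A t) (A' t z) z)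
    {y : ℝ → G} {α : Lp V 1 (volume.restrict (Icc c d))}
    (hy : HasACDeriv y (fun t ↦ A t (y t) (α t)) c d) (hyΩ : ∀ t ∈ Icc c d, y t ∈ Ω) {C : ℝ}
    (hC : ∀ t ∈ Icc c d, ‖A' t (y t)‖ ≤ C) (hsmall : C * ‖α‖ < 1) :
    ∃ (Φ : G × Lp V 1 (volume.restrict (Icc c d)) → ℝ → G)
      (Φ' : ℝ → G × Lp V 1 (volume.restrict (Icc c d)) →L[ℝ] G),
      (∀ t ∈ Icc c d, Φ (y c, α) t = y t) ∧
      (∀ᶠ q in 𝓝 (y c, α), Φ q c = q.1 ∧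
        HasACDeriv (Φ q) (fun t ↦ A t (Φ q t) (q.2 t)) c d ∧ ∀ t ∈ Icc c d, Φ q t ∈ Ω) ∧
      (∀ t ∈ Icc c d, HasStrictFDerivAt (fun q ↦ Φ q t) (Φ' t) (y c, α)) ∧
      ∀ q w, HasACDeriv w (fun t ↦ A' t (y t) (w t) (α t) + A t (y t) (q.2 t)) c d → w c = q.1 →
        ∀ t ∈ Icc c d, Φ' t q = w t := by
  have hycont := hy.continuousOn hcd
  let Y : C(Icc c d, G) := ⟨fun t ↦ y t, continuousOn_iff_continuous_domRestrict.1 hycont⟩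
  have hcC : 0 ≤ C := (norm_nonneg (A' c (y c))).trans (hC c ⟨le_rfl, hcd⟩)
  have hmap : Continuous fun q : Icc c d × G ↦ ((q.1 : ℝ), q.2) := by fun_prop
  obtain ⟨N, N', hN, hNd, hN'C, hN'⟩ := hasStrictFDerivAt_nemytskii
    (K := Icc c d) (A := fun t z ↦ A t z) (A' := fun t z ↦ A' t z) hΩ
    (hA.comp hmap.continuousOn fun q hq ↦ ⟨q.1.2, hq.2⟩)
    (hA'.comp hmap.continuousOn fun q hq ↦ ⟨q.1.2, hq.2⟩)
    (fun t z hz ↦ hderiv t t.2 z hz) (y := Y) (fun t ↦ hyΩ t t.2) hcC (fun t ↦ hC t t.2)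
  let K := ContinuousLinearMap.const (R := ℝ) (M := G) (Icc c d)
  -- Near `Y`, the zeros of `𝓕` are the triples of initial value, control and curve that satisfy the
  -- integral equation.
  let 𝓕 : (G × Lp V 1 (volume.restrict (Icc c d))) × C(Icc c d, G) → C(Icc c d, G) :=
    fun u ↦ u.2 - K u.1.1 - volterra G V hcd (N u.2) u.1.2
  let p₁ := ContinuousLinearMap.fst ℝ (G × Lp V 1 (volume.restrict (Icc c d))) C(Icc c d, G)
  let p₂ := ContinuousLinearMap.snd ℝ (G × Lp V 1 (volume.restrict (Icc c d))) C(Icc c d, G)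
  let q₁ := ContinuousLinearMap.fst ℝ G (Lp V 1 (volume.restrict (Icc c d)))
  let q₂ := ContinuousLinearMap.snd ℝ G (Lp V 1 (volume.restrict (Icc c d)))
  let 𝓕' := p₂ - K ∘L q₁ ∘L p₁ - ((volterra G V hcd (N Y)) ∘L (q₂ ∘L p₁) +
    (((volterra G V hcd) ∘L N') ∘L p₂).flip α)
  have hu : HasStrictFDerivAt 𝓕 𝓕' ((y c, α), Y) := by
    have h1 : HasStrictFDerivAt (fun u : (G × Lp V 1 (volume.restrict (Icc c d))) × C(Icc c d, G) ↦
        volterra G V hcd (N u.2)) (((volterra G V hcd) ∘L N') ∘L p₂) ((y c, α), Y) := by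
      have h0 : HasStrictFDerivAt (fun u : (G × Lp V 1 (volume.restrict (Icc c d))) ×
          C(Icc c d, G) ↦ N u.2) (N' ∘L p₂) ((y c, α), Y) :=
        HasStrictFDerivAt.comp _ (by exact hNd) p₂.hasStrictFDerivAt
      exact HasStrictFDerivAt.comp (g := fun B ↦ volterra G V hcd B) _
        (by exact (volterra G V hcd).hasStrictFDerivAt) h0
    exact (p₂.hasStrictFDerivAt.sub (K ∘L q₁ ∘L p₁).hasStrictFDerivAt).sub
      (h1.clm_apply (q₂ ∘L p₁).hasStrictFDerivAt)
  have hinv : (𝓕' ∘L .inr ℝ _ _).IsInvertible := by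
    have := isInvertible_id_sub (norm_volterra_comp_lt hcd N' hN'C α hsmall)
    have e : 𝓕' ∘L .inr ℝ _ _ =
        ContinuousLinearMap.id ℝ _ - ((volterra G V hcd).flip α).comp N' := by
      ext1 δ
      simp [𝓕', p₁, p₂, q₁, q₂, K]
    rw [e]
    exact this
  let Ψ := hu.implicitFunctionOfProdDomain hinv
  have hΨd := hu.hasStrictFDerivAt_implicitFunctionOfProdDomain hinv
  have hΨev := hu.eventually_apply_implicitFunctionOfProdDomain hinv
  have hΨt := hu.tendsto_implicitFunctionOfProdDomain hinv
  have hYval : 𝓕 ((y c, α), Y) = 0 := by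
    ext t
    have e1 := (hN.self_of_nhds t).2
    simp only [𝓕, volterra_apply, ContinuousMap.sub_apply, volterraFun_apply]
    change y t - y c - _ = 0
    rw [hy.2 t t.2, sub_eq_zero, add_sub_cancel_left]
    refine intervalIntegral.integral_congr fun s hs ↦ ?_
    rw [uIcc_of_le t.2.1] at hs
    have hs' : s ∈ Icc c d := ⟨hs.1, hs.2.trans t.2.2⟩
    have := (hN.self_of_nhds ⟨s, hs'⟩).2
    simp only [projIcc_of_mem hcd hs', this]
    rfl
  have hΨY : Ψ (y c, α) = Y :=
    (hu.eventually_apply_eq_iff_implicitFunctionOfProdDomain hinv).self_of_nhds.mp rfl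
  let Ψ' : G × Lp V 1 (volume.restrict (Icc c d)) →L[ℝ] C(Icc c d, G) :=
    -(𝓕' ∘L .inr ℝ _ _).inverse ∘L (𝓕' ∘L .inl ℝ _ _)
  -- Differentiating `𝓕 (q, Ψ q) = 0` gives the linearized integral equation for `Ψ' q`, without
  -- computing the inverse in the definition of `Ψ'`.
  have hlin : ∀ q : G × Lp V 1 (volume.restrict (Icc c d)), Ψ' q - K q.1 - (volterra G V hcd (N Y) q.2 + volterra G V hcd (N' (Ψ' q)) α)
      = 0 := by
    intro q
    have h1 : HasStrictFDerivAt (fun q ↦ 𝓕 (q, Ψ q)) (𝓕' ∘L ((ContinuousLinearMap.id ℝ _).prod Ψ')) (y c, α) := by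
      refine HasStrictFDerivAt.comp (g := 𝓕) (y c, α) ?_ ((hasStrictFDerivAt_id _).prodMk hΨd)
      change HasStrictFDerivAt 𝓕 𝓕' ((y c, α), Ψ (y c, α))
      rwa [hΨY]
    have h2 : HasFDerivAt (fun q ↦ 𝓕 (q, Ψ q)) (0 : _ →L[ℝ] C(Icc c d, G)) (y c, α) :=
      (hasFDerivAt_const (𝕜 := ℝ) (𝓕 ((y c, α), Y)) (y c, α)).congr_of_eventuallyEq hΨev
    have h3 := h1.hasFDerivAt.unique h2
    have h4 := DFunLike.congr_fun h3 q
    simpa [𝓕', p₁, p₂, q₁, q₂] using h4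
  refine ⟨fun q t ↦ Ψ q (projIcc c d hcd t),
    fun t ↦ (ContinuousMap.evalCLM ℝ (projIcc c d hcd t)) ∘L Ψ', fun t ht ↦ ?_, ?_,
    fun t ht ↦ ?_, fun q w hw hwc t ht ↦ ?_⟩
  · change Ψ (y c, α) (projIcc c d hcd t) = y t
    rw [hΨY, projIcc_of_mem hcd ht]
    rfl
  · filter_upwards [hΨev, hΨt.eventually hN] with q hq hq'
    rw [hYval] at hq
    replace hq : 𝓕 (q, Ψ q) = 0 := hq
    replace hq' : ∀ k, Ψ q k ∈ Ω ∧ N (Ψ q) k = A k (Ψ q k) := hq'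
    have hΩ' : ∀ t, Ψ q (projIcc c d hcd t) ∈ Ω := fun t ↦ (hq' _).1
    have hcontΨ := continuousOn_projIcc_comp hcd (Ψ q)
    have hint : IntervalIntegrable (fun t ↦ A t (Ψ q (projIcc c d hcd t)) (q.2 t)) volume c d := by
      refine intervalIntegrable_clm_apply hcd ?_ (integrable_Lp_one hcd q.2)
      exact hA.comp (continuousOn_id.prodMk hcontΨ) fun t ht ↦ ⟨ht, hΩ' t⟩
    have hval : ∀ t ∈ Icc c d, Ψ q (projIcc c d hcd t) = q.1 +
        ∫ s in c..t, A s (Ψ q (projIcc c d hcd s)) (q.2 s) := by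
      intro t ht
      have h1 := congrArg (fun f : C(Icc c d, G) ↦ f ⟨t, ht⟩) hq
      simp only [𝓕, volterra_apply, ContinuousMap.sub_apply, volterraFun_apply,
        ContinuousMap.zero_apply] at h1
      rw [sub_sub, sub_eq_zero] at h1
      rw [projIcc_of_mem hcd ht]
      refine h1.trans ?_
      congr 1
      refine intervalIntegral.integral_congr fun s hs ↦ ?_
      rw [uIcc_of_le ht.1] at hs
      have hs' : s ∈ Icc c d := ⟨hs.1, hs.2.trans ht.2⟩
      have := (hq' ⟨s, hs'⟩).2
      simp only [projIcc_of_mem hcd hs']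
      rw [this]
    have hc0 : Ψ q (projIcc c d hcd c) = q.1 := by rw [hval c ⟨le_rfl, hcd⟩]; simp
    exact ⟨hc0, ⟨hint, fun t ht ↦ (hval t ht).trans (by rw [← hc0])⟩, fun t _ ↦ hΩ' t⟩
  · exact (ContinuousMap.evalCLM ℝ (projIcc c d hcd t)).hasStrictFDerivAt.comp _ hΨd
  -- `Ψ' q` and `w` solve the same inhomogeneous linear equation with the same initial value, so
  -- their difference solves the homogeneous one and vanishes.
  · have hsub : HasACDeriv (fun t ↦ Ψ' q (projIcc c d hcd t) - w t)
        (fun t ↦ A' t (y t) (Ψ' q (projIcc c d hcd t) - w t) (α t)) c d := by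
      have hcont' : ContinuousOn (fun t ↦ A' t (y t)) (Icc c d) :=
        hA'.comp (continuousOn_id.prodMk hycont) fun t ht ↦ ⟨ht, hyΩ t ht⟩
      have hcontA : ContinuousOn (fun t ↦ A t (y t)) (Icc c d) :=
        hA.comp (continuousOn_id.prodMk hycont) fun t ht ↦ ⟨ht, hyΩ t ht⟩
      have hcontΨ := continuousOn_projIcc_comp hcd (Ψ' q)
      have hα := integrable_Lp_one hcd α
      have i1 : IntervalIntegrable (fun t ↦ A' t (y t) (Ψ' q (projIcc c d hcd t)) (α t))
          volume c d := intervalIntegrable_clm_apply hcd (hcont'.clm_apply hcontΨ) hα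
      have i2 : IntervalIntegrable (fun t ↦ A' t (y t) (w t) (α t)) volume c d :=
        intervalIntegrable_clm_apply hcd (hcont'.clm_apply (hw.continuousOn hcd)) hα
      have i3 : IntervalIntegrable (fun t ↦ A t (y t) (q.2 t)) volume c d :=
        intervalIntegrable_clm_apply hcd hcontA (integrable_Lp_one hcd q.2)
      have hval : ∀ t ∈ Icc c d, Ψ' q (projIcc c d hcd t) = q.1 +
          ∫ s in c..t, (A' s (y s) (Ψ' q (projIcc c d hcd s)) (α s) + A s (y s) (q.2 s)) := by
        intro t ht
        have h1 := congrArg (fun f : C(Icc c d, G) ↦ f ⟨t, ht⟩) (hlin q)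
        simp only [volterra_apply, ContinuousMap.sub_apply, volterraFun_apply,
          ContinuousMap.zero_apply, ContinuousMap.add_apply] at h1
        rw [sub_sub, sub_eq_zero] at h1
        have hsub : uIcc c t ⊆ uIcc c d := uIcc_subset_uIcc_left (Icc_subset_uIcc ht)
        rw [projIcc_of_mem hcd ht, h1, intervalIntegral.integral_add (i1.mono_set hsub)
          (i3.mono_set hsub), add_comm (∫ s in c..t, A' s (y s) _ (α s))]
        congr 1
        congr 1
        · refine intervalIntegral.integral_congr fun s hs ↦ ?_
          rw [uIcc_of_le ht.1] at hs
          have hs' : s ∈ Icc c d := ⟨hs.1, hs.2.trans ht.2⟩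
          have := (hN.self_of_nhds ⟨s, hs'⟩).2
          simp only [projIcc_of_mem hcd hs']
          rw [this]
          rfl
        · refine intervalIntegral.integral_congr fun s hs ↦ ?_
          rw [uIcc_of_le ht.1] at hs
          have hs' : s ∈ Icc c d := ⟨hs.1, hs.2.trans ht.2⟩
          simp only [projIcc_of_mem hcd hs']
          rw [hN']
          rfl
      have hΨ1 : HasACDeriv (fun t ↦ Ψ' q (projIcc c d hcd t))
          (fun s ↦ A' s (y s) (Ψ' q (projIcc c d hcd s)) (α s) + A s (y s) (q.2 s)) c d := by
        refine ⟨i1.add i3, fun t ht ↦ (hval t ht).trans ?_⟩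
        congr 1
        exact ((hval c ⟨le_rfl, hcd⟩).trans (by simp)).symm
      have h2 := (hΨ1.prodMk hw).clm_comp
        (ContinuousLinearMap.fst ℝ G G - ContinuousLinearMap.snd ℝ G G)
      refine h2.congr_fun hcd (fun t _ ↦ rfl) fun t _ ↦ ?_
      simp [sub_eq_add_neg]
    have hz : Ψ' q (projIcc c d hcd c) - w c = 0 := by
      have h1 := congrArg (fun f : C(Icc c d, G) ↦ f ⟨c, ⟨le_rfl, hcd⟩⟩) (hlin q)
      simp only [volterra_apply, ContinuousMap.sub_apply, volterraFun_apply,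
        ContinuousMap.zero_apply, ContinuousMap.add_apply, intervalIntegral.integral_same,
        add_zero, sub_zero] at h1
      rw [projIcc_of_mem hcd ⟨le_rfl, hcd⟩, hwc]
      exact h1
    have := eq_zero_of_norm_deriv_le hcd hsub
      ((integrable_Lp_one hcd α).norm.const_mul C)
      ((ae_restrict_iff' measurableSet_Icc).2 (.of_forall fun s hs ↦ by
        refine ((A' s (y s) _).le_opNorm _).trans ?_
        calc _ ≤ (C * ‖Ψ' q (projIcc c d hcd s) - w s‖) * ‖α s‖ := by
              gcongr
              exact ((A' s (y s)).le_opNorm _).trans (by gcongr; exact hC s hs)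
          _ = _ := by ring)) ⟨le_rfl, hcd⟩ hz t ht
    exact sub_eq_zero.1 this

end LocalFlow

/-! ### The connection, its Christoffel symbols and its torsion in a chart -/

section Geometry

set_option linter.unusedSectionVars false

variable {F : Type*} [NormedAddCommGroup F] [NormedSpace ℝ F]
  {M : Type*} [TopologicalSpace M] [ChartedSpace F M] [IsManifold 𝓘(ℝ, F) ∞ M]

/-- The coordinate expression of tangent vectors in the chart at `x₀`. -/
noncomputable def toModel (x₀ x : M) : TangentSpace 𝓘(ℝ, F) x →L[ℝ] F :=
  (trivializationAt F (TangentSpace 𝓘(ℝ, F)) x₀).continuousLinearMapAt ℝ x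

/-- The tangent vector with given coordinate expression in the chart at `x₀`. -/
noncomputable def ofModel (x₀ x : M) : F →L[ℝ] TangentSpace 𝓘(ℝ, F) x :=
  (trivializationAt F (TangentSpace 𝓘(ℝ, F)) x₀).symmL ℝ x

variable {x₀ x : M}

theorem toModel_ofModel (hx : x ∈ (chartAt F x₀).source) (v : F) :
    toModel x₀ x (ofModel x₀ x v) = v :=
  (trivializationAt F (TangentSpace 𝓘(ℝ, F)) x₀).continuousLinearMapAt_symmL (R := ℝ)
    (by simpa using hx) v

theorem ofModel_toModel (hx : x ∈ (chartAt F x₀).source) (v : TangentSpace 𝓘(ℝ, F) x) :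
    ofModel x₀ x (toModel x₀ x v) = v :=
  (trivializationAt F (TangentSpace 𝓘(ℝ, F)) x₀).symmL_continuousLinearMapAt (R := ℝ)
    (by simpa using hx) v

theorem toModel_eq_mfderiv (hx : x ∈ (chartAt F x₀).source) :
    toModel x₀ x = mfderiv 𝓘(ℝ, F) 𝓘(ℝ, F) (chartAt F x₀) x := by
  have : IsManifold 𝓘(ℝ, F) 1 M := .of_le (n := ∞) (by simp)
  have := TangentBundle.continuousLinearMapAt_trivializationAt (I := 𝓘(ℝ, F)) hx
  simpa [toModel] using this

theorem toModel_eq_snd (hx : x ∈ (chartAt F x₀).source) (v : TangentSpace 𝓘(ℝ, F) x) :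
    toModel x₀ x v = (trivializationAt F (TangentSpace 𝓘(ℝ, F)) x₀
      (⟨x, v⟩ : TangentBundle 𝓘(ℝ, F) M)).2 :=
  Trivialization.continuousLinearMapAt_apply_of_mem (R := ℝ)
    (trivializationAt F (TangentSpace 𝓘(ℝ, F)) x₀) (by simpa using hx) v

theorem hasMFDerivAt_chartAt (hx : x ∈ (chartAt F x₀).source) :
    HasMFDerivAt 𝓘(ℝ, F) 𝓘(ℝ, F) (chartAt F x₀) x (toModel x₀ x) := by
  have : IsManifold 𝓘(ℝ, F) 1 M := .of_le (n := ∞) (by simp)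
  rw [toModel_eq_mfderiv hx]
  exact (mdifferentiableAt_atlas (chart_mem_atlas F x₀) hx).hasMFDerivAt

theorem contMDiffAt_section_iff {V : ∀ x : M, TangentSpace 𝓘(ℝ, F) x}
    (hx : x ∈ (chartAt F x₀).source) :
    ContMDiffAt 𝓘(ℝ, F) 𝓘(ℝ, F).tangent ∞
      (fun y ↦ (⟨y, V y⟩ : TangentBundle 𝓘(ℝ, F) M)) x ↔
    ContMDiffAt 𝓘(ℝ, F) 𝓘(ℝ, F) ∞ (fun y ↦ toModel x₀ y (V y)) x := by
  rw [(trivializationAt F (TangentSpace 𝓘(ℝ, F)) x₀).contMDiffAt_section_iff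
    (by simpa using hx)]
  refine Filter.EventuallyEq.contMDiffAt_iff ?_
  filter_upwards [(chartAt F x₀).open_source.mem_nhds hx] with y hy
  exact (toModel_eq_snd hy _).symm

theorem mdifferentiableAt_section_iff {V : ∀ x : M, TangentSpace 𝓘(ℝ, F) x}
    (hx : x ∈ (chartAt F x₀).source) :
    MDifferentiableAt 𝓘(ℝ, F) 𝓘(ℝ, F).tangent
      (fun y ↦ (⟨y, V y⟩ : TangentBundle 𝓘(ℝ, F) M)) x ↔
    MDifferentiableAt 𝓘(ℝ, F) 𝓘(ℝ, F) (fun y ↦ toModel x₀ y (V y)) x := by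
  have : IsManifold 𝓘(ℝ, F) 1 M := .of_le (n := ∞) (by simp)
  rw [(trivializationAt F (TangentSpace 𝓘(ℝ, F)) x₀).mdifferentiableAt_section_iff 𝓘(ℝ, F) _
    (by simpa using hx)]
  refine Filter.EventuallyEq.mdifferentiableAt_iff ?_
  filter_upwards [(chartAt F x₀).open_source.mem_nhds hx] with y hy
  exact (toModel_eq_snd hy _).symm

theorem contMDiffAt_ofModel (w : F) (hx : x ∈ (chartAt F x₀).source) :
    ContMDiffAt 𝓘(ℝ, F) 𝓘(ℝ, F).tangent ∞
      (fun y ↦ (⟨y, ofModel x₀ y w⟩ : TangentBundle 𝓘(ℝ, F) M)) x := by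
  rw [contMDiffAt_section_iff hx]
  refine (contMDiffAt_const (c := w)).congr_of_eventuallyEq ?_
  filter_upwards [(chartAt F x₀).open_source.mem_nhds hx] with y hy
  exact toModel_ofModel hy w

theorem mdifferentiableAt_ofModel (w : F) (hx : x ∈ (chartAt F x₀).source) :
    MDifferentiableAt 𝓘(ℝ, F) 𝓘(ℝ, F).tangent
      (fun y ↦ (⟨y, ofModel x₀ y w⟩ : TangentBundle 𝓘(ℝ, F) M)) x :=
  (contMDiffAt_ofModel w hx).mdifferentiableAt (by simp)

variable (cov : CovariantDerivative 𝓘(ℝ, F) F (TangentSpace 𝓘(ℝ, F) : M → Type _))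

/-- The Leibniz rule for a field expanded in a local frame. Differentiability of the partial sums is
carried along because the induction step needs it for additivity of `cov`. -/
theorem cov_sum {ι : Type*} (s : Finset ι) (g : ι → M → ℝ)
    (V : ι → ∀ x : M, TangentSpace 𝓘(ℝ, F) x)
    (hg : ∀ i, MDifferentiableAt 𝓘(ℝ, F) 𝓘(ℝ, ℝ) (g i) x)
    (hV : ∀ i, MDifferentiableAt 𝓘(ℝ, F) 𝓘(ℝ, F).tangent
      (fun y ↦ (⟨y, V i y⟩ : TangentBundle 𝓘(ℝ, F) M)) x) (X : TangentSpace 𝓘(ℝ, F) x) :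
    MDifferentiableAt 𝓘(ℝ, F) 𝓘(ℝ, F).tangent
      (fun y ↦ (⟨y, ∑ i ∈ s, g i y • V i y⟩ : TangentBundle 𝓘(ℝ, F) M)) x ∧
    cov (fun y ↦ ∑ i ∈ s, g i y • V i y) x X =
      ∑ i ∈ s, (g i x • cov (V i) x X + mvfderiv 𝓘(ℝ, F) (g i) x X • V i x) := by
  classical
  have : IsManifold 𝓘(ℝ, F) 1 M := .of_le (n := ∞) (by simp)
  induction s using Finset.induction_on with
  | empty =>
    simp only [Finset.sum_empty]
    exact ⟨mdifferentiableAt_zeroSection .., DFunLike.congr_fun (congrFun cov.zero x) X⟩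
  | insert i s hi ih =>
    simp only [Finset.sum_insert hi]
    have h1 := (hg i).smul_section (hV i)
    refine ⟨mdifferentiableAt_add_section h1 ih.1, ?_⟩
    have h2 := cov.isCovariantDerivativeOn.add h1 ih.1 (mem_univ x)
    have h3 := cov.isCovariantDerivativeOn.leibniz (hV i) (hg i) (mem_univ x)
    rw [← ih.2]
    exact (DFunLike.congr_fun h2 X).trans (congrArg₂ (· + ·) (DFunLike.congr_fun h3 X) rfl)

variable [FiniteDimensional ℝ F]

/-- The coordinate expression of `X ↦ ∇_X s`, `s` the vector field with constant coordinate
expression `w`. -/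
noncomputable def covConst (x₀ : M) (w : F) (ξ : F) : F →L[ℝ] F :=
  toModel x₀ ((chartAt F x₀).symm ξ) ∘L
    cov (fun y ↦ ofModel x₀ y w) ((chartAt F x₀).symm ξ) ∘L ofModel x₀ ((chartAt F x₀).symm ξ)

/-- The Christoffel symbols of `∇` in the chart at `x₀`, as a bilinear map: `X, w ↦ ∇_X w` for
`w` with constant coordinates. -/
noncomputable def christoffel (x₀ : M) (ξ : F) : F →L[ℝ] F →L[ℝ] F :=
  ∑ i, (ContinuousLinearMap.smulRightL ℝ F F ((Module.finBasis ℝ F).coord i).toContinuousLinearMap)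
    ∘L covConst cov x₀ (Module.finBasis ℝ F i) ξ

theorem covConst_chart (hx : x ∈ (chartAt F x₀).source) (w : F) :
    covConst cov x₀ w (chartAt F x₀ x) =
      toModel x₀ x ∘L cov (fun y ↦ ofModel x₀ y w) x ∘L ofModel x₀ x := by
  have h := (chartAt F x₀).left_inv hx
  unfold covConst
  rw [h]

/-- `∇` in a chart. -/
theorem toModel_cov {f : F → F} {f' : F →L[ℝ] F} (hx : x ∈ (chartAt F x₀).source)
    (hf : HasFDerivAt f f' (chartAt F x₀ x)) (X : TangentSpace 𝓘(ℝ, F) x) :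
    toModel x₀ x (cov (fun y ↦ ofModel x₀ y (f (chartAt F x₀ y))) x X) =
      f' (toModel x₀ x X) +
        christoffel cov x₀ (chartAt F x₀ x) (toModel x₀ x X) (f (chartAt F x₀ x)) := by
  let b := Module.finBasis ℝ F
  let ℓ : ∀ i, F →L[ℝ] ℝ := fun i ↦ (b.coord i).toContinuousLinearMap
  have hb : ∀ v : F, ∑ i, ℓ i v • b i = v := fun v ↦ b.sum_repr v
  have hg : ∀ i, HasMFDerivAt 𝓘(ℝ, F) 𝓘(ℝ, ℝ) (fun y ↦ ℓ i (f (chartAt F x₀ y))) x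
      (((ℓ i) ∘L f') ∘L toModel x₀ x) := fun i ↦
    HasMFDerivAt.comp (g := fun ξ ↦ ℓ i (f ξ)) x
      (((ℓ i).hasFDerivAt.comp _ hf).hasMFDerivAt) (hasMFDerivAt_chartAt hx)
  have hsum : (fun y ↦ ofModel x₀ y (f (chartAt F x₀ y))) =
      fun y ↦ ∑ i, (ℓ i (f (chartAt F x₀ y))) • ofModel x₀ y (b i) := by
    funext y
    conv_lhs => rw [← hb (f (chartAt F x₀ y)), map_sum]
    exact Finset.sum_congr rfl fun i _ ↦ map_smul _ _ _
  have hd : ∀ i, mvfderiv 𝓘(ℝ, F) (fun y ↦ ℓ i (f (chartAt F x₀ y))) x X =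
      ℓ i (f' (toModel x₀ x X)) := by
    intro i
    exact DFunLike.congr_fun (hg i).mfderiv X
  rw [hsum, (cov_sum cov Finset.univ _ _ (fun i ↦ (hg i).mdifferentiableAt)
    (fun i ↦ mdifferentiableAt_ofModel (b i) hx) X).2, map_sum]
  simp only [map_add, map_smul, hd, Finset.sum_add_distrib, toModel_ofModel hx]
  rw [hb, add_comm]
  congr 1
  simp only [christoffel, covConst_chart cov hx, _root_.sum_apply,
    ContinuousLinearMap.comp_apply, ofModel_toModel hx]
  rfl

/-- Smoothness of a connection is a statement about globally smooth fields, whereas coordinate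
fields live on a chart domain only. A bump function extends them, and since it is one near the point
in question, `cov` does not notice. -/
theorem contDiffOn_covConst [CovariantDerivative.ContMDiffCovariantDerivative cov ∞] [T2Space M]
    (x₀ : M) (w : F) : ContDiffOn ℝ ∞ (covConst cov x₀ w) (chartAt F x₀).target := by
  rw [contDiffOn_clm_apply]
  intro X ξ hξ
  set x := (chartAt F x₀).symm ξ with hxdef
  have hx : x ∈ (chartAt F x₀).source := (chartAt F x₀).map_target hξ
  obtain ⟨f, hf, -⟩ := (SmoothBumpFunction.nhds_basis_support (I := 𝓘(ℝ, F))
    ((chartAt F x₀).open_source.mem_nhds hx)).mem_iff.1 ((chartAt F x₀).open_source.mem_nhds hx)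
  have hs : ContMDiffOn 𝓘(ℝ, F) 𝓘(ℝ, F).tangent ∞
      (fun y ↦ (⟨y, ofModel x₀ y w⟩ : TangentBundle 𝓘(ℝ, F) M)) (chartAt F x₀).source :=
    fun y hy ↦ (contMDiffAt_ofModel w hy).contMDiffWithinAt
  have hs' := ContMDiffOn.smul_section_of_tsupport (f.contMDiff.contMDiffOn)
    (chartAt F x₀).open_source hf hs
  have hc := (CovariantDerivative.ContMDiffCovariantDerivative.contMDiff
    (cov := cov) (k := ∞)).contMDiff (by simpa using! hs'.contMDiffOn)
  have hc' := (hc.contMDiffAt univ_mem (x := x)).clm_bundle_apply (contMDiffAt_ofModel X hx)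
  rw [contMDiffAt_section_iff hx] at hc'
  have hsymm : ContMDiffAt 𝓘(ℝ, F) 𝓘(ℝ, F) ∞ (chartAt F x₀).symm ξ :=
    (contMDiffOn_chart_symm (n := ∞) (I := 𝓘(ℝ, F)) (x := x₀)).contMDiffAt
      ((chartAt F x₀).open_target.mem_nhds hξ)
  have := (ContMDiffAt.comp ξ hc' hsymm).contDiffAt
  refine (this.congr_of_eventuallyEq ?_).contDiffWithinAt
  have h1 : ∀ᶠ y in 𝓝 x, y ∈ (chartAt F x₀).source ∧ f =ᶠ[𝓝 y] 1 :=
    Filter.Eventually.and ((chartAt F x₀).open_source.mem_nhds hx)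
      f.eventuallyEq_one.eventuallyEq_nhds
  filter_upwards [((chartAt F x₀).continuousAt_symm hξ).eventually h1] with η ⟨hη, hη1⟩
  set y := (chartAt F x₀).symm η with hy
  have : cov (fun z ↦ f z • ofModel x₀ z w) y = cov (fun y ↦ ofModel x₀ y w) y := by
    refine cov.isCovariantDerivativeOn.congr_of_eventuallyEq
      (hs'.mdifferentiableAt (by simp)) (mdifferentiableAt_ofModel w hη) univ_mem ?_
    filter_upwards [hη1] with z hz
    simp [hz]
  simp only [Function.comp_apply, covConst, ContinuousLinearMap.comp_apply]
  exact congrArg (toModel x₀ y) (DFunLike.congr_fun this _).symm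

theorem contDiffOn_christoffel [CovariantDerivative.ContMDiffCovariantDerivative cov ∞] [T2Space M]
    (x₀ : M) : ContDiffOn ℝ ∞ (christoffel cov x₀) (chartAt F x₀).target := by
  have := fun i ↦ contDiffOn_covConst cov x₀ (Module.finBasis ℝ F i)
  unfold christoffel
  fun_prop

/-- Extend both vectors to fields with constant coordinates. These are pullbacks of constant fields,
so their bracket vanishes and only the antisymmetrized Christoffel symbols remain. -/
theorem toModel_torsion (hx : x ∈ (chartAt F x₀).source) (X Y : TangentSpace 𝓘(ℝ, F) x) :
    toModel x₀ x (cov.torsion x X Y) =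
      christoffel cov x₀ (chartAt F x₀ x) (toModel x₀ x X) (toModel x₀ x Y) -
      christoffel cov x₀ (chartAt F x₀ x) (toModel x₀ x Y) (toModel x₀ x X) := by
  set a := toModel x₀ x X with ha
  set b := toModel x₀ x Y with hb
  have hX := mdifferentiableAt_ofModel a hx
  have hY := mdifferentiableAt_ofModel b hx
  have h1 := cov.torsion_apply hX hY
  have h0 : VectorField.mlieBracket 𝓘(ℝ, F) (fun y ↦ ofModel x₀ y a) (fun y ↦ ofModel x₀ y b) x
      = 0 := by
    have h2 : minSmoothness ℝ 2 ≤ (∞ : WithTop ℕ∞) := by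
      rw [minSmoothness_of_isRCLikeNormedField]
      exact WithTop.coe_le_coe.2 (le_top : (2 : ℕ∞) ≤ ⊤)
    have : IsManifold 𝓘(ℝ, F) (minSmoothness ℝ 2) M := .of_le (n := ∞) h2
    let cst : F → ∀ ξ : F, TangentSpace 𝓘(ℝ, F) ξ := fun v _ ↦ v
    have hc : ∀ v : F, MDifferentiableAt 𝓘(ℝ, F) 𝓘(ℝ, F).tangent
        (fun y ↦ (⟨y, cst v y⟩ : TangentBundle 𝓘(ℝ, F) F)) (chartAt F x₀ x) := fun v ↦
      (contMDiffAt_vectorSpace_iff_contDiffAt.2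
        (contDiffAt_const (n := 1))).mdifferentiableAt (by simp)
    have h := VectorField.mpullback_mlieBracket (hc a) (hc b)
      (contMDiffAt_of_mem_maximalAtlas (n := ∞) (IsManifold.chart_mem_maximalAtlas x₀) hx) h2
    have hp : ∀ v : F, (fun y ↦ ofModel x₀ y v) =ᶠ[𝓝 x]
        VectorField.mpullback 𝓘(ℝ, F) 𝓘(ℝ, F) (chartAt F x₀) (cst v) := fun v ↦ by
      filter_upwards [(chartAt F x₀).open_source.mem_nhds hx] with y hy
      change ofModel x₀ y v = (mfderiv 𝓘(ℝ, F) 𝓘(ℝ, F) (chartAt F x₀) y).inverse v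
      rw [← toModel_eq_mfderiv hy]
      let e : TangentSpace 𝓘(ℝ, F) y ≃L[ℝ] F := .equivOfInverse (toModel x₀ y) (ofModel x₀ y)
        (ofModel_toModel hy) (toModel_ofModel hy)
      exact (DFunLike.congr_fun (ContinuousLinearMap.inverse_equiv e) v).symm
    rw [(hp a).mlieBracket_vectorField_eq (hp b)]
    refine h.symm.trans ?_
    rw [VectorField.mpullback_apply]
    have : VectorField.mlieBracket 𝓘(ℝ, F) (cst a) (cst b) (chartAt F x₀ x) = 0 := by
      rw [← VectorField.mlieBracketWithin_univ, VectorField.mlieBracketWithin_eq_lieBracketWithin,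
        VectorField.lieBracketWithin_univ]
      change fderiv ℝ (fun _ : F ↦ b) _ a - fderiv ℝ (fun _ : F ↦ a) _ b = 0
      simp
    exact (congrArg _ this).trans (map_zero _)
  rw [ofModel_toModel hx, ofModel_toModel hx, h0, sub_zero] at h1
  rw [h1, map_sub]
  have h2 := toModel_cov cov hx (hasFDerivAt_const a (chartAt F x₀ x)) Y
  have h3 := toModel_cov cov hx (hasFDerivAt_const b (chartAt F x₀ x)) X
  rw [h2, h3]
  simp [← ha, ← hb]

/-- The change of coordinates from the chart at `x₀` to the chart at `x₁`. -/
noncomputable def transition (x₀ x₁ : M) (ξ : F) : F := chartAt F x₁ ((chartAt F x₀).symm ξ)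

variable {x₁ : M}

theorem contDiffAt_transition (hx : x ∈ (chartAt F x₀).source) (hx' : x ∈ (chartAt F x₁).source) :
    ContDiffAt ℝ ∞ (transition x₀ x₁) (chartAt F x₀ x) := by
  have h1 : ContMDiffAt 𝓘(ℝ, F) 𝓘(ℝ, F) ∞ (chartAt F x₀).symm (chartAt F x₀ x) :=
    (contMDiffOn_chart_symm (n := ∞) (I := 𝓘(ℝ, F)) (x := x₀)).contMDiffAt
      ((chartAt F x₀).open_target.mem_nhds ((chartAt F x₀).map_source hx))
  have h2 : ContMDiffAt 𝓘(ℝ, F) 𝓘(ℝ, F) ∞ (chartAt F x₁)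
      ((chartAt F x₀).symm (chartAt F x₀ x)) := by
    rw [(chartAt F x₀).left_inv hx]
    exact contMDiffAt_of_mem_maximalAtlas (n := ∞) (IsManifold.chart_mem_maximalAtlas x₁) hx'
  exact (h2.comp _ h1).contDiffAt

theorem transition_chart (hx : x ∈ (chartAt F x₀).source) :
    transition x₀ x₁ (chartAt F x₀ x) = chartAt F x₁ x := by
  rw [transition, (chartAt F x₀).left_inv hx]

theorem fderiv_transition_toModel (hx : x ∈ (chartAt F x₀).source)
    (hx' : x ∈ (chartAt F x₁).source) (v : TangentSpace 𝓘(ℝ, F) x) :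
    fderiv ℝ (transition x₀ x₁) (chartAt F x₀ x) (toModel x₀ x v) = toModel x₁ x v := by
  have h1 := ((contDiffAt_transition hx hx').differentiableAt (by simp)).hasFDerivAt.hasMFDerivAt
  have h2 := HasMFDerivAt.comp x h1 (hasMFDerivAt_chartAt hx)
  have h3 := h2.congr_of_eventuallyEq (f₁ := chartAt F x₁) (by
    filter_upwards [(chartAt F x₀).open_source.mem_nhds hx] with y hy
    exact (transition_chart hy).symm)
  exact DFunLike.congr_fun (hasMFDerivAt_unique h3 (hasMFDerivAt_chartAt hx')) v

/-- The transformation law of the Christoffel symbols. -/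
theorem christoffel_transition (hx : x ∈ (chartAt F x₀).source)
    (hx' : x ∈ (chartAt F x₁).source) (X w : F) :
    christoffel cov x₁ (chartAt F x₁ x) (fderiv ℝ (transition x₀ x₁) (chartAt F x₀ x) X)
        (fderiv ℝ (transition x₀ x₁) (chartAt F x₀ x) w) =
      fderiv ℝ (transition x₀ x₁) (chartAt F x₀ x) (christoffel cov x₀ (chartAt F x₀ x) X w) -
        fderiv ℝ (fderiv ℝ (transition x₀ x₁)) (chartAt F x₀ x) X w := by
  set ψ : F → F := transition x₀ x₁
  -- This is the coordinate expression in the chart at `x₁` of the field that has constant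
  -- coordinates `w` in the chart at `x₀`. The law follows by computing its covariant derivative in
  -- both charts.
  let f : F → F := fun η ↦ fderiv ℝ ψ (transition x₁ x₀ η) w
  have e : transition x₁ x₀ (chartAt F x₁ x) = chartAt F x₀ x := transition_chart hx'
  have hψ2 : HasFDerivAt (fderiv ℝ ψ) (fderiv ℝ (fderiv ℝ ψ) (chartAt F x₀ x))
      (transition x₁ x₀ (chartAt F x₁ x)) := by
    rw [e]
    exact (((contDiffAt_transition hx hx').fderiv_right (m := ∞) (by simp)).differentiableAt
      (by simp)).hasFDerivAt
  have hf := (hψ2.comp (chartAt F x₁ x)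
    ((contDiffAt_transition hx' hx).differentiableAt (by simp)).hasFDerivAt).clm_apply
    (hasFDerivAt_const w _)
  set Y := ofModel x₀ x X with hY
  have hYX : toModel x₀ x Y = X := toModel_ofModel hx X
  have hev : ∀ᶠ y in 𝓝 x, ofModel x₁ y (f (chartAt F x₁ y)) = ofModel x₀ y w := by
    filter_upwards [(chartAt F x₀).open_source.mem_nhds hx,
      (chartAt F x₁).open_source.mem_nhds hx'] with y hy hy'
    simp only [f]
    rw [transition_chart hy', ← toModel_ofModel hy w, fderiv_transition_toModel hy hy',
      ofModel_toModel hy', toModel_ofModel hy w]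
  have hcov : cov (fun y ↦ ofModel x₁ y (f (chartAt F x₁ y))) x = cov (fun y ↦ ofModel x₀ y w) x := by
    have hm := mdifferentiableAt_ofModel w hx
    refine cov.isCovariantDerivativeOn.congr_of_eventuallyEq
      (hm.congr_of_eventuallyEq ?_) hm univ_mem hev
    filter_upwards [hev] with y hy
    rw [hy]
  have h1 := toModel_cov cov hx' hf Y
  have h0 := toModel_cov cov hx (hasFDerivAt_const w (chartAt F x₀ x)) Y
  have h2 := fderiv_transition_toModel hx hx' (cov (fun y ↦ ofModel x₀ y w) x Y)
  have h3 := fderiv_transition_toModel hx hx' Y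
  have h4 := fderiv_transition_toModel hx' hx Y
  rw [h0, hYX] at h2
  rw [hYX] at h3
  rw [hYX] at h4
  have h5 := (congrArg (fun L ↦ toModel x₁ x (L Y)) hcov).symm.trans h1
  rw [h3]
  simp only [_root_.zero_apply, zero_add] at h2
  rw [h2, h5]
  simp [h4, e]

end Geometry

/-! ### Space derivatives of maps that are smooth up to the ends of a time interval -/

section PartialDerivative

variable {G W : Type*} [NormedAddCommGroup G] [NormedSpace ℝ G] [NormedAddCommGroup W]
  [NormedSpace ℝ W] {A : ℝ → G → W} {a b : ℝ} {Ω : Set G}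

/-- In time only a derivative within the closed interval is available; on a slice of fixed time it
restricts to a full derivative because `Ω` is open. -/
theorem hasFDerivAt_of_contDiffOn_prod (hΩ : IsOpen Ω)
    (hA : ContDiffOn ℝ 1 (fun q : ℝ × G ↦ A q.1 q.2) (Icc a b ×ˢ Ω)) {t : ℝ} (ht : t ∈ Icc a b)
    {z : G} (hz : z ∈ Ω) :
    HasFDerivAt (A t) (fderivWithin ℝ (fun q : ℝ × G ↦ A q.1 q.2) (Icc a b ×ˢ Ω) (t, z) ∘L
      ContinuousLinearMap.inr ℝ ℝ G) z := by
  have h1 := ((hA.differentiableOn (by simp)) (t, z) ⟨ht, hz⟩).hasFDerivWithinAt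
  have h2 : HasFDerivWithinAt (fun z' : G ↦ (t, z')) (ContinuousLinearMap.inr ℝ ℝ G) Ω z :=
    ((hasFDerivAt_const t z).prodMk (hasFDerivAt_id z)).hasFDerivWithinAt
  exact (h1.comp z h2 fun z' hz' ↦ ⟨ht, hz'⟩).hasFDerivAt (hΩ.mem_nhds hz)

theorem continuousOn_fderiv_of_contDiffOn_prod (hab : a < b) (hΩ : IsOpen Ω)
    (hA : ContDiffOn ℝ 1 (fun q : ℝ × G ↦ A q.1 q.2) (Icc a b ×ˢ Ω)) :
    ContinuousOn (fun q : ℝ × G ↦ fderiv ℝ (A q.1) q.2) (Icc a b ×ˢ Ω) := by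
  have h := hA.continuousOn_fderivWithin ((uniqueDiffOn_Icc hab).prod hΩ.uniqueDiffOn) le_rfl
  exact (h.clm_comp continuousOn_const).congr fun q hq ↦
    (hasFDerivAt_of_contDiffOn_prod hΩ hA hq.1 hq.2).fderiv

end PartialDerivative

/-! ### Velocities, vector fields and the development equation in coordinates -/

section Geometry

set_option linter.unusedSectionVars false

variable {F : Type*} [NormedAddCommGroup F] [NormedSpace ℝ F] [FiniteDimensional ℝ F]
  {M : Type*} [TopologicalSpace M] [ChartedSpace F M] [IsManifold 𝓘(ℝ, F) ∞ M] {x₀ x₁ x : M}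

/-- `velocity` is a manifold derivative, which is zero by default where `γ` is not differentiable.
Continuity of `γ` allows differentiability to be recovered from the chart expression. -/
theorem toModel_velocity {γ : ℝ → M} {t : ℝ} {v : F} (hx : γ t ∈ (chartAt F x₀).source)
    (hγ : ContinuousAt γ t) (h : HasDerivAt (fun s ↦ chartAt F x₀ (γ s)) v t) :
    toModel x₀ (γ t) (velocity γ t) = v := by
  have hsymm : MDifferentiableAt 𝓘(ℝ, F) 𝓘(ℝ, F) (chartAt F x₀).symm (chartAt F x₀ (γ t)) :=
    ((contMDiffOn_chart_symm (n := ∞) (I := 𝓘(ℝ, F)) (x := x₀)).contMDiffAt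
      ((chartAt F x₀).open_target.mem_nhds ((chartAt F x₀).map_source hx))).mdifferentiableAt
      (by simp)
  have hev : (fun s ↦ (chartAt F x₀).symm (chartAt F x₀ (γ s))) =ᶠ[𝓝 t] γ := by
    filter_upwards [hγ.eventually ((chartAt F x₀).open_source.mem_nhds hx)] with s hs
    exact (chartAt F x₀).left_inv hs
  have hγd : MDifferentiableAt 𝓘(ℝ, ℝ) 𝓘(ℝ, F) γ t :=
    (MDifferentiableAt.comp t hsymm h.hasFDerivAt.hasMFDerivAt.mdifferentiableAt).congr_of_eventuallyEq
      hev.symm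
  have h1 := HasMFDerivAt.comp t (hasMFDerivAt_chartAt hx) hγd.hasMFDerivAt
  have h2 := hasMFDerivAt_unique h1 h.hasFDerivAt.hasMFDerivAt
  have h3 := DFunLike.congr_fun h2 (1 : ℝ)
  refine h3.trans ?_
  exact one_smul ℝ v

/-- The coordinate expression of tangent vectors, as an operator on the model space. -/
noncomputable def coordMap (x₀ x : M) : F →L[ℝ] F := toModel x₀ x

/-- The inverse of `coordMap`. -/
noncomputable def coordInv (x₀ x : M) : F →L[ℝ] F := ofModel x₀ x

theorem coordMap_coordInv (hx : x ∈ (chartAt F x₀).source) (v : F) :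
    coordMap x₀ x (coordInv x₀ x v) = v := toModel_ofModel hx v

theorem coordInv_coordMap (hx : x ∈ (chartAt F x₀).source) (v : F) :
    coordInv x₀ x (coordMap x₀ x v) = v := ofModel_toModel hx v

theorem coordInv_comp_coordMap (hx : x ∈ (chartAt F x₀).source) :
    coordInv (F := F) x₀ x ∘L coordMap x₀ x = ContinuousLinearMap.id ℝ F :=
  ContinuousLinearMap.ext (coordInv_coordMap hx)

theorem coordMap_comp_coordInv (hx : x ∈ (chartAt F x₀).source) :
    coordMap (F := F) x₀ x ∘L coordInv x₀ x = ContinuousLinearMap.id ℝ F :=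
  ContinuousLinearMap.ext (coordMap_coordInv hx)

theorem fderiv_transition_comp_coordMap (hx : x ∈ (chartAt F x₀).source)
    (hx' : x ∈ (chartAt F x₁).source) :
    fderiv ℝ (transition (F := F) x₀ x₁) (chartAt F x₀ x) ∘L coordMap x₀ x = coordMap x₁ x :=
  ContinuousLinearMap.ext (fderiv_transition_toModel hx hx')

/-- The coordinate expression of a vector field. -/
noncomputable def fieldCoord (V : ∀ x : M, TangentSpace 𝓘(ℝ, F) x) (x₀ : M) (ξ : F) : F :=
  toModel x₀ ((chartAt F x₀).symm ξ) (V ((chartAt F x₀).symm ξ))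

theorem fieldCoord_chart (V : ∀ x : M, TangentSpace 𝓘(ℝ, F) x) (hx : x ∈ (chartAt F x₀).source) :
    fieldCoord V x₀ (chartAt F x₀ x) = toModel x₀ x (V x) := by
  have h := (chartAt F x₀).left_inv hx
  unfold fieldCoord
  rw [h]

theorem contDiffOn_fieldCoord {s : Set ℝ} {u : ℝ → ∀ x : M, TangentSpace 𝓘(ℝ, F) x}
    (hu : ContMDiffOn (𝓘(ℝ, ℝ).prod 𝓘(ℝ, F)) 𝓘(ℝ, F).tangent ∞
      (fun p : ℝ × M ↦ (⟨p.2, u p.1 p.2⟩ : TangentBundle 𝓘(ℝ, F) M)) (s ×ˢ univ)) (x₀ : M) :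
    ContDiffOn ℝ ∞ (fun q : ℝ × F ↦ fieldCoord (u q.1) x₀ q.2) (s ×ˢ (chartAt F x₀).target) := by
  rintro ⟨t, ξ⟩ ⟨ht, hξ⟩
  set x := (chartAt F x₀).symm ξ with hxd
  have hx : x ∈ (chartAt F x₀).source := (chartAt F x₀).map_target hξ
  have h1 := hu (t, x) ⟨ht, mem_univ _⟩
  rw [(trivializationAt F (TangentSpace 𝓘(ℝ, F)) x₀).contMDiffWithinAt_iff (by simpa using hx)]
    at h1
  have hsymm : ContMDiffAt 𝓘(ℝ, F) 𝓘(ℝ, F) ∞ (chartAt F x₀).symm ξ :=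
    (contMDiffOn_chart_symm (n := ∞) (I := 𝓘(ℝ, F)) (x := x₀)).contMDiffAt
      ((chartAt F x₀).open_target.mem_nhds hξ)
  have h2 : ContMDiffWithinAt 𝓘(ℝ, ℝ × F) (𝓘(ℝ, ℝ).prod 𝓘(ℝ, F)) ∞
      (fun q : ℝ × F ↦ (q.1, (chartAt F x₀).symm q.2)) (s ×ˢ (chartAt F x₀).target) (t, ξ) :=
    (contDiff_fst.contDiffAt.contMDiffAt.prodMk
      (ContMDiffAt.comp (t, ξ) hsymm contDiff_snd.contDiffAt.contMDiffAt)).contMDiffWithinAt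
  have h3 := ContMDiffWithinAt.comp (t, ξ) h1.2 h2 fun q hq ↦ mk_mem_prod hq.1 (mem_univ _)
  refine h3.contDiffWithinAt.congr (fun q hq ↦ ?_) ?_
  · exact toModel_eq_snd ((chartAt F x₀).map_target hq.2) _
  · exact toModel_eq_snd hx _

variable (cov : CovariantDerivative 𝓘(ℝ, F) F (TangentSpace 𝓘(ℝ, F) : M → Type _))

/-- `∇V` in a chart. -/
theorem toModel_cov_field {V : ∀ x : M, TangentSpace 𝓘(ℝ, F) x} (hx : x ∈ (chartAt F x₀).source)
    {f' : F →L[ℝ] F} (hV : HasFDerivAt (fieldCoord V x₀) f' (chartAt F x₀ x))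
    (X : TangentSpace 𝓘(ℝ, F) x) :
    toModel x₀ x (cov V x X) = f' (toModel x₀ x X) +
      christoffel cov x₀ (chartAt F x₀ x) (toModel x₀ x X) (fieldCoord V x₀ (chartAt F x₀ x)) := by
  rw [← toModel_cov cov hx hV X]
  have hev : ∀ᶠ y in 𝓝 x, V y = ofModel x₀ y (fieldCoord V x₀ (chartAt F x₀ y)) := by
    filter_upwards [(chartAt F x₀).open_source.mem_nhds hx] with y hy
    rw [fieldCoord_chart V hy, ofModel_toModel hy]
  have hm : MDifferentiableAt 𝓘(ℝ, F) 𝓘(ℝ, F).tangent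
      (fun y ↦ (⟨y, V y⟩ : TangentBundle 𝓘(ℝ, F) M)) x := by
    rw [mdifferentiableAt_section_iff hx]
    refine ((HasMFDerivAt.comp x hV.hasMFDerivAt
      (hasMFDerivAt_chartAt hx)).mdifferentiableAt).congr_of_eventuallyEq ?_
    filter_upwards [(chartAt F x₀).open_source.mem_nhds hx] with y hy
    exact (fieldCoord_chart V hy).symm
  have hcov : cov V x = cov (fun y ↦ ofModel x₀ y (fieldCoord V x₀ (chartAt F x₀ y))) x := by
    refine cov.isCovariantDerivativeOn.congr_of_eventuallyEq
      hm (hm.congr_of_eventuallyEq ?_) univ_mem hev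
    filter_upwards [hev] with y hy
    rw [← hy]
  rw [hcov]

/-- The right-hand side of the equations `ξ' = v`, `p' = -Γ(ξ)(v) p` of a curve and a parallel
frame along it. -/
noncomputable def transportSystem (x₀ : M) (z : F × (F →L[ℝ] F)) : F →L[ℝ] F × (F →L[ℝ] F) :=
  (ContinuousLinearMap.id ℝ F).prod
    (-((ContinuousLinearMap.compL ℝ F F F).flip z.2 ∘L christoffel cov x₀ z.1))

theorem transportSystem_apply (x₀ : M) (z : F × (F →L[ℝ] F)) (v : F) :
    transportSystem cov x₀ z v = (v, -(christoffel cov x₀ z.1 v ∘L z.2)) := rfl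

/-- The right-hand side of the equations of affine development: `v = p α + r u(t, ξ)`. -/
noncomputable def developmentSystem (u : ℝ → ∀ x : M, TangentSpace 𝓘(ℝ, F) x) (x₀ : M) (t : ℝ)
    (z : F × (F →L[ℝ] F)) : ℝ × F →L[ℝ] F × (F →L[ℝ] F) :=
  transportSystem cov x₀ z ∘L
    (z.2 ∘L ContinuousLinearMap.snd ℝ ℝ F +
      (ContinuousLinearMap.fst ℝ ℝ F).smulRight (fieldCoord (u t) x₀ z.1))

theorem developmentSystem_apply (u : ℝ → ∀ x : M, TangentSpace 𝓘(ℝ, F) x) (x₀ : M) (t : ℝ)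
    (z : F × (F →L[ℝ] F)) (β : ℝ × F) : developmentSystem cov u x₀ t z β =
      transportSystem cov x₀ z (z.2 β.2 + β.1 • fieldCoord (u t) x₀ z.1) := rfl

variable [CovariantDerivative.ContMDiffCovariantDerivative cov ∞] [T2Space M]

theorem contDiffOn_transportSystem (x₀ : M) :
    ContDiffOn ℝ ∞ (transportSystem cov x₀) ((chartAt F x₀).target ×ˢ univ) := by
  have h1 : ContDiffOn ℝ ∞ (fun z : F × (F →L[ℝ] F) ↦ christoffel cov x₀ z.1)
      ((chartAt F x₀).target ×ˢ univ) :=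
    (contDiffOn_christoffel cov x₀).comp contDiffOn_fst fun z hz ↦ hz.1
  have h2 : ContDiffOn ℝ ∞ (fun z : F × (F →L[ℝ] F) ↦ (ContinuousLinearMap.compL ℝ F F F).flip z.2)
      ((chartAt F x₀).target ×ˢ univ) :=
    (ContinuousLinearMap.contDiff _).comp_contDiffOn contDiffOn_snd
  have h3 := (h2.clm_comp h1).neg
  exact contDiffOn_clm_apply.2 fun v ↦ contDiffOn_const.prodMk (contDiffOn_clm_apply.1 h3 v)

theorem contDiffOn_developmentSystem {u : ℝ → ∀ x : M, TangentSpace 𝓘(ℝ, F) x} {s : Set ℝ}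
    (hu : ContMDiffOn (𝓘(ℝ, ℝ).prod 𝓘(ℝ, F)) 𝓘(ℝ, F).tangent ∞
      (fun p : ℝ × M ↦ (⟨p.2, u p.1 p.2⟩ : TangentBundle 𝓘(ℝ, F) M)) (s ×ˢ univ)) (x₀ : M) :
    ContDiffOn ℝ ∞ (fun q : ℝ × F × (F →L[ℝ] F) ↦ developmentSystem cov u x₀ q.1 q.2)
      (s ×ˢ (chartAt F x₀).target ×ˢ univ) := by
  have h1 : ContDiffOn ℝ ∞ (fun q : ℝ × F × (F →L[ℝ] F) ↦ transportSystem cov x₀ q.2)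
      (s ×ˢ (chartAt F x₀).target ×ˢ univ) :=
    (contDiffOn_transportSystem cov x₀).comp contDiffOn_snd fun z hz ↦ hz.2
  have h2 : ContDiffOn ℝ ∞ (fun q : ℝ × F × (F →L[ℝ] F) ↦ fieldCoord (u q.1) x₀ q.2.1)
      (s ×ˢ (chartAt F x₀).target ×ˢ univ) :=
    (contDiffOn_fieldCoord hu x₀).comp (contDiffOn_fst.prodMk contDiffOn_snd.fst)
      fun q hq ↦ ⟨hq.1, hq.2.1⟩
  have h3 : ContDiffOn ℝ ∞ (fun q : ℝ × F × (F →L[ℝ] F) ↦ q.2.2)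
      (s ×ˢ (chartAt F x₀).target ×ˢ univ) := contDiffOn_snd.snd
  refine contDiffOn_clm_apply.2 fun β ↦ ?_
  exact h1.clm_apply ((h3.clm_apply contDiffOn_const).add (contDiffOn_const.smul h2))

end Geometry

/-! ### Concatenation, reparametrization and linear equations with integrable coefficients -/

section

set_option linter.unusedSectionVars false
set_option synthInstance.maxHeartbeats 200000

variable {G : Type*} [NormedAddCommGroup G] [NormedSpace ℝ G] [CompleteSpace G]

theorem HasACDeriv.piecewise {f f' g g' : ℝ → G} {a m b : ℝ} (ham : a ≤ m) (hmb : m ≤ b)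
    (h1 : HasACDeriv f f' a m) (h2 : HasACDeriv g g' m b) (h : f m = g m) :
    HasACDeriv (fun t ↦ if t ≤ m then f t else g t) (fun t ↦ if t ≤ m then f' t else g' t) a b := by
  refine HasACDeriv.glue (m := m) (h1.congr_fun ham (fun t ht ↦ ?_) fun t ht ↦ ?_)
    (h2.congr hmb (fun t ht ↦ ?_) ?_) ham hmb
  · simp [ht.2]
  · simp [ht.2]
  · rcases ht.1.eq_or_lt with rfl | hlt
    · simp [h]
    · simp [not_le.2 hlt]
  -- At `m` the two derivatives may disagree, which is a null set.
  · filter_upwards [ae_restrict_mem measurableSet_Icc, ae_restrict_of_ae (Measure.ae_ne volume m)]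
      with t ht htm
    simp [not_le.2 (ht.1.lt_of_ne' htm)]

/-- The sign of `m` is irrelevant because the integrals are oriented; slope `-1` serves to reverse
curves. -/
theorem HasACDeriv.comp_affine {f f' : ℝ → G} {a b c d m n : ℝ} (h : HasACDeriv f f' a b)
    (hcd : c ≤ d) (hmap : ∀ s ∈ Icc c d, m * s + n ∈ Icc a b) :
    HasACDeriv (fun s ↦ f (m * s + n)) (fun s ↦ m • f' (m * s + n)) c d := by
  have hc := hmap c ⟨le_rfl, hcd⟩
  have hd := hmap d ⟨hcd, le_rfl⟩
  constructor
  · rcases eq_or_ne m 0 with rfl | hm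
    · simp
    · have h1 := (h.intervalIntegrable_sub hc hd).comp_add_right n
      have h2 := h1.comp_mul_left (c := m)
      rw [add_sub_cancel_right, add_sub_cancel_right, mul_div_cancel_left₀ _ hm,
        mul_div_cancel_left₀ _ hm] at h2
      exact h2.smul m
  · intro t ht
    rw [intervalIntegral.integral_smul, intervalIntegral.smul_integral_comp_mul_add]
    exact h.eq_add_integral hc (hmap t ht)

theorem HasACDeriv.of_contDiffOn {f : ℝ → G} {a b : ℝ} (hab : a ≤ b)
    (h : ContDiffOn ℝ 1 f (Icc a b)) : HasACDeriv f (deriv f) a b := by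
  rcases hab.eq_or_lt with rfl | hlt
  · refine ⟨by simp, fun t ht ↦ ?_⟩
    rw [Icc_self, mem_singleton_iff] at ht
    simp [ht]
  have hc := h.continuousOn_derivWithin (uniqueDiffOn_Icc hlt) le_rfl
  have hderiv : ∀ t ∈ Ioo a b, HasDerivAt f (derivWithin f (Icc a b) t) t := fun t ht ↦
    ((h.differentiableOn (by simp) t (Ioo_subset_Icc_self ht)).hasDerivWithinAt).hasDerivAt
      (Icc_mem_nhds ht.1 ht.2)
  have key : HasACDeriv f (derivWithin f (Icc a b)) a b := by
    refine ⟨ContinuousOn.intervalIntegrable (by rwa [uIcc_of_le hab]), fun t ht ↦ ?_⟩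
    rw [intervalIntegral.integral_eq_sub_of_hasDerivAt_of_le ht.1
      (h.continuousOn.mono (Icc_subset_Icc_right ht.2))
      (fun s hs ↦ hderiv s ⟨hs.1, hs.2.trans_le ht.2⟩)
      (ContinuousOn.intervalIntegrable (by
        rw [uIcc_of_le ht.1]
        exact hc.mono (Icc_subset_Icc_right ht.2)))]
    abel
  refine key.congr hab (fun _ _ ↦ rfl) ?_
  filter_upwards [key.ae_hasDerivAt] with t ht
  exact ht.deriv.symm

/-- Existence of solutions of linear equations with integrable coefficients. -/
theorem exists_linear_ode {B : ℝ → G →L[ℝ] G} {f : ℝ → G} {a b : ℝ} (hab : a ≤ b)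
    (hB : IntervalIntegrable B volume a b) (hf : IntervalIntegrable f volume a b) {t₀ : ℝ}
    (ht₀ : t₀ ∈ Icc a b) (y₀ : G) :
    ∃ y, HasACDeriv y (fun t ↦ B t (y t) + f t) a b ∧ y t₀ = y₀ := by
  suffices ∀ t₀ ∈ Icc a b, ∀ y₀, ∃ y, HasACDeriv y (fun t ↦ B t (y t) + f t) a b ∧ y t₀ = y₀ from
    this t₀ ht₀ y₀
  refine interval_induction (p := fun c d ↦ ∀ t₀ ∈ Icc c d, ∀ y₀, ∃ y,
    HasACDeriv y (fun t ↦ B t (y t) + f t) c d ∧ y t₀ = y₀) hab (fun t ht ↦ ?_) ?_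
  -- With this bound the integral operator `V` and its evaluation `E ∘ V` each have norm at most `1
  -- / 4`, so that their difference has norm below one.
  · obtain ⟨ε, hε, h1⟩ := exists_integral_norm_lt hB (δ := 1 / 4) (by norm_num) ht
    refine ⟨ε, hε, fun c d hcd hc hd hct hdt t₀ ht₀ y₀ ↦ ?_⟩
    have hint := h1 c d hcd hc hd hct hdt
    have hsub : uIcc c d ⊆ uIcc a b := uIcc_subset_uIcc (Icc_subset_uIcc hc) (Icc_subset_uIcc hd)
    have hB' := hB.mono_set hsub
    have hf' := hf.mono_set hsub
    have hBL : MemLp B 1 (volume.restrict (Icc c d)) := by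
      rw [memLp_one_iff_integrable]
      exact (intervalIntegrable_iff_integrableOn_Icc_of_le hcd).1 hB'
    let β := hBL.toLp B
    have hβ : ∀ᵐ s ∂(volume.restrict (Icc c d)), β s = B s := hBL.coeFn_toLp
    have hβn : ‖β‖ < 1 / 4 := by
      rw [← integral_norm_Lp_one hcd]
      refine lt_of_le_of_lt (le_of_eq ?_) hint
      refine intervalIntegral.integral_congr_ae ?_
      filter_upwards [(ae_restrict_iff' measurableSet_Icc).1 hβ] with s hs hs'
      rw [uIoc_of_le hcd] at hs'
      rw [hs (Ioc_subset_Icc_self hs')]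
    -- The roles are exchanged: the coefficient `B` acts as the integrable control, and the unknown
    -- `y` supplies the continuous operator `L ↦ L y`.
    let K : C(Icc c d, G) →L[ℝ] C(Icc c d, (G →L[ℝ] G) →L[ℝ] G) :=
      ContinuousLinearMap.compLeftContinuous ℝ (Icc c d) (ContinuousLinearMap.apply ℝ G)
    have hK : ∀ y, ‖K y‖ ≤ ‖y‖ := fun y ↦ by
      refine (ContinuousMap.norm_le _ (norm_nonneg _)).2 fun s ↦ ?_
      refine ContinuousLinearMap.opNorm_le_bound _ (norm_nonneg _) fun L ↦ ?_
      change ‖L (y s)‖ ≤ _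
      rw [mul_comm]
      exact (L.le_opNorm _).trans (by gcongr; exact y.norm_coe_le_norm s)
    let V : C(Icc c d, G) →L[ℝ] C(Icc c d, G) := ((volterra G (G →L[ℝ] G) hcd).flip β).comp K
    have hV : ∀ y, ‖V y‖ ≤ 1 / 4 * ‖y‖ := fun y ↦ by
      refine (norm_volterraFun_le hcd (K y) β).trans ?_
      rw [mul_comm]
      exact mul_le_mul hβn.le (hK y) (norm_nonneg _) (by norm_num)
    let t₁ : Icc c d := ⟨t₀, ht₀⟩
    -- Volterra integrals start at `c`; subtracting the value at `t₀` turns `∫_c` into `∫_{t₀}`,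
    -- which imposes the initial condition at an arbitrary time.
    let E : C(Icc c d, G) →L[ℝ] C(Icc c d, G) :=
      (ContinuousLinearMap.const (R := ℝ) (M := G) (Icc c d)).comp (ContinuousMap.evalCLM ℝ t₁)
    have hE : ∀ y, ‖E y‖ ≤ ‖y‖ := fun y ↦ by
      rw [ContinuousMap.norm_le _ (norm_nonneg _)]
      exact fun s ↦ y.norm_coe_le_norm t₁
    have hL : ‖V - E.comp V‖ < 1 := by
      refine lt_of_le_of_lt (ContinuousLinearMap.opNorm_le_bound _ (by norm_num : (0 : ℝ) ≤ 1 / 2)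
        fun y ↦ ?_) (by norm_num)
      calc ‖V y - E (V y)‖ ≤ ‖V y‖ + ‖E (V y)‖ := norm_sub_le _ _
        _ ≤ 1 / 4 * ‖y‖ + 1 / 4 * ‖y‖ := add_le_add (hV y) ((hE _).trans (hV y))
        _ = 1 / 2 * ‖y‖ := by ring
    obtain ⟨e, he⟩ := isInvertible_id_sub hL
    have hgc : Continuous fun t : Icc c d ↦ y₀ + ∫ s in t₀..t, f s := by
      have h2 := intervalIntegral.continuousOn_primitive_interval' hf'
        (Icc_subset_uIcc ht₀)
      rw [uIcc_of_le hcd] at h2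
      exact continuous_const.add (continuousOn_iff_continuous_domRestrict.1 h2)
    let g : C(Icc c d, G) := ⟨_, hgc⟩
    set y := e.symm g with hy
    have hey : y - (V y - E (V y)) = g := by
      have h2 : e y = g := e.apply_symm_apply g
      have h3 := DFunLike.congr_fun he y
      exact h3.symm.trans h2
    have hint1 : IntervalIntegrable (fun s ↦ B s (y (projIcc c d hcd s))) volume c d := by
      have h2 := intervalIntegrable_clm_apply (V := G →L[ℝ] G) (G := G) hcd
        (B := fun s ↦ ContinuousLinearMap.apply ℝ G (y (projIcc c d hcd s)))
        ((ContinuousLinearMap.apply ℝ G : G →L[ℝ] _).continuous.comp_continuousOn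
          (continuousOn_projIcc_comp hcd y)) hB'
      exact h2
    have hsub' : ∀ {r s}, r ∈ Icc c d → s ∈ Icc c d → uIcc r s ⊆ uIcc c d := fun hr hs ↦
      uIcc_subset_uIcc (Icc_subset_uIcc hr) (Icc_subset_uIcc hs)
    have hcm : c ∈ Icc c d := ⟨le_rfl, hcd⟩
    have hVy : ∀ t : Icc c d, V y t = ∫ s in c..t, B s (y (projIcc c d hcd s)) := fun t ↦ by
      refine intervalIntegral.integral_congr_ae ?_
      filter_upwards [(ae_restrict_iff' measurableSet_Icc).1 hβ] with s hs hs'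
      rw [uIoc_of_le t.2.1] at hs'
      rw [hs ⟨hs'.1.le, hs'.2.trans t.2.2⟩]
      rfl
    have hval : ∀ t ∈ Icc c d, y (projIcc c d hcd t) =
        y₀ + ∫ s in t₀..t, (B s (y (projIcc c d hcd s)) + f s) := by
      intro t ht
      have h2 := congrArg (fun k : C(Icc c d, G) ↦ k ⟨t, ht⟩) hey
      have h3 : y ⟨t, ht⟩ - (V y ⟨t, ht⟩ - V y t₁) = y₀ + ∫ s in t₀..t, f s := h2
      rw [hVy, hVy, intervalIntegral.integral_interval_sub_left
        (hint1.mono_set (hsub' hcm ht)) (hint1.mono_set (hsub' hcm ht₀)), sub_eq_iff_eq_add] at h3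
      rw [projIcc_of_mem hcd ht, h3, intervalIntegral.integral_add
        (hint1.mono_set (hsub' ht₀ ht)) (hf'.mono_set (hsub' ht₀ ht))]
      abel
    refine ⟨fun t ↦ y (projIcc c d hcd t), ⟨hint1.add hf', fun t ht ↦ ?_⟩, ?_⟩
    · beta_reduce
      rw [hval t ht, hval c hcm, add_assoc, intervalIntegral.integral_add_adjacent_intervals
        ((hint1.add hf').mono_set (hsub' ht₀ hcm)) ((hint1.add hf').mono_set (hsub' hcm ht))]
    · simp [hval t₀ ht₀]
  · intro c m d hcm hmd hc hd h1 h2 t₀ ht₀ y₀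
    rcases le_total t₀ m with h | h
    · obtain ⟨y, hy, hy0⟩ := h1 t₀ ⟨ht₀.1, h⟩ y₀
      obtain ⟨z, hz, hz0⟩ := h2 m ⟨le_rfl, hmd⟩ (y m)
      refine ⟨fun t ↦ if t ≤ m then y t else z t,
        (hy.piecewise hcm hmd hz hz0.symm).congr_fun (hcm.trans hmd) (fun _ _ ↦ rfl)
        (fun t _ ↦ ?_), by simp [h, hy0]⟩
      dsimp only
      split_ifs <;> rfl
    · obtain ⟨z, hz, hz0⟩ := h2 t₀ ⟨h, ht₀.2⟩ y₀
      obtain ⟨y, hy, hy0⟩ := h1 m ⟨hcm, le_rfl⟩ (z m)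
      refine ⟨fun t ↦ if t ≤ m then y t else z t,
        (hy.piecewise hcm hmd hz hy0).congr_fun (hcm.trans hmd) (fun _ _ ↦ rfl)
        (fun t _ ↦ ?_), ?_⟩
      · dsimp only
        split_ifs <;> rfl
      · rcases h.eq_or_lt with rfl | hlt
        · simp [hy0, hz0]
        · simp [not_le.2 hlt, hz0]

end

/-! ### Absolutely continuous curves and parallel frames along them -/

section Transport

set_option linter.unusedSectionVars false

variable {F : Type*} [NormedAddCommGroup F] [NormedSpace ℝ F] [FiniteDimensional ℝ F]
  {M : Type*} [TopologicalSpace M] [ChartedSpace F M]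

theorem exists_mapsTo_chart_source {γ : ℝ → M} {a b t : ℝ} (hγ : ContinuousOn γ (Icc a b))
    (ht : t ∈ Icc a b) : ∃ ε > 0, ∀ c d, c ≤ d → c ∈ Icc a b → d ∈ Icc a b → |c - t| < ε →
      |d - t| < ε → MapsTo γ (Icc c d) (chartAt F (γ t)).source := by
  have h1 := (hγ t ht).eventually ((chartAt F (γ t)).open_source.mem_nhds (mem_chart_source F (γ t)))
  obtain ⟨ε, hε, h2⟩ := Metric.mem_nhdsWithin_iff.1 h1
  refine ⟨ε, hε, fun c d _ hc hd hct hdt s hs ↦ h2 ⟨?_, hc.1.trans hs.1, hs.2.trans hd.2⟩⟩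
  rw [Metric.mem_ball, Real.dist_eq, abs_lt]
  exact ⟨by linarith [(abs_lt.1 hct).1, hs.1], by linarith [(abs_lt.1 hdt).2, hs.2]⟩

/-- `γ` restricted to `[a, b]` is an absolutely continuous curve. -/
def IsACCurve (F : Type*) [NormedAddCommGroup F] [NormedSpace ℝ F] {M : Type*} [TopologicalSpace M]
    [ChartedSpace F M] (γ : ℝ → M) (a b : ℝ) : Prop :=
  ContinuousOn γ (Icc a b) ∧
    ∀ (x₀ : M) (c d : ℝ), c ≤ d → Icc c d ⊆ Icc a b → MapsTo γ (Icc c d) (chartAt F x₀).source →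
      HasACDeriv (fun t ↦ chartAt F x₀ (γ t)) (deriv fun t ↦ chartAt F x₀ (γ t)) c d

theorem HasACDeriv.ae_deriv {G : Type*} [NormedAddCommGroup G] [NormedSpace ℝ G] [CompleteSpace G]
    {f f' : ℝ → G} {a b : ℝ} (h : HasACDeriv f f' a b) :
    ∀ᵐ t ∂(volume.restrict (Icc a b)), f' t = deriv f t := by
  filter_upwards [h.ae_hasDerivAt] with t ht
  exact ht.deriv.symm

theorem IsH1Curve.isACCurve {γ : ℝ → M} {a b : ℝ} (h : IsH1Curve F γ a b) : IsACCurve F γ a b := by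
  refine ⟨h.1, fun x₀ c d hcd hsub hmap ↦ ?_⟩
  obtain ⟨h1, h2⟩ := h.2 x₀ c d hcd hsub hmap
  refine HasACDeriv.of_ac hcd h1 ?_ ?_
  · rw [intervalIntegrable_iff_integrableOn_Icc_of_le hcd]
    exact h2.integrable (by norm_num)
  · rw [ae_Icc_iff_ae_uIcc hcd]
    filter_upwards [h1.boundedVariationOn.ae_differentiableAt_of_mem_uIcc] with t ht htm
    exact (ht htm).hasDerivAt

variable [IsManifold 𝓘(ℝ, F) ∞ M]
  (cov : CovariantDerivative 𝓘(ℝ, F) F (TangentSpace 𝓘(ℝ, F) : M → Type _))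
  {x₀ x₁ : M} {γ γ' : ℝ → M} {P Q : ℝ → F →L[ℝ] F} {a b c d m : ℝ}

/-- A curve and a frame along it, in a chart. -/
noncomputable def chartState (x₀ : M) (γ : ℝ → M) (P : ℝ → F →L[ℝ] F) (t : ℝ) : F × (F →L[ℝ] F) :=
  (chartAt F x₀ (γ t), coordMap x₀ (γ t) ∘L P t)

/-- `P t : F → T_{γ t} M` is parallel along the absolutely continuous curve `γ` on `[a, b]`. -/
def IsTransport (γ : ℝ → M) (P : ℝ → F →L[ℝ] F) (a b : ℝ) : Prop :=
  ContinuousOn γ (Icc a b) ∧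
    ∀ (x₀ : M) (c d : ℝ), c ≤ d → Icc c d ⊆ Icc a b → MapsTo γ (Icc c d) (chartAt F x₀).source →
      HasACDeriv (chartState x₀ γ P) (fun t ↦ transportSystem cov x₀ (chartState x₀ γ P t)
        (deriv (fun s ↦ chartAt F x₀ (γ s)) t)) c d

variable {cov}

/-- The first component of `transportSystem` is the identity, so `v` must be the velocity of the
curve almost everywhere. Hence any `v` may be used to verify parallelism. -/
theorem hasACDeriv_deriv_fst {y : ℝ → F × (F →L[ℝ] F)} {v : ℝ → F} (hcd : c ≤ d)
    (h : HasACDeriv y (fun t ↦ transportSystem cov x₀ (y t) (v t)) c d) :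
    HasACDeriv y (fun t ↦ transportSystem cov x₀ (y t) (deriv (fun s ↦ (y s).1) t)) c d := by
  refine h.congr hcd (fun _ _ ↦ rfl) ?_
  filter_upwards [(h.clm_comp (ContinuousLinearMap.fst ℝ F (F →L[ℝ] F))).ae_deriv] with t ht
  exact congrArg _ ht

theorem IsTransport.mk' (hγ : ContinuousOn γ (Icc a b))
    (h : ∀ (x₀ : M) (c d : ℝ), c ≤ d → Icc c d ⊆ Icc a b →
      MapsTo γ (Icc c d) (chartAt F x₀).source → ∃ v : ℝ → F,
      HasACDeriv (chartState x₀ γ P) (fun t ↦ transportSystem cov x₀ (chartState x₀ γ P t) (v t))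
        c d) : IsTransport cov γ P a b :=
  ⟨hγ, fun x₀ c d hcd hsub hmap ↦ by
    obtain ⟨v, hv⟩ := h x₀ c d hcd hsub hmap
    exact hasACDeriv_deriv_fst hcd hv⟩

/-- The change of coordinates of frames. -/
noncomputable def stateTransition (x₀ x₁ : M) (z : F × (F →L[ℝ] F)) : F × (F →L[ℝ] F) :=
  (transition x₀ x₁ z.1, fderiv ℝ (transition x₀ x₁) z.1 ∘L z.2)

theorem contDiffOn_stateTransition (x₀ x₁ : M) :
    IsOpen ((chartAt F x₀).target ∩ (chartAt F x₀).symm ⁻¹' (chartAt F x₁).source) ∧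
    ContDiffOn ℝ ∞ (stateTransition x₀ x₁)
      (((chartAt F x₀).target ∩ (chartAt F x₀).symm ⁻¹' (chartAt F x₁).source) ×ˢ univ) := by
  refine ⟨(chartAt F x₀).isOpen_inter_preimage_symm (chartAt F x₁).open_source, ?_⟩
  rintro ⟨ξ, p⟩ ⟨⟨hξ, hξ'⟩, -⟩
  have h1 := contDiffAt_transition ((chartAt F x₀).map_target hξ) hξ'
  rw [(chartAt F x₀).right_inv hξ] at h1
  have h2 := h1.fderiv_right (m := ∞) (by simp)
  refine ContDiffAt.contDiffWithinAt ?_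
  exact (h1.comp (ξ, p) contDiffAt_fst).prodMk
    ((h2.comp (ξ, p) contDiffAt_fst).clm_comp contDiffAt_snd)

theorem stateTransition_chart {x : M} (p : F →L[ℝ] F) (h₀ : x ∈ (chartAt F x₀).source)
    (h₁ : x ∈ (chartAt F x₁).source) :
    stateTransition x₀ x₁ (chartAt F x₀ x, coordMap x₀ x ∘L p) =
      (chartAt F x₁ x, coordMap x₁ x ∘L p) := by
  simp only [stateTransition]
  rw [transition_chart h₀, ← ContinuousLinearMap.comp_assoc,
    fderiv_transition_comp_coordMap h₀ h₁]

theorem hasFDerivAt_stateTransition {x : M} (p : F →L[ℝ] F) (h₀ : x ∈ (chartAt F x₀).source)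
    (h₁ : x ∈ (chartAt F x₁).source) :
    ∃ L : (F × (F →L[ℝ] F)) →L[ℝ] F × (F →L[ℝ] F),
      HasFDerivAt (stateTransition x₀ x₁) L (chartAt F x₀ x, p) ∧
      ∀ δ, L δ = (fderiv ℝ (transition x₀ x₁) (chartAt F x₀ x) δ.1,
        fderiv ℝ (transition x₀ x₁) (chartAt F x₀ x) ∘L δ.2 +
          fderiv ℝ (fderiv ℝ (transition x₀ x₁)) (chartAt F x₀ x) δ.1 ∘L p) := by
  have e1 := contDiffAt_transition h₀ h₁
  have e2 := (e1.differentiableAt (by simp)).hasFDerivAt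
  have e3 := ((e1.fderiv_right (m := ∞) (by simp)).differentiableAt (by simp)).hasFDerivAt
  refine ⟨_, (HasFDerivAt.comp (g := transition x₀ x₁) (chartAt F x₀ x, p) e2
    hasFDerivAt_fst).prodMk ((HasFDerivAt.comp (g := fderiv ℝ (transition x₀ x₁))
      (chartAt F x₀ x, p) e3 hasFDerivAt_fst).clm_comp hasFDerivAt_snd), fun δ ↦ ?_⟩
  rfl

/-- The equation does not depend on the chart: the second derivative of the change of coordinates,
which appears when the frame is transformed, is the inhomogeneous term in the transformation law of
the Christoffel symbols. -/
theorem HasACDeriv.chartState_transition {v : ℝ → F} (hcd : c ≤ d)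
    (h : HasACDeriv (chartState x₀ γ P)
      (fun t ↦ transportSystem cov x₀ (chartState x₀ γ P t) (v t)) c d)
    (h₀ : MapsTo γ (Icc c d) (chartAt F x₀).source)
    (h₁ : MapsTo γ (Icc c d) (chartAt F x₁).source) :
    HasACDeriv (chartState x₁ γ P) (fun t ↦ transportSystem cov x₁ (chartState x₁ γ P t)
      (fderiv ℝ (transition x₀ x₁) (chartAt F x₀ (γ t)) (v t))) c d := by
  obtain ⟨ho, hs⟩ := contDiffOn_stateTransition (F := F) x₀ x₁
  have h2 := h.comp_contDiffOn hcd (ho.prod isOpen_univ) (hs.of_le (by simp)) fun t ht ↦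
    ⟨⟨(chartAt F x₀).map_source (h₀ ht), by
      change (chartAt F x₀).symm (chartAt F x₀ (γ t)) ∈ (chartAt F x₁).source
      rw [(chartAt F x₀).left_inv (h₀ ht)]
      exact h₁ ht⟩, mem_univ _⟩
  refine h2.congr_fun hcd (fun t ht ↦ stateTransition_chart (P t) (h₀ ht) (h₁ ht)) fun t ht ↦ ?_
  obtain ⟨L, hL, hL'⟩ := hasFDerivAt_stateTransition (coordMap x₀ (γ t) ∘L P t) (h₀ ht) (h₁ ht)
  have e4 : fderiv ℝ (stateTransition x₀ x₁) (chartState x₀ γ P t) = L := hL.fderiv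
  beta_reduce
  rw [e4, hL']
  simp only [transportSystem_apply]
  refine Prod.ext rfl ?_
  ext w
  have e5 := christoffel_transition cov (h₀ ht) (h₁ ht) (v t) (coordMap x₀ (γ t) (P t w))
  have e6 := DFunLike.congr_fun (fderiv_transition_comp_coordMap (h₀ ht) (h₁ ht)) (P t w)
  simp only [ContinuousLinearMap.comp_apply] at e6
  rw [e6] at e5
  simp [chartState, e5]
  abel

/-- Parallelism can be checked locally, in one chart around each point. -/
theorem IsTransport.of_local (hγ : ContinuousOn γ (Icc a b))
    (h : ∀ t ∈ Icc a b, ∃ x₀ : M, ∃ ε > 0, ∀ c d, c ≤ d → c ∈ Icc a b → d ∈ Icc a b →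
      |c - t| < ε → |d - t| < ε → MapsTo γ (Icc c d) (chartAt F x₀).source ∧ ∃ v : ℝ → F,
      HasACDeriv (chartState x₀ γ P) (fun t ↦ transportSystem cov x₀ (chartState x₀ γ P t) (v t))
        c d) : IsTransport cov γ P a b := by
  refine ⟨hγ, fun x₁ c d hcd hsub hmap ↦ ?_⟩
  refine interval_induction (p := fun c d ↦ HasACDeriv (chartState x₁ γ P)
    (fun t ↦ transportSystem cov x₁ (chartState x₁ γ P t)
        (deriv (fun s ↦ chartAt F x₁ (γ s)) t)) c d) hcd (fun t ht ↦ ?_)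
    fun c m d hcm hmd _ _ h1 h2 ↦ h1.glue h2 hcm hmd
  obtain ⟨x₀, ε, hε, h1⟩ := h t (hsub ht)
  refine ⟨ε, hε, fun c' d' hcd' hc' hd' hct hdt ↦ ?_⟩
  obtain ⟨h2, v, hv⟩ := h1 c' d' hcd' (hsub hc') (hsub hd') hct hdt
  exact hasACDeriv_deriv_fst hcd' (hv.chartState_transition hcd' h2
    (hmap.mono (Icc_subset_Icc hc'.1 hd'.2) subset_rfl))

namespace IsTransport

theorem hasACDeriv (h : IsTransport cov γ P a b) (hcd : c ≤ d) (hc : c ∈ Icc a b)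
    (hd : d ∈ Icc a b) (hmap : MapsTo γ (Icc c d) (chartAt F x₀).source) :
    HasACDeriv (chartState x₀ γ P) (fun t ↦ transportSystem cov x₀ (chartState x₀ γ P t)
        (deriv (fun s ↦ chartAt F x₀ (γ s)) t)) c d :=
  h.2 x₀ c d hcd (Icc_subset_Icc hc.1 hd.2) hmap

theorem mono (h : IsTransport cov γ P a b) (hc : c ∈ Icc a b) (hd : d ∈ Icc a b) :
    IsTransport cov γ P c d :=
  ⟨h.1.mono (Icc_subset_Icc hc.1 hd.2), fun x₀ c' d' hcd hsub hmap ↦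
    h.2 x₀ c' d' hcd (hsub.trans (Icc_subset_Icc hc.1 hd.2)) hmap⟩

theorem congr (h : IsTransport cov γ P a b) (hγ : EqOn γ γ' (Icc a b)) (hP : EqOn P Q (Icc a b)) :
    IsTransport cov γ' Q a b := by
  refine mk' (h.1.congr hγ.symm) fun x₀ c d hcd hsub hmap ↦
    ⟨deriv fun s ↦ chartAt F x₀ (γ s), (h.2 x₀ c d hcd hsub fun t ht ↦ by rw [hγ (hsub ht)]; exact hmap ht).congr_fun hcd
      (fun t ht ↦ ?_) fun t ht ↦ ?_⟩
  · simp only [chartState, hγ (hsub ht), hP (hsub ht)]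
  · simp only [chartState, hγ (hsub ht), hP (hsub ht)]

theorem isACCurve (h : IsTransport cov γ P a b) : IsACCurve F γ a b :=
  ⟨h.1, fun x₀ c d hcd hsub hmap ↦
    (h.2 x₀ c d hcd hsub hmap).clm_comp (ContinuousLinearMap.fst ℝ F (F →L[ℝ] F))⟩

theorem glue (h1 : IsTransport cov γ P a m) (h2 : IsTransport cov γ P m b) (ham : a ≤ m)
    (hmb : m ≤ b) : IsTransport cov γ P a b := by
  refine ⟨?_, fun x₀ c d hcd hsub hmap ↦ ?_⟩
  · rw [← Icc_union_Icc_eq_Icc ham hmb]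
    exact h1.1.union_of_isClosed h2.1 isClosed_Icc isClosed_Icc
  have hc := hsub ⟨le_rfl, hcd⟩
  have hd := hsub ⟨hcd, le_rfl⟩
  rcases le_total d m with hdm | hdm
  · exact h1.2 x₀ c d hcd (Icc_subset_Icc hc.1 hdm) hmap
  rcases le_total m c with hmc | hmc
  · exact h2.2 x₀ c d hcd (Icc_subset_Icc hmc hd.2) hmap
  · exact (h1.2 x₀ c m hmc (Icc_subset_Icc hc.1 le_rfl)
      (hmap.mono (Icc_subset_Icc_right hdm) subset_rfl)).glue
      (h2.2 x₀ m d hdm (Icc_subset_Icc le_rfl hd.2)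
      (hmap.mono (Icc_subset_Icc_left hmc) subset_rfl)) hmc hdm

theorem piecewise (h1 : IsTransport cov γ P a m) (h2 : IsTransport cov γ Q m b) (ham : a ≤ m)
    (hmb : m ≤ b) (h : P m = Q m) :
    IsTransport cov γ (fun t ↦ if t ≤ m then P t else Q t) a b := by
  refine (h1.congr (fun _ _ ↦ rfl) fun t ht ↦ ?_).glue (h2.congr (fun _ _ ↦ rfl) fun t ht ↦ ?_)
    ham hmb
  · simp [ht.2]
  · rcases ht.1.eq_or_lt with rfl | hlt
    · simp [h]
    · simp [not_le.2 hlt]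

/-- The equation of the frame acts from the left, so right composition with a constant preserves it.
This adjusts the initial value of a frame. -/
theorem comp_right (h : IsTransport cov γ P a b) (L : F →L[ℝ] F) :
    IsTransport cov γ (fun t ↦ P t ∘L L) a b := by
  refine mk' h.1 fun x₀ c d hcd hsub hmap ↦ ?_
  have h1 := (h.2 x₀ c d hcd hsub hmap).clm_comp
    ((ContinuousLinearMap.fst ℝ F (F →L[ℝ] F)).prod
      ((ContinuousLinearMap.compL ℝ F F F).flip L ∘L ContinuousLinearMap.snd ℝ F (F →L[ℝ] F)))
  exact ⟨_, h1.congr_fun hcd (fun t _ ↦ rfl) fun t _ ↦ rfl⟩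

end IsTransport

end Transport

section

set_option linter.unusedSectionVars false

variable {E G : Type*} [NormedAddCommGroup E] [NormedSpace ℝ E] [FiniteDimensional ℝ E]
  [NormedAddCommGroup G] [NormedSpace ℝ G] [CompleteSpace G] {c d : ℝ}

theorem HasACDeriv.of_clm_apply {p p' : ℝ → E →L[ℝ] G} (hp' : IntervalIntegrable p' volume c d)
    (h : ∀ w, HasACDeriv (fun t ↦ p t w) (fun t ↦ p' t w) c d) : HasACDeriv p p' c d := by
  refine ⟨hp', fun t ht ↦ ContinuousLinearMap.ext fun w ↦ ?_⟩
  have hi : IntervalIntegrable p' volume c t :=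
    hp'.mono_set (uIcc_subset_uIcc_left (Icc_subset_uIcc ht))
  have h1 := (h w).2 t ht
  beta_reduce at h1
  rw [h1, _root_.add_apply, ContinuousLinearMap.intervalIntegral_apply hi]

theorem HasACDeriv.sub {f f' g g' : ℝ → G} (hf : HasACDeriv f f' c d) (hg : HasACDeriv g g' c d) :
    HasACDeriv (fun t ↦ f t - g t) (fun t ↦ f' t - g' t) c d :=
  (hf.prodMk hg).clm_comp (ContinuousLinearMap.fst ℝ G G - ContinuousLinearMap.snd ℝ G G)

theorem intervalIntegrable_clm_comp {E' : Type*} [NormedAddCommGroup E'] [NormedSpace ℝ E']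
    {A : ℝ → E →L[ℝ] G} {p : ℝ → E' →L[ℝ] E} (hcd : c ≤ d)
    (hA : IntervalIntegrable A volume c d) (hp : ContinuousOn p (Icc c d)) :
    IntervalIntegrable (fun t ↦ A t ∘L p t) volume c d :=
  intervalIntegrable_clm_apply (V := E →L[ℝ] G) (G := E' →L[ℝ] G) hcd
    (B := fun t ↦ (ContinuousLinearMap.compL ℝ E' E G).flip (p t))
    ((ContinuousLinearMap.compL ℝ E' E G).flip.continuous.comp_continuousOn hp) hA

end

/-! ### Existence, uniqueness and injectivity of parallel transport -/

section Transport

set_option linter.unusedSectionVars false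
set_option synthInstance.maxHeartbeats 200000

variable {F : Type*} [NormedAddCommGroup F] [NormedSpace ℝ F] [FiniteDimensional ℝ F]
  {M : Type*} [TopologicalSpace M] [ChartedSpace F M] [IsManifold 𝓘(ℝ, F) ∞ M] [T2Space M]
  {cov : CovariantDerivative 𝓘(ℝ, F) F (TangentSpace 𝓘(ℝ, F) : M → Type _)}
  [CovariantDerivative.ContMDiffCovariantDerivative cov ∞]
  {x₀ x₁ o : M} {γ γ' : ℝ → M} {P Q : ℝ → F →L[ℝ] F} {a b c d m : ℝ}

theorem intervalIntegrable_christoffel {ξ v : ℝ → F} (hcd : c ≤ d) (hξ : ContinuousOn ξ (Icc c d))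
    (hξt : MapsTo ξ (Icc c d) (chartAt F x₀).target) (hv : IntervalIntegrable v volume c d) :
    IntervalIntegrable (fun t ↦ christoffel cov x₀ (ξ t) (v t)) volume c d :=
  intervalIntegrable_clm_apply hcd
    ((contDiffOn_christoffel cov x₀).continuousOn.comp hξ hξt) hv

/-- In a chart the frame satisfies the linear equation `p' = -Γ(ξ)(ξ') p` with integrable
coefficient. The starting time is arbitrary because, after a subdivision, the solution has to be
continued out of the half that contains it, on either side. -/
theorem IsTransport.exists_of_isACCurve (h : IsACCurve F γ a b) (hab : a ≤ b) {t₀ : ℝ}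
    (ht₀ : t₀ ∈ Icc a b) (P₀ : F →L[ℝ] F) : ∃ P, IsTransport cov γ P a b ∧ P t₀ = P₀ := by
  suffices ∀ t₀ ∈ Icc a b, ∀ P₀, ∃ P, IsTransport cov γ P a b ∧ P t₀ = P₀ from this t₀ ht₀ P₀
  refine interval_induction (p := fun c d ↦ ∀ t₀ ∈ Icc c d, ∀ P₀, ∃ P,
    IsTransport cov γ P c d ∧ P t₀ = P₀) hab (fun t ht ↦ ?_) ?_
  · obtain ⟨ε, hε, h1⟩ := exists_mapsTo_chart_source (F := F) h.1 ht
    refine ⟨ε, hε, fun c d hcd hc hd hct hdt t₀ ht₀ P₀ ↦ ?_⟩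
    have hmap := h1 c d hcd hc hd hct hdt
    set x₀ := γ t with hx₀
    set ξ : ℝ → F := fun s ↦ chartAt F x₀ (γ s) with hξ
    have hξ' := h.2 x₀ c d hcd (Icc_subset_Icc hc.1 hd.2) hmap
    have hξt : MapsTo ξ (Icc c d) (chartAt F x₀).target := fun s hs ↦
      (chartAt F x₀).map_source (hmap hs)
    have hΓ := intervalIntegrable_christoffel (cov := cov) hcd (hξ'.continuousOn hcd) hξt hξ'.1
    have hB : IntervalIntegrable (fun s ↦ ContinuousLinearMap.compL ℝ F F F
        (-christoffel cov x₀ (ξ s) (deriv ξ s))) volume c d := by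
      have h2 := intervalIntegrable_clm_apply hcd (G := (F →L[ℝ] F) →L[ℝ] F →L[ℝ] F)
        (B := fun _ ↦ ContinuousLinearMap.compL ℝ F F F) continuousOn_const hΓ.neg
      exact h2
    obtain ⟨p, hp, hp0⟩ := exists_linear_ode hcd hB (f := fun _ ↦ 0)
      (by simp [IntervalIntegrable]) ht₀ (coordMap x₀ (γ t₀) ∘L P₀)
    refine ⟨fun s ↦ coordInv x₀ (γ s) ∘L p s, ?_, ?_⟩
    · refine IsTransport.of_local (h.1.mono (Icc_subset_Icc hc.1 hd.2)) fun s hs ↦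
        ⟨x₀, 1, one_pos, fun c' d' hcd' hc' hd' _ _ ↦
          ⟨hmap.mono (Icc_subset_Icc hc'.1 hd'.2) subset_rfl, deriv ξ, ?_⟩⟩
      refine ((hξ'.prodMk hp).mono hc' hd').congr_fun hcd' (fun r hr ↦ ?_) fun r hr ↦ ?_
      · have hr' := hmap ⟨hc'.1.trans hr.1, hr.2.trans hd'.2⟩
        have hr2 : coordMap x₀ (γ r) ∘L (coordInv x₀ (γ r) ∘L p r) = p r := by
          rw [← ContinuousLinearMap.comp_assoc, coordMap_comp_coordInv hr',
            ContinuousLinearMap.id_comp]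
        simp only [chartState, hr2]
      · have hr' := hmap ⟨hc'.1.trans hr.1, hr.2.trans hd'.2⟩
        have hr2 : coordMap x₀ (γ r) ∘L (coordInv x₀ (γ r) ∘L p r) = p r := by
          rw [← ContinuousLinearMap.comp_assoc, coordMap_comp_coordInv hr',
            ContinuousLinearMap.id_comp]
        simp [chartState, transportSystem_apply, hr2, hξ]
    · dsimp only
      rw [hp0, ← ContinuousLinearMap.comp_assoc, coordInv_comp_coordMap (hmap ht₀),
        ContinuousLinearMap.id_comp]
  · intro c m d hcm hmd _ _ h1 h2 t₀ ht₀ P₀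
    rcases le_total t₀ m with h | h
    · obtain ⟨P, hP, hP0⟩ := h1 t₀ ⟨ht₀.1, h⟩ P₀
      obtain ⟨Q, hQ, hQ0⟩ := h2 m ⟨le_rfl, hmd⟩ (P m)
      exact ⟨_, hP.piecewise hQ hcm hmd hQ0.symm, by simp [h, hP0]⟩
    · obtain ⟨Q, hQ, hQ0⟩ := h2 t₀ ⟨h, ht₀.2⟩ P₀
      obtain ⟨P, hP, hP0⟩ := h1 m ⟨hcm, le_rfl⟩ (Q m)
      refine ⟨_, hP.piecewise hQ hcm hmd hP0, ?_⟩
      rcases h.eq_or_lt with rfl | hlt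
      · simp [hP0, hQ0]
      · simp [not_le.2 hlt, hQ0]

theorem IsTransport.eqOn (hP : IsTransport cov γ P a b) (hQ : IsTransport cov γ Q a b)
    (hab : a ≤ b) {t₀ : ℝ} (ht₀ : t₀ ∈ Icc a b) (h0 : P t₀ = Q t₀) : EqOn P Q (Icc a b) := by
  suffices (∃ t₀ ∈ Icc a b, P t₀ = Q t₀) → EqOn P Q (Icc a b) from this ⟨t₀, ht₀, h0⟩
  refine interval_induction (p := fun c d ↦ (∃ t₀ ∈ Icc c d, P t₀ = Q t₀) → EqOn P Q (Icc c d))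
    hab (fun t ht ↦ ?_) ?_
  · obtain ⟨ε, hε, h1⟩ := exists_mapsTo_chart_source (F := F) hP.1 ht
    refine ⟨ε, hε, fun c d hcd hc hd hct hdt ⟨t₀, ht₀, h0⟩ ↦ ?_⟩
    have hmap := h1 c d hcd hc hd hct hdt
    set x₀ := γ t with hx₀
    have hP' := hP.hasACDeriv hcd hc hd hmap
    have hQ' := hQ.hasACDeriv hcd hc hd hmap
    have hξ := (hP.mono hc hd).isACCurve.2 x₀ c d hcd subset_rfl hmap
    have hΓ := intervalIntegrable_christoffel (cov := cov) hcd (hξ.continuousOn hcd)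
      (fun s hs ↦ (chartAt F x₀).map_source (hmap hs)) hξ.1
    have hw := (hP'.clm_comp (ContinuousLinearMap.snd ℝ F (F →L[ℝ] F))).sub
      (hQ'.clm_comp (ContinuousLinearMap.snd ℝ F (F →L[ℝ] F)))
    have hz := eq_zero_of_norm_deriv_le hcd hw hΓ.norm (.of_forall fun s ↦ ?_) ht₀ ?_
    · intro s hs
      have h2 : coordMap x₀ (γ s) ∘L P s - coordMap x₀ (γ s) ∘L Q s = 0 := hz s hs
      have h3 := congrArg (fun L ↦ coordInv x₀ (γ s) ∘L L) (sub_eq_zero.1 h2)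
      simpa only [← ContinuousLinearMap.comp_assoc, coordInv_comp_coordMap (hmap hs),
        ContinuousLinearMap.id_comp] using h3
    · have e : ContinuousLinearMap.snd ℝ F (F →L[ℝ] F)
            (transportSystem cov x₀ (chartState x₀ γ P s) (deriv (fun r ↦ chartAt F x₀ (γ r)) s)) -
          ContinuousLinearMap.snd ℝ F (F →L[ℝ] F)
            (transportSystem cov x₀ (chartState x₀ γ Q s) (deriv (fun r ↦ chartAt F x₀ (γ r)) s)) =
          -(christoffel cov x₀ (chartAt F x₀ (γ s)) (deriv (fun r ↦ chartAt F x₀ (γ r)) s) ∘L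
            (coordMap x₀ (γ s) ∘L P s - coordMap x₀ (γ s) ∘L Q s)) := by
        simp only [transportSystem_apply, ContinuousLinearMap.coe_snd', chartState,
          ContinuousLinearMap.comp_sub]
        abel
      rw [e, norm_neg]
      exact ContinuousLinearMap.opNorm_comp_le _ _
    · simp [chartState, h0]
  · intro c m d hcm hmd _ _ h1 h2 ⟨t₀, ht₀, h0⟩ t ht
    have key : ∀ r ∈ Icc c d, P r = Q r → P m = Q m := fun r hr h ↦ by
      rcases le_total r m with hrm | hrm
      · exact h1 ⟨r, ⟨hr.1, hrm⟩, h⟩ ⟨hcm, le_rfl⟩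
      · exact h2 ⟨r, ⟨hrm, hr.2⟩, h⟩ ⟨le_rfl, hmd⟩
    have hm := key t₀ ht₀ h0
    rcases le_total t m with htm | htm
    · exact h1 ⟨m, ⟨hcm, le_rfl⟩, hm⟩ ⟨ht.1, htm⟩
    · exact h2 ⟨m, ⟨le_rfl, hmd⟩, hm⟩ ⟨htm, ht.2⟩

/-- If `P t` kills `v`, compose `P` with an operator `L` of rank one with image spanned by `v`. The
frames `P ∘ L` and `P ∘ 0` agree at `t`, hence at `t₀` by uniqueness, where injectivity is
contradicted. -/
theorem IsTransport.injective (hP : IsTransport cov γ P a b) {t₀ t : ℝ} (ht₀ : t₀ ∈ Icc a b)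
    (ht : t ∈ Icc a b) (h0 : Function.Injective (P t₀)) : Function.Injective (P t) := by
  rw [injective_iff_map_eq_zero]
  intro v hv
  by_contra hne
  obtain ⟨ℓ, -, hℓ⟩ := exists_dual_vector ℝ v (by simpa using hne)
  let L : F →L[ℝ] F := ℓ.smulRight v
  have h1 := (hP.comp_right L).eqOn (hP.comp_right 0) (ht.1.trans ht.2) ht (by
    ext w
    simp [L, hv])
  have h2 := DFunLike.congr_fun (h1 ht₀) v
  simp only [L, ContinuousLinearMap.comp_apply, ContinuousLinearMap.smulRight_apply, map_smul,
    _root_.zero_apply, map_zero, hℓ] at h2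
  rcases smul_eq_zero.1 h2 with h3 | h3
  · exact hne (by simpa using h3)
  · exact hne (h0 (by simpa using h3))

/-- Operators between tangent spaces, as operators on the model space. -/
def asModel (P : ∀ t, TangentSpace 𝓘(ℝ, F) o →L[ℝ] TangentSpace 𝓘(ℝ, F) (γ t)) :
    ℝ → F →L[ℝ] F := P

/-- Operators on the model space, as operators between tangent spaces. -/
def ofAsModel (o : M) (γ : ℝ → M) (P : ℝ → F →L[ℝ] F) :
    ∀ t, TangentSpace 𝓘(ℝ, F) o →L[ℝ] TangentSpace 𝓘(ℝ, F) (γ t) := P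

theorem toModel_cov_velocity {s : ℝ} {w v : F} (hx : γ s ∈ (chartAt F x₀).source)
    (hγ : ContinuousAt γ s) (h : HasDerivAt (fun r ↦ chartAt F x₀ (γ r)) v s) :
    toModel x₀ (γ s) (cov (fun x ↦ ofModel x₀ x w) (γ s) (velocity γ s)) =
      christoffel cov x₀ (chartAt F x₀ (γ s)) v w := by
  have h1 := toModel_cov cov hx (hasFDerivAt_const w _) (velocity γ s)
  rw [toModel_velocity hx hγ h] at h1
  rw [h1]
  simp

theorem ae_mem_Ioo (c d : ℝ) : ∀ᵐ t ∂(volume.restrict (Icc c d)), t ∈ Ioo c d := by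
  filter_upwards [ae_restrict_mem measurableSet_Icc, ae_restrict_of_ae (Measure.ae_ne volume c),
    ae_restrict_of_ae (Measure.ae_ne volume d)] with t ht h1 h2
  exact ⟨ht.1.lt_of_ne' h1, ht.2.lt_of_ne h2⟩

theorem IsTransport.isParallelAlong (hP : IsTransport cov γ P a b) (w : F) :
    IsParallelAlong cov γ a b fun t ↦ ofAsModel o γ P t w := by
  intro x₀ c d hcd hsub hmap
  have h1 := hP.2 x₀ c d hcd hsub hmap
  have h2 := h1.clm_comp (ContinuousLinearMap.apply ℝ F w ∘L ContinuousLinearMap.snd ℝ F (F →L[ℝ] F))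
  have h3 := hP.isACCurve.2 x₀ c d hcd hsub hmap
  refine ⟨h2.ac hcd, ?_⟩
  filter_upwards [h2.ae_hasDerivAt, h3.ae_hasDerivAt, ae_mem_Ioo c d] with t ht ht' htm
  have h4 := toModel_cov_velocity (cov := cov) (w := coordMap x₀ (γ t) (P t w))
    (hmap (Ioo_subset_Icc_self htm)) (hP.1.continuousAt (mem_of_superset
      (Icc_mem_nhds htm.1 htm.2) hsub)) ht'
  refine ht.congr_deriv ?_
  exact congrArg Neg.neg h4.symm

/-- The definition of parallel fields works vector by vector with derivatives almost everywhere. In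
finite dimension pointwise continuity gives continuity of the operator `p`, which makes the
operator-valued derivative integrable; the integral equation is then checked on vectors. -/
theorem IsTransport.of_isParallelAlong (hγ : IsACCurve F γ a b)
    {P : ∀ t, TangentSpace 𝓘(ℝ, F) o →L[ℝ] TangentSpace 𝓘(ℝ, F) (γ t)}
    (hP : ∀ v, IsParallelAlong cov γ a b fun t ↦ P t v) : IsTransport cov γ (asModel P) a b := by
  refine ⟨hγ.1, fun x₀ c d hcd hsub hmap ↦ ?_⟩
  have h3 := hγ.2 x₀ c d hcd hsub hmap
  have hΓ := intervalIntegrable_christoffel (cov := cov) hcd (h3.continuousOn hcd)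
      (fun s hs ↦ (chartAt F x₀).map_source (hmap hs)) h3.1
  set Γ : ℝ → F →L[ℝ] F := fun s ↦ christoffel cov x₀ (chartAt F x₀ (γ s))
    (deriv (fun r ↦ chartAt F x₀ (γ r)) s) with hΓdef
  set p : ℝ → F →L[ℝ] F := fun t ↦ coordMap x₀ (γ t) ∘L asModel P t with hp
  have hpac : ∀ w : F, AbsolutelyContinuousOnInterval (fun t ↦ p t w) c d := fun w ↦
    (hP w x₀ c d hcd hsub hmap).1
  have hpc : ∀ w : F, ContinuousOn (fun t ↦ p t w) (Icc c d) := fun w ↦ by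
    have := (hpac w).continuousOn
    rwa [uIcc_of_le hcd] at this
  have hpc' : ContinuousOn p (Icc c d) := continuousOn_clm_apply.2 hpc
  have hint : IntervalIntegrable (fun t ↦ -(Γ t ∘L p t)) volume c d :=
    (intervalIntegrable_clm_comp hcd hΓ hpc').neg
  refine h3.prodMk (HasACDeriv.of_clm_apply hint fun w ↦ HasACDeriv.of_ac hcd (hpac w) ?_ ?_)
  · have h4 : IntervalIntegrable (fun t ↦ ContinuousLinearMap.apply ℝ F w (-(Γ t ∘L p t))) volume c d :=
      intervalIntegrable_clm_apply hcd continuousOn_const hint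
    exact h4
  · filter_upwards [(hP w x₀ c d hcd hsub hmap).2, h3.ae_hasDerivAt, ae_mem_Ioo c d]
      with t ht ht' htm
    have h4 := toModel_cov_velocity (cov := cov) (w := coordMap x₀ (γ t) (P t w))
      (hmap (Ioo_subset_Icc_self htm)) (hγ.1.continuousAt (mem_of_superset
        (Icc_mem_nhds htm.1 htm.2) hsub)) ht'
    refine HasDerivAt.congr_deriv ht ?_
    exact congrArg Neg.neg h4

/-- All tangent spaces are the model space by definition. Initial and final values of transports,
which a priori live over different points, can therefore be compared as elements of `F`. -/
theorem tangentBundle_mk_eq {x y : M} {v : TangentSpace 𝓘(ℝ, F) x} {w : TangentSpace 𝓘(ℝ, F) y} :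
    (⟨x, v⟩ : TangentBundle 𝓘(ℝ, F) M) = ⟨y, w⟩ ↔ x = y ∧ (v : F) = w := by
  constructor
  · intro h
    cases h
    exact ⟨rfl, rfl⟩
  · rintro ⟨rfl, h⟩
    exact congrArg _ h

theorem IsTransport.isParallelTransport {T : ℝ} (hP : IsTransport cov γ P 0 T) (h0 : γ 0 = o)
    (hP0 : P 0 = ContinuousLinearMap.id ℝ F) :
    IsParallelTransport cov o T γ (ofAsModel o γ P) :=
  ⟨h0, fun v ↦ ⟨tangentBundle_mk_eq.2 ⟨h0, DFunLike.congr_fun hP0 v⟩, hP.isParallelAlong v⟩⟩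

theorem IsTransport.of_isParallelTransport {T : ℝ} (hγ : IsACCurve F γ 0 T)
    {P : ∀ t, TangentSpace 𝓘(ℝ, F) o →L[ℝ] TangentSpace 𝓘(ℝ, F) (γ t)}
    (hP : IsParallelTransport cov o T γ P) :
    IsTransport cov γ (asModel P) 0 T ∧ asModel P 0 = ContinuousLinearMap.id ℝ F :=
  ⟨of_isParallelAlong hγ fun v ↦ (hP.2 v).2,
    ContinuousLinearMap.ext fun v ↦ (tangentBundle_mk_eq.1 (hP.2 v).1).2⟩

end Transport

/-! ### Piecewise smooth curves: concatenation, reparametrization, reversal -/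

section PiecewiseSmooth

set_option linter.unusedSectionVars false

variable {F : Type*} [NormedAddCommGroup F] [NormedSpace ℝ F]
  {M : Type*} [TopologicalSpace M] [ChartedSpace F M] {γ γ' : ℝ → M} {a b c d m n : ℝ}

/-- Partition points indexed by natural numbers are easier to concatenate and to reverse than points
indexed by `Fin`. -/
theorem isPiecewiseSmooth_iff : IsPiecewiseSmooth F γ a b ↔
    ∃ (k : ℕ) (τ : ℕ → ℝ), Monotone τ ∧ τ 0 = a ∧ τ k = b ∧
      ∀ i < k, ContMDiffOn 𝓘(ℝ, ℝ) 𝓘(ℝ, F) ∞ γ (Icc (τ i) (τ (i + 1))) := by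
  constructor
  · rintro ⟨k, τ, hτ, h0, h1, h⟩
    refine ⟨k, fun i ↦ τ ⟨min i k, by omega⟩, fun i j hij ↦ hτ (by simp; omega), by simpa using h0,
      by simpa [Fin.last] using h1, fun i hi ↦ ?_⟩
    have := h ⟨i, hi⟩
    simp only [Fin.castSucc_mk, Fin.succ_mk] at this
    simpa [min_eq_left hi.le, min_eq_left (show i + 1 ≤ k from hi)] using this
  · rintro ⟨k, τ, hτ, h0, h1, h⟩
    exact ⟨k, fun i ↦ τ i, fun i j hij ↦ hτ hij, by simpa using h0, by simpa using h1,
      fun i ↦ by simpa using h i i.2⟩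

theorem isPiecewiseSmooth_of_contMDiffOn (hab : a ≤ b)
    (h : ContMDiffOn 𝓘(ℝ, ℝ) 𝓘(ℝ, F) ∞ γ (Icc a b)) : IsPiecewiseSmooth F γ a b := by
  refine isPiecewiseSmooth_iff.2 ⟨1, fun i ↦ if i = 0 then a else b, fun i j hij ↦ ?_, by simp,
    by simp, fun i hi ↦ ?_⟩
  · dsimp only
    split_ifs <;> first | omega | exact le_rfl
  · obtain rfl : i = 0 := by omega
    simpa using h

theorem IsPiecewiseSmooth.congr (h : IsPiecewiseSmooth F γ a b) (hγ : EqOn γ γ' (Icc a b)) :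
    IsPiecewiseSmooth F γ' a b := by
  obtain ⟨k, τ, hτ, rfl, rfl, hs⟩ := isPiecewiseSmooth_iff.1 h
  exact isPiecewiseSmooth_iff.2 ⟨k, τ, hτ, rfl, rfl, fun i hi ↦ (hs i hi).congr fun t ht ↦
    (hγ ⟨(hτ (Nat.zero_le i)).trans ht.1, ht.2.trans (hτ hi)⟩).symm⟩

theorem IsPiecewiseSmooth.trans (h1 : IsPiecewiseSmooth F γ a m)
    (h2 : IsPiecewiseSmooth F γ m b) : IsPiecewiseSmooth F γ a b := by
  obtain ⟨k, τ, hτ, rfl, hk, hs⟩ := isPiecewiseSmooth_iff.1 h1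
  obtain ⟨l, ρ, hρ, hρ0, rfl, hs'⟩ := isPiecewiseSmooth_iff.1 h2
  refine isPiecewiseSmooth_iff.2 ⟨k + l, fun i ↦ if i ≤ k then τ i else ρ (i - k),
    fun i j hij ↦ ?_, by simp, ?_, fun i hi ↦ ?_⟩
  · dsimp only
    split_ifs with h3 h4
    · exact hτ hij
    · exact (hτ h3).trans ((hk.trans hρ0.symm).le.trans (hρ (Nat.zero_le _)))
    · omega
    · exact hρ (by omega)
  · rcases Nat.eq_zero_or_pos l with rfl | hl
    · simp [hk, hρ0]
    · simp [hl.ne']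
  · by_cases h3 : i + 1 ≤ k
    · simpa [h3, (Nat.le_succ i).trans h3] using hs i (by omega)
    · have h4 := hs' (i - k) (by omega)
      have e : i + 1 - k = i - k + 1 := by omega
      rcases (show k ≤ i by omega).eq_or_lt with rfl | hlt
      · simpa [hk, ← hρ0] using h4
      · simpa [h3, not_le.2 hlt, e] using h4

theorem IsPiecewiseSmooth.comp_affine_pos (h : IsPiecewiseSmooth F γ (m * c + n) (m * d + n))
    (hm : 0 < m) : IsPiecewiseSmooth F (fun s ↦ γ (m * s + n)) c d := by
  obtain ⟨k, τ, hτ, h0, h1, hs⟩ := isPiecewiseSmooth_iff.1 h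
  refine isPiecewiseSmooth_iff.2 ⟨k, fun i ↦ (τ i - n) / m, fun i j hij ↦ ?_, ?_, ?_,
    fun i hi ↦ ?_⟩
  · dsimp only
    gcongr
    exact hτ hij
  · simp only [h0]
    field_simp
    ring
  · simp only [h1]
    field_simp
    ring
  · refine (hs i hi).comp (t := Icc (τ i) (τ (i + 1))) (f := fun s : ℝ ↦ m * s + n)
      (ContDiff.contMDiff (by fun_prop)).contMDiffOn fun s hs ↦ ?_
    rw [mem_Icc, div_le_iff₀ hm, le_div_iff₀ hm] at hs
    exact ⟨by linarith [hs.1], by linarith [hs.2]⟩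

theorem IsPiecewiseSmooth.reverse (h : IsPiecewiseSmooth F γ (n - d) (n - c)) :
    IsPiecewiseSmooth F (fun s ↦ γ (n - s)) c d := by
  obtain ⟨k, τ, hτ, h0, h1, hs⟩ := isPiecewiseSmooth_iff.1 h
  refine isPiecewiseSmooth_iff.2 ⟨k, fun i ↦ n - τ (k - i), fun i j hij ↦ ?_, ?_, ?_,
    fun i hi ↦ ?_⟩
  · dsimp only
    gcongr
    exact hτ (by omega)
  · simp [h1]
  · simp [h0]
  · refine (hs (k - (i + 1)) (by omega)).comp (f := fun s : ℝ ↦ n - s)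
      (ContDiff.contMDiff (by fun_prop)).contMDiffOn fun s hs ↦ ?_
    have e : k - (i + 1) + 1 = k - i := by omega
    rw [e]
    exact ⟨by linarith [hs.2], by linarith [hs.1]⟩

/-- The concatenation of two curves on `[0, 1]`. -/
noncomputable def concat {X : Type*} (f g : ℝ → X) (t : ℝ) : X :=
  if t ≤ 1 / 2 then f (2 * t + 0) else g (2 * t + -1)

theorem concat_left {X : Type*} {f g : ℝ → X} : EqOn (fun t ↦ f (2 * t + 0)) (concat f g)
    (Icc 0 (1 / 2)) := fun t ht ↦ by simp only [concat, if_pos ht.2]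

theorem concat_right {X : Type*} {f g : ℝ → X} (h : f 1 = g 0) :
    EqOn (fun t ↦ g (2 * t + -1)) (concat f g) (Icc (1 / 2) 1) := fun t ht ↦ by
  rcases ht.1.eq_or_lt with rfl | hlt
  · simp [concat, h]
  · simp only [concat, if_neg (not_le.2 hlt)]

theorem IsPiecewiseSmooth.concat (h1 : IsPiecewiseSmooth F γ 0 1)
    (h2 : IsPiecewiseSmooth F γ' 0 1) (h : γ 1 = γ' 0) :
    IsPiecewiseSmooth F (concat γ γ') 0 1 := by
  refine IsPiecewiseSmooth.trans (m := 1 / 2) (congr (comp_affine_pos ?_ two_pos) concat_left)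
    (congr (comp_affine_pos ?_ two_pos) (concat_right h))
  · simpa using h1
  · convert h2 using 1 <;> norm_num

theorem IsPiecewiseSmooth.isACCurve [FiniteDimensional ℝ F] [IsManifold 𝓘(ℝ, F) ∞ M]
    (h : IsPiecewiseSmooth F γ a b) : IsACCurve F γ a b := by
  obtain ⟨k, τ, hτ, rfl, rfl, hs⟩ := isPiecewiseSmooth_iff.1 h
  have key : ∀ i, i ≤ k → IsACCurve F γ (τ 0) (τ i) := by
    intro i hi
    induction i with
    | zero =>
      refine ⟨by simp, fun x₀ c d hcd hsub _ ↦ ?_⟩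
      have hc := hsub ⟨le_rfl, hcd⟩
      have hd := hsub ⟨hcd, le_rfl⟩
      simp only [Icc_self, mem_singleton_iff] at hc hd
      subst hc
      subst hd
      exact ⟨by simp, fun t ht ↦ by
        rw [Icc_self, mem_singleton_iff] at ht
        simp [ht]⟩
    | succ i ih =>
      have ih := ih (by omega)
      have hi' := hs i hi
      refine ⟨?_, fun x₀ c d hcd hsub hmap ↦ ?_⟩
      · rw [← Icc_union_Icc_eq_Icc (hτ (Nat.zero_le i)) (hτ (Nat.le_succ i))]
        exact ih.1.union_of_isClosed hi'.continuousOn isClosed_Icc isClosed_Icc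
      have hc := hsub ⟨le_rfl, hcd⟩
      have hd := hsub ⟨hcd, le_rfl⟩
      have smooth : ∀ {c' d'}, c' ≤ d' → Icc c' d' ⊆ Icc c d → Icc c' d' ⊆ Icc (τ i) (τ (i + 1)) →
          HasACDeriv (fun t ↦ chartAt F x₀ (γ t)) (deriv fun t ↦ chartAt F x₀ (γ t)) c' d' := by
        intro c' d' hcd' hs1 hs2
        refine HasACDeriv.of_contDiffOn hcd' ?_
        have h1 := (contMDiffOn_chart (n := ∞) (I := 𝓘(ℝ, F)) (x := x₀)).comp (hi'.mono hs2)
          fun t ht ↦ hmap (hs1 ht)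
        exact h1.contDiffOn.of_le (by simp)
      rcases le_total d (τ i) with hdm | hdm
      · exact ih.2 x₀ c d hcd (Icc_subset_Icc hc.1 hdm) hmap
      rcases le_total (τ i) c with hmc | hmc
      · exact smooth hcd subset_rfl (Icc_subset_Icc hmc hd.2)
      · exact (ih.2 x₀ c (τ i) hmc (Icc_subset_Icc hc.1 le_rfl)
          (hmap.mono (Icc_subset_Icc_right hdm) subset_rfl)).glue
          (smooth hdm (Icc_subset_Icc_left hmc) (Icc_subset_Icc le_rfl hd.2)) hmc hdm
  exact key k le_rfl

end PiecewiseSmooth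

/-! ### Transports from the base point and holonomy -/

section Reach

set_option linter.unusedSectionVars false
set_option synthInstance.maxHeartbeats 200000

variable {F : Type*} [NormedAddCommGroup F] [NormedSpace ℝ F] [FiniteDimensional ℝ F]
  {M : Type*} [TopologicalSpace M] [ChartedSpace F M] [IsManifold 𝓘(ℝ, F) ∞ M] [T2Space M]
  {cov : CovariantDerivative 𝓘(ℝ, F) F (TangentSpace 𝓘(ℝ, F) : M → Type _)}
  [CovariantDerivative.ContMDiffCovariantDerivative cov ∞]
  {x₀ x o : M} {γ γ' : ℝ → M} {P Q : ℝ → F →L[ℝ] F} {R R' : F →L[ℝ] F} {a b c d m n : ℝ}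

/-- Parallelism is invariant under reparametrization because the equation is linear in the velocity.
A negative slope is allowed and gives the transport along the reversed curve. -/
theorem IsTransport.comp_affine (h : IsTransport cov γ P a b) (hm : m ≠ 0)
    (hmap : MapsTo (fun s ↦ m * s + n) (Icc c d) (Icc a b)) :
    IsTransport cov (fun s ↦ γ (m * s + n)) (fun s ↦ P (m * s + n)) c d := by
  refine mk' (h.1.comp (by fun_prop) hmap) fun x₀ c' d' hcd' hsub hs ↦ ?_
  have e : ∀ r, m * ((r - n) / m) + n = r := fun r ↦ by
    field_simp
    ring
  obtain ⟨p, q, hpq, hp, hq, hpq1, hpq2⟩ : ∃ p q, p ≤ q ∧ p ∈ Icc a b ∧ q ∈ Icc a b ∧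
      (∀ s ∈ Icc c' d', m * s + n ∈ Icc p q) ∧ ∀ r ∈ Icc p q, (r - n) / m ∈ Icc c' d' := by
    have h1 := hmap (hsub ⟨le_rfl, hcd'⟩)
    have h2 := hmap (hsub ⟨hcd', le_rfl⟩)
    rcases hm.lt_or_gt with hneg | hpos
    · refine ⟨m * d' + n, m * c' + n, by nlinarith, h2, h1, fun s hs ↦ ⟨?_, ?_⟩, fun r hr ↦ ?_⟩
      · nlinarith [hs.2]
      · nlinarith [hs.1]
      · rw [mem_Icc, le_div_iff_of_neg hneg, div_le_iff_of_neg hneg]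
        exact ⟨by linarith [hr.2], by linarith [hr.1]⟩
    · refine ⟨m * c' + n, m * d' + n, by nlinarith, h1, h2, fun s hs ↦ ⟨?_, ?_⟩, fun r hr ↦ ?_⟩
      · nlinarith [hs.1]
      · nlinarith [hs.2]
      · rw [mem_Icc, le_div_iff₀ hpos, div_le_iff₀ hpos]
        exact ⟨by linarith [hr.1], by linarith [hr.2]⟩
  have h1 := (h.hasACDeriv hpq hp hq (x₀ := x₀) fun r hr ↦ by
    have := hs (hpq2 r hr)
    simp only [e] at this
    exact this).comp_affine hcd' hpq1
  exact ⟨fun s ↦ m • deriv (fun s ↦ chartAt F x₀ (γ s)) (m * s + n),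
    h1.congr_fun hcd' (fun _ _ ↦ rfl) fun s _ ↦ (map_smul _ _ _).symm⟩

theorem IsTransport.concat (h1 : IsTransport cov γ P 0 1) (h2 : IsTransport cov γ' Q 0 1)
    (h : γ 1 = γ' 0) (h' : P 1 = Q 0) : IsTransport cov (concat γ γ') (concat P Q) 0 1 := by
  refine IsTransport.glue (m := 1 / 2)
    ((h1.comp_affine (c := 0) (d := 1 / 2) two_ne_zero fun s hs ↦ ?_).congr concat_left concat_left)
    ((h2.comp_affine (c := 1 / 2) (d := 1) two_ne_zero fun s hs ↦ ?_).congr (concat_right h)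
      (concat_right h')) (by norm_num) (by norm_num)
  · exact ⟨by linarith [hs.1], by linarith [hs.2]⟩
  · exact ⟨by linarith [hs.1], by linarith [hs.2]⟩

variable (cov) in
/-- `R` is the parallel transport along a piecewise smooth curve from `o` to `x`. -/
def Reach (o x : M) (R : F →L[ℝ] F) : Prop :=
  ∃ (c : ℝ → M) (P : ℝ → F →L[ℝ] F), IsPiecewiseSmooth F c 0 1 ∧ c 0 = o ∧ c 1 = x ∧
    IsTransport cov c P 0 1 ∧ P 0 = ContinuousLinearMap.id ℝ F ∧ P 1 = R

theorem Reach.refl (o : M) : Reach cov o o (ContinuousLinearMap.id ℝ F) := by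
  have h : IsPiecewiseSmooth F (fun _ : ℝ ↦ o) 0 1 :=
    isPiecewiseSmooth_of_contMDiffOn zero_le_one contMDiffOn_const
  obtain ⟨P, hP, hP0⟩ := IsTransport.exists_of_isACCurve (cov := cov) h.isACCurve zero_le_one
    (t₀ := 0) (by simp) (ContinuousLinearMap.id ℝ F)
  refine ⟨fun _ ↦ o, fun _ ↦ ContinuousLinearMap.id ℝ F, h, rfl, rfl, ?_, rfl, rfl⟩
  refine IsTransport.mk' continuousOn_const fun x₀ c d hcd _ _ ↦ ⟨fun _ ↦ 0, ?_, ?_⟩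
  · simp
  · simp [chartState]

theorem Reach.injective (h : Reach cov o x R) : Function.Injective R := by
  obtain ⟨c, P, -, -, -, hP, hP0, rfl⟩ := h
  exact hP.injective (t₀ := 0) (by simp) (by simp) (by rw [hP0]; exact fun _ _ h ↦ h)

/-- The inverse of an injective endomorphism of a finite-dimensional space. -/
theorem exists_comp_eq_id (hR : Function.Injective R) :
    ∃ L : F →L[ℝ] F, R ∘L L = ContinuousLinearMap.id ℝ F ∧ L ∘L R = ContinuousLinearMap.id ℝ F := by
  let e := (LinearEquiv.ofInjectiveEndo (R : F →ₗ[ℝ] F) hR).toContinuousLinearEquiv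
  exact ⟨e.symm, ContinuousLinearMap.ext fun v ↦ e.apply_symm_apply v,
    ContinuousLinearMap.ext fun v ↦ e.symm_apply_apply v⟩

/-- The new piece is rescaled to `[0, 1]` and appended. The degenerate case `a = b` is separate
since the rescaling has slope `b - a`. -/
theorem Reach.trans (h : Reach cov o (γ a) R) (hab : a ≤ b)
    (hγ : ContMDiffOn 𝓘(ℝ, ℝ) 𝓘(ℝ, F) ∞ γ (Icc a b)) (hQ : IsTransport cov γ Q a b)
    (hQa : Q a = R) : Reach cov o (γ b) (Q b) := by
  rcases hab.eq_or_lt with rfl | hlt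
  · rwa [hQa]
  have hpos : 0 < b - a := sub_pos.2 hlt
  obtain ⟨c, P, hc, hc0, hc1, hP, hP0, hP1⟩ := h
  have e1 : (b - a) * 1 + a = b := by ring
  have e0 : (b - a) * 0 + a = a := by ring
  have hγ' : IsPiecewiseSmooth F (fun s ↦ γ ((b - a) * s + a)) 0 1 :=
    IsPiecewiseSmooth.comp_affine_pos
      (by rw [e0, e1]; exact isPiecewiseSmooth_of_contMDiffOn hab hγ) hpos
  have hQ' : IsTransport cov (fun s ↦ γ ((b - a) * s + a)) (fun s ↦ Q ((b - a) * s + a)) 0 1 :=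
    hQ.comp_affine hpos.ne' fun s hs ↦ ⟨by nlinarith [hs.1], by nlinarith [hs.2]⟩
  have j1 : c 1 = (fun s ↦ γ ((b - a) * s + a)) 0 := by simp [hc1]
  have j2 : P 1 = (fun s ↦ Q ((b - a) * s + a)) 0 := by simp [hP1, hQa]
  refine ⟨_, _, hc.concat hγ' j1, ?_, ?_, hP.concat hQ' j1 j2, ?_, ?_⟩
  · simp [AffineDev.concat, hc0]
  · norm_num [AffineDev.concat]
  · simp [AffineDev.concat, hP0]
  · norm_num [AffineDev.concat]

/-- Follow the first curve to `x` and return along the reversed second one: the transport along this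
loop is `R'⁻¹ R`. -/
theorem Reach.isHolonomy (h : Reach cov o x R) (h' : Reach cov o x R') :
    ∃ L : F →L[ℝ] F, IsHolonomy cov o L ∧ R = R' ∘L L := by
  obtain ⟨L', hL1, hL2⟩ := exists_comp_eq_id h'.injective
  obtain ⟨c, P, hc, hc0, hc1, hP, hP0, rfl⟩ := h
  obtain ⟨c', P', hc', hc0', hc1', hP', hP0', rfl⟩ := h'
  have hrev : IsPiecewiseSmooth F (fun s ↦ c' (1 - s)) 0 1 :=
    IsPiecewiseSmooth.reverse (by simpa using hc')
  have e : ∀ s : ℝ, -1 * s + 1 = 1 - s := fun s ↦ by ring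
  -- The factor on the right makes the returning frame start at `P 1`.
  have hQ : IsTransport cov (fun s ↦ c' (1 - s)) (fun s ↦ P' (1 - s) ∘L (L' ∘L P 1)) 0 1 := by
    have h1 := (hP'.comp_affine (m := -1) (n := 1) (c := 0) (d := 1) (by norm_num)
      fun s hs ↦ ⟨by linarith [hs.2], by linarith [hs.1]⟩).comp_right (L' ∘L P 1)
    simpa only [e] using h1
  have j1 : c 1 = (fun s ↦ c' (1 - s)) 0 := by simp [hc1, hc1']
  have j2 : P 1 = (fun s ↦ P' (1 - s) ∘L (L' ∘L P 1)) 0 := by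
    simp only [sub_zero]
    rw [← ContinuousLinearMap.comp_assoc, hL1, ContinuousLinearMap.id_comp]
  have hT := hP.concat hQ j1 j2
  have hT0 : concat c (fun s ↦ c' (1 - s)) 0 = o := by simp [AffineDev.concat, hc0]
  refine ⟨L' ∘L P 1, ⟨_, _, hc.concat hrev j1, hT.isParallelTransport hT0 ?_, fun v ↦ ?_⟩, ?_⟩
  · simp [AffineDev.concat, hP0]
  · refine tangentBundle_mk_eq.2 ⟨?_, ?_⟩
    · norm_num [AffineDev.concat, hc0']
    · change AffineDev.concat P (fun s ↦ P' (1 - s) ∘L (L' ∘L P 1)) 1 v = (L' ∘L P 1) v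
      norm_num [AffineDev.concat, hP0']
  · rw [← ContinuousLinearMap.comp_assoc, hL1, ContinuousLinearMap.id_comp]

end Reach

/-! ### Short intervals and approximation by smooth controls -/

section

variable {V : Type*} [NormedAddCommGroup V] [NormedSpace ℝ V] {a b c d : ℝ}

/-- A property of intervals that holds for all intervals on which `‖f‖` has small integral and is
stable under concatenation holds for every interval. -/
theorem interval_induction_integral {f : ℝ → V} (hf : IntervalIntegrable f volume a b) {δ : ℝ}
    (hδ : 0 < δ) {p : ℝ → ℝ → Prop} (hab : a ≤ b)
    (hloc : ∀ c d, c ≤ d → c ∈ Icc a b → d ∈ Icc a b → ∫ s in c..d, ‖f s‖ < δ → p c d)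
    (hglue : ∀ c m d, c ≤ m → m ≤ d → c ∈ Icc a b → d ∈ Icc a b → p c m → p m d → p c d) :
    p a b := by
  refine interval_induction hab (fun t ht ↦ ?_) hglue
  obtain ⟨ε, hε, h⟩ := exists_integral_norm_lt hf hδ ht
  exact ⟨ε, hε, fun c d hcd hc hd hct hdt ↦ hloc c d hcd hc hd (h c d hcd hc hd hct hdt)⟩

/-- A property of intervals that holds for all intervals that `γ` maps into the domain of a chart
and is stable under concatenation holds for every interval. -/
theorem interval_induction_chart (F : Type*) [NormedAddCommGroup F] {M : Type*}
    [TopologicalSpace M] [ChartedSpace F M] [NormedSpace ℝ F] [FiniteDimensional ℝ F]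
    {γ : ℝ → M} (hγ : ContinuousOn γ (Icc a b))
    {p : ℝ → ℝ → Prop} (hab : a ≤ b)
    (hloc : ∀ (x₀ : M) c d, c ≤ d → c ∈ Icc a b → d ∈ Icc a b →
      MapsTo γ (Icc c d) (chartAt F x₀).source → p c d)
    (hglue : ∀ c m d, c ≤ m → m ≤ d → c ∈ Icc a b → d ∈ Icc a b → p c m → p m d → p c d) :
    p a b := by
  refine interval_induction hab (fun t ht ↦ ?_) hglue
  obtain ⟨ε, hε, h⟩ := exists_mapsTo_chart_source (F := F) hγ ht
  exact ⟨ε, hε, fun c d hcd hc hd hct hdt ↦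
    hloc (γ t) c d hcd hc hd (h c d hcd hc hd hct hdt)⟩

theorem exists_Lp_one (hcd : c ≤ d) {f : ℝ → V} (hf : IntervalIntegrable f volume c d) :
    ∃ α : Lp V 1 (volume.restrict (Icc c d)), (∀ᵐ t ∂(volume.restrict (Icc c d)), α t = f t) ∧
      ‖α‖ = ∫ t in c..d, ‖f t‖ := by
  have h1 : MemLp f 1 (volume.restrict (Icc c d)) := by
    rw [memLp_one_iff_integrable]
    exact (intervalIntegrable_iff_integrableOn_Icc_of_le hcd).1 hf
  refine ⟨h1.toLp, h1.coeFn_toLp, ?_⟩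
  rw [← integral_norm_Lp_one hcd, intervalIntegral.integral_of_le hcd,
    intervalIntegral.integral_of_le hcd, ← integral_Icc_eq_integral_Ioc,
    ← integral_Icc_eq_integral_Ioc]
  exact integral_congr_ae (h1.coeFn_toLp.mono fun t ht ↦ by simp only [ht])

/-- Integrable functions are limits in `L¹` of smooth functions with the same integral. -/
theorem mem_closure_smooth [CompleteSpace V] [FiniteDimensional ℝ V] (hcd : c < d)
    (α : Lp V 1 (volume.restrict (Icc c d))) :
    α ∈ closure {β : Lp V 1 (volume.restrict (Icc c d)) | ∃ g : ℝ → V, ContDiff ℝ ∞ g ∧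
      (∀ᵐ t ∂(volume.restrict (Icc c d)), β t = g t) ∧ ∫ t in c..d, g t = ∫ t in c..d, α t} := by
  let μ := volume.restrict (Icc c d)
  let I : Lp V 1 μ → V := fun β ↦ ∫ t, β t ∂μ
  have hI : ∀ f : ℝ → V, ∫ t in c..d, f t = ∫ t, f t ∂μ := fun f ↦ by
    rw [intervalIntegral.integral_of_le hcd.le, ← integral_Icc_eq_integral_Ioc]
  let Ψ : Lp V 1 μ → Lp V 1 μ := fun β ↦ β + Lp.constL 1 μ ℝ ((d - c)⁻¹ • (I α - I β))
  have hΨ : Continuous Ψ := by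
    have : Continuous I := continuous_integral
    fun_prop
  have hα : Ψ α = α := by simp [Ψ]
  have h1 := image_closure_subset_closure_image hΨ
    (mem_image_of_mem Ψ ((Lp.dense_hasCompactSupport_contDiff (F := V) (μ := μ) (p := 1)
      (by simp)) α))
  rw [hα] at h1
  refine closure_mono ?_ h1
  rintro _ ⟨β, ⟨g, hg, -, hgs⟩, rfl⟩
  set k := (d - c)⁻¹ • (I α - I β) with hk
  refine ⟨fun t ↦ g t + k, hgs.add contDiff_const, ?_, ?_⟩
  · filter_upwards [Lp.coeFn_add β (Lp.constL 1 μ ℝ k), hg, Lp.coeFn_const 1 μ k]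
      with t h2 h3 h4
    change (β + Lp.constL 1 μ ℝ k : Lp V 1 μ) t = _
    rw [h2, Pi.add_apply, h3]
    congr 1
  · rw [intervalIntegral.integral_add (hgs.continuous.intervalIntegrable _ _) (by simp),
      intervalIntegral.integral_const, hI, hI, hk, smul_smul,
      mul_inv_cancel₀ (sub_pos.2 hcd).ne', one_smul, ← integral_congr_ae hg]
    simp [I]

/-- The flow of a smooth system depends differentiably on the initial value and on the control, on
intervals on which the control is small in `L¹`. -/
theorem exists_local_flow_of_contDiffOn {G V : Type*} [NormedAddCommGroup G] [NormedSpace ℝ G]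
    [CompleteSpace G] [NormedAddCommGroup V] [NormedSpace ℝ V] [CompleteSpace V] {a b : ℝ} (hab : a < b)
    {A : ℝ → G → V →L[ℝ] G} {Ω : Set G} (hΩ : IsOpen Ω)
    (hA : ContDiffOn ℝ ∞ (fun q : ℝ × G ↦ A q.1 q.2) (Icc a b ×ˢ Ω)) {y : ℝ → G}
    (hycont : ContinuousOn y (Icc a b)) (hyΩ : ∀ t ∈ Icc a b, y t ∈ Ω) :
    ∃ δ > 0, ∀ c d, c ≤ d → c ∈ Icc a b → d ∈ Icc a b →
      ∀ α : Lp V 1 (volume.restrict (Icc c d)), HasACDeriv y (fun t ↦ A t (y t) (α t)) c d →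
      ‖α‖ < δ →
      ∃ (Φ : G × Lp V 1 (volume.restrict (Icc c d)) → ℝ → G)
        (Φ' : ℝ → G × Lp V 1 (volume.restrict (Icc c d)) →L[ℝ] G),
        (∀ t ∈ Icc c d, Φ (y c, α) t = y t) ∧
        (∀ᶠ q in 𝓝 (y c, α), Φ q c = q.1 ∧
          HasACDeriv (Φ q) (fun t ↦ A t (Φ q t) (q.2 t)) c d ∧ ∀ t ∈ Icc c d, Φ q t ∈ Ω) ∧
        (∀ t ∈ Icc c d, HasStrictFDerivAt (fun q ↦ Φ q t) (Φ' t) (y c, α)) ∧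
        ∀ q w, HasACDeriv w (fun t ↦ fderiv ℝ (A t) (y t) (w t) (α t) + A t (y t) (q.2 t)) c d →
          w c = q.1 → ∀ t ∈ Icc c d, Φ' t q = w t := by
  have hA1 : ContDiffOn ℝ 1 (fun q : ℝ × G ↦ A q.1 q.2) (Icc a b ×ˢ Ω) := hA.of_le (by simp)
  have hA' := continuousOn_fderiv_of_contDiffOn_prod hab hΩ hA1
  obtain ⟨C, hC⟩ := isCompact_Icc.exists_bound_of_continuousOn
    (hA'.comp (continuousOn_id.prodMk hycont) fun t ht ↦ ⟨ht, hyΩ t ht⟩)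
  have hC0 : 0 ≤ C := (norm_nonneg _).trans (hC a ⟨le_rfl, hab.le⟩)
  -- `C` bounds the derivative along all of `y`, so one `δ` serves every subinterval; `‖α‖ < 1 / (C
  -- + 1)` gives `C * ‖α‖ < 1`.
  refine ⟨1 / (C + 1), by positivity, fun c d hcd hc hd α hy hα ↦ ?_⟩
  have hsub : Icc c d ⊆ Icc a b := Icc_subset_Icc hc.1 hd.2
  refine exists_local_flow hcd (A' := fun t z ↦ fderiv ℝ (A t) z) hΩ
    (hA.continuousOn.mono (prod_mono hsub subset_rfl)) (hA'.mono (prod_mono hsub subset_rfl))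
    (fun t ht z hz ↦ ?_) hy (fun t ht ↦ hyΩ t (hsub ht)) (C := C) (fun t ht ↦ hC t (hsub ht)) ?_
  · exact (hasFDerivAt_of_contDiffOn_prod hΩ hA1 (hsub ht) hz).differentiableAt.hasFDerivAt
  · rw [lt_div_iff₀ (by positivity)] at hα
    nlinarith [norm_nonneg α]

end

/-! ### Invariance of the subbundle under parallel transport -/

section Subbundle

set_option linter.unusedSectionVars false
set_option synthInstance.maxHeartbeats 200000

variable {F : Type*} [NormedAddCommGroup F] [NormedSpace ℝ F] [FiniteDimensional ℝ F]
  {M : Type*} [TopologicalSpace M] [ChartedSpace F M] [IsManifold 𝓘(ℝ, F) ∞ M] [T2Space M]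
  {cov : CovariantDerivative 𝓘(ℝ, F) F (TangentSpace 𝓘(ℝ, F) : M → Type _)}
  [CovariantDerivative.ContMDiffCovariantDerivative cov ∞]
  {x₀ o x : M} {γ : ℝ → M} {P : ℝ → F →L[ℝ] F} {R R' p : F →L[ℝ] F} {a b c d : ℝ}
  {𝔢 : Type*} [NormedAddCommGroup 𝔢] [InnerProductSpace ℝ 𝔢]
  {ι : 𝔢 →L[ℝ] TangentSpace 𝓘(ℝ, F) o}

theorem IsTransport.of_chart {y : ℝ → F × (F →L[ℝ] F)} {v : ℝ → F} (hcd : c ≤ d)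
    (hy : HasACDeriv y (fun t ↦ transportSystem cov x₀ (y t) (v t)) c d)
    (hyt : ∀ t ∈ Icc c d, (y t).1 ∈ (chartAt F x₀).target) :
    IsTransport cov (fun t ↦ (chartAt F x₀).symm (y t).1)
        (fun t ↦ coordInv x₀ ((chartAt F x₀).symm (y t).1) ∘L (y t).2) c d ∧
      EqOn y (chartState x₀ (fun t ↦ (chartAt F x₀).symm (y t).1)
        (fun t ↦ coordInv x₀ ((chartAt F x₀).symm (y t).1) ∘L (y t).2)) (Icc c d) := by
  have hE : EqOn y (chartState x₀ (fun t ↦ (chartAt F x₀).symm (y t).1)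
        (fun t ↦ coordInv x₀ ((chartAt F x₀).symm (y t).1) ∘L (y t).2)) (Icc c d) := by
    intro t ht
    refine Prod.ext ?_ ?_
    · exact ((chartAt F x₀).right_inv (hyt t ht)).symm
    · simp only [chartState]
      rw [← ContinuousLinearMap.comp_assoc,
        coordMap_comp_coordInv ((chartAt F x₀).map_target (hyt t ht)),
        ContinuousLinearMap.id_comp]
  refine ⟨IsTransport.of_local ?_ fun t ht ↦ ⟨x₀, 1, one_pos, fun c' d' hcd' hc' hd' _ _ ↦
    ⟨fun s hs ↦ ?_, v, ?_⟩⟩, hE⟩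
  · exact (chartAt F x₀).continuousOn_symm.comp (continuous_fst.comp_continuousOn
      (hy.continuousOn hcd)) fun t ht ↦ hyt t ht
  · exact (chartAt F x₀).map_target (hyt s ⟨hc'.1.trans hs.1, hs.2.trans hd'.2⟩)
  · refine (hy.mono hc' hd').congr_fun hcd' (hE.mono (Icc_subset_Icc hc'.1 hd'.2)) fun s hs ↦ ?_
    have := hE ⟨hc'.1.trans hs.1, hs.2.trans hd'.2⟩
    beta_reduce
    rw [← this]

/-- The subspace `ι(𝔢)`. -/
def modelE (ι : 𝔢 →L[ℝ] TangentSpace 𝓘(ℝ, F) o) : Submodule ℝ F :=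
  LinearMap.range (ι : 𝔢 →ₗ[ℝ] TangentSpace 𝓘(ℝ, F) o)

/-- Two transports to `x` differ by a holonomy, which preserves `ι(𝔢)`. So the fiber of `E` at `x`
can be computed with any single transport. -/
theorem Reach.exists_apply_eq (hB : HolonomyPreserves cov ι) (h : Reach cov o x R)
    (h' : Reach cov o x R') {s : F} (hs : s ∈ modelE ι) : ∃ s' ∈ modelE ι, R s = R' s' := by
  obtain ⟨L, hL, rfl⟩ := h.isHolonomy h'
  obtain ⟨v, rfl⟩ := hs
  obtain ⟨L', hL'⟩ := hB L hL
  exact ⟨ι (L' v), ⟨L' v, rfl⟩, congrArg R' (hL' v)⟩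

variable (cov ι) in
/-- `p` maps `ι(𝔢)` into `E_x`. -/
def MapsToE (x : M) (p : F →L[ℝ] F) : Prop :=
  ∃ R, Reach cov o x R ∧ ∀ s ∈ modelE ι, ∃ s' ∈ modelE ι, p s = R s'

theorem MapsToE.of_reach (hB : HolonomyPreserves cov ι) (h : MapsToE cov ι x p)
    (hR : Reach cov o x R) {s : F} (hs : s ∈ modelE ι) : ∃ s' ∈ modelE ι, p s = R s' := by
  obtain ⟨R', hR', h'⟩ := h
  obtain ⟨s', hs', e⟩ := h' s hs
  obtain ⟨s'', hs'', e'⟩ := hR'.exists_apply_eq hB hR hs'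
  exact ⟨s'', hs'', e.trans e'⟩

/-- Parallel transport along smooth curves preserves `E`. -/
theorem MapsToE.of_contMDiffOn (h : MapsToE cov ι (γ a) (P a)) (hab : a ≤ b)
    (hγ : ContMDiffOn 𝓘(ℝ, ℝ) 𝓘(ℝ, F) ∞ γ (Icc a b))
    (hP : IsTransport cov γ P a b) : MapsToE cov ι (γ b) (P b) := by
  obtain ⟨R, hR, h⟩ := h
  obtain ⟨L, hL, hL'⟩ := exists_comp_eq_id hR.injective
  obtain ⟨Q, hQ, rfl⟩ := IsTransport.exists_of_isACCurve (cov := cov) hP.isACCurve hab (left_mem_Icc.2 hab) R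
  -- `Q` continues the transport `R` along `γ`. It differs from `P` by the constant factor `R⁻¹ P
  -- a`, which maps `ι(𝔢)` into itself.
  have h1 : P b = Q b ∘L (L ∘L P a) := hP.eqOn (hQ.comp_right (L ∘L P a)) hab (left_mem_Icc.2 hab)
    (by rw [← ContinuousLinearMap.comp_assoc, hL, ContinuousLinearMap.id_comp])
    (right_mem_Icc.2 hab)
  refine ⟨_, hR.trans hab hγ hQ rfl, fun s hs ↦ ?_⟩
  obtain ⟨s', hs', e⟩ := h s hs
  have h2 : L (Q a s') = s' := DFunLike.congr_fun hL' s'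
  exact ⟨s', hs', by rw [h1, ContinuousLinearMap.comp_apply, ContinuousLinearMap.comp_apply, e, h2]⟩

theorem contMDiffOn_chart_symm_comp {ξ : ℝ → F} {s : Set ℝ} (hξ : ContDiffOn ℝ ∞ ξ s)
    (h : MapsTo ξ s (chartAt F x₀).target) :
    ContMDiffOn 𝓘(ℝ, ℝ) 𝓘(ℝ, F) ∞ (fun t ↦ (chartAt F x₀).symm (ξ t)) s :=
  ContMDiffOn.comp (contMDiffOn_chart_symm (n := ∞)) hξ.contMDiffOn h

/-- Parallel transport along absolutely continuous curves preserves `E`. -/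
theorem MapsToE.transport (hB : HolonomyPreserves cov ι) (hP : IsTransport cov γ P a b)
    (hab : a ≤ b) (h : MapsToE cov ι (γ a) (P a)) :
    MapsToE cov ι (γ b) (P b) := by
  revert h
  refine interval_induction_chart F (p := fun c d ↦ MapsToE cov ι (γ c) (P c) →
    MapsToE cov ι (γ d) (P d)) hP.1 hab (fun x₀ a' b' hab' ha' hb' hmap ↦ ?_)
    fun c m d _ _ _ _ h1 h2 h ↦ h2 (h1 h)
  have hy := hP.hasACDeriv hab' ha' hb' hmap
  set y := chartState x₀ γ P with hydef
  set ξ : ℝ → F := fun s ↦ chartAt F x₀ (γ s) with hξ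
  have hξint : IntervalIntegrable (deriv ξ) volume a' b' :=
    (hy.clm_comp (ContinuousLinearMap.fst ℝ F (F →L[ℝ] F))).1
  rcases hab'.eq_or_lt with rfl | hlt'
  · exact id
  set Ω : Set (F × (F →L[ℝ] F)) := (chartAt F x₀).target ×ˢ univ with hΩ
  have hΩo : IsOpen Ω := (chartAt F x₀).open_target.prod isOpen_univ
  have hyΩ : ∀ t ∈ Icc a' b', y t ∈ Ω := fun t ht ↦
    ⟨(chartAt F x₀).map_source (hmap ht), mem_univ _⟩
  obtain ⟨δ, hδ, hflow⟩ := exists_local_flow_of_contDiffOn hlt'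
    (A := fun _ z ↦ transportSystem cov x₀ z) hΩo
    ((contDiffOn_transportSystem cov x₀).comp contDiffOn_snd fun q hq ↦ hq.2)
    (hy.continuousOn hab') hyΩ
  refine interval_induction_integral hξint hδ (p := fun c d ↦ MapsToE cov ι (γ c) (P c) →
    MapsToE cov ι (γ d) (P d)) hab'
    (fun c d hcd hc hd hsmall hcE ↦ ?_) fun c m d _ _ _ _ h1 h2 h ↦ h2 (h1 h)
  rcases hcd.eq_or_lt with rfl | hlt
  · exact hcE
  have hsub : Icc c d ⊆ Icc a' b' := Icc_subset_Icc hc.1 hd.2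
  obtain ⟨α, hα, hαn⟩ := exists_Lp_one hcd (hξint.mono_set
    (by rw [uIcc_of_le hcd, uIcc_of_le hab']; exact hsub))
  have hyα : HasACDeriv y (fun t ↦ transportSystem cov x₀ (y t) (α t)) c d :=
    (hy.mono hc hd).congr hcd (fun _ _ ↦ rfl) (hα.mono fun t ht ↦ by rw [ht])
  obtain ⟨Φ, Φ', h1, h2, h3, -⟩ := hflow c d hcd hc hd α hyα (hαn.trans_lt hsmall)
  have hcont : Continuous fun β : Lp F 1 (volume.restrict (Icc c d)) ↦ (y c, β) := by fun_prop
  have hev := hcont.continuousAt (x := α) |>.eventually h2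
  -- Smooth velocities with the same integral as `α` exist arbitrarily close to `α` in `L¹`. Their
  -- curves in the chart have the same endpoints as `γ`, so smooth transport carries `ι(𝔢)` into one
  -- fixed fiber.
  have hfr : ∃ᶠ β in 𝓝 α, MapsToE cov ι (γ d) (coordInv x₀ (γ d) ∘L (Φ (y c, β) d).2) := by
    refine ((mem_closure_iff_frequently.1 (mem_closure_smooth hlt α)).and_eventually hev).mono ?_
    rintro β ⟨⟨g, hg, hβg, hgα⟩, e0, e1, e2⟩
    obtain ⟨hQ, -⟩ := IsTransport.of_chart hcd e1 fun t ht ↦ (e2 t ht).1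
    have hfst : ∀ t ∈ Icc c d, (Φ (y c, β) t).1 = ξ c + ∫ s in c..t, g s := by
      intro t ht
      have h5 := ((e1.clm_comp (ContinuousLinearMap.fst ℝ F (F →L[ℝ] F))).congr hcd
        (fun _ _ ↦ rfl) (hβg.mono fun t ht ↦ show _ = g t from ht)).2 t ht
      change (Φ (y c, β) t).1 = (Φ (y c, β) c).1 + _ at h5
      rw [h5, e0]
      rfl
    have hξd : (Φ (y c, β) d).1 = ξ d := by
      have h5 := ((hyα.clm_comp (ContinuousLinearMap.fst ℝ F (F →L[ℝ] F))).congr hcd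
        (fun _ _ ↦ rfl) (.of_forall fun t ↦ show _ = α t from rfl)).2 d ⟨hcd, le_rfl⟩
      rw [hfst d ⟨hcd, le_rfl⟩, hgα]
      exact h5.symm
    have hγc : (chartAt F x₀).symm (Φ (y c, β) c).1 = γ c := by
      rw [e0]
      exact (chartAt F x₀).left_inv (hmap hc)
    have hγd : (chartAt F x₀).symm (Φ (y c, β) d).1 = γ d := by
      rw [hξd]
      exact (chartAt F x₀).left_inv (hmap hd)
    have hQc : coordInv x₀ ((chartAt F x₀).symm (Φ (y c, β) c).1) ∘L (Φ (y c, β) c).2 = P c := by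
      rw [hγc, e0]
      simp only [hydef, chartState]
      rw [← ContinuousLinearMap.comp_assoc, coordInv_comp_coordMap (hmap hc),
        ContinuousLinearMap.id_comp]
    have h6 := MapsToE.of_contMDiffOn (ι := ι) (a := c) (b := d)
      (γ := fun t ↦ (chartAt F x₀).symm (Φ (y c, β) t).1) (by
        rw [hQc, hγc]
        exact hcE) hcd (contMDiffOn_chart_symm_comp ?_ fun t ht ↦ (e2 t ht).1) hQ
    · rwa [hγd] at h6
    · refine ContDiffOn.congr (f := fun t ↦ ξ c + ∫ s in c..t, g s) ?_ hfst
      refine (contDiff_const.add ?_).contDiffOn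
      rw [contDiff_infty_iff_deriv]
      have hd : ∀ t, HasDerivAt (fun t ↦ ∫ s in c..t, g s) (g t) t := fun t ↦
        hg.continuous.integral_hasStrictDerivAt c t |>.hasDerivAt
      refine ⟨fun t ↦ (hd t).differentiableAt, ?_⟩
      rwa [show deriv (fun t ↦ ∫ s in c..t, g s) = g from funext fun t ↦ (hd t).deriv]
  obtain ⟨β₀, R, hR, -⟩ := hfr.exists
  refine ⟨R, hR, fun s hs ↦ ?_⟩
  -- The fiber of `E` over `γ d` in coordinates is closed, and transport depends continuously on the
  -- velocity in `L¹`; so the limit `β → α` stays in this fiber.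
  let K : Submodule ℝ F := (modelE ι).map ((coordMap x₀ (γ d) ∘L R : F →L[ℝ] F) : F →ₗ[ℝ] F)
  have hK : IsClosed (K : Set F) := K.closed_of_finiteDimensional
  have hlim : Tendsto (fun β ↦ (Φ (y c, β) d).2 s) (𝓝 α) (𝓝 ((Φ (y c, α) d).2 s)) := by
    have h7 := (h3 d ⟨hcd, le_rfl⟩).hasFDerivAt.continuousAt
    have h8 : ContinuousAt (fun β ↦ Φ (y c, β) d) α :=
      ContinuousAt.comp (g := fun q ↦ Φ q d) h7 hcont.continuousAt
    exact (((ContinuousLinearMap.apply ℝ F s).continuous.comp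
      continuous_snd).continuousAt.comp h8)
  have hmem : (Φ (y c, α) d).2 s ∈ K := by
    refine hK.mem_of_frequently_of_tendsto (hfr.mono fun β hβ ↦ ?_) hlim
    obtain ⟨s', hs', e⟩ := hβ.of_reach hB hR hs
    refine ⟨s', hs', ?_⟩
    change coordMap x₀ (γ d) (R s') = _
    rw [← e, ContinuousLinearMap.comp_apply, coordMap_coordInv (hmap hd)]
  rw [h1 d ⟨hcd, le_rfl⟩] at hmem
  obtain ⟨s', hs', e⟩ := hmem
  refine ⟨s', hs', ?_⟩
  have e' : coordMap x₀ (γ d) (R s') = coordMap x₀ (γ d) (P d s) := e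
  rw [← coordInv_coordMap (hmap hd) (P d s), ← e', coordInv_coordMap (hmap hd)]

end Subbundle

/-! ### Fibers of the subbundle and covariant derivatives of its sections -/

section Subbundle

set_option linter.unusedSectionVars false
set_option synthInstance.maxHeartbeats 200000

variable {F : Type*} [NormedAddCommGroup F] [NormedSpace ℝ F] [FiniteDimensional ℝ F]
  {M : Type*} [TopologicalSpace M] [ChartedSpace F M] [IsManifold 𝓘(ℝ, F) ∞ M] [T2Space M]
  {cov : CovariantDerivative 𝓘(ℝ, F) F (TangentSpace 𝓘(ℝ, F) : M → Type _)}
  [CovariantDerivative.ContMDiffCovariantDerivative cov ∞]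
  {x₀ o x : M} {γ : ℝ → M} {P : ℝ → F →L[ℝ] F} {R R' p : F →L[ℝ] F} {a b c d : ℝ}
  {𝔢 : Type*} [NormedAddCommGroup 𝔢] [InnerProductSpace ℝ 𝔢]
  {ι : 𝔢 →L[ℝ] TangentSpace 𝓘(ℝ, F) o}

/-- A dimension count: `p(ι(𝔢))` lies in `R(ι(𝔢))`, and by injectivity both have the dimension of
`ι(𝔢)`. -/
theorem MapsToE.exists_eq_apply (hB : HolonomyPreserves cov ι) (h : MapsToE cov ι x p)
    (hp : Function.Injective p) (hR : Reach cov o x R) {s : F} (hs : s ∈ modelE ι) :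
    ∃ s' ∈ modelE ι, R s = p s' := by
  have hle : (modelE ι).map (p : F →ₗ[ℝ] F) ≤ (modelE ι).map (R : F →ₗ[ℝ] F) := by
    rintro _ ⟨s, hs, rfl⟩
    obtain ⟨s', hs', e⟩ := h.of_reach hB hR hs
    exact ⟨s', hs', e.symm⟩
  have h1 := Submodule.eq_of_le_of_finrank_eq hle (by
    rw [← (Submodule.equivMapOfInjective (p : F →ₗ[ℝ] F) hp (modelE ι)).finrank_eq,
      ← (Submodule.equivMapOfInjective (R : F →ₗ[ℝ] F) hR.injective (modelE ι)).finrank_eq])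
  have h2 : (R : F →ₗ[ℝ] F) s ∈ (modelE ι).map (p : F →ₗ[ℝ] F) := h1 ▸ ⟨s, hs, rfl⟩
  obtain ⟨s', hs', e⟩ := h2
  exact ⟨s', hs', e.symm⟩

theorem mem_fiberE_iff {z : TangentSpace 𝓘(ℝ, F) x} :
    z ∈ fiberE cov ι x ↔ ∃ R, Reach cov o x R ∧ ∃ s ∈ modelE ι, R s = z := by
  constructor
  · rintro ⟨c, P, v, hc, hP, e⟩
    obtain ⟨hT, h0⟩ := IsTransport.of_isParallelTransport hc.isACCurve hP
    obtain ⟨e1, e2⟩ := tangentBundle_mk_eq.1 e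
    exact ⟨_, ⟨c, asModel P, hc, hP.1, e1, hT, h0, rfl⟩, ι v, ⟨v, rfl⟩, e2⟩
  · rintro ⟨R, ⟨c, P, hc, h0, h1, hP, hP0, rfl⟩, _, ⟨v, rfl⟩, e⟩
    exact ⟨c, _, v, hc, hP.isParallelTransport h0 hP0, tangentBundle_mk_eq.2 ⟨h1, e⟩⟩

theorem MapsToE.mem_fiberE_iff (hB : HolonomyPreserves cov ι) (h : MapsToE cov ι x p)
    (hp : Function.Injective p) {z : TangentSpace 𝓘(ℝ, F) x} :
    z ∈ fiberE cov ι x ↔ ∃ s ∈ modelE ι, p s = z := by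
  rw [AffineDev.mem_fiberE_iff]
  constructor
  · rintro ⟨R, hR, s, hs, rfl⟩
    obtain ⟨s', hs', e⟩ := h.exists_eq_apply hB hp hR hs
    exact ⟨s', hs', e.symm⟩
  · rintro ⟨s, hs, rfl⟩
    obtain ⟨R, hR, h'⟩ := h
    obtain ⟨s', hs', e⟩ := h' s hs
    exact ⟨R, hR, s', hs', e.symm⟩

theorem IsTransport.mapsToE (hB : HolonomyPreserves cov ι) (hP : IsTransport cov γ P a b)
    (hab : a ≤ b) (h0 : γ a = o) (hP0 : P a = ContinuousLinearMap.id ℝ F) :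
    MapsToE cov ι (γ b) (P b) :=
  MapsToE.transport hB hP hab ⟨_, by rw [h0, hP0]; exact Reach.refl o, fun s hs ↦ ⟨s, hs, rfl⟩⟩

theorem hasDerivAt_mem_submodule {K : Submodule ℝ F} {g : ℝ → F} {g' : F}
    (hg : HasDerivAt g g' 0) (h : ∀ᶠ s in 𝓝 0, g s ∈ K) : g' ∈ K := by
  have hK : IsClosed (K : Set F) := K.closed_of_finiteDimensional
  refine hK.mem_of_tendsto (hasDerivAt_iff_tendsto_slope.1 hg) ?_
  filter_upwards [h.filter_mono nhdsWithin_le_nhds] with s hs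
  exact K.smul_mem _ (K.sub_mem hs h.self_of_nhds)

/-- Covariant derivatives of sections of `E` are sections of `E`. -/
theorem MapsToE.exists_deriv_eq (hB : HolonomyPreserves cov ι) {ξ : ℝ → F} {p : ℝ → F →L[ℝ] F}
    {ξ' : F} {p' : F →L[ℝ] F} (hξ : HasDerivAt ξ ξ' 0) (hp : HasDerivAt p p' 0)
    (hξt : ξ 0 ∈ (chartAt F x₀).target) (hinj : Function.Injective (p 0))
    (h : ∀ᶠ s in 𝓝 0, MapsToE cov ι ((chartAt F x₀).symm (ξ s))
      (coordInv x₀ ((chartAt F x₀).symm (ξ s)) ∘L p s)) {s : F} (hs : s ∈ modelE ι) :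
    ∃ s' ∈ modelE ι, p' s + christoffel cov x₀ (ξ 0) ξ' (p 0 s) = p 0 s' := by
  set Ω : Set (F × (F →L[ℝ] F)) := (chartAt F x₀).target ×ˢ univ with hΩ
  have hΩo : IsOpen Ω := (chartAt F x₀).open_target.prod isOpen_univ
  -- The flow is linearized at the curve that rests at `ξ 0`. Nearby, vectors over `ξ r` are
  -- transported to the fixed point `ξ 0`, where derivatives in the parameter `r` can be taken
  -- inside one fiber.
  let y : ℝ → F × (F →L[ℝ] F) := fun _ ↦ (ξ 0, ContinuousLinearMap.id ℝ F)
  obtain ⟨δ, hδ, hflow⟩ := exists_local_flow_of_contDiffOn (zero_lt_one' ℝ)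
    (A := fun _ z ↦ transportSystem cov x₀ z) hΩo
    ((contDiffOn_transportSystem cov x₀).comp contDiffOn_snd fun q hq ↦ hq.2)
    (y := y) continuousOn_const fun _ _ ↦ ⟨hξt, mem_univ _⟩
  obtain ⟨Φ, Φ', h1, h2, h3, h4⟩ := hflow 0 1 zero_le_one (by simp) (by simp) 0
    (HasACDeriv.congr (f := y) (f' := fun _ ↦ 0) ⟨by simp, fun _ _ ↦ by simp [y]⟩ zero_le_one
      (fun _ _ ↦ rfl) (by
        filter_upwards [Lp.coeFn_zero F 1 (volume.restrict (Icc (0 : ℝ) 1))] with t ht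
        rw [ht]; simp)) (by simpa using hδ)
  let cst := Lp.constL (E := F) 1 (volume.restrict (Icc (0 : ℝ) 1)) ℝ
  -- Start at `ξ r` with the identity frame and move with constant velocity `ξ 0 - ξ r`: the
  -- coordinate segment reaches `ξ 0` at time one.
  let q : ℝ → (F × (F →L[ℝ] F)) × Lp F 1 (volume.restrict (Icc (0 : ℝ) 1)) := fun r ↦
    ((ξ r, ContinuousLinearMap.id ℝ F), cst (ξ 0 - ξ r))
  have hq0 : q 0 = (y 0, 0) := by simp [q, y]
  have hq : HasDerivAt q ((ξ', 0), cst (-ξ')) 0 := by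
    refine (hξ.prodMk (hasDerivAt_const _ _)).prodMk (cst.hasFDerivAt.comp_hasDerivAt 0 ?_)
    exact hξ.const_sub (ξ 0)
  have hcst : ∀ v : F, ∀ᵐ t ∂(volume.restrict (Icc (0 : ℝ) 1)), cst v t = v := fun v ↦
    Lp.coeFn_const 1 (volume.restrict (Icc (0 : ℝ) 1)) v
  -- The linearized equation at rest is solved explicitly by `t ↦ (ξ' - t ξ', t Γ(ξ'))`. Thus to
  -- first order in `r` the transport back is the identity plus `r Γ(ξ')`.
  have hW : HasDerivAt (fun r ↦ Φ (q r) 1)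
      ((0 : F), christoffel cov x₀ (ξ 0) ξ') 0 := by
    have h5 := (h3 1 (by simp)).hasFDerivAt
    rw [← hq0] at h5
    have h6 := h5.comp_hasDerivAt 0 hq
    have h7 := h4 ((ξ', 0), cst (-ξ'))
      (fun t ↦ (ξ' - t • ξ', t • christoffel cov x₀ (ξ 0) ξ')) ?_ (by simp) 1 (by simp)
    · rw [h7] at h6
      have e8 : (ξ' - (1 : ℝ) • ξ', (1 : ℝ) • christoffel cov x₀ (ξ 0) ξ') =
        ((0 : F), christoffel cov x₀ (ξ 0) ξ') := by simp
      rw [e8] at h6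
      exact h6
    · refine HasACDeriv.congr (f := fun t : ℝ ↦ (ξ' - t • ξ', t • christoffel cov x₀ (ξ 0) ξ'))
        (f' := fun _ ↦ (-ξ', christoffel cov x₀ (ξ 0) ξ')) ⟨by simp, fun t ht ↦ ?_⟩ zero_le_one
        (fun _ _ ↦ rfl) ?_
      · ext1 <;> simp [sub_eq_add_neg]
      · filter_upwards [Lp.coeFn_zero F 1 (volume.restrict (Icc (0 : ℝ) 1)), hcst (-ξ')]
          with t ht ht'
        rw [ht, ht']
        simp [y, transportSystem_apply]
  have hev : ∀ᶠ r in 𝓝 (0 : ℝ), MapsToE cov ι ((chartAt F x₀).symm (ξ 0))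
      (coordInv x₀ ((chartAt F x₀).symm (ξ 0)) ∘L ((Φ (q r) 1).2 ∘L p r)) := by
    have hqc := hq.continuousAt.eventually (hq0.symm ▸ h2)
    filter_upwards [hqc, h] with r ⟨e0, e1, e2⟩ hr
    obtain ⟨hQ, -⟩ := IsTransport.of_chart zero_le_one e1 fun t ht ↦ (e2 t ht).1
    have hfst : ∀ t ∈ Icc (0 : ℝ) 1, (Φ (q r) t).1 = ξ r + t • (ξ 0 - ξ r) := by
      intro t ht
      have h5 := ((e1.clm_comp (ContinuousLinearMap.fst ℝ F (F →L[ℝ] F))).congr zero_le_one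
        (fun _ _ ↦ rfl) ((hcst (ξ 0 - ξ r)).mono fun t ht ↦ show _ = ξ 0 - ξ r from ht)).2 t ht
      change (Φ (q r) t).1 = (Φ (q r) 0).1 + _ at h5
      rw [h5, e0]
      simp [q, smul_sub]
    have g0 : (Φ (q r) 0).1 = ξ r := by simpa using hfst 0 (by simp)
    have g1 : (Φ (q r) 1).1 = ξ 0 := by simpa using hfst 1 (by simp)
    have h6 := MapsToE.of_contMDiffOn (ι := ι) (a := 0) (b := 1)
      (γ := fun t ↦ (chartAt F x₀).symm (Φ (q r) t).1) (by
        rw [g0, e0]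
        exact hr) zero_le_one (contMDiffOn_chart_symm_comp ?_ fun t ht ↦ (e2 t ht).1)
        (hQ.comp_right (p r))
    · rw [g1] at h6
      exact h6
    · exact ContDiffOn.congr (by fun_prop) hfst
  obtain ⟨R, hR, -⟩ := h.self_of_nhds
  set x := (chartAt F x₀).symm (ξ 0) with hx
  have hxs : x ∈ (chartAt F x₀).source := (chartAt F x₀).map_target hξt
  let K : Submodule ℝ F := (modelE ι).map ((coordMap x₀ x ∘L R : F →L[ℝ] F) : F →ₗ[ℝ] F)
  have hΦ0 : (Φ (q 0) 1).2 = ContinuousLinearMap.id ℝ F := by rw [hq0, h1 1 (by simp)]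
  -- By the product rule the derivative of the vectors transported back is `p' s + Γ(ξ') (p s)`, the
  -- covariant derivative. They all lie in the fiber of `E` at `ξ 0`, hence so does the derivative.
  have hg : HasDerivAt (fun r ↦ (Φ (q r) 1).2 (p r s))
      (christoffel cov x₀ (ξ 0) ξ' (p 0 s) + (Φ (q 0) 1).2 (p' s)) 0 := by
    have hW2 : HasDerivAt (fun r ↦ (Φ (q r) 1).2) (christoffel cov x₀ (ξ 0) ξ') 0 :=
      (ContinuousLinearMap.snd ℝ F (F →L[ℝ] F)).hasFDerivAt.comp_hasDerivAt 0 hW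
    have hps : HasDerivAt (fun r ↦ p r s) (p' s) 0 := by
      simpa using hp.clm_apply (hasDerivAt_const (0 : ℝ) s)
    exact hW2.clm_apply hps
  have hmem : christoffel cov x₀ (ξ 0) ξ' (p 0 s) + (Φ (q 0) 1).2 (p' s) ∈ K := by
    refine hasDerivAt_mem_submodule hg (hev.mono fun r hr ↦ ?_)
    obtain ⟨s', hs', e⟩ := hr.of_reach hB hR hs
    refine ⟨s', hs', ?_⟩
    change coordMap x₀ x (R s') = _
    rw [← e, ContinuousLinearMap.comp_apply, coordMap_coordInv hxs]
    rfl
  obtain ⟨s', hs', e⟩ := hmem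
  have e : coordMap x₀ x (R s') = _ := e
  have hinj' : Function.Injective (coordInv x₀ x ∘L p 0) := by
    intro v w hvw
    have := congrArg (coordMap x₀ x) hvw
    simp only [ContinuousLinearMap.comp_apply, coordMap_coordInv hxs] at this
    exact hinj this
  obtain ⟨s'', hs'', e'⟩ := h.self_of_nhds.exists_eq_apply hB hinj' hR hs'
  refine ⟨s'', hs'', ?_⟩
  rw [e', ContinuousLinearMap.comp_apply, coordMap_coordInv hxs, hΦ0] at e
  rw [e, add_comm]
  rfl

end Subbundle

/-! ### Continuity of the square root of the covariance and of its inverse -/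

section SquareRoot

variable {𝔢 : Type*} [NormedAddCommGroup 𝔢] [InnerProductSpace ℝ 𝔢] [FiniteDimensional ℝ 𝔢]

/-- The square root is Hölder continuous. -/
theorem norm_posSqrt_sub_sq_le {A B : 𝔢 →L[ℝ] 𝔢} (hA : A.IsPositive) (hB : B.IsPositive) :
    ‖posSqrt hA - posSqrt hB‖ ^ 2 ≤ ‖A - B‖ := by
  set X := posSqrt hA
  set Y := posSqrt hB
  have hX : X.IsPositive := posSqrt_isPositive hA
  have hY : Y.IsPositive := posSqrt_isPositive hB
  have hXX : ∀ v, X (X v) = A v := DFunLike.congr_fun (posSqrt_comp_self hA)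
  have hYY : ∀ v, Y (Y v) = B v := DFunLike.congr_fun (posSqrt_comp_self hB)
  have hD : ((X - Y : 𝔢 →L[ℝ] 𝔢) : 𝔢 →ₗ[ℝ] 𝔢).IsSymmetric := hX.isSymmetric.sub hY.isSymmetric
  set b := hD.eigenvectorBasis rfl
  set l := hD.eigenvalues rfl
  have hb : ∀ i, X (b i) - Y (b i) = l i • b i := fun i ↦ hD.apply_eigenvectorBasis rfl i
  have hl : ∀ i, l i ^ 2 ≤ ‖A - B‖ := by
    intro i
    have hbi : inner ℝ (b i) (b i) = 1 := by simp
    -- From `A - B = X (X - Y) + (X - Y) Y` on an eigenvector of `X - Y` with eigenvalue `l`. By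
    -- positivity `|l| = |⟨X b, b⟩ - ⟨Y b, b⟩|` is at most `⟨X b, b⟩ + ⟨Y b, b⟩`, so that `l ^ 2 ≤
    -- ‖A - B‖`.
    have e1 : inner ℝ ((A - B) (b i)) (b i) =
        l i * (inner ℝ (X (b i)) (b i) + inner ℝ (Y (b i)) (b i)) := by
      have e2 : (A - B) (b i) = X (X (b i) - Y (b i)) + (X (Y (b i)) - Y (Y (b i))) := by
        simp [hXX, hYY]
      have e3 : inner ℝ (X (Y (b i)) - Y (Y (b i))) (b i) = l i * inner ℝ (Y (b i)) (b i) := by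
        have := hD (Y (b i)) (b i)
        change inner ℝ (X (Y (b i)) - Y (Y (b i))) (b i) =
          inner ℝ (Y (b i)) (X (b i) - Y (b i)) at this
        rw [this, hb, inner_smul_right]
      rw [e2, hb, inner_add_left, e3, map_smul, inner_smul_left]
      simp
      ring
    have e4 : inner ℝ (X (b i)) (b i) - inner ℝ (Y (b i)) (b i) = l i := by
      rw [← inner_sub_left, hb, inner_smul_left, hbi]
      simp
    have e5 : |inner ℝ ((A - B) (b i)) (b i)| ≤ ‖A - B‖ := by
      refine (abs_real_inner_le_norm _ _).trans ?_
      simpa using (A - B).le_opNorm (b i)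
    have h1 : 0 ≤ inner ℝ (X (b i)) (b i) := hX.inner_nonneg_left (b i)
    have h2 : 0 ≤ inner ℝ (Y (b i)) (b i) := hY.inner_nonneg_left (b i)
    rw [e1] at e5
    have h3 := abs_le.1 e5
    rcases le_total 0 (l i) with h | h <;> nlinarith
  have hnorm : ‖X - Y‖ ≤ √‖A - B‖ := by
    refine ContinuousLinearMap.opNorm_le_bound _ (Real.sqrt_nonneg _) fun v ↦ ?_
    rw [← Real.sqrt_sq (norm_nonneg v), ← Real.sqrt_mul (norm_nonneg _)]
    refine Real.le_sqrt_of_sq_le ?_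
    rw [← b.sum_sq_norm_inner_right ((X - Y) v), ← b.sum_sq_norm_inner_right v, Finset.mul_sum]
    refine Finset.sum_le_sum fun i _ ↦ ?_
    have e6 : inner ℝ (b i) ((X - Y) v) = l i * inner ℝ (b i) v := by
      have := hD (b i) v
      change inner ℝ (X (b i) - Y (b i)) v = inner ℝ (b i) ((X - Y) v) at this
      rw [← this, hb, inner_smul_left]
      simp
    rw [e6, norm_mul, mul_pow, Real.norm_eq_abs, sq_abs]
    gcongr
    exact hl i
  calc ‖X - Y‖ ^ 2 ≤ √‖A - B‖ ^ 2 := by gcongr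
    _ = ‖A - B‖ := Real.sq_sqrt (norm_nonneg _)

variable {J : ℕ} {σ : Fin J → ℝ → 𝔢} {s : Set ℝ}

/-- The eigenvectors in the definition of `posSqrt` need not depend continuously on `t`; the Hölder
estimate for the square root avoids them. -/
theorem continuousOn_sqrtCovariance (hσ : ∀ j, ContinuousOn (σ j) s) :
    ContinuousOn (sqrtCovariance σ) s := by
  have hc : ContinuousOn (covariance σ) s := by
    refine continuousOn_finsetSum _ fun j _ ↦ ?_
    have h1 : ContinuousOn (fun t ↦ (innerSL ℝ (σ j t)).smulRight (σ j t)) s :=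
      ((ContinuousLinearMap.smulRightL ℝ 𝔢 𝔢).continuous₂.comp_continuousOn
        (((innerSL ℝ (E := 𝔢)).continuous.comp_continuousOn (hσ j)).prodMk (hσ j)))
    refine h1.congr fun t ht ↦ ?_
    ext v
    simp
  intro t ht
  have h2 : Tendsto (fun r ↦ √‖covariance σ r - covariance σ t‖) (𝓝[s] t) (𝓝 0) := by
    have := ((hc t ht).sub (continuousWithinAt_const (b := covariance σ t))).norm.sqrt
    simpa [ContinuousWithinAt] using this
  refine tendsto_iff_norm_sub_tendsto_zero.2 (squeeze_zero (fun _ ↦ norm_nonneg _) (fun r ↦ ?_) h2)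
  exact Real.le_sqrt_of_sq_le (norm_posSqrt_sub_sq_le _ _)

/-- Surjectivity of `Σ = Σ^{1/2} Σ^{1/2}` forces that of `Σ^{1/2}`, which is then bijective in
finite dimension, and inversion is continuous on invertible operators. -/
theorem exists_inverse_sqrtCovariance (hσ : ∀ j, ContinuousOn (σ j) s)
    (hs : ∀ t ∈ s, Function.Surjective (covariance σ t)) :
    ∃ S : ℝ → 𝔢 →L[ℝ] 𝔢, ContinuousOn S s ∧ ∀ t ∈ s, ∀ v,
      sqrtCovariance σ t (S t v) = v ∧ S t (sqrtCovariance σ t v) = v := by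
  have hbij : ∀ t ∈ s, Function.Bijective (sqrtCovariance σ t) := by
    intro t ht
    have h1 : Function.Surjective (sqrtCovariance σ t) := fun v ↦ by
      obtain ⟨w, rfl⟩ := hs t ht v
      exact ⟨_, DFunLike.congr_fun (posSqrt_comp_self (covariance_isPositive σ t)) w⟩
    exact ⟨(LinearMap.injective_iff_surjective (f := (sqrtCovariance σ t : 𝔢 →ₗ[ℝ] 𝔢))).2 h1, h1⟩
  have hinv : ∀ t ∈ s, ∃ e : 𝔢 ≃L[ℝ] 𝔢, (e : 𝔢 →L[ℝ] 𝔢) = sqrtCovariance σ t := fun t ht ↦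
    ⟨(LinearEquiv.ofBijective (sqrtCovariance σ t : 𝔢 →ₗ[ℝ] 𝔢) (hbij t ht)).toContinuousLinearEquiv,
      by ext; rfl⟩
  refine ⟨fun t ↦ (sqrtCovariance σ t).inverse, fun t ht ↦ ?_, fun t ht v ↦ ?_⟩
  · obtain ⟨e, he⟩ := hinv t ht
    have h1 : ContinuousAt ContinuousLinearMap.inverse (sqrtCovariance σ t) := by
      rw [← he]
      exact (contDiffAt_map_inverse (n := 1) e).continuousAt
    exact h1.comp_continuousWithinAt (continuousOn_sqrtCovariance hσ t ht)
  · obtain ⟨e, he⟩ := hinv t ht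
    dsimp only
    rw [← he, ContinuousLinearMap.inverse_equiv]
    exact ⟨e.apply_symm_apply v, e.symm_apply_apply v⟩

end SquareRoot

/-! ### From square integrable curves to integrable controls -/

section Control

variable {V W : Type*} [NormedAddCommGroup V] [NormedSpace ℝ V] [NormedAddCommGroup W]
  [NormedSpace ℝ W] {a b c d : ℝ}

theorem memLp_clm_apply {p : ENNReal} {B : ℝ → V →L[ℝ] W} {f : ℝ → V} (hB : ContinuousOn B (Icc a b))
    (hf : MemLp f p (volume.restrict (Icc a b))) :
    ∃ C : ℝ, 0 ≤ C ∧ MemLp (fun t ↦ B t (f t)) p (volume.restrict (Icc a b)) ∧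
      ∀ t ∈ Icc a b, ‖B t‖ ≤ C := by
  obtain ⟨C, hC⟩ := isCompact_Icc.exists_bound_of_continuousOn hB
  refine ⟨|C|, abs_nonneg C, hf.of_le_mul (c := |C|) ?_ ?_, fun t ht ↦ (hC t ht).trans (le_abs_self C)⟩
  · exact (ContinuousLinearMap.apply ℝ W : V →L[ℝ] (V →L[ℝ] W) →L[ℝ] W).flip
      |>.aestronglyMeasurable_comp₂ (hB.aestronglyMeasurable measurableSet_Icc)
        hf.aestronglyMeasurable
  · filter_upwards [ae_restrict_mem measurableSet_Icc] with t ht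
    refine ((B t).le_opNorm _).trans ?_
    gcongr
    exact (hC t ht).trans (le_abs_self C)

/-- Links the Hilbert space of controls with the local flows, whose controls are in `L¹` of a
subinterval. Multiplication by `B` is bounded by compactness, and Hölder's inequality compares the
norms. -/
theorem exists_control (hc : c ∈ Icc a b) (hd : d ∈ Icc a b) {B : ℝ → V →L[ℝ] W}
    (hB : ContinuousOn B (Icc a b)) :
    ∃ L : Lp V 2 (volume.restrict (Icc a b)) →L[ℝ] Lp W 1 (volume.restrict (Icc c d)),
      ∀ η, ∀ᵐ t ∂(volume.restrict (Icc c d)), L η t = B t (η t) := by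
  have hsub : Icc c d ⊆ Icc a b := Icc_subset_Icc hc.1 hd.2
  set μ := volume.restrict (Icc c d)
  have hle : μ ≤ volume.restrict (Icc a b) :=
    Measure.restrict_mono hsub le_rfl
  have hη : ∀ η : Lp V 2 (volume.restrict (Icc a b)), MemLp η 2 μ :=
    fun η ↦ (Lp.memLp η).mono_measure hle
  have hm : ∀ η : Lp V 2 (volume.restrict (Icc a b)),
      MemLp (fun t ↦ B t (η t)) 1 μ := fun η ↦ by
    obtain ⟨_, _, h, _⟩ := memLp_clm_apply (hB.mono hsub) (hη η)
    exact h.mono_exponent (by norm_num)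
  obtain ⟨C, hC⟩ := isCompact_Icc.exists_bound_of_continuousOn hB
  let L₀ : Lp V 2 (volume.restrict (Icc a b)) →ₗ[ℝ] Lp W 1 μ :=
    { toFun := fun η ↦ (hm η).toLp
      map_add' := fun η θ ↦ by
        refine Lp.ext ?_
        filter_upwards [(hm η).coeFn_toLp, (hm θ).coeFn_toLp, (hm (η + θ)).coeFn_toLp,
          Lp.coeFn_add (hm η).toLp (hm θ).toLp, hle.absolutelyContinuous.ae_le (Lp.coeFn_add η θ)]
          with t h1 h2 h3 h4 h5
        rw [h3, h4, Pi.add_apply, h1, h2, h5, Pi.add_apply, map_add]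
      map_smul' := fun r η ↦ by
        refine Lp.ext ?_
        filter_upwards [(hm η).coeFn_toLp, (hm (r • η)).coeFn_toLp,
          Lp.coeFn_smul r (hm η).toLp, hle.absolutelyContinuous.ae_le (Lp.coeFn_smul r η)]
          with t h1 h3 h4 h5
        rw [RingHom.id_apply, h3, h4, Pi.smul_apply, h1, h5, Pi.smul_apply, map_smul] }
  set K : ENNReal := μ univ ^ (1 / (1 : ENNReal).toReal - 1 / (2 : ENNReal).toReal) with hK
  have hKtop : K ≠ ⊤ := ENNReal.rpow_ne_top_of_nonneg (by norm_num) (measure_ne_top _ _)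
  refine ⟨L₀.mkContinuous (|C| * K.toReal) fun η ↦ ?_, fun η ↦ (hm η).coeFn_toLp⟩
  change ‖(hm η).toLp‖ ≤ _
  rw [Lp.norm_toLp]
  have h1 : eLpNorm (fun t ↦ B t (η t)) 1 μ ≤ ENNReal.ofReal |C| * eLpNorm η 1 μ := by
    refine eLpNorm_le_mul_eLpNorm_of_ae_le_mul ?_ 1
    filter_upwards [ae_restrict_mem measurableSet_Icc] with t ht
    refine ((B t).le_opNorm _).trans ?_
    gcongr
    exact (hC t (hsub ht)).trans (le_abs_self C)
  have h2 : eLpNorm η 1 μ ≤ eLpNorm η 2 μ * K :=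
    eLpNorm_le_eLpNorm_mul_rpow_measure_univ (by norm_num) (hη η).aestronglyMeasurable
  have h3 : eLpNorm η 2 μ ≤ eLpNorm η 2 (volume.restrict (Icc a b)) := eLpNorm_mono_measure _ hle
  have h4 : eLpNorm (fun t ↦ B t (η t)) 1 μ ≤
      ENNReal.ofReal |C| * (eLpNorm η 2 (volume.restrict (Icc a b)) * K) := by
    refine h1.trans ?_
    gcongr
    exact h2.trans (by gcongr)
  refine (ENNReal.toReal_mono ?_ h4).trans_eq ?_
  · exact ENNReal.mul_ne_top ENNReal.ofReal_ne_top (ENNReal.mul_ne_top (Lp.eLpNorm_ne_top η) hKtop)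
  · rw [ENNReal.toReal_mul, ENNReal.toReal_mul, ENNReal.toReal_ofReal (abs_nonneg C), Lp.norm_def]
    ring

end Control

/-! ### Developments: curve and frame as one system, with uniqueness -/

section Development

set_option linter.unusedSectionVars false
set_option synthInstance.maxHeartbeats 200000

variable {F : Type*} [NormedAddCommGroup F] [NormedSpace ℝ F] [FiniteDimensional ℝ F]
  {M : Type*} [TopologicalSpace M] [ChartedSpace F M] [IsManifold 𝓘(ℝ, F) ∞ M] [T2Space M]
  (cov : CovariantDerivative 𝓘(ℝ, F) F (TangentSpace 𝓘(ℝ, F) : M → Type _))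
  [CovariantDerivative.ContMDiffCovariantDerivative cov ∞]
  {x₀ x₁ o x : M} {γ γ' : ℝ → M} {P P' : ℝ → F →L[ℝ] F} {a b c d m T : ℝ}
  (u : ℝ → ∀ x : M, TangentSpace 𝓘(ℝ, F) x) {α α' : ℝ → F}

/-- `γ' = P α + u(γ)` and `P` is parallel along `γ` on `[a, b]`. -/
def IsDevelopment (α : ℝ → F) (γ : ℝ → M) (P : ℝ → F →L[ℝ] F) (a b : ℝ) : Prop :=
  ContinuousOn γ (Icc a b) ∧
    ∀ (x₀ : M) (c d : ℝ), c ≤ d → Icc c d ⊆ Icc a b → MapsTo γ (Icc c d) (chartAt F x₀).source →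
      HasACDeriv (chartState x₀ γ P) (fun t ↦ developmentSystem cov u x₀ t (chartState x₀ γ P t)
        (1, α t)) c d

variable {cov u}

/-- The right-hand side of the equation is an honest tangent vector, so the development equation
inherits chart independence from the transport equation. -/
theorem fderiv_transition_velocity (V : ∀ x : M, TangentSpace 𝓘(ℝ, F) x) (p : F →L[ℝ] F) (w : F)
    (h₀ : x ∈ (chartAt F x₀).source) (h₁ : x ∈ (chartAt F x₁).source) :
    fderiv ℝ (transition x₀ x₁) (chartAt F x₀ x)
      ((coordMap x₀ x ∘L p) w + (1 : ℝ) • fieldCoord V x₀ (chartAt F x₀ x)) =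
      (coordMap x₁ x ∘L p) w + (1 : ℝ) • fieldCoord V x₁ (chartAt F x₁ x) := by
  rw [map_add, one_smul, one_smul, fieldCoord_chart V h₀, fieldCoord_chart V h₁,
    fderiv_transition_toModel h₀ h₁]
  congr 1
  exact DFunLike.congr_fun (fderiv_transition_comp_coordMap h₀ h₁) (p w)

namespace IsDevelopment

theorem of_local (hγ : ContinuousOn γ (Icc a b))
    (h : ∀ t ∈ Icc a b, ∃ x₀ : M, ∃ ε > 0, ∀ c d, c ≤ d → c ∈ Icc a b → d ∈ Icc a b →
      |c - t| < ε → |d - t| < ε → MapsTo γ (Icc c d) (chartAt F x₀).source ∧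
      HasACDeriv (chartState x₀ γ P) (fun t ↦ developmentSystem cov u x₀ t (chartState x₀ γ P t)
        (1, α t)) c d) : IsDevelopment cov u α γ P a b := by
  refine ⟨hγ, fun x₁ c d hcd hsub hmap ↦ ?_⟩
  refine interval_induction (p := fun c d ↦ HasACDeriv (chartState x₁ γ P)
    (fun t ↦ developmentSystem cov u x₁ t (chartState x₁ γ P t) (1, α t)) c d) hcd (fun t ht ↦ ?_)
    fun c m d hcm hmd _ _ h1 h2 ↦ h1.glue h2 hcm hmd
  obtain ⟨x₀, ε, hε, h1⟩ := h t (hsub ht)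
  refine ⟨ε, hε, fun c' d' hcd' hc' hd' hct hdt ↦ ?_⟩
  obtain ⟨h2, hv⟩ := h1 c' d' hcd' (hsub hc') (hsub hd') hct hdt
  have hmap' := hmap.mono (Icc_subset_Icc hc'.1 hd'.2) subset_rfl
  refine (HasACDeriv.chartState_transition hcd' hv h2 hmap').congr_fun hcd' (fun _ _ ↦ rfl)
    fun s hs ↦ ?_
  exact congrArg (transportSystem cov x₁ (chartState x₁ γ P s))
    (fderiv_transition_velocity (u s) (P s) (α s) (h2 hs) (hmap' hs))

theorem hasACDeriv (h : IsDevelopment cov u α γ P a b) (hcd : c ≤ d) (hc : c ∈ Icc a b)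
    (hd : d ∈ Icc a b) (hmap : MapsTo γ (Icc c d) (chartAt F x₀).source) :
    HasACDeriv (chartState x₀ γ P) (fun t ↦ developmentSystem cov u x₀ t (chartState x₀ γ P t)
        (1, α t)) c d :=
  h.2 x₀ c d hcd (Icc_subset_Icc hc.1 hd.2) hmap

theorem isTransport (h : IsDevelopment cov u α γ P a b) : IsTransport cov γ P a b :=
  IsTransport.mk' h.1 fun x₀ c d hcd hsub hmap ↦ ⟨_, h.2 x₀ c d hcd hsub hmap⟩

theorem congr (h : IsDevelopment cov u α γ P a b) (hγ : EqOn γ γ' (Icc a b))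
    (hP : EqOn P P' (Icc a b)) : IsDevelopment cov u α γ' P' a b := by
  refine ⟨h.1.congr hγ.symm, fun x₀ c d hcd hsub hmap ↦
    (h.2 x₀ c d hcd hsub fun t ht ↦ by rw [hγ (hsub ht)]; exact hmap ht).congr_fun hcd
      (fun t ht ↦ ?_) fun t ht ↦ ?_⟩
  · simp only [chartState, hγ (hsub ht), hP (hsub ht)]
  · simp only [chartState, hγ (hsub ht), hP (hsub ht)]

theorem glue (h1 : IsDevelopment cov u α γ P a m) (h2 : IsDevelopment cov u α γ P m b)
    (ham : a ≤ m) (hmb : m ≤ b) : IsDevelopment cov u α γ P a b := by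
  refine ⟨?_, fun x₀ c d hcd hsub hmap ↦ ?_⟩
  · rw [← Icc_union_Icc_eq_Icc ham hmb]
    exact h1.1.union_of_isClosed h2.1 isClosed_Icc isClosed_Icc
  have hc := hsub ⟨le_rfl, hcd⟩
  have hd := hsub ⟨hcd, le_rfl⟩
  rcases le_total d m with hdm | hdm
  · exact h1.2 x₀ c d hcd (Icc_subset_Icc hc.1 hdm) hmap
  rcases le_total m c with hmc | hmc
  · exact h2.2 x₀ c d hcd (Icc_subset_Icc hmc hd.2) hmap
  · exact (h1.2 x₀ c m hmc (Icc_subset_Icc hc.1 le_rfl)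
      (hmap.mono (Icc_subset_Icc_right hdm) subset_rfl)).glue
      (h2.2 x₀ m d hdm (Icc_subset_Icc le_rfl hd.2)
      (hmap.mono (Icc_subset_Icc_left hmc) subset_rfl)) hmc hdm

theorem piecewise (h1 : IsDevelopment cov u α γ P a m) (h2 : IsDevelopment cov u α γ' P' m b)
    (ham : a ≤ m) (hmb : m ≤ b) (hγ : γ m = γ' m) (hP : P m = P' m) :
    IsDevelopment cov u α (fun t ↦ if t ≤ m then γ t else γ' t)
      (fun t ↦ if t ≤ m then P t else P' t) a b := by
  refine (h1.congr (fun t ht ↦ ?_) fun t ht ↦ ?_).glue (h2.congr (fun t ht ↦ ?_) fun t ht ↦ ?_)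
    ham hmb
  · simp [ht.2]
  · simp [ht.2]
  · rcases ht.1.eq_or_lt with rfl | hlt
    · simp [hγ]
    · simp [not_le.2 hlt]
  · rcases ht.1.eq_or_lt with rfl | hlt
    · simp [hP]
    · simp [not_le.2 hlt]

theorem of_chart {y : ℝ → F × (F →L[ℝ] F)} (hcd : c ≤ d)
    (hy : HasACDeriv y (fun t ↦ developmentSystem cov u x₀ t (y t) (1, α t)) c d)
    (hyt : ∀ t ∈ Icc c d, (y t).1 ∈ (chartAt F x₀).target) :
    IsDevelopment cov u α (fun t ↦ (chartAt F x₀).symm (y t).1)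
        (fun t ↦ coordInv x₀ ((chartAt F x₀).symm (y t).1) ∘L (y t).2) c d ∧
      EqOn y (chartState x₀ (fun t ↦ (chartAt F x₀).symm (y t).1)
        (fun t ↦ coordInv x₀ ((chartAt F x₀).symm (y t).1) ∘L (y t).2)) (Icc c d) := by
  obtain ⟨h1, hE⟩ := IsTransport.of_chart (cov := cov) hcd hy hyt
  refine ⟨of_local h1.1 fun t ht ↦ ⟨x₀, 1, one_pos, fun c' d' hcd' hc' hd' _ _ ↦
    ⟨fun s hs ↦ ?_, ?_⟩⟩, hE⟩
  · exact (chartAt F x₀).map_target (hyt s ⟨hc'.1.trans hs.1, hs.2.trans hd'.2⟩)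
  · refine (hy.mono hc' hd').congr_fun hcd' (hE.mono (Icc_subset_Icc hc'.1 hd'.2)) fun s hs ↦ ?_
    have := hE ⟨hc'.1.trans hs.1, hs.2.trans hd'.2⟩
    beta_reduce
    rw [← this]

end IsDevelopment

theorem eq_of_chartState_eq {t : ℝ} (h : γ t ∈ (chartAt F x₀).source)
    (h' : γ' t ∈ (chartAt F x₀).source) (he : chartState x₀ γ P t = chartState x₀ γ' P' t) :
    γ t = γ' t ∧ P t = P' t := by
  have h1 : γ t = γ' t := (chartAt F x₀).injOn h h' (congrArg Prod.fst he)
  refine ⟨h1, ?_⟩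
  have h2 : coordMap x₀ (γ t) ∘L P t = coordMap x₀ (γ' t) ∘L P' t := congrArg Prod.snd he
  rw [← h1] at h2
  have h3 := congrArg (fun L ↦ coordInv x₀ (γ t) ∘L L) h2
  simpa only [← ContinuousLinearMap.comp_assoc, coordInv_comp_coordMap h,
    ContinuousLinearMap.id_comp] using h3

/-- Solutions of `y' = A(t, y) α` are unique near each point. -/
theorem exists_forall_eqOn_of_hasACDeriv {G V : Type*} [NormedAddCommGroup G] [NormedSpace ℝ G]
    [CompleteSpace G] [NormedAddCommGroup V] [NormedSpace ℝ V] [CompleteSpace V] (hab : a < b)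
    {A : ℝ → G → V →L[ℝ] G} {Ω : Set G} (hΩ : IsOpen Ω)
    (hA : ContDiffOn ℝ ∞ (fun q : ℝ × G ↦ A q.1 q.2) (Icc a b ×ˢ Ω)) {t : ℝ} (ht : t ∈ Icc a b)
    {z : G} (hz : z ∈ Ω) :
    ∃ ρ > 0, ∀ c d, c ≤ d → c ∈ Icc a b → d ∈ Icc a b → |c - t| < ρ → |d - t| < ρ →
      ∀ (y y' : ℝ → G) (β : ℝ → V), IntervalIntegrable β volume c d →
      HasACDeriv y (fun t ↦ A t (y t) (β t)) c d → HasACDeriv y' (fun t ↦ A t (y' t) (β t)) c d →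
      (∀ s ∈ Icc c d, ‖y s - z‖ < ρ) → (∀ s ∈ Icc c d, ‖y' s - z‖ < ρ) → y c = y' c →
      EqOn y y' (Icc c d) := by
  have hA1 : ContDiffOn ℝ 1 (fun q : ℝ × G ↦ A q.1 q.2) (Icc a b ×ˢ Ω) := hA.of_le (by simp)
  have hA' := continuousOn_fderiv_of_contDiffOn_prod hab hΩ hA1
  -- Near `(t, z)` the space derivative of `A` stays within distance one of its value there, so `A
  -- r` is Lipschitz with constant `C` on a ball and the difference of two solutions obeys a linear
  -- differential inequality.
  obtain ⟨ε, hε, h1⟩ := Metric.continuousOn_iff.1 hA' (t, z) ⟨ht, hz⟩ 1 one_pos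
  obtain ⟨ε', hε', h2⟩ := Metric.isOpen_iff.1 hΩ z hz
  set C := ‖fderiv ℝ (A t) z‖ + 1
  refine ⟨min ε ε', lt_min hε hε', fun c d hcd hc hd hct hdt y y' β hβ hy hy' hyz hyz' h0 s hs ↦ ?_⟩
  have hz := eq_zero_of_norm_deriv_le hcd (hy.sub hy') (hβ.norm.const_mul C)
    ((ae_restrict_iff' measurableSet_Icc).2 (.of_forall fun r hr ↦ ?_)) (left_mem_Icc.2 hcd)
    (by simp [h0]) s hs
  · exact sub_eq_zero.1 hz
  have hr' : r ∈ Icc a b := ⟨hc.1.trans hr.1, hr.2.trans hd.2⟩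
  have hball : Metric.ball z (min ε ε') ⊆ Ω :=
    (Metric.ball_subset_ball (min_le_right _ _)).trans h2
  have hLip : ‖A r (y r) - A r (y' r)‖ ≤ C * ‖y r - y' r‖ := by
    refine (convex_ball z (min ε ε')).norm_image_sub_le_of_norm_fderiv_le (𝕜 := ℝ)
      (fun w hw ↦ (hasFDerivAt_of_contDiffOn_prod hΩ hA1 hr' (hball hw)).differentiableAt)
      (fun w hw ↦ ?_) (by rw [mem_ball_iff_norm]; exact hyz' r hr)
      (by rw [mem_ball_iff_norm]; exact hyz r hr)
    have h3 := h1 (r, w) ⟨hr', hball hw⟩ (by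
      rw [Prod.dist_eq, max_lt_iff]
      refine ⟨?_, (Metric.mem_ball.1 hw).trans_le (min_le_left _ _)⟩
      refine lt_of_lt_of_le ?_ (min_le_left ε ε')
      rw [Real.dist_eq, abs_lt]
      exact ⟨by linarith [(abs_lt.1 hct).1, hr.1], by linarith [(abs_lt.1 hdt).2, hr.2]⟩)
    rw [dist_eq_norm] at h3
    have h4 := norm_le_norm_add_norm_sub' (fderiv ℝ (A r) w) (fderiv ℝ (A t) z)
    have hC : C = ‖fderiv ℝ (A t) z‖ + 1 := rfl
    change ‖fderiv ℝ (A r) w - fderiv ℝ (A t) z‖ < 1 at h3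
    linarith
  calc ‖A r (y r) (β r) - A r (y' r) (β r)‖ = ‖(A r (y r) - A r (y' r)) (β r)‖ := by simp
    _ ≤ ‖A r (y r) - A r (y' r)‖ * ‖β r‖ := ContinuousLinearMap.le_opNorm _ _
    _ ≤ C * ‖y r - y' r‖ * ‖β r‖ := by gcongr
    _ = C * ‖β r‖ * ‖y r - y' r‖ := by ring

theorem continuousOn_chartState (h : IsTransport cov γ P a b) (hcd : c ≤ d) (hc : c ∈ Icc a b)
    (hd : d ∈ Icc a b) (hmap : MapsTo γ (Icc c d) (chartAt F x₀).source) :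
    ContinuousOn (chartState x₀ γ P) (Icc c d) :=
  (h.hasACDeriv hcd hc hd hmap).continuousOn hcd

/-- Developments with the same initial data coincide. -/
theorem IsDevelopment.eqOn (hu : ContMDiffOn (𝓘(ℝ, ℝ).prod 𝓘(ℝ, F)) 𝓘(ℝ, F).tangent ∞
      (fun p : ℝ × M ↦ (⟨p.2, u p.1 p.2⟩ : TangentBundle 𝓘(ℝ, F) M)) (Icc 0 T ×ˢ univ))
    (hT : 0 < T) (hα : IntervalIntegrable α volume a b) (h : IsDevelopment cov u α γ P a b)
    (h' : IsDevelopment cov u α γ' P' a b) (hab : a ≤ b) (ha : a ∈ Icc 0 T) (hb : b ∈ Icc 0 T)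
    (hγ : γ a = γ' a) (hP : P a = P' a) : ∀ t ∈ Icc a b, γ t = γ' t ∧ P t = P' t := by
  suffices γ a = γ' a ∧ P a = P' a → ∀ t ∈ Icc a b, γ t = γ' t ∧ P t = P' t from this ⟨hγ, hP⟩
  refine interval_induction (p := fun c d ↦ γ c = γ' c ∧ P c = P' c →
    ∀ t ∈ Icc c d, γ t = γ' t ∧ P t = P' t) hab (fun t ht ↦ ?_) fun c m d hcm hmd _ _ h1 h2 h t ht ↦ ?_
  · obtain ⟨ε, hε, h1⟩ : ∃ ε > 0, γ t = γ' t → ∀ c d, c ≤ d → c ∈ Icc a b → d ∈ Icc a b →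
        |c - t| < ε → |d - t| < ε → MapsTo γ (Icc c d) (chartAt F (γ t)).source ∧
          MapsTo γ' (Icc c d) (chartAt F (γ t)).source := by
      by_cases he : γ t = γ' t
      · obtain ⟨ε, hε, h1⟩ := exists_mapsTo_chart_source (F := F) h.1 ht
        obtain ⟨ε', hε', h2⟩ := exists_mapsTo_chart_source (F := F) h'.1 ht
        refine ⟨min ε ε', lt_min hε hε', fun _ c d hcd hc hd hct hdt ↦
          ⟨h1 c d hcd hc hd (hct.trans_le (min_le_left _ _)) (hdt.trans_le (min_le_left _ _)), ?_⟩⟩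
        rw [he]
        exact h2 c d hcd hc hd (hct.trans_le (min_le_right _ _)) (hdt.trans_le (min_le_right _ _))
      · exact ⟨1, one_pos, fun h ↦ absurd h he⟩
    by_cases he : γ t = γ' t
    swap
    -- If the curves differ at `t`, they differ nearby because `M` is Hausdorff. The property then
    -- holds vacuously on short intervals, since the curves do not agree at the left end. The same
    -- is done below for the frames.
    · have hev : ∀ᶠ s in 𝓝[Icc a b] t, γ s ≠ γ' s :=
        (Tendsto.prodMk_nhds (h.1 t ht) (h'.1 t ht)).eventually
          ((isClosed_diagonal.isOpen_compl).mem_nhds he)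
      obtain ⟨ρ, hρ, h2⟩ := Metric.mem_nhdsWithin_iff.1 hev
      exact ⟨ρ, hρ, fun c d _ hc _ hct _ h0 ↦ absurd h0.1
        (h2 ⟨by rwa [Metric.mem_ball, Real.dist_eq], hc⟩)⟩
    set x₀ := γ t
    set a' := max a (t - ε / 2)
    set b' := min b (t + ε / 2)
    have ha' : a' ∈ Icc a b := ⟨le_max_left _ _, max_le hab (by linarith [ht.2])⟩
    have hb' : b' ∈ Icc a b := ⟨le_min hab (by linarith [ht.1]), min_le_left _ _⟩
    have hta : t ∈ Icc a' b' := ⟨max_le ht.1 (by linarith), le_min ht.2 (by linarith)⟩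
    have hab' : a' ≤ b' := hta.1.trans hta.2
    obtain ⟨hm, hm'⟩ := h1 he a' b' hab' ha' hb'
      (by rw [abs_lt]; constructor <;> linarith [le_max_right a (t - ε / 2), hta.1])
      (by rw [abs_lt]; constructor <;> linarith [min_le_right b (t + ε / 2), hta.2])
    have hy := continuousOn_chartState h.isTransport hab' ha' hb' hm
    have hy' := continuousOn_chartState h'.isTransport hab' ha' hb' hm'
    have hinside : ∀ c d : ℝ, c ∈ Icc a b → d ∈ Icc a b → |c - t| < ε / 2 → |d - t| < ε / 2 →
        Icc c d ⊆ Icc a' b' := fun c d hc hd hct hdt ↦ Icc_subset_Icc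
      (max_le hc.1 (by linarith [(abs_lt.1 hct).1])) (le_min hd.2 (by linarith [(abs_lt.1 hdt).2]))
    by_cases hst : chartState x₀ γ P t = chartState x₀ γ' P' t
    swap
    · have hev : ∀ᶠ s in 𝓝[Icc a' b'] t, chartState x₀ γ P s ≠ chartState x₀ γ' P' s :=
        (Tendsto.prodMk_nhds (hy t hta) (hy' t hta)).eventually
          ((isClosed_diagonal.isOpen_compl).mem_nhds hst)
      obtain ⟨ρ, hρ, h2⟩ := Metric.mem_nhdsWithin_iff.1 hev
      refine ⟨min ρ (ε / 2), lt_min hρ (by positivity), fun c d hcd hc hd hct hdt h0 ↦ ?_⟩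
      have hca := hinside c d hc hd (hct.trans_le (min_le_right _ _))
        (hdt.trans_le (min_le_right _ _)) (left_mem_Icc.2 hcd)
      refine absurd ?_ (h2 ⟨?_, hca⟩)
      · simp only [chartState, h0.1, h0.2]
      · rw [Metric.mem_ball, Real.dist_eq]
        exact hct.trans_le (min_le_left _ _)
    obtain ⟨ρ, hρ, huniq⟩ := exists_forall_eqOn_of_hasACDeriv hT
      (A := fun t z ↦ developmentSystem cov u x₀ t z)
      ((chartAt F x₀).open_target.prod isOpen_univ) (contDiffOn_developmentSystem cov hu x₀)
      (t := t) ⟨ha.1.trans ht.1, ht.2.trans hb.2⟩ (z := chartState x₀ γ P t)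
      ⟨(chartAt F x₀).map_source (hm hta), mem_univ _⟩
    obtain ⟨δ, hδ, h3⟩ := Metric.continuousOn_iff.1 hy t hta ρ hρ
    obtain ⟨δ', hδ', h3'⟩ := Metric.continuousOn_iff.1 hy' t hta ρ hρ
    set r := min (min ρ (ε / 2)) (min δ δ')
    have hr1 : r ≤ ρ := (min_le_left _ _).trans (min_le_left _ _)
    have hr2 : r ≤ ε / 2 := (min_le_left _ _).trans (min_le_right _ _)
    have hr3 : r ≤ δ := (min_le_right _ _).trans (min_le_left _ _)
    have hr4 : r ≤ δ' := (min_le_right _ _).trans (min_le_right _ _)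
    refine ⟨r, lt_min (lt_min hρ (by positivity)) (lt_min hδ hδ'),
      fun c d hcd hc hd hct hdt h0 s hs ↦ ?_⟩
    have hsub := hinside c d hc hd (hct.trans_le hr2) (hdt.trans_le hr2)
    have hdist : ∀ s ∈ Icc c d, dist s t < r := fun s hs ↦ by
      rw [Real.dist_eq, abs_lt]
      exact ⟨by linarith [(abs_lt.1 hct).1, hs.1], by linarith [(abs_lt.1 hdt).2, hs.2]⟩
    have sub : ∀ r ∈ Icc a b, r ∈ Icc 0 T := fun r hr ↦ ⟨ha.1.trans hr.1, hr.2.trans hb.2⟩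
    refine eq_of_chartState_eq (hm (hsub hs)) (hm' (hsub hs)) (huniq c d hcd (sub c hc) (sub d hd)
      (hct.trans_le hr1) (hdt.trans_le hr1) _ _ (fun t ↦ (1, α t)) ?_
      (h.hasACDeriv hcd hc hd (hm.mono hsub subset_rfl))
      (h'.hasACDeriv hcd hc hd (hm'.mono hsub subset_rfl)) (fun s hs ↦ ?_) (fun s hs ↦ ?_) ?_ hs)
    · have hα' : IntervalIntegrable α volume c d := hα.mono_set (by
        rw [uIcc_of_le hcd, uIcc_of_le hab]; exact Icc_subset_Icc hc.1 hd.2)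
      exact ⟨(intervalIntegrable_const (c := (1 : ℝ))).1.prodMk hα'.1,
        (intervalIntegrable_const (c := (1 : ℝ))).2.prodMk hα'.2⟩
    · rw [← dist_eq_norm]
      exact h3 s (hsub hs) ((hdist s hs).trans_le hr3)
    · rw [← dist_eq_norm, hst]
      exact h3' s (hsub hs) ((hdist s hs).trans_le hr4)
    · simp only [chartState, h0.1, h0.2]
  · rcases le_total t m with htm | htm
    · exact h1 h t ⟨ht.1, htm⟩
    · exact h2 (h1 h m ⟨hcm, le_rfl⟩) t ⟨htm, ht.2⟩

end Development

/-! ### Solutions for a Cameron-Martin control are developments -/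

section Solution

set_option linter.unusedSectionVars false
set_option synthInstance.maxHeartbeats 200000

variable {F : Type*} [NormedAddCommGroup F] [NormedSpace ℝ F] [FiniteDimensional ℝ F]
  {M : Type*} [TopologicalSpace M] [ChartedSpace F M] [IsManifold 𝓘(ℝ, F) ∞ M] [T2Space M]
  {cov : CovariantDerivative 𝓘(ℝ, F) F (TangentSpace 𝓘(ℝ, F) : M → Type _)}
  [CovariantDerivative.ContMDiffCovariantDerivative cov ∞]
  {x₀ x₁ o x : M} {γ γ' : ℝ → M} {P P' : ℝ → F →L[ℝ] F} {a b c d m T : ℝ}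
  {u : ℝ → ∀ x : M, TangentSpace 𝓘(ℝ, F) x} {α α' : ℝ → F}

theorem ae_restrict_glue {p : ℝ → Prop} (h1 : ∀ᵐ t ∂(volume.restrict (Icc a m)), p t)
    (h2 : ∀ᵐ t ∂(volume.restrict (Icc m b)), p t) (ham : a ≤ m) (hmb : m ≤ b) :
    ∀ᵐ t ∂(volume.restrict (Icc a b)), p t := by
  rw [← Icc_union_Icc_eq_Icc ham hmb, ae_restrict_union_iff]
  exact ⟨h1, h2⟩

theorem memLp_glue {G : Type*} [NormedAddCommGroup G] {f : ℝ → G}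
    (h1 : MemLp f 2 (volume.restrict (Icc a m))) (h2 : MemLp f 2 (volume.restrict (Icc m b)))
    (ham : a ≤ m) (hmb : m ≤ b) : MemLp f 2 (volume.restrict (Icc a b)) := by
  have hm : AEStronglyMeasurable f (volume.restrict (Icc a b)) := by
    rw [← Icc_union_Icc_eq_Icc ham hmb]
    exact aestronglyMeasurable_union_iff.2 ⟨h1.1, h2.1⟩
  rw [memLp_two_iff_integrable_sq_norm hm, ← Icc_union_Icc_eq_Icc ham hmb]
  exact IntegrableOn.union ((memLp_two_iff_integrable_sq_norm h1.1).1 h1)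
    ((memLp_two_iff_integrable_sq_norm h2.1).1 h2)

/-- A tangent vector, as an element of the model space. -/
def vec (v : TangentSpace 𝓘(ℝ, F) x) : F := v

theorem coordMap_velocity {t : ℝ} {v : F} (hx : γ t ∈ (chartAt F x₀).source)
    (hγ : ContinuousAt γ t) (h : HasDerivAt (fun s ↦ chartAt F x₀ (γ s)) v t) :
    coordMap x₀ (γ t) (vec (velocity (F := F) γ t)) = v :=
  toModel_velocity hx hγ h

theorem coordMap_field (V : ∀ x : M, TangentSpace 𝓘(ℝ, F) x) (hx : x ∈ (chartAt F x₀).source) :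
    coordMap (F := F) x₀ x (vec (V x)) = fieldCoord V x₀ (chartAt F x₀ x) :=
  (fieldCoord_chart V hx).symm

theorem coordMap_injective (hx : x ∈ (chartAt F x₀).source) :
    Function.Injective (coordMap (F := F) x₀ x) := fun v w h ↦ by
  rw [← coordInv_coordMap hx v, h, coordInv_coordMap hx]

/-- The velocity of a development. -/
theorem IsDevelopment.ae_velocity (h : IsDevelopment cov u α γ P a b) (hab : a ≤ b) :
    ∀ᵐ t ∂(volume.restrict (Icc a b)), vec (velocity (F := F) γ t) = P t (α t) + vec (u t (γ t)) := by
  refine interval_induction_chart F (p := fun c d ↦ ∀ᵐ t ∂(volume.restrict (Icc c d)),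
    vec (velocity (F := F) γ t) = P t (α t) + vec (u t (γ t))) h.1 hab (fun x₀ c d hcd hc hd hmap ↦ ?_)
    fun c m d hcm hmd _ _ h1 h2 ↦ ae_restrict_glue h1 h2 hcm hmd
  have hy := (h.hasACDeriv hcd hc hd hmap).clm_comp (ContinuousLinearMap.fst ℝ F (F →L[ℝ] F))
  filter_upwards [hy.ae_hasDerivAt, ae_mem_Ioo c d] with t ht htm
  have hs := hmap (Ioo_subset_Icc_self htm)
  have hv := coordMap_velocity hs (h.1.continuousAt (mem_of_superset
    (Icc_mem_nhds htm.1 htm.2) (Icc_subset_Icc hc.1 hd.2))) ht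
  refine coordMap_injective hs (hv.trans ?_)
  rw [map_add, coordMap_field (u t) hs]
  change (coordMap x₀ (γ t) ∘L P t) (α t) + (1 : ℝ) • fieldCoord (u t) x₀ (chartAt F x₀ (γ t)) = _
  rw [one_smul]
  rfl

/-- A parallel frame along a curve with the right velocity is a development. -/
theorem IsTransport.isDevelopment (h : IsTransport cov γ P a b)
    (hv : ∀ᵐ t ∂(volume.restrict (Icc a b)), vec (velocity (F := F) γ t) = P t (α t) + vec (u t (γ t))) :
    IsDevelopment cov u α γ P a b := by
  refine ⟨h.1, fun x₀ c d hcd hsub hmap ↦ ?_⟩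
  have hy := h.2 x₀ c d hcd hsub hmap
  refine hy.congr hcd (fun _ _ ↦ rfl) ?_
  have hfst := h.isACCurve.2 x₀ c d hcd hsub hmap
  filter_upwards [hfst.ae_hasDerivAt, ae_mem_Ioo c d,
    ae_restrict_of_ae_restrict_of_subset hsub hv] with t ht htm hvt
  have hs := hmap (Ioo_subset_Icc_self htm)
  have hv := coordMap_velocity hs (h.1.continuousAt (mem_of_superset
    (Icc_mem_nhds htm.1 htm.2) hsub)) ht
  rw [hvt, map_add, coordMap_field (u t) hs] at hv
  refine congrArg (transportSystem cov x₀ (chartState x₀ γ P t)) (hv.symm.trans ?_)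
  change _ = (coordMap x₀ (γ t) ∘L P t) (α t) + (1 : ℝ) • fieldCoord (u t) x₀ (chartAt F x₀ (γ t))
  rw [one_smul]
  rfl

theorem continuousOn_fieldCoord_curve
    (hu : ContMDiffOn (𝓘(ℝ, ℝ).prod 𝓘(ℝ, F)) 𝓘(ℝ, F).tangent ∞
      (fun p : ℝ × M ↦ (⟨p.2, u p.1 p.2⟩ : TangentBundle 𝓘(ℝ, F) M)) (Icc 0 T ×ˢ univ))
    (hγ : ContinuousOn γ (Icc c d)) (hsub : Icc c d ⊆ Icc 0 T)
    (hmap : MapsTo γ (Icc c d) (chartAt F x₀).source) :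
    ContinuousOn (fun t ↦ fieldCoord (u t) x₀ (chartAt F x₀ (γ t))) (Icc c d) := by
  have hc : ContinuousOn (fun t ↦ chartAt F x₀ (γ t)) (Icc c d) :=
    (chartAt F x₀).continuousOn.comp hγ hmap
  have hg : ContinuousOn (fun t ↦ (t, chartAt F x₀ (γ t))) (Icc c d) := continuousOn_id.prodMk hc
  have hf : ContinuousOn (fun q : ℝ × F ↦ fieldCoord (u q.1) x₀ q.2)
    (Icc 0 T ×ˢ (chartAt F x₀).target) := (contDiffOn_fieldCoord hu x₀).continuousOn
  have h := hf.comp hg fun t ht ↦ ⟨hsub ht, (chartAt F x₀).map_source (hmap ht)⟩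
  exact h

variable {𝔢 : Type*} [NormedAddCommGroup 𝔢] [InnerProductSpace ℝ 𝔢] [FiniteDimensional ℝ 𝔢]
  {ι : 𝔢 →L[ℝ] TangentSpace 𝓘(ℝ, F) o} {J : ℕ} {σ : Fin J → ℝ → 𝔢}
  {η : CameronMartin T 𝔢}

/-- `ι Σ_t^{1/2}`. -/
noncomputable def controlMap (ι : 𝔢 →L[ℝ] TangentSpace 𝓘(ℝ, F) o) (σ : Fin J → ℝ → 𝔢) (t : ℝ) : 𝔢 →L[ℝ] F :=
  (show 𝔢 →L[ℝ] F from ι) ∘L sqrtCovariance σ t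

theorem continuousOn_controlMap {s : Set ℝ} (hσ : ∀ j, ContinuousOn (σ j) s) :
    ContinuousOn (controlMap ι σ) s :=
  continuousOn_const.clm_comp (continuousOn_sqrtCovariance hσ)

theorem controlMap_mem (t : ℝ) (v : 𝔢) : controlMap ι σ t v ∈ modelE ι := ⟨_, rfl⟩

theorem memLp_control (hσ : ∀ j, ContinuousOn (σ j) (Icc 0 T)) :
    MemLp (fun t ↦ controlMap ι σ t (η t)) 2 (volume.restrict (Icc 0 T)) := by
  obtain ⟨_, -, h, -⟩ := memLp_clm_apply (continuousOn_controlMap (ι := ι) hσ) (Lp.memLp η)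
  exact h

theorem intervalIntegrable_control (hT : 0 ≤ T) (hσ : ∀ j, ContinuousOn (σ j) (Icc 0 T)) :
    IntervalIntegrable (fun t ↦ controlMap ι σ t (η t)) volume 0 T :=
  intervalIntegrable_clm_apply hT (continuousOn_controlMap hσ) (η.intervalIntegrable hT)

theorem IsSolution.exists_isDevelopment (h : IsSolution cov ι σ u T η γ) :
    ∃ P, IsDevelopment cov u (fun t ↦ controlMap ι σ t (η t)) γ P 0 T ∧ γ 0 = o ∧
      P 0 = ContinuousLinearMap.id ℝ F := by
  obtain ⟨hγ, P, hP, hv⟩ := h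
  obtain ⟨hT, h0⟩ := IsTransport.of_isParallelTransport hγ.isACCurve hP
  exact ⟨asModel P, hT.isDevelopment hv, hP.1, h0⟩

theorem memLp_of_continuousOn {G : Type*} [NormedAddCommGroup G] {f : ℝ → G}
    (hf : ContinuousOn f (Icc a b)) : MemLp f 2 (volume.restrict (Icc a b)) := by
  obtain ⟨C, hC⟩ := isCompact_Icc.exists_bound_of_continuousOn hf
  exact MemLp.of_bound (hf.aestronglyMeasurable measurableSet_Icc) C
    ((ae_restrict_iff' measurableSet_Icc).2 (.of_forall hC))

/-- Developments are only required to be absolutely continuous. Square integrability of the velocity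
follows from the equation: the control is in `L²`, while the frame and `u` along the curve are
continuous. -/
theorem IsDevelopment.isSolution (hu : ContMDiffOn (𝓘(ℝ, ℝ).prod 𝓘(ℝ, F)) 𝓘(ℝ, F).tangent ∞
      (fun p : ℝ × M ↦ (⟨p.2, u p.1 p.2⟩ : TangentBundle 𝓘(ℝ, F) M)) (Icc 0 T ×ˢ univ))
    (hT : 0 ≤ T) (hσ : ∀ j, ContinuousOn (σ j) (Icc 0 T))
    (h : IsDevelopment cov u (fun t ↦ controlMap ι σ t (η t)) γ P 0 T) (h0 : γ 0 = o)
    (hP0 : P 0 = ContinuousLinearMap.id ℝ F) : IsSolution cov ι σ u T η γ := by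
  refine ⟨⟨h.1, fun x₀ c d hcd hsub hmap ↦ ?_⟩, ofAsModel o γ P,
    h.isTransport.isParallelTransport h0 hP0, h.ae_velocity hT⟩
  have hy := h.2 x₀ c d hcd hsub hmap
  have hfst := hy.clm_comp (ContinuousLinearMap.fst ℝ F (F →L[ℝ] F))
  refine ⟨hfst.ac hcd, MemLp.ae_eq hfst.ae_deriv ?_⟩
  have hyc := hy.continuousOn hcd
  have h1 : MemLp (fun t ↦ (chartState x₀ γ P t).2 (controlMap ι σ t (η t))) 2
      (volume.restrict (Icc c d)) := by
    have hp : ContinuousOn (fun t ↦ (chartState x₀ γ P t).2) (Icc c d) :=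
      continuous_snd.comp_continuousOn hyc
    obtain ⟨_, -, h, -⟩ := memLp_clm_apply (B := fun t ↦ (chartState x₀ γ P t).2) hp
      (f := fun t ↦ controlMap ι σ t (η t)) (p := 2) ((memLp_control (ι := ι) (η := η) hσ).mono_measure (Measure.restrict_mono hsub le_rfl))
    exact h
  have h2 : MemLp (fun t ↦ (1 : ℝ) • fieldCoord (u t) x₀ (chartState x₀ γ P t).1) 2
      (volume.restrict (Icc c d)) := by
    exact memLp_of_continuousOn
      ((continuousOn_fieldCoord_curve hu (h.1.mono hsub) hsub hmap).const_smul (1 : ℝ))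
  exact h1.add h2

end Solution

section Shortcuts

variable {E G : Type*} [NormedAddCommGroup E] [NormedSpace ℝ E] [NormedAddCommGroup G]
  [NormedSpace ℝ G]

/-- A shortcut for type class inference. -/
noncomputable instance instNormedAddCommGroupCLM : NormedAddCommGroup (E →L[ℝ] G) :=
  ContinuousLinearMap.toNormedAddCommGroup

/-- A shortcut for type class inference. -/
noncomputable instance instNormedSpaceCLM : NormedSpace ℝ (E →L[ℝ] G) :=
  ContinuousLinearMap.toNormedSpace

end Shortcuts

/-! ### The linearized development equation in the moving frame -/

section Linearization

set_option linter.unusedSectionVars false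
set_option synthInstance.maxHeartbeats 200000

variable {F : Type*} [NormedAddCommGroup F] [NormedSpace ℝ F] [FiniteDimensional ℝ F]
  {M : Type*} [TopologicalSpace M] [ChartedSpace F M] [IsManifold 𝓘(ℝ, F) ∞ M] [T2Space M]
  (cov : CovariantDerivative 𝓘(ℝ, F) F (TangentSpace 𝓘(ℝ, F) : M → Type _))
  [CovariantDerivative.ContMDiffCovariantDerivative cov ∞]
  {x₀ x₁ o x : M} {γ γ' : ℝ → M} {P P' : ℝ → F →L[ℝ] F} {a b c d m T : ℝ}
  {u : ℝ → ∀ x : M, TangentSpace 𝓘(ℝ, F) x} {α α' : ℝ → F}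

/-- The variation of a curve and a parallel frame `(ξ, p)` whose components in the frame are `z`
and `K`. -/
noncomputable def variationState (x₀ : M) (y : F × (F →L[ℝ] F)) (z : F) (K : F →L[ℝ] F) :
    F × (F →L[ℝ] F) :=
  (y.2 z, y.2 ∘L K - christoffel cov x₀ y.1 (y.2 z) ∘L y.2)

/-- The curvature `R(v, p z) p` in a chart. -/
noncomputable def curvatureCoord (x₀ : M) (y : F × (F →L[ℝ] F)) (v z : F) : F →L[ℝ] F :=
  fderiv ℝ (christoffel cov x₀) y.1 v (y.2 z) ∘L y.2 -
    christoffel cov x₀ y.1 (y.2 z) ∘L (christoffel cov x₀ y.1 v ∘L y.2) -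
    fderiv ℝ (christoffel cov x₀) y.1 (y.2 z) v ∘L y.2 +
    christoffel cov x₀ y.1 v ∘L (christoffel cov x₀ y.1 (y.2 z) ∘L y.2)

/-- `∇_{p z} u + T(v, p z)` in a chart. -/
noncomputable def jacobiCoord (u : ℝ → ∀ x : M, TangentSpace 𝓘(ℝ, F) x) (x₀ : M) (t : ℝ)
    (y : F × (F →L[ℝ] F)) (v z : F) : F :=
  fderiv ℝ (fieldCoord (u t) x₀) y.1 (y.2 z) +
    christoffel cov x₀ y.1 (y.2 z) (fieldCoord (u t) x₀ y.1) +
    (christoffel cov x₀ y.1 v (y.2 z) - christoffel cov x₀ y.1 (y.2 z) v)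

variable {cov}

theorem hasFDerivAt_christoffel {ξ : F} (hξ : ξ ∈ (chartAt F x₀).target) :
    HasFDerivAt (christoffel cov x₀) (fderiv ℝ (christoffel cov x₀) ξ) ξ :=
  (((contDiffOn_christoffel cov x₀).contDiffAt
    ((chartAt F x₀).open_target.mem_nhds hξ)).differentiableAt (by simp)).hasFDerivAt

/-- The pair `(z, K)` is independent of the chart: `K` is the covariant variation of the frame, and
the Christoffel correction in `variationState` absorbs the second derivative of the change of
coordinates. -/
theorem fderiv_stateTransition_variationState {p : F →L[ℝ] F} (z : F) (K : F →L[ℝ] F)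
    (h₀ : x ∈ (chartAt F x₀).source) (h₁ : x ∈ (chartAt F x₁).source) :
    fderiv ℝ (stateTransition x₀ x₁) (chartAt F x₀ x, coordMap x₀ x ∘L p)
      (variationState cov x₀ (chartAt F x₀ x, coordMap x₀ x ∘L p) z K) =
    variationState cov x₁ (chartAt F x₁ x, coordMap x₁ x ∘L p) z K := by
  obtain ⟨L, hL, hL'⟩ := hasFDerivAt_stateTransition (coordMap x₀ x ∘L p) h₀ h₁
  rw [hL.fderiv, hL']
  have e : ∀ w, fderiv ℝ (transition x₀ x₁) (chartAt F x₀ x) (coordMap x₀ x w) =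
      coordMap x₁ x w := fun w ↦ DFunLike.congr_fun (fderiv_transition_comp_coordMap h₀ h₁) w
  refine Prod.ext (by simp [variationState, e]) ?_
  ext w
  have e5 := christoffel_transition cov h₀ h₁ (coordMap x₀ x (p z)) (coordMap x₀ x (p w))
  rw [e, e] at e5
  simp [variationState, e, e5]
  abel

theorem contDiffOn_variationState :
    ContDiffOn ℝ ∞ (fun q : (F × (F →L[ℝ] F)) × F × (F →L[ℝ] F) ↦
      variationState cov x₀ q.1 q.2.1 q.2.2) (((chartAt F x₀).target ×ˢ univ) ×ˢ univ) := by
  have h1 : ContDiffOn ℝ ∞ (fun q : (F × (F →L[ℝ] F)) × F × (F →L[ℝ] F) ↦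
      christoffel cov x₀ q.1.1) (((chartAt F x₀).target ×ˢ univ) ×ˢ univ) :=
    (contDiffOn_christoffel cov x₀).comp contDiffOn_fst.fst fun q hq ↦ hq.1.1
  have h2 : ContDiffOn ℝ ∞ (fun q : (F × (F →L[ℝ] F)) × F × (F →L[ℝ] F) ↦ q.1.2)
    (((chartAt F x₀).target ×ˢ univ) ×ˢ univ) := contDiffOn_fst.snd
  have h3 : ContDiffOn ℝ ∞ (fun q : (F × (F →L[ℝ] F)) × F × (F →L[ℝ] F) ↦ q.1.2 q.2.1)
    (((chartAt F x₀).target ×ˢ univ) ×ˢ univ) := h2.clm_apply contDiffOn_snd.fst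
  exact h3.prodMk ((h2.clm_comp contDiffOn_snd.snd).sub ((h1.clm_apply h3).clm_comp h2))

theorem fderiv_variationState {y δ : F × (F →L[ℝ] F)} {z z' : F} {K K' : F →L[ℝ] F}
    (hy : y.1 ∈ (chartAt F x₀).target) :
    fderiv ℝ (fun q : (F × (F →L[ℝ] F)) × F × (F →L[ℝ] F) ↦
      variationState cov x₀ q.1 q.2.1 q.2.2) (y, z, K) (δ, z', K') =
    (y.2 z' + δ.2 z, (y.2 ∘L K' + δ.2 ∘L K) -
      (christoffel cov x₀ y.1 (y.2 z) ∘L δ.2 + (christoffel cov x₀ y.1 (y.2 z' + δ.2 z) +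
        fderiv ℝ (christoffel cov x₀) y.1 δ.1 (y.2 z)) ∘L y.2)) := by
  have f1 : HasFDerivAt (fun q : (F × (F →L[ℝ] F)) × F × (F →L[ℝ] F) ↦ q.1.2) _ (y, z, K) :=
    (hasFDerivAt_fst (𝕜 := ℝ) (p := (y, z, K))).snd
  have f2 : HasFDerivAt (fun q : (F × (F →L[ℝ] F)) × F × (F →L[ℝ] F) ↦ q.2.1) _ (y, z, K) :=
    (hasFDerivAt_snd (𝕜 := ℝ) (p := (y, z, K))).fst
  have f3 : HasFDerivAt (fun q : (F × (F →L[ℝ] F)) × F × (F →L[ℝ] F) ↦ q.2.2) _ (y, z, K) :=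
    (hasFDerivAt_snd (𝕜 := ℝ) (p := (y, z, K))).snd
  have f4 : HasFDerivAt (fun q : (F × (F →L[ℝ] F)) × F × (F →L[ℝ] F) ↦ christoffel cov x₀ q.1.1) _
      (y, z, K) := HasFDerivAt.comp (g := christoffel cov x₀) (y, z, K)
    (hasFDerivAt_christoffel hy) (hasFDerivAt_fst (𝕜 := ℝ) (p := (y, z, K))).fst
  have f5 := f1.clm_apply f2
  have f6 := f5.prodMk ((f1.clm_comp f3).sub ((f4.clm_apply f5).clm_comp f1))
  have f7 : HasFDerivAt (fun q : (F × (F →L[ℝ] F)) × F × (F →L[ℝ] F) ↦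
      variationState cov x₀ q.1 q.2.1 q.2.2) _ (y, z, K) := f6
  rw [f7.fderiv]
  rfl

set_option maxHeartbeats 1000000 in
theorem fderiv_developmentSystem
    (hu : ContMDiffOn (𝓘(ℝ, ℝ).prod 𝓘(ℝ, F)) 𝓘(ℝ, F).tangent ∞
      (fun p : ℝ × M ↦ (⟨p.2, u p.1 p.2⟩ : TangentBundle 𝓘(ℝ, F) M)) (Icc 0 T ×ˢ univ))
    {t : ℝ} (ht : t ∈ Icc 0 T) {y δ : F × (F →L[ℝ] F)} (hy : y.1 ∈ (chartAt F x₀).target)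
    (w : F) :
    fderiv ℝ (developmentSystem cov u x₀ t) y δ (1, w) =
      (fderiv ℝ (fieldCoord (u t) x₀) y.1 δ.1 + δ.2 w,
        -(christoffel cov x₀ y.1 (y.2 w + fieldCoord (u t) x₀ y.1) ∘L δ.2 +
          (christoffel cov x₀ y.1 (fderiv ℝ (fieldCoord (u t) x₀) y.1 δ.1 + δ.2 w) +
            fderiv ℝ (christoffel cov x₀) y.1 δ.1 (y.2 w + fieldCoord (u t) x₀ y.1)) ∘L y.2)) := by
  have hU : HasFDerivAt (fieldCoord (u t) x₀) (fderiv ℝ (fieldCoord (u t) x₀) y.1) y.1 :=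
    (hasFDerivAt_of_contDiffOn_prod (A := fun t ξ ↦ fieldCoord (u t) x₀ ξ)
      (chartAt F x₀).open_target ((contDiffOn_fieldCoord hu x₀).of_le (by simp)) ht hy).differentiableAt.hasFDerivAt
  have hA : DifferentiableAt ℝ (developmentSystem cov u x₀ t) y :=
    (hasFDerivAt_of_contDiffOn_prod ((chartAt F x₀).open_target.prod isOpen_univ)
      ((contDiffOn_developmentSystem cov hu x₀).of_le (by simp)) ht ⟨hy, mem_univ _⟩).differentiableAt
  have e1 : fderiv ℝ (developmentSystem cov u x₀ t) y δ (1, w) =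
      fderiv ℝ (fun z ↦ developmentSystem cov u x₀ t z (1, w)) y δ := by
    rw [(hA.hasFDerivAt.clm_apply (hasFDerivAt_const ((1 : ℝ), w) y)).fderiv]
    simp
  rw [e1]
  have f1 : HasFDerivAt (fun z : F × (F →L[ℝ] F) ↦ z.2) _ y := hasFDerivAt_snd (𝕜 := ℝ)
  have f2 : HasFDerivAt (fun z : F × (F →L[ℝ] F) ↦ fieldCoord (u t) x₀ z.1) _ y :=
    HasFDerivAt.comp (g := fieldCoord (u t) x₀) y hU (hasFDerivAt_fst (𝕜 := ℝ) (p := y))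
  have f3 : HasFDerivAt (fun z : F × (F →L[ℝ] F) ↦ christoffel cov x₀ z.1) _ y :=
    HasFDerivAt.comp (g := christoffel cov x₀) y (hasFDerivAt_christoffel hy)
      (hasFDerivAt_fst (𝕜 := ℝ) (p := y))
  have f4 := f2.add (f1.clm_apply (hasFDerivAt_const w y))
  have f5 := f4.prodMk ((f3.clm_apply f4).clm_comp f1).neg
  have f6 := f5.congr_of_eventuallyEq (f₁ := fun z ↦ developmentSystem cov u x₀ t z (1, w))
    (.of_forall fun z ↦ by
      simp [developmentSystem_apply, transportSystem_apply, add_comm])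
  rw [f6.fderiv]
  refine Prod.ext (by simp) ?_
  ext v
  simp [add_comm]

/-- The structure equations. Exchanging the derivative along the curve with the variation costs the
torsion for `z` and the curvature for `K`, so a solution `(z, K)` of the equations in the frame
yields a solution of the linearized system in the chart. This makes the abstract derivative of the
flow computable. -/
theorem hasACDeriv_variationState
    (hu : ContMDiffOn (𝓘(ℝ, ℝ).prod 𝓘(ℝ, F)) 𝓘(ℝ, F).tangent ∞
      (fun p : ℝ × M ↦ (⟨p.2, u p.1 p.2⟩ : TangentBundle 𝓘(ℝ, F) M)) (Icc 0 T ×ˢ univ))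
    (hcd : c ≤ d) (hsub : Icc c d ⊆ Icc 0 T) {y : ℝ → F × (F →L[ℝ] F)} {κ z : ℝ → F}
    {B K : ℝ → F →L[ℝ] F} {C : ℝ → F →L[ℝ] F →L[ℝ] F}
    (hy : HasACDeriv y (fun t ↦ developmentSystem cov u x₀ t (y t) (1, α t)) c d)
    (hyt : ∀ t ∈ Icc c d, (y t).1 ∈ (chartAt F x₀).target)
    (hz : HasACDeriv z (fun t ↦ κ t + K t (α t) + B t (z t)) c d)
    (hK : HasACDeriv K (fun t ↦ C t (z t)) c d)
    (hB : ∀ᵐ t ∂(volume.restrict (Icc c d)), ∀ w, (y t).2 (B t w) =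
      jacobiCoord cov u x₀ t (y t) ((y t).2 (α t) + fieldCoord (u t) x₀ (y t).1) w)
    (hC : ∀ᵐ t ∂(volume.restrict (Icc c d)), ∀ w, (y t).2 ∘L C t w =
      curvatureCoord cov x₀ (y t) ((y t).2 (α t) + fieldCoord (u t) x₀ (y t).1) w) :
    HasACDeriv (fun t ↦ variationState cov x₀ (y t) (z t) (K t))
      (fun t ↦ fderiv ℝ (developmentSystem cov u x₀ t) (y t)
          (variationState cov x₀ (y t) (z t) (K t)) (1, α t) +
        developmentSystem cov u x₀ t (y t) (0, κ t)) c d := by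
  have h1 := (hy.prodMk (hz.prodMk hK)).comp_contDiffOn hcd
    (((chartAt F x₀).open_target.prod isOpen_univ).prod isOpen_univ)
    ((contDiffOn_variationState (cov := cov) (x₀ := x₀)).of_le (by simp))
    fun t ht ↦ ⟨⟨hyt t ht, mem_univ _⟩, mem_univ _⟩
  refine h1.congr hcd (fun _ _ ↦ rfl) ?_
  filter_upwards [hB, hC, ae_restrict_mem measurableSet_Icc] with t htB htC ht
  have hBt := htB (z t)
  have hCt := htC (z t)
  rw [fderiv_variationState (hyt t ht), fderiv_developmentSystem hu (hsub ht) (hyt t ht)]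
  simp only [developmentSystem_apply, transportSystem_apply, variationState, one_smul, zero_smul,
    add_zero]
  set v := (y t).2 (α t) + fieldCoord (u t) x₀ (y t).1 with hv
  set Γ := christoffel cov x₀ (y t).1
  have hα : (y t).2 (α t) = v - fieldCoord (u t) x₀ (y t).1 := by rw [hv]; abel
  -- The torsion part of `jacobiCoord` cancels `Γ v (p z)`, which comes from `p'`, and leaves `Γ (p
  -- z) v`, part of which comes from the variation of the frame. The identity is used again in the
  -- second component.
  have e1 : (y t).2 (κ t + K t (α t) + B t (z t)) + -(Γ v ∘L (y t).2) (z t) =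
      fderiv ℝ (fieldCoord (u t) x₀) (y t).1 ((y t).2 (z t)) +
        ((y t).2 ∘L K t - Γ ((y t).2 (z t)) ∘L (y t).2) (α t) + (y t).2 (κ t) := by
    rw [map_add, map_add, hBt]
    simp only [jacobiCoord, _root_.sub_apply, ContinuousLinearMap.comp_apply, hα,
      map_sub]
    abel
  refine Prod.ext e1 ?_
  refine ContinuousLinearMap.ext fun w ↦ ?_
  have hCw := DFunLike.congr_fun hCt w
  simp only [curvatureCoord, ContinuousLinearMap.comp_apply, _root_.sub_apply,
    _root_.add_apply] at hCw
  simp only [Prod.snd_add, ContinuousLinearMap.comp_apply, _root_.sub_apply, _root_.neg_apply,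
    _root_.add_apply] at e1 ⊢
  rw [e1, hCw]
  simp only [map_add, map_sub, map_neg, _root_.add_apply, _root_.sub_apply]
  abel

end Linearization

/-! ### The coefficients `B` and `C` of the variation equations -/

section Operators

set_option linter.unusedSectionVars false
set_option synthInstance.maxHeartbeats 200000

variable {F : Type*} [NormedAddCommGroup F] [NormedSpace ℝ F] [FiniteDimensional ℝ F]
  {M : Type*} [TopologicalSpace M] [ChartedSpace F M] [IsManifold 𝓘(ℝ, F) ∞ M] [T2Space M]
  (cov : CovariantDerivative 𝓘(ℝ, F) F (TangentSpace 𝓘(ℝ, F) : M → Type _))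
  [CovariantDerivative.ContMDiffCovariantDerivative cov ∞]
  {x₀ x₁ o x : M} {γ γ' : ℝ → M} {P P' : ℝ → F →L[ℝ] F} {a b c d m T : ℝ}
  {u : ℝ → ∀ x : M, TangentSpace 𝓘(ℝ, F) x} {α α' : ℝ → F}

theorem continuousOn_inverse {X : Type*} [TopologicalSpace X] {s : Set X} {p : X → F →L[ℝ] F}
    (hp : ContinuousOn p s) (hinj : ∀ t ∈ s, Function.Injective (p t)) :
    ContinuousOn (fun t ↦ (p t).inverse) s ∧ ∀ t ∈ s, ∀ v, p t ((p t).inverse v) = v ∧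
      (p t).inverse (p t v) = v := by
  have hinv : ∀ t ∈ s, ∃ e : F ≃L[ℝ] F, (e : F →L[ℝ] F) = p t := fun t ht ↦
    ⟨(LinearEquiv.ofInjectiveEndo (p t : F →ₗ[ℝ] F) (hinj t ht)).toContinuousLinearEquiv,
      by ext; rfl⟩
  refine ⟨fun t ht ↦ ?_, fun t ht v ↦ ?_⟩
  · obtain ⟨e, he⟩ := hinv t ht
    have h1 : ContinuousAt ContinuousLinearMap.inverse (p t) := by
      rw [← he]
      exact (contDiffAt_map_inverse (n := 1) e).continuousAt
    exact h1.comp_continuousWithinAt (hp t ht)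
  · obtain ⟨e, he⟩ := hinv t ht
    rw [← he, ContinuousLinearMap.inverse_equiv]
    exact ⟨e.apply_symm_apply v, e.symm_apply_apply v⟩

/-- Integrability on an interval, for functions with values in a normed space. -/
abbrev NormedIntegrable {W : Type*} [NormedAddCommGroup W] (f : ℝ → W) (a b : ℝ) : Prop :=
  IntervalIntegrable f volume a b

theorem NormedIntegrable.piecewise {W : Type*} [NormedAddCommGroup W] {f g : ℝ → W}
    (hf : NormedIntegrable f c m) (hg : NormedIntegrable g m d) (hcm : c ≤ m) (hmd : m ≤ d) :
    NormedIntegrable (fun t ↦ if t ≤ m then f t else g t) c d := by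
  refine (hf.congr_ae ?_).trans (hg.congr_ae ?_)
  · rw [uIoc_of_le hcm]
    filter_upwards [ae_restrict_mem measurableSet_Ioc] with t ht
    rw [if_pos ht.2]
  · rw [uIoc_of_le hmd]
    filter_upwards [ae_restrict_mem measurableSet_Ioc] with t ht
    rw [if_neg (not_le.2 ht.1)]

/-- An element of the model space, as a tangent vector. -/
def unvec (x : M) (v : F) : TangentSpace 𝓘(ℝ, F) x := v

/-- `∇_w u + T(γ', w)`. -/
noncomputable def jacobiField (u : ℝ → ∀ x : M, TangentSpace 𝓘(ℝ, F) x) (γ : ℝ → M) (t : ℝ)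
    (w : F) : F :=
  vec (cov (u t) (γ t) (unvec (γ t) w) + cov.torsion (γ t) (velocity (F := F) γ t) (unvec (γ t) w))

theorem coordMap_jacobiField
    (hu : ContMDiffOn (𝓘(ℝ, ℝ).prod 𝓘(ℝ, F)) 𝓘(ℝ, F).tangent ∞
      (fun p : ℝ × M ↦ (⟨p.2, u p.1 p.2⟩ : TangentBundle 𝓘(ℝ, F) M)) (Icc 0 T ×ˢ univ))
    {t : ℝ} (ht : t ∈ Icc 0 T) {v : F} (hx : γ t ∈ (chartAt F x₀).source) (hγ : ContinuousAt γ t)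
    (h : HasDerivAt (fun s ↦ chartAt F x₀ (γ s)) v t) (w : F) :
    coordMap x₀ (γ t) (jacobiField cov u γ t (P t w)) =
      jacobiCoord cov u x₀ t (chartState x₀ γ P t) v w := by
  have hU : HasFDerivAt (fieldCoord (u t) x₀) (fderiv ℝ (fieldCoord (u t) x₀) (chartAt F x₀ (γ t)))
      (chartAt F x₀ (γ t)) :=
    (hasFDerivAt_of_contDiffOn_prod (A := fun t ξ ↦ fieldCoord (u t) x₀ ξ)
      (chartAt F x₀).open_target ((contDiffOn_fieldCoord hu x₀).of_le (by simp))
      ht ((chartAt F x₀).map_source hx)).differentiableAt.hasFDerivAt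
  have h1 := toModel_cov_field cov hx hU (unvec (γ t) (P t w))
  have h2 := toModel_torsion cov hx (velocity (F := F) γ t) (unvec (γ t) (P t w))
  rw [toModel_velocity hx hγ h] at h2
  exact (map_add (toModel x₀ (γ t)) _ _).trans (congrArg₂ (· + ·) h1 h2)

/-- The operator is `P⁻¹ (∇u + T(γ', ·)) P`. It is only integrable, as the torsion term is linear in
the velocity. It is built chart by chart; the pieces fit together because `jacobiField` is
intrinsic. -/
theorem exists_jacobiOperator (hT : 0 < T)
    (hu : ContMDiffOn (𝓘(ℝ, ℝ).prod 𝓘(ℝ, F)) 𝓘(ℝ, F).tangent ∞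
      (fun p : ℝ × M ↦ (⟨p.2, u p.1 p.2⟩ : TangentBundle 𝓘(ℝ, F) M)) (Icc 0 T ×ˢ univ))
    (hP : IsTransport cov γ P 0 T) (hinj : ∀ t ∈ Icc 0 T, Function.Injective (P t)) :
    ∃ B : ℝ → F →L[ℝ] F, IntervalIntegrable B volume 0 T ∧
      ∀ᵐ t ∂(volume.restrict (Icc 0 T)), ∀ w, P t (B t w) = jacobiField cov u γ t (P t w) := by
  refine interval_induction_chart F (p := fun c d ↦ ∃ B : ℝ → F →L[ℝ] F,
    IntervalIntegrable B volume c d ∧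
      ∀ᵐ t ∂(volume.restrict (Icc c d)), ∀ w, P t (B t w) = jacobiField cov u γ t (P t w)) hP.1 hT.le
    (fun x₀ c d hcd hc hd hmap ↦ ?_) ?_
  · have hsub : Icc c d ⊆ Icc 0 T := Icc_subset_Icc hc.1 hd.2
    have hy := hP.hasACDeriv hcd hc hd hmap
    have hyc := hy.continuousOn hcd
    set y := chartState x₀ γ P with hydef
    set ξ : ℝ → F := fun s ↦ chartAt F x₀ (γ s) with hξdef
    have hξ : HasACDeriv ξ (deriv ξ) c d := hy.clm_comp (ContinuousLinearMap.fst ℝ F (F →L[ℝ] F))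
    have hp : ContinuousOn (fun t ↦ (y t).2) (Icc c d) := continuous_snd.comp_continuousOn hyc
    have hpinj : ∀ t ∈ Icc c d, Function.Injective (y t).2 := fun t ht ↦
      (coordMap_injective (hmap ht)).comp (hinj t (hsub ht))
    obtain ⟨hq, hpq⟩ := continuousOn_inverse hp hpinj
    have hξc : ContinuousOn ξ (Icc c d) := hξ.continuousOn hcd
    have hξt : MapsTo ξ (Icc c d) (chartAt F x₀).target := fun t ht ↦
      (chartAt F x₀).map_source (hmap ht)
    have hΓ : ContinuousOn (fun t ↦ christoffel cov x₀ (ξ t)) (Icc c d) :=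
      (contDiffOn_christoffel cov x₀).continuousOn.comp hξc hξt
    have hDU : ContinuousOn (fun t ↦ fderiv ℝ (fieldCoord (u t) x₀) (ξ t)) (Icc c d) := by
      have h1 := continuousOn_fderiv_of_contDiffOn_prod (A := fun t ξ ↦ fieldCoord (u t) x₀ ξ) hT
        (chartAt F x₀).open_target ((contDiffOn_fieldCoord hu x₀).of_le (by simp))
      have h2 : ContinuousOn (fun t ↦ (t, ξ t)) (Icc c d) := continuousOn_id.prodMk hξc
      have h3 := h1.comp h2 fun t ht ↦ ⟨hsub ht, hξt ht⟩
      exact h3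
    have hU : ContinuousOn (fun t ↦ fieldCoord (u t) x₀ (ξ t)) (Icc c d) :=
      continuousOn_fieldCoord_curve hu (hP.1.mono hsub) hsub hmap
    have hΓf : ContinuousOn (fun t ↦ (christoffel cov x₀ (ξ t)).flip) (Icc c d) :=
      (ContinuousLinearMap.flipₗᵢ ℝ F F F).continuous.comp_continuousOn hΓ
    let comp := ContinuousLinearMap.compL ℝ F F F
    -- `B₁` collects the terms without velocity and is continuous; `B₂` is the torsion, a continuous
    -- operator that is applied to the integrable velocity.
    let B₁ : ℝ → F →L[ℝ] F := fun t ↦ (y t).2.inverse ∘L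
      ((fderiv ℝ (fieldCoord (u t) x₀) (ξ t) +
        (christoffel cov x₀ (ξ t)).flip (fieldCoord (u t) x₀ (ξ t))) ∘L (y t).2)
    let B₂ : ℝ → F →L[ℝ] F →L[ℝ] F := fun t ↦ comp (y t).2.inverse ∘L (comp.flip (y t).2 ∘L
      (christoffel cov x₀ (ξ t) - (christoffel cov x₀ (ξ t)).flip))
    have hB₁ : ContinuousOn B₁ (Icc c d) :=
      hq.clm_comp ((hDU.add (hΓf.clm_apply hU)).clm_comp hp)
    have hB₂ : ContinuousOn B₂ (Icc c d) :=
      (comp.continuous.comp_continuousOn hq).clm_comp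
        ((comp.flip.continuous.comp_continuousOn hp).clm_comp (hΓ.sub hΓf))
    refine ⟨fun t ↦ B₁ t + B₂ t (deriv ξ t), ?_, ?_⟩
    · refine IntervalIntegrable.add ?_ (intervalIntegrable_clm_apply hcd hB₂ hξ.1)
      rw [← uIcc_of_le hcd] at hB₁
      exact hB₁.intervalIntegrable
    · filter_upwards [hξ.ae_hasDerivAt, ae_mem_Ioo c d] with t ht htm w
      have htc := Ioo_subset_Icc_self htm
      refine coordMap_injective (hmap htc) ?_
      rw [coordMap_jacobiField cov hu (hsub htc) (hmap htc) (hP.1.continuousAt (mem_of_superset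
        (Icc_mem_nhds htm.1 htm.2) hsub)) ht w]
      change (y t).2 ((B₁ t + B₂ t (deriv ξ t)) w) = _
      simp only [B₁, B₂, comp, _root_.add_apply, _root_.sub_apply, ContinuousLinearMap.comp_apply,
        ContinuousLinearMap.compL_apply, ContinuousLinearMap.flip_apply, map_add, jacobiCoord,
        (hpq t htc _).1]
      rfl
  · rintro c m d hcm hmd hc hd ⟨B, hB, hB'⟩ ⟨B₁, hB₁, hB₁'⟩
    refine ⟨fun t ↦ if t ≤ m then B t else B₁ t, NormedIntegrable.piecewise hB hB₁ hcm hmd,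
      ae_restrict_glue ?_ ?_ hcm hmd⟩
    · filter_upwards [hB', ae_restrict_mem measurableSet_Icc] with t ht htm
      rwa [if_pos htm.2]
    · filter_upwards [hB₁', ae_mem_Ioo m d] with t ht htm
      rwa [if_neg (not_le.2 htm.1)]

theorem normedIntegrable_clm_apply {W : Type*} [NormedAddCommGroup W] [NormedSpace ℝ W] (hcd : c ≤ d)
    {R : ℝ → F →L[ℝ] F →L[ℝ] W} {v : ℝ → F}
    (hR : ∀ v z, ContinuousOn (fun t ↦ R t v z) (Icc c d))
    (hv : IntervalIntegrable v volume c d) : NormedIntegrable (fun t ↦ R t (v t)) c d :=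
  intervalIntegrable_clm_apply hcd
    (continuousOn_clm_apply.2 fun v ↦ continuousOn_clm_apply.2 fun z ↦ hR v z) hv

theorem curvatureCoord_add_left (y : F × (F →L[ℝ] F)) (v v' z : F) :
    curvatureCoord cov x₀ y (v + v') z = curvatureCoord cov x₀ y v z + curvatureCoord cov x₀ y v' z := by
  simp only [curvatureCoord, map_add, _root_.add_apply, ContinuousLinearMap.add_comp,
    ContinuousLinearMap.comp_add]
  abel

theorem curvatureCoord_smul_left (y : F × (F →L[ℝ] F)) (r : ℝ) (v z : F) :
    curvatureCoord cov x₀ y (r • v) z = r • curvatureCoord cov x₀ y v z := by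
  simp only [curvatureCoord, map_smul, _root_.smul_apply, ContinuousLinearMap.smul_comp,
    ContinuousLinearMap.comp_smul, smul_add, smul_sub]

theorem curvatureCoord_add_right (y : F × (F →L[ℝ] F)) (v z z' : F) :
    curvatureCoord cov x₀ y v (z + z') = curvatureCoord cov x₀ y v z + curvatureCoord cov x₀ y v z' := by
  simp only [curvatureCoord, map_add, _root_.add_apply, ContinuousLinearMap.add_comp,
    ContinuousLinearMap.comp_add]
  abel

theorem curvatureCoord_smul_right (y : F × (F →L[ℝ] F)) (r : ℝ) (v z : F) :
    curvatureCoord cov x₀ y v (r • z) = r • curvatureCoord cov x₀ y v z := by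
  simp only [curvatureCoord, map_smul, _root_.smul_apply, ContinuousLinearMap.smul_comp,
    ContinuousLinearMap.comp_smul, smul_add, smul_sub]

/-- The curvature in a chart followed by `q`, as a bilinear operator. -/
noncomputable def curvatureBilin (x₀ : M) (y : F × (F →L[ℝ] F)) (q : F →L[ℝ] F) :
    F →L[ℝ] F →L[ℝ] F →L[ℝ] F :=
  (LinearMap.mk₂ ℝ (fun v z ↦ q ∘L curvatureCoord cov x₀ y v z)
    (fun v v' z ↦ by rw [curvatureCoord_add_left, ContinuousLinearMap.comp_add])
    (fun r v z ↦ by rw [curvatureCoord_smul_left, ContinuousLinearMap.comp_smul])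
    (fun v z z' ↦ by rw [curvatureCoord_add_right, ContinuousLinearMap.comp_add])
    (fun r v z ↦ by
      rw [curvatureCoord_smul_right, ContinuousLinearMap.comp_smul])).toContinuousBilinearMap

theorem curvatureBilin_apply (y : F × (F →L[ℝ] F)) (q : F →L[ℝ] F) (v z : F) :
    curvatureBilin cov x₀ y q v z = q ∘L curvatureCoord cov x₀ y v z := rfl

/-- This is `P⁻¹ R(v, P ·) P`, computed in a single chart. That curvature is a tensor is never
needed: operators from different charts are merely glued, and only existence and integrability of
`C` are used. -/
theorem exists_curvatureOperator {y : ℝ → F × (F →L[ℝ] F)} {v : ℝ → F} (hcd : c ≤ d)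
    (hyc : ContinuousOn y (Icc c d)) (hyt : ∀ t ∈ Icc c d, (y t).1 ∈ (chartAt F x₀).target)
    (hpinj : ∀ t ∈ Icc c d, Function.Injective (y t).2) (hv : IntervalIntegrable v volume c d) :
    ∃ C : ℝ → F →L[ℝ] F →L[ℝ] F, NormedIntegrable C c d ∧
      ∀ t ∈ Icc c d, ∀ z, (y t).2 ∘L C t z = curvatureCoord cov x₀ (y t) (v t) z := by
  have hp : ContinuousOn (fun t ↦ (y t).2) (Icc c d) := continuous_snd.comp_continuousOn hyc
  have hξc : ContinuousOn (fun t ↦ (y t).1) (Icc c d) := continuous_fst.comp_continuousOn hyc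
  obtain ⟨hq, hpq⟩ := continuousOn_inverse hp hpinj
  have hΓ : ContinuousOn (fun t ↦ christoffel cov x₀ (y t).1) (Icc c d) :=
    (contDiffOn_christoffel cov x₀).continuousOn.comp hξc hyt
  have hDΓ : ContinuousOn (fun t ↦ fderiv ℝ (christoffel cov x₀) (y t).1) (Icc c d) :=
    ((contDiffOn_christoffel cov x₀).continuousOn_fderiv_of_isOpen (chartAt F x₀).open_target
      (by simp)).comp hξc hyt
  have hR : ∀ v z, ContinuousOn
      (fun t ↦ (y t).2.inverse ∘L curvatureCoord cov x₀ (y t) v z) (Icc c d) := by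
    intro v z
    have hpz : ContinuousOn (fun t ↦ (y t).2 z) (Icc c d) := hp.clm_apply continuousOn_const
    have h1 : ContinuousOn (fun t ↦ christoffel cov x₀ (y t).1 ((y t).2 z)) (Icc c d) :=
      hΓ.clm_apply hpz
    have h2 : ContinuousOn (fun t ↦ christoffel cov x₀ (y t).1 v) (Icc c d) :=
      hΓ.clm_apply continuousOn_const
    have h3 : ContinuousOn (fun t ↦ fderiv ℝ (christoffel cov x₀) (y t).1 v ((y t).2 z)) (Icc c d) :=
      (hDΓ.clm_apply continuousOn_const).clm_apply hpz
    have h4 : ContinuousOn (fun t ↦ fderiv ℝ (christoffel cov x₀) (y t).1 ((y t).2 z) v) (Icc c d) :=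
      (hDΓ.clm_apply hpz).clm_apply continuousOn_const
    have h5 := hq.clm_comp ((((h3.clm_comp hp).sub (h1.clm_comp (h2.clm_comp hp))).sub
      (h4.clm_comp hp)).add (h2.clm_comp (h1.clm_comp hp)))
    exact h5
  refine ⟨fun t ↦ curvatureBilin cov x₀ (y t) (y t).2.inverse (v t), ?_, fun t ht z ↦ ?_⟩
  · exact normedIntegrable_clm_apply hcd hR hv
  · beta_reduce
    rw [curvatureBilin_apply]
    refine ContinuousLinearMap.ext fun w ↦ ?_
    rw [ContinuousLinearMap.comp_apply, ContinuousLinearMap.comp_apply, (hpq t ht _).1]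

end Operators

/-! ### Differentiating the state at time `t` with respect to the control -/

section Flow

set_option linter.unusedSectionVars false
set_option synthInstance.maxHeartbeats 200000

variable {F : Type*} [NormedAddCommGroup F] [NormedSpace ℝ F] [FiniteDimensional ℝ F]
  {M : Type*} [TopologicalSpace M] [ChartedSpace F M] [IsManifold 𝓘(ℝ, F) ∞ M] [T2Space M]
  (cov : CovariantDerivative 𝓘(ℝ, F) F (TangentSpace 𝓘(ℝ, F) : M → Type _))
  [CovariantDerivative.ContMDiffCovariantDerivative cov ∞]
  {𝔢 : Type*} [NormedAddCommGroup 𝔢] [InnerProductSpace ℝ 𝔢] [FiniteDimensional ℝ 𝔢]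
  {T : ℝ} (u : ℝ → ∀ x : M, TangentSpace 𝓘(ℝ, F) x) (S : ℝ → 𝔢 →L[ℝ] F) (o : M)
  {x₀ x₁ x : M} (η₀ : CameronMartin T 𝔢) (γ : ℝ → M) (P : ℝ → F →L[ℝ] F) {a b c d e m t : ℝ}

/-- Near `η₀` the developments of `S η` started at `o` exist up to time `t`, and their state at time
`t` depends differentiably on `η`, with derivative `D` in the chart at `x₀`; the development of
`S η₀` is `(γ, P)`. -/
def FlowDeriv (x₀ : M) (t : ℝ) (D : CameronMartin T 𝔢 →L[ℝ] F × (F →L[ℝ] F)) : Prop :=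
  ∃ (Γ : CameronMartin T 𝔢 → ℝ → M) (Q : CameronMartin T 𝔢 → ℝ → F →L[ℝ] F),
    (∀ᶠ η in 𝓝 η₀, IsDevelopment cov u (fun t ↦ S t (η t)) (Γ η) (Q η) 0 t ∧ Γ η 0 = o ∧
      Q η 0 = ContinuousLinearMap.id ℝ F) ∧
    Γ η₀ t = γ t ∧ Q η₀ t = P t ∧ ContinuousAt (fun η ↦ Γ η t) η₀ ∧
    HasFDerivAt (fun η ↦ chartState x₀ (Γ η) (Q η) t) D η₀

variable {cov u S o η₀ γ P}

theorem FlowDeriv.zero (h0 : γ 0 = o) (hP0 : P 0 = ContinuousLinearMap.id ℝ F) (x₀ : M) :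
    FlowDeriv cov u S o η₀ γ P x₀ 0 0 := by
  refine ⟨fun _ ↦ γ, fun _ ↦ P, .of_forall fun η ↦ ⟨⟨?_, fun x₀ c d hcd hsub _ ↦ ?_⟩, h0, hP0⟩,
    rfl, rfl, continuousAt_const, hasFDerivAt_const _ _⟩
  · simp
  · have hc := hsub ⟨le_rfl, hcd⟩
    have hd := hsub ⟨hcd, le_rfl⟩
    obtain rfl : c = 0 := le_antisymm hc.2 hc.1
    obtain rfl : d = 0 := le_antisymm hd.2 hd.1
    refine ⟨by simp, fun t ht ↦ ?_⟩
    obtain rfl : t = 0 := le_antisymm ht.2 ht.1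
    simp

/-- The chain rule for the change of frames. Continuity of `η ↦ Γ η t` belongs to `FlowDeriv` so
that nearby end points stay in both chart domains. -/
theorem FlowDeriv.chart {D : CameronMartin T 𝔢 →L[ℝ] F × (F →L[ℝ] F)}
    (h : FlowDeriv cov u S o η₀ γ P x₀ t D) (h₀ : γ t ∈ (chartAt F x₀).source)
    (h₁ : γ t ∈ (chartAt F x₁).source) :
    FlowDeriv cov u S o η₀ γ P x₁ t
      (fderiv ℝ (stateTransition x₀ x₁) (chartState x₀ γ P t) ∘L D) := by
  obtain ⟨Γ, Q, hdev, hγ, hP, hc, hD⟩ := h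
  refine ⟨Γ, Q, hdev, hγ, hP, hc, ?_⟩
  obtain ⟨L, hL, -⟩ := hasFDerivAt_stateTransition (coordMap x₀ (γ t) ∘L P t) h₀ h₁
  have e0 : chartState x₀ (Γ η₀) (Q η₀) t = chartState x₀ γ P t := by
    simp only [chartState, hγ, hP]
  have hL' : HasFDerivAt (stateTransition x₀ x₁)
      (fderiv ℝ (stateTransition x₀ x₁) (chartState x₀ γ P t)) (chartState x₀ (Γ η₀) (Q η₀) t) := by
    rw [e0]
    exact hL.differentiableAt.hasFDerivAt
  refine (HasFDerivAt.comp (g := stateTransition x₀ x₁) η₀ hL' hD).congr_of_eventuallyEq ?_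
  have hs : ∀ᶠ η in 𝓝 η₀, Γ η t ∈ (chartAt F x₀).source ∩ (chartAt F x₁).source :=
    hc.preimage_mem_nhds (((chartAt F x₀).open_source.inter (chartAt F x₁).open_source).mem_nhds
      (by rw [hγ]; exact ⟨h₀, h₁⟩))
  filter_upwards [hs] with η hη
  exact (stateTransition_chart (Q η t) hη.1 hη.2).symm

/-- The state at `e` is the local flow applied to the state at `c` and to the control on `[c, e]`,
so the chain rule and the linearized equation of the local flow give its derivative. Developments up
to `c` are concatenated with the flow in the chart. -/
theorem FlowDeriv.step (hu : ContMDiffOn (𝓘(ℝ, ℝ).prod 𝓘(ℝ, F)) 𝓘(ℝ, F).tangent ∞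
      (fun p : ℝ × M ↦ (⟨p.2, u p.1 p.2⟩ : TangentBundle 𝓘(ℝ, F) M)) (Icc 0 T ×ˢ univ))
    (hS : ContinuousOn S (Icc 0 T)) (h : IsDevelopment cov u (fun t ↦ S t (η₀ t)) γ P 0 T)
    (hab : a < b) (hsub : Icc a b ⊆ Icc 0 T) (hmap : MapsTo γ (Icc a b) (chartAt F x₀).source) :
    ∃ δ > 0, ∀ c e, c ≤ e → c ∈ Icc a b → e ∈ Icc a b →
      ∫ t in c..e, ‖((1 : ℝ), S t (η₀ t))‖ < δ →
      ∀ D, FlowDeriv cov u S o η₀ γ P x₀ c D → ∃ D', FlowDeriv cov u S o η₀ γ P x₀ e D' ∧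
        ∀ (k : CameronMartin T 𝔢) w, HasACDeriv w
          (fun t ↦ fderiv ℝ (developmentSystem cov u x₀ t) (chartState x₀ γ P t) (w t)
              (1, S t (η₀ t)) +
            developmentSystem cov u x₀ t (chartState x₀ γ P t) (0, S t (k t))) c e →
          w c = D k → w e = D' k := by
  set y := chartState x₀ γ P with hydef
  have hy := h.hasACDeriv hab.le (hsub ⟨le_rfl, hab.le⟩) (hsub ⟨hab.le, le_rfl⟩) hmap
  have hyΩ : ∀ t ∈ Icc a b, y t ∈ (chartAt F x₀).target ×ˢ (univ : Set (F →L[ℝ] F)) := fun t ht ↦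
    ⟨(chartAt F x₀).map_source (hmap ht), mem_univ _⟩
  obtain ⟨δ, hδ, hflow⟩ := exists_local_flow_of_contDiffOn hab
    ((chartAt F x₀).open_target.prod isOpen_univ)
    (A := fun t z ↦ developmentSystem cov u x₀ t z)
    ((contDiffOn_developmentSystem cov hu x₀).mono (prod_mono_left hsub)) (hy.continuousOn hab.le) hyΩ
  refine ⟨δ, hδ, fun c e hce hc he hlt D hD ↦ ?_⟩
  have hT0 : ∀ {s}, s ∈ Icc c e → s ∈ Icc a b := fun hs ↦ ⟨hc.1.trans hs.1, hs.2.trans he.2⟩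
  rcases hce.eq_or_lt with rfl | hce'
  -- For `e = c` nothing moves; below, `c < e` ensures that the concatenations take the value of the
  -- new piece at `e`.
  · exact ⟨D, hD, fun k w _ h0 ↦ h0⟩
  obtain ⟨L, hL⟩ := exists_control (hsub hc) (hsub he)
    (B := fun t ↦ ContinuousLinearMap.inr ℝ ℝ F ∘L S t) (continuousOn_const.clm_comp hS)
  -- The system is linear in `(r, α)` with `r` multiplying `u`. The constant control `r = 1`
  -- switches the drift on, and the full control `L η + β₁` is affine in `η`.
  obtain ⟨β₁, hβ₁, -⟩ := exists_Lp_one (c := c) (d := e) hce (f := fun _ ↦ ((1 : ℝ), (0 : F)))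
    intervalIntegrable_const
  have hβ : ∀ η : CameronMartin T 𝔢, ∀ᵐ t ∂(volume.restrict (Icc c e)),
      (L η + β₁) t = (1, S t (η t)) := by
    intro η
    filter_upwards [hL η, hβ₁, Lp.coeFn_add (L η) β₁] with t h1 h2 h3
    rw [h3, Pi.add_apply, h1, h2]
    simp
  have hyce : HasACDeriv y (fun t ↦ developmentSystem cov u x₀ t (y t) ((L η₀ + β₁) t)) c e := by
    refine (hy.mono hc he).congr hce (fun _ _ ↦ rfl) ?_
    filter_upwards [hβ η₀] with t ht
    rw [ht]
  have hnorm : ‖L η₀ + β₁‖ < δ := by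
    rw [← integral_norm_Lp_one hce]
    refine lt_of_eq_of_lt (intervalIntegral.integral_congr_ae ?_) hlt
    have := (ae_restrict_iff' measurableSet_Icc).1 (hβ η₀)
    filter_upwards [this] with t ht htm
    rw [uIoc_of_le hce] at htm
    rw [ht (Ioc_subset_Icc_self htm)]
  obtain ⟨Φ, Φ', hΦ0, hΦ, hΦd, hΦ'⟩ := hflow c e hce hc he _ hyce hnorm
  obtain ⟨Γ, Q, hdev, hΓ, hQ, hcont, hder⟩ := hD
  have e0 : chartState x₀ (Γ η₀) (Q η₀) c = y c := by simp only [chartState, hydef, hΓ, hQ]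
  let q : CameronMartin T 𝔢 → (F × (F →L[ℝ] F)) × Lp (ℝ × F) 1 (volume.restrict (Icc c e)) :=
    fun η ↦ (chartState x₀ (Γ η) (Q η) c, L η + β₁)
  have hq0 : q η₀ = (y c, L η₀ + β₁) := by simp only [q, e0]
  have hqd : HasFDerivAt q (D.prod L) η₀ := hder.prodMk (L.hasFDerivAt.add_const β₁)
  have hqc : Tendsto q (𝓝 η₀) (𝓝 (y c, L η₀ + β₁)) := by
    rw [← hq0]
    exact hqd.continuousAt
  let Γ' : CameronMartin T 𝔢 → ℝ → M := fun η t ↦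
    if t ≤ c then Γ η t else (chartAt F x₀).symm (Φ (q η) t).1
  let Q' : CameronMartin T 𝔢 → ℝ → F →L[ℝ] F := fun η t ↦
    if t ≤ c then Q η t else
      coordInv x₀ ((chartAt F x₀).symm (Φ (q η) t).1) ∘L (Φ (q η) t).2
  have hΓe : ∀ η, Γ' η e = (chartAt F x₀).symm (Φ (q η) e).1 := fun η ↦ if_neg (not_le.2 hce')
  have hQe : ∀ η, Q' η e = coordInv x₀ ((chartAt F x₀).symm (Φ (q η) e).1) ∘L (Φ (q η) e).2 :=
    fun η ↦ if_neg (not_le.2 hce')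
  have hes : γ e ∈ (chartAt F x₀).source := hmap he
  have hye : Φ (q η₀) e = y e := by rw [hq0]; exact hΦ0 e ⟨hce, le_rfl⟩
  have hΓ0e : Γ' η₀ e = γ e := by
    rw [hΓe, hye]
    exact (chartAt F x₀).left_inv hes
  have hs : ∀ᶠ η in 𝓝 η₀, Γ η c ∈ (chartAt F x₀).source :=
    hcont.preimage_mem_nhds ((chartAt F x₀).open_source.mem_nhds (by rw [hΓ]; exact hmap hc))
  have hΦq := hqc.eventually hΦ
  have hΦe : HasFDerivAt (fun η ↦ Φ (q η) e) (Φ' e ∘L D.prod L) η₀ := by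
    have h1 := (hΦd e ⟨hce, le_rfl⟩).hasFDerivAt
    rw [← hq0] at h1
    exact HasFDerivAt.comp (g := fun q ↦ Φ q e) η₀ h1 hqd
  refine ⟨Φ' e ∘L D.prod L, ⟨Γ', Q', ?_, hΓ0e, ?_, ?_, ?_⟩, fun k w hw hwc ↦ ?_⟩
  · filter_upwards [hdev, hs, hΦq] with η ⟨hd1, hd2, hd3⟩ hsη ⟨hφ1, hφ2, hφ3⟩
    have h1 : HasACDeriv (Φ (q η)) (fun t ↦ developmentSystem cov u x₀ t (Φ (q η) t)
        (1, S t (η t))) c e := by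
      refine hφ2.congr hce (fun _ _ ↦ rfl) ?_
      filter_upwards [hβ η] with t ht
      simp only [q]
      rw [ht]
    have h2 := (IsDevelopment.of_chart (α := fun t ↦ S t (η t)) hce h1
      fun t ht ↦ (hφ3 t ht).1).1
    have e1 : Γ η c = (chartAt F x₀).symm (Φ (q η) c).1 := by
      rw [hφ1]
      exact ((chartAt F x₀).left_inv hsη).symm
    refine ⟨hd1.piecewise h2 ((hsub hc).1) hce e1 ?_, ?_, ?_⟩
    · rw [← e1, hφ1]
      change _ = coordInv x₀ (Γ η c) ∘L (coordMap x₀ (Γ η c) ∘L Q η c)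
      rw [← ContinuousLinearMap.comp_assoc, coordInv_comp_coordMap hsη,
        ContinuousLinearMap.id_comp]
    · exact (if_pos (hsub hc).1).trans hd2
    · exact (if_pos (hsub hc).1).trans hd3
  · rw [hQe, ← hΓe, hΓ0e, hye]
    change coordInv x₀ (γ e) ∘L (coordMap x₀ (γ e) ∘L P e) = _
    rw [← ContinuousLinearMap.comp_assoc, coordInv_comp_coordMap hes, ContinuousLinearMap.id_comp]
  · simp only [hΓe]
    have h1 : ContinuousAt (chartAt F x₀).symm (Φ (q η₀) e).1 := by
      rw [hye]
      exact (chartAt F x₀).continuousAt_symm ((chartAt F x₀).map_source hes)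
    exact ContinuousAt.comp (g := (chartAt F x₀).symm) (f := fun η ↦ (Φ (q η) e).1) h1
      (continuous_fst.continuousAt.comp hΦe.continuousAt)
  · refine hΦe.congr_of_eventuallyEq ?_
    filter_upwards [hΦq] with η ⟨_, _, hφ3⟩
    have ht := (hφ3 e ⟨hce, le_rfl⟩).1
    simp only [chartState]
    rw [hQe, ← hΓe]
    have hse : Γ' η e ∈ (chartAt F x₀).source := by
      rw [hΓe]
      exact (chartAt F x₀).map_target ht
    rw [← ContinuousLinearMap.comp_assoc, coordMap_comp_coordInv hse, ContinuousLinearMap.id_comp,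
      hΓe, (chartAt F x₀).right_inv ht]
  · refine (hΦ' (D k, L k) w ?_ hwc e ⟨hce, le_rfl⟩).symm
    refine hw.congr hce (fun _ _ ↦ rfl) ?_
    filter_upwards [hβ η₀, hL k] with t h1 h2
    rw [h1, h2]
    rfl

end Flow

/-! ### Propagation of the variation `(z, K)` through charts -/

section Variation

set_option linter.unusedSectionVars false
set_option synthInstance.maxHeartbeats 200000

variable {F : Type*} [NormedAddCommGroup F] [NormedSpace ℝ F] [FiniteDimensional ℝ F]
  {M : Type*} [TopologicalSpace M] [ChartedSpace F M] [IsManifold 𝓘(ℝ, F) ∞ M] [T2Space M]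
  {cov : CovariantDerivative 𝓘(ℝ, F) F (TangentSpace 𝓘(ℝ, F) : M → Type _)}
  [CovariantDerivative.ContMDiffCovariantDerivative cov ∞]
  {𝔢 : Type*} [NormedAddCommGroup 𝔢] [InnerProductSpace ℝ 𝔢] [FiniteDimensional ℝ 𝔢]
  {T : ℝ} {u : ℝ → ∀ x : M, TangentSpace 𝓘(ℝ, F) x} {S : ℝ → 𝔢 →L[ℝ] F} {o : M}
  {x₀ x₁ x : M} {η₀ k : CameronMartin T 𝔢} {γ : ℝ → M} {P : ℝ → F →L[ℝ] F} {a b c d e m t : ℝ}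
  {B K : ℝ → F →L[ℝ] F} {C C' : ℝ → F →L[ℝ] F →L[ℝ] F} {z : ℝ → F}

/-- The variation `(z, K)` of a development of `S η₀` in the direction `k`, in the moving frame:
`z` is the variation of the curve and `K` that of the frame. -/
def IsVariation (S : ℝ → 𝔢 →L[ℝ] F) (η₀ : CameronMartin T 𝔢) (B : ℝ → F →L[ℝ] F)
    (C : ℝ → F →L[ℝ] F →L[ℝ] F) (k : CameronMartin T 𝔢) (z : ℝ → F) (K : ℝ → F →L[ℝ] F)
    (c e : ℝ) : Prop :=
  HasACDeriv z (fun t ↦ S t (k t) + K t (S t (η₀ t)) + B t (z t)) c e ∧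
    HasACDeriv K (fun t ↦ C t (z t)) c e

theorem IsVariation.mono (h : IsVariation S η₀ B C k z K a b) (hc : c ∈ Icc a b) (hd : d ∈ Icc a b) :
    IsVariation S η₀ B C k z K c d :=
  ⟨h.1.mono hc hd, h.2.mono hc hd⟩

theorem IsVariation.congr (h : IsVariation S η₀ B C k z K a b) (hab : a ≤ b)
    (hC : ∀ᵐ t ∂(volume.restrict (Icc a b)), C t = C' t) : IsVariation S η₀ B C' k z K a b :=
  ⟨h.1, h.2.congr hab (fun _ _ ↦ rfl) (by filter_upwards [hC] with t ht; rw [ht])⟩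

/-- `C` transports derivatives of the developments over `[c, d]`. -/
def TransportsVariation (cov : CovariantDerivative 𝓘(ℝ, F) F (TangentSpace 𝓘(ℝ, F) : M → Type _))
    (u : ℝ → ∀ x : M, TangentSpace 𝓘(ℝ, F) x) (S : ℝ → 𝔢 →L[ℝ] F) (o : M)
    (η₀ : CameronMartin T 𝔢) (γ : ℝ → M) (P : ℝ → F →L[ℝ] F)
    (B : ℝ → F →L[ℝ] F) (C : ℝ → F →L[ℝ] F →L[ℝ] F) (c d : ℝ) : Prop :=
  ∀ e ∈ Icc c d, ∀ x₀ D, γ c ∈ (chartAt F x₀).source → FlowDeriv cov u S o η₀ γ P x₀ c D →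
    ∀ x₁, γ e ∈ (chartAt F x₁).source → ∃ D', FlowDeriv cov u S o η₀ γ P x₁ e D' ∧
      ∀ k z K, IsVariation S η₀ B C k z K c e →
        D k = variationState cov x₀ (chartState x₀ γ P c) (z c) (K c) →
        D' k = variationState cov x₁ (chartState x₁ γ P e) (z e) (K e)

/-- Derivatives are handed over at time `m` in the chart at `γ m`, which is possible since all
charts are allowed at both ends. The two operators are spliced at `m`; their values there are
irrelevant. -/
theorem TransportsVariation.glue (h1 : TransportsVariation cov u S o η₀ γ P B C c m)
    (h2 : TransportsVariation cov u S o η₀ γ P B C' m d) (hcm : c ≤ m) :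
    TransportsVariation cov u S o η₀ γ P B (fun t ↦ if t ≤ m then C t else C' t) c d := by
  intro e he x₀ D hx₀ hD x₁ hx₁
  have hc1 : ∀ {e'}, e' ≤ m → ∀ᵐ t ∂(volume.restrict (Icc c e')),
      (if t ≤ m then C t else C' t) = C t := fun {e'} hle ↦ by
    filter_upwards [ae_restrict_mem measurableSet_Icc] with t ht
    rw [if_pos (ht.2.trans hle)]
  rcases le_or_gt e m with hem | hme
  · obtain ⟨D', hD', hv⟩ := h1 e ⟨he.1, hem⟩ x₀ D hx₀ hD x₁ hx₁
    exact ⟨D', hD', fun k z K h ↦ hv k z K (h.congr he.1 (hc1 hem))⟩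
  · obtain ⟨Dm, hDm, hvm⟩ := h1 m ⟨hcm, le_rfl⟩ x₀ D hx₀ hD (γ m) (mem_chart_source F (γ m))
    obtain ⟨D', hD', hv⟩ := h2 e ⟨hme.le, he.2⟩ (γ m) Dm (mem_chart_source F (γ m)) hDm x₁ hx₁
    refine ⟨D', hD', fun k z K h h0 ↦ hv k z K ?_ (hvm k z K ?_ h0)⟩
    · refine (h.mono ⟨hcm, hme.le⟩ ⟨he.1, le_rfl⟩).congr hme.le ?_
      filter_upwards [ae_mem_Ioo m e] with t ht
      rw [if_neg (not_le.2 ht.1)]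
    · exact (h.mono ⟨le_rfl, he.1⟩ ⟨hcm, hme.le⟩).congr hcm (hc1 le_rfl)

/-- Conjugation with changes of charts, under which `variationState` is invariant, reduces the claim
to one chart around the whole piece. -/
theorem TransportsVariation.of_step (hmap : MapsTo γ (Icc c d) (chartAt F x₀).source)
    (h : ∀ e ∈ Icc c d, ∀ D, FlowDeriv cov u S o η₀ γ P x₀ c D →
      ∃ D', FlowDeriv cov u S o η₀ γ P x₀ e D' ∧ ∀ k z K, IsVariation S η₀ B C k z K c e →
        D k = variationState cov x₀ (chartState x₀ γ P c) (z c) (K c) →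
        D' k = variationState cov x₀ (chartState x₀ γ P e) (z e) (K e)) :
    TransportsVariation cov u S o η₀ γ P B C c d := by
  intro e he x₂ D hx₂ hD x₁ hx₁
  have hc := hmap ⟨le_rfl, he.1.trans he.2⟩
  obtain ⟨D', hD', hv⟩ := h e he _ (hD.chart hx₂ hc)
  refine ⟨_, hD'.chart (hmap he) hx₁, fun k z K hk h0 ↦ ?_⟩
  rw [ContinuousLinearMap.comp_apply, hv k z K hk]
  · exact fderiv_stateTransition_variationState _ _ (hmap he) hx₁
  · rw [ContinuousLinearMap.comp_apply, h0]
    exact fderiv_stateTransition_variationState _ _ hx₂ hc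

/-- There are two nested subdivisions: first into pieces inside one chart, then into pieces on which
the control is small enough for the local flow. On each of them the linearized flow is matched with
the equations in the frame. The operator `C` is quantified inside the induction because it is built
in the chart of each piece. -/
theorem exists_transportsVariation (hT : 0 < T)
    (hu : ContMDiffOn (𝓘(ℝ, ℝ).prod 𝓘(ℝ, F)) 𝓘(ℝ, F).tangent ∞
      (fun p : ℝ × M ↦ (⟨p.2, u p.1 p.2⟩ : TangentBundle 𝓘(ℝ, F) M)) (Icc 0 T ×ˢ univ))
    (hS : ContinuousOn S (Icc 0 T)) (h : IsDevelopment cov u (fun t ↦ S t (η₀ t)) γ P 0 T)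
    (hinj : ∀ t ∈ Icc 0 T, Function.Injective (P t))
    (hB : ∀ᵐ t ∂(volume.restrict (Icc 0 T)), ∀ w, P t (B t w) = jacobiField cov u γ t (P t w)) :
    ∃ C, NormedIntegrable C 0 T ∧ TransportsVariation cov u S o η₀ γ P B C 0 T := by
  have hα : IntervalIntegrable (fun t ↦ S t (η₀ t)) volume 0 T :=
    intervalIntegrable_clm_apply hT.le hS (η₀.intervalIntegrable hT.le)
  have hglue : ∀ c m d, c ≤ m → m ≤ d →
      (∃ C, NormedIntegrable C c m ∧ TransportsVariation cov u S o η₀ γ P B C c m) →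
      (∃ C, NormedIntegrable C m d ∧ TransportsVariation cov u S o η₀ γ P B C m d) →
      ∃ C, NormedIntegrable C c d ∧ TransportsVariation cov u S o η₀ γ P B C c d := by
    rintro c m d hcm hmd ⟨C, hC, hC'⟩ ⟨C₁, hC₁, hC₁'⟩
    exact ⟨_, hC.piecewise hC₁ hcm hmd, hC'.glue hC₁' hcm⟩
  refine interval_induction_chart F (p := fun c d ↦ ∃ C, NormedIntegrable C c d ∧
    TransportsVariation cov u S o η₀ γ P B C c d) h.1 hT.le (fun x₀ a b hab ha hb hmap ↦ ?_)
    fun c m d hcm hmd _ _ ↦ hglue c m d hcm hmd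
  rcases hab.eq_or_lt with rfl | hab'
  · refine ⟨0, by simp [NormedIntegrable], TransportsVariation.of_step hmap fun e he D hD ↦ ?_⟩
    obtain rfl : e = a := le_antisymm he.2 he.1
    exact ⟨D, hD, fun k z K _ h0 ↦ h0⟩
  have hsub : Icc a b ⊆ Icc 0 T := Icc_subset_Icc ha.1 hb.2
  obtain ⟨δ, hδ, hstep⟩ := FlowDeriv.step (o := o) hu hS h hab' hsub hmap
  have hf : IntervalIntegrable (fun t ↦ ((1 : ℝ), S t (η₀ t))) volume a b := by
    have h1 := hα.mono_set (uIcc_subset_uIcc (Icc_subset_uIcc ha) (Icc_subset_uIcc hb))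
    rw [intervalIntegrable_iff_integrableOn_Icc_of_le hab] at h1 ⊢
    exact Integrable.prodMk (integrable_const _) h1
  refine interval_induction_integral hf hδ (p := fun c d ↦ ∃ C, NormedIntegrable C c d ∧
    TransportsVariation cov u S o η₀ γ P B C c d) hab (fun c d hcd hc hd hlt ↦ ?_)
    fun c m d hcm hmd _ _ ↦ hglue c m d hcm hmd
  have hsub' : Icc c d ⊆ Icc a b := Icc_subset_Icc hc.1 hd.2
  have hmap' : MapsTo γ (Icc c d) (chartAt F x₀).source := hmap.mono hsub' subset_rfl
  have hy := h.hasACDeriv hcd (hsub hc) (hsub hd) hmap'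
  have hyt : ∀ t ∈ Icc c d, (chartState x₀ γ P t).1 ∈ (chartAt F x₀).target := fun t ht ↦
    (chartAt F x₀).map_source (hmap' ht)
  have hξ := hy.clm_comp (ContinuousLinearMap.fst ℝ F (F →L[ℝ] F))
  obtain ⟨C, hC, hC'⟩ := exists_curvatureOperator cov (x₀ := x₀) (y := chartState x₀ γ P)
    (v := fun t ↦ (chartState x₀ γ P t).2 (S t (η₀ t)) +
      (1 : ℝ) • fieldCoord (u t) x₀ (chartState x₀ γ P t).1) hcd
    (hy.continuousOn hcd) hyt
    (fun t ht ↦ (coordMap_injective (hmap' ht)).comp (hinj t (hsub (hsub' ht)))) hξ.1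
  refine ⟨C, hC, TransportsVariation.of_step hmap' fun e he D hD ↦ ?_⟩
  have hle : ∫ t in c..e, ‖((1 : ℝ), S t (η₀ t))‖ < δ := by
    refine lt_of_le_of_lt (intervalIntegral.integral_mono_interval le_rfl he.1 he.2
      (.of_forall fun _ ↦ norm_nonneg _) ?_) hlt
    exact (hf.mono_set (uIcc_subset_uIcc (Icc_subset_uIcc hc) (Icc_subset_uIcc hd))).norm
  obtain ⟨D', hD', hv⟩ := hstep c e he.1 hc (hsub' he) hle D hD
  refine ⟨D', hD', fun k z K hk h0 ↦
    (hv k (fun t ↦ variationState cov x₀ (chartState x₀ γ P t) (z t) (K t)) ?_ h0.symm).symm⟩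
  have hsubce : Icc c e ⊆ Icc c d := Icc_subset_Icc le_rfl he.2
  refine hasACDeriv_variationState hu he.1 (hsubce.trans (hsub'.trans hsub))
    (hy.mono ⟨le_rfl, hcd⟩ he) (fun t ht ↦ hyt t (hsubce ht)) hk.1 hk.2 ?_ ?_
  · filter_upwards [ae_restrict_of_ae_restrict_of_subset (hsubce.trans (hsub'.trans hsub)) hB,
      ae_restrict_of_ae_restrict_of_subset hsubce hξ.ae_hasDerivAt, ae_mem_Ioo c e]
      with t hBt hξt ht w
    have htd := hsubce (Ioo_subset_Icc_self ht)
    have h1 := coordMap_jacobiField (P := P) cov hu (hsub (hsub' htd)) (hmap' htd)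
      (h.1.continuousAt (mem_of_superset (Icc_mem_nhds ht.1 ht.2)
        (hsubce.trans (hsub'.trans hsub)))) hξt w
    change coordMap x₀ (γ t) (P t (B t w)) = _
    rw [hBt w, h1, ← one_smul ℝ (fieldCoord (u t) x₀ (chartState x₀ γ P t).1)]
    rfl
  · refine (ae_restrict_iff' measurableSet_Icc).2 (.of_forall fun t ht w ↦ ?_)
    rw [hC' t (hsubce ht) w, one_smul]

end Variation

/-! ### The differential of the endpoint map -/

section Regular

set_option linter.unusedSectionVars false
set_option synthInstance.maxHeartbeats 200000

variable {F : Type*} [NormedAddCommGroup F] [NormedSpace ℝ F] [FiniteDimensional ℝ F]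
  {M : Type*} [TopologicalSpace M] [ChartedSpace F M] [IsManifold 𝓘(ℝ, F) ∞ M] [T2Space M]
  {cov : CovariantDerivative 𝓘(ℝ, F) F (TangentSpace 𝓘(ℝ, F) : M → Type _)}
  [CovariantDerivative.ContMDiffCovariantDerivative cov ∞]
  {𝔢 : Type*} [NormedAddCommGroup 𝔢] [InnerProductSpace ℝ 𝔢] [FiniteDimensional ℝ 𝔢]
  {T : ℝ} {u : ℝ → ∀ x : M, TangentSpace 𝓘(ℝ, F) x} {o : M}
  {x₀ x₁ x : M} {η₀ k : CameronMartin T 𝔢} {γ : ℝ → M} {P : ℝ → F →L[ℝ] F} {a b c d e m t : ℝ}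
  {B : ℝ → F →L[ℝ] F} {C : ℝ → F →L[ℝ] F →L[ℝ] F} {α f : ℝ → F}
  {ι : 𝔢 →L[ℝ] TangentSpace 𝓘(ℝ, F) o} {J : ℕ} {σ : Fin J → ℝ → 𝔢}

/-- The operator `(z, K) ↦ (R (K α) + B z, C z)`. -/
noncomputable def variationOperator (R : F →L[ℝ] F) :
    F × (F →L[ℝ] F) × (F →L[ℝ] F →L[ℝ] F) →L[ℝ] F × (F →L[ℝ] F) →L[ℝ] F × (F →L[ℝ] F) :=
  let X := F × (F →L[ℝ] F)
  ((ContinuousLinearMap.compL ℝ X (F →L[ℝ] F) X).flip (ContinuousLinearMap.snd ℝ F (F →L[ℝ] F)) ∘L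
      ContinuousLinearMap.compL ℝ (F →L[ℝ] F) F X (ContinuousLinearMap.inl ℝ F (F →L[ℝ] F) ∘L R) ∘L
      ContinuousLinearMap.apply ℝ F).coprod
    (((ContinuousLinearMap.compL ℝ X F X).flip (ContinuousLinearMap.fst ℝ F (F →L[ℝ] F)) ∘L
      ContinuousLinearMap.compL ℝ F F X (ContinuousLinearMap.inl ℝ F (F →L[ℝ] F))).coprod
    ((ContinuousLinearMap.compL ℝ X F X).flip (ContinuousLinearMap.fst ℝ F (F →L[ℝ] F)) ∘L
      ContinuousLinearMap.compL ℝ F (F →L[ℝ] F) X (ContinuousLinearMap.inr ℝ F (F →L[ℝ] F))))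

theorem variationOperator_apply (R : F →L[ℝ] F) (v : F) (b : F →L[ℝ] F) (c : F →L[ℝ] F →L[ℝ] F)
    (y : F × (F →L[ℝ] F)) :
    variationOperator R (v, b, c) y = (R (y.2 v) + b y.1, c y.1) := by
  change ((R (y.2 v), 0) : F × (F →L[ℝ] F)) + ((b y.1, 0) + (0, c y.1)) = _
  simp

/-- A linear equation for the pair `(z, K)`. The extra operator `R` is the identity for genuine
variations; `exists_covector` takes for `R` a projection that kills `ι(𝔢)`, so as to prescribe the
control part of `z'`. -/
theorem exists_variation_ode (hab : a ≤ b) (hα : IntervalIntegrable α volume a b)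
    (hB : IntervalIntegrable B volume a b) (hC : NormedIntegrable C a b)
    (hf : IntervalIntegrable f volume a b) (R : F →L[ℝ] F) :
    ∃ (z : ℝ → F) (K : ℝ → F →L[ℝ] F),
      HasACDeriv z (fun t ↦ f t + R (K t (α t)) + B t (z t)) a b ∧
      HasACDeriv K (fun t ↦ C t (z t)) a b ∧ z a = 0 ∧ K a = 0 := by
  have h1 : NormedIntegrable (fun t ↦ variationOperator R (α t, B t, C t)) a b := by
    unfold NormedIntegrable at hC ⊢
    rw [intervalIntegrable_iff_integrableOn_Icc_of_le hab] at *
    exact (variationOperator R).integrable_comp (Integrable.prodMk hα (Integrable.prodMk hB hC))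
  have h2 : IntervalIntegrable (fun t ↦ (f t, (0 : F →L[ℝ] F))) volume a b := by
    rw [intervalIntegrable_iff_integrableOn_Icc_of_le hab] at *
    exact Integrable.prodMk hf (integrable_zero _ _ _)
  obtain ⟨y, hy, hy0⟩ := exists_linear_ode hab h1 h2 ⟨le_rfl, hab⟩ 0
  refine ⟨fun t ↦ (y t).1, fun t ↦ (y t).2, ?_, ?_, congrArg Prod.fst hy0,
    congrArg Prod.snd hy0⟩
  · refine (hy.clm_comp (ContinuousLinearMap.fst ℝ F (F →L[ℝ] F))).congr_fun hab (fun _ _ ↦ rfl)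
      fun t _ ↦ ?_
    simp only [variationOperator_apply]
    change R ((y t).2 (α t)) + B t (y t).1 + f t = _
    abel
  · refine (hy.clm_comp (ContinuousLinearMap.snd ℝ F (F →L[ℝ] F))).congr_fun hab (fun _ _ ↦ rfl)
      fun t _ ↦ ?_
    simp only [variationOperator_apply]
    exact add_zero _

/-- The derivative of the endpoint map, in the moving frame. -/
theorem exists_endpointDerivative (hT : 0 < T)
    (hu : ContMDiffOn (𝓘(ℝ, ℝ).prod 𝓘(ℝ, F)) 𝓘(ℝ, F).tangent ∞
      (fun p : ℝ × M ↦ (⟨p.2, u p.1 p.2⟩ : TangentBundle 𝓘(ℝ, F) M)) (Icc 0 T ×ˢ univ))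
    (hσ : ∀ j, ContinuousOn (σ j) (Icc 0 T))
    (h : IsDevelopment cov u (fun t ↦ controlMap ι σ t (η₀ t)) γ P 0 T) (h0 : γ 0 = o)
    (hP0 : P 0 = ContinuousLinearMap.id ℝ F)
    (htr : TransportsVariation cov u (controlMap ι σ) o η₀ γ P B C 0 T) :
    ∃ A : CameronMartin T 𝔢 →ₗ[ℝ] F,
      (IsRegularPoint cov ι σ u T η₀ ↔ Function.Surjective A) ∧
      ∀ k z K, IsVariation (controlMap ι σ) η₀ B C k z K 0 T → z 0 = 0 → K 0 = 0 → A k = z T := by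
  have hinj : ∀ t ∈ Icc 0 T, Function.Injective (P t) := fun t ht ↦
    h.isTransport.injective ⟨le_rfl, hT.le⟩ ht (by rw [hP0]; exact Function.injective_id)
  obtain ⟨D, hD, hDk⟩ := htr T ⟨hT.le, le_rfl⟩ (γ 0) 0 (mem_chart_source F (γ 0))
    (FlowDeriv.zero h0 hP0 (γ 0)) (γ T) (mem_chart_source F (γ T))
  obtain ⟨Γ, Q, hdev, hΓ, hQ, hcont, hder⟩ := hD
  -- Solutions exist for all controls near `η₀`, and by uniqueness the solution selected by choice
  -- in `endpointMap` ends where the flow does.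
  have hend : endpointMap cov ι σ u T =ᶠ[𝓝 η₀] fun η ↦ Γ η T := by
    filter_upwards [hdev] with η ⟨h1, h2, h3⟩
    have hex : ∃ γ, IsSolution cov ι σ u T η γ := ⟨Γ η, h1.isSolution hu hT.le hσ h2 h3⟩
    have he : endpointMap cov ι σ u T η = hex.choose T := dif_pos hex
    rw [he]
    obtain ⟨P', hP', hγ0', hP0'⟩ := hex.choose_spec.exists_isDevelopment
    exact (hP'.eqOn hu hT (intervalIntegrable_control hT.le hσ) h1 hT.le ⟨le_rfl, hT.le⟩
      ⟨hT.le, le_rfl⟩ (by rw [hγ0', h2]) (by rw [hP0', h3]) T ⟨hT.le, le_rfl⟩).1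
  have hm : HasMFDerivAt 𝓘(ℝ, CameronMartin T 𝔢) 𝓘(ℝ, F) (fun η ↦ Γ η T) η₀
      (ContinuousLinearMap.fst ℝ F (F →L[ℝ] F) ∘L D) := by
    refine ⟨hcont, ?_⟩
    have h1 := (ContinuousLinearMap.fst ℝ F (F →L[ℝ] F)).hasFDerivAt.comp η₀ hder
    simp only [writtenInExtChartAt, mfld_simps, hΓ]
    exact h1.hasFDerivWithinAt
  have hm' := hm.congr_of_eventuallyEq hend
  have hreg : IsRegularPoint cov ι σ u T η₀ ↔ Function.Surjective fun k ↦ (D k).1 := by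
    constructor
    · rintro ⟨-, h⟩
      rw [hm'.mfderiv] at h
      exact h
    · intro h
      refine ⟨hm'.mdifferentiableAt, ?_⟩
      rw [hm'.mfderiv]
      exact h
  have hTm : T ∈ Icc 0 T := ⟨hT.le, le_rfl⟩
  have hDk' : ∀ k z K, IsVariation (controlMap ι σ) η₀ B C k z K 0 T → z 0 = 0 → K 0 = 0 →
      (D k).1 = (coordMap (γ T) (γ T) ∘L P T) (z T) := by
    intro k z K hk hz hK
    rw [hDk k z K hk (by simp [variationState, hz, hK]; rfl)]
    rfl
  have hinjT : Function.Injective (coordMap (γ T) (γ T) ∘L P T) :=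
    (coordMap_injective (mem_chart_source F (γ T))).comp (hinj T hTm)
  -- The frame at time `T` in the chart at `γ T`; composing the differential with its inverse leaves
  -- surjectivity unchanged and turns the value at `k` into `z T`.
  let E : F ≃ₗ[ℝ] F := LinearEquiv.ofInjectiveEndo
    (coordMap (γ T) (γ T) ∘L P T : F →ₗ[ℝ] F) hinjT
  refine ⟨E.symm.toLinearMap ∘ₗ
    (ContinuousLinearMap.fst ℝ F (F →L[ℝ] F) ∘L D : CameronMartin T 𝔢 →ₗ[ℝ] F),
    hreg.trans (E.symm.toEquiv.comp_surjective (fun k ↦ (D k).1)).symm, fun k z K hk hz hK ↦ ?_⟩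
  change E.symm (D k).1 = z T
  rw [LinearEquiv.symm_apply_eq, hDk' k z K hk hz hK]
  rfl

end Regular

/-! ### Covectors annihilating the image of the differential -/

section Covector

set_option linter.unusedSectionVars false
set_option synthInstance.maxHeartbeats 200000

variable {F : Type*} [NormedAddCommGroup F] [NormedSpace ℝ F] [FiniteDimensional ℝ F]
  {M : Type*} [TopologicalSpace M] [ChartedSpace F M] [IsManifold 𝓘(ℝ, F) ∞ M] [T2Space M]
  {cov : CovariantDerivative 𝓘(ℝ, F) F (TangentSpace 𝓘(ℝ, F) : M → Type _)}
  [CovariantDerivative.ContMDiffCovariantDerivative cov ∞]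
  {𝔢 : Type*} [NormedAddCommGroup 𝔢] [InnerProductSpace ℝ 𝔢] [FiniteDimensional ℝ 𝔢]
  {T : ℝ} {u : ℝ → ∀ x : M, TangentSpace 𝓘(ℝ, F) x} {o : M} {S : ℝ → 𝔢 →L[ℝ] F}
  {η₀ k : CameronMartin T 𝔢} {γ : ℝ → M} {P : ℝ → F →L[ℝ] F} {a b e t : ℝ}
  {B K : ℝ → F →L[ℝ] F} {C : ℝ → F →L[ℝ] F →L[ℝ] F} {z z' : ℝ → F} {μ μ' : ℝ → F →L[ℝ] ℝ}
  {ι : 𝔢 →L[ℝ] TangentSpace 𝓘(ℝ, F) o} {J : ℕ} {σ : Fin J → ℝ → 𝔢}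

/-- The only place where the variation meets the holonomy hypothesis. For all controls `η₀ + r k`
near `η₀` the frame at time `e` maps `s` into `E`; differentiating in `r`, the covariant derivative
of this section is `P (K s)`, and it lies in `E`. This replaces any statement that curvature
preserves `𝔢`. -/
theorem IsVariation.apply_mem (hE : HolonomyPreserves cov ι)
    (h : IsDevelopment cov u (fun t ↦ S t (η₀ t)) γ P 0 T) (h0 : γ 0 = o)
    (hP0 : P 0 = ContinuousLinearMap.id ℝ F)
    (htr : TransportsVariation cov u S o η₀ γ P B C 0 T)
    (hk : IsVariation S η₀ B C k z K 0 T) (hz0 : z 0 = 0) (hK0 : K 0 = 0)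
    (he : e ∈ Icc 0 T) {s : F} (hs : s ∈ modelE ι) : K e s ∈ modelE ι := by
  have hT0 : (0 : ℝ) ∈ Icc 0 T := ⟨le_rfl, he.1.trans he.2⟩
  have hinj : Function.Injective (P e) :=
    h.isTransport.injective hT0 he (by rw [hP0]; exact Function.injective_id)
  have hes := mem_chart_source F (γ e)
  obtain ⟨D, ⟨Γ, Q, hdev, hΓ, hQ, hcont, hder⟩, hD⟩ := htr e he (γ 0) 0 (mem_chart_source F (γ 0))
    (FlowDeriv.zero h0 hP0 (γ 0)) (γ e) hes
  have hDk := hD k z K (hk.mono hT0 he) (by simp [variationState, hz0, hK0]; rfl)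
  have hline : HasDerivAt (fun r : ℝ ↦ η₀ + r • k) k 0 := by
    simpa using ((hasDerivAt_id (0 : ℝ)).smul_const k).const_add η₀
  have hl0 : η₀ + (0 : ℝ) • k = η₀ := by simp
  have hl : Tendsto (fun r : ℝ ↦ η₀ + r • k) (𝓝 0) (𝓝 η₀) := by
    have := hline.continuousAt
    rwa [ContinuousAt, hl0] at this
  have hy : HasDerivAt (fun r : ℝ ↦ chartState (γ e) (Γ (η₀ + r • k)) (Q (η₀ + r • k)) e) (D k) 0 := by
    rw [← hl0] at hder
    exact hder.comp_hasDerivAt 0 hline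
  have hy0 : chartState (γ e) (Γ (η₀ + (0 : ℝ) • k)) (Q (η₀ + (0 : ℝ) • k)) e =
      chartState (γ e) γ P e := by
    rw [hl0]
    simp only [chartState, hΓ, hQ]
  have hpinj : Function.Injective (coordMap (γ e) (γ e) ∘L P e) := (coordMap_injective hes).comp hinj
  have hsrc : ∀ᶠ η in 𝓝 η₀, Γ η e ∈ (chartAt F (γ e)).source :=
    hcont.preimage_mem_nhds ((chartAt F (γ e)).open_source.mem_nhds (by rw [hΓ]; exact hes))
  have hfst : HasDerivAt
      (fun r : ℝ ↦ (chartState (γ e) (Γ (η₀ + r • k)) (Q (η₀ + r • k)) e).1) (D k).1 0 :=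
    (ContinuousLinearMap.fst ℝ F (F →L[ℝ] F)).hasFDerivAt.comp_hasDerivAt 0 hy
  have hsnd : HasDerivAt
      (fun r : ℝ ↦ (chartState (γ e) (Γ (η₀ + r • k)) (Q (η₀ + r • k)) e).2) (D k).2 0 :=
    (ContinuousLinearMap.snd ℝ F (F →L[ℝ] F)).hasFDerivAt.comp_hasDerivAt 0 hy
  obtain ⟨s', hs', e1⟩ := MapsToE.exists_deriv_eq (x₀ := γ e) (s := s) hE hfst hsnd (by
      rw [hy0]; exact (chartAt F (γ e)).map_source hes) (by rw [hy0]; exact hpinj) (by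
      filter_upwards [hl.eventually hdev, hl.eventually hsrc] with r ⟨h1, h2, h3⟩ h4
      have h5 := h1.isTransport.mapsToE hE he.1 h2 h3
      have e2 : (chartAt F (γ e)).symm (chartState (γ e) (Γ (η₀ + r • k)) (Q (η₀ + r • k)) e).1 =
        Γ (η₀ + r • k) e := (chartAt F (γ e)).left_inv h4
      rw [e2]
      change MapsToE cov ι _ (coordInv (γ e) _ ∘L (coordMap (γ e) _ ∘L _))
      rwa [← ContinuousLinearMap.comp_assoc, coordInv_comp_coordMap h4,
        ContinuousLinearMap.id_comp]) hs
  rw [hy0, hDk] at e1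
  simp only [variationState, _root_.sub_apply, ContinuousLinearMap.comp_apply] at e1
  -- The Christoffel term of `variationState` cancels that of the covariant derivative, which leaves
  -- `P (K s) = P s'` in coordinates.
  rw [sub_add_cancel] at e1
  have e2 : K e s = s' := hpinj e1
  rwa [e2]

theorem HasACDeriv.apply (hab : a ≤ b) (hμ : HasACDeriv μ μ' a b) (hz : HasACDeriv z z' a b) :
    HasACDeriv (fun t ↦ μ t (z t)) (fun t ↦ μ t (z' t) + μ' t (z t)) a b := by
  have hd : ∀ q : (F →L[ℝ] ℝ) × F, HasFDerivAt (fun q : (F →L[ℝ] ℝ) × F ↦ q.1 q.2)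
      (q.1 ∘L ContinuousLinearMap.snd ℝ (F →L[ℝ] ℝ) F +
        (ContinuousLinearMap.fst ℝ (F →L[ℝ] ℝ) F).flip q.2) q := fun q ↦
    hasFDerivAt_fst.clm_apply hasFDerivAt_snd
  have hc : ContDiffOn ℝ 1 (fun q : (F →L[ℝ] ℝ) × F ↦ q.1 q.2) univ :=
    contDiff_fst.clm_apply contDiff_snd |>.contDiffOn
  refine ((hμ.prodMk hz).comp_contDiffOn hab isOpen_univ hc fun _ _ ↦ mem_univ _).congr_fun hab
    (fun _ _ ↦ rfl) fun t _ ↦ ?_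
  beta_reduce
  rw [(hd _).fderiv]
  rfl

/-- A covector that is transported backwards annihilates all variations. -/
theorem IsVariation.covector_apply_eq_zero (hab : 0 ≤ T) (hS : ∀ t v, S t v ∈ modelE ι)
    (hK : ∀ t ∈ Icc 0 T, ∀ s ∈ modelE ι, K t s ∈ modelE ι)
    (hk : IsVariation S η₀ B C k z K 0 T) (hz0 : z 0 = 0)
    (hμ : HasACDeriv μ (fun t ↦ -(μ t ∘L B t)) 0 T)
    (hμ0 : ∀ t ∈ Icc 0 T, ∀ s ∈ modelE ι, μ t s = 0) : μ T (z T) = 0 := by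
  have h1 := (hμ.apply hab hk.1).congr_fun (g := fun t ↦ μ t (z t)) (g' := fun _ ↦ (0 : ℝ)) hab
    (fun _ _ ↦ rfl) fun t ht ↦ by
      simp only [map_add, _root_.neg_apply, ContinuousLinearMap.comp_apply,
        hμ0 t ht _ (hS t (k t)), hμ0 t ht _ (hK t ht _ (hS t (η₀ t)))]
      ring
  have h2 := h1.2 T ⟨hab, le_rfl⟩
  simpa [hz0] using h2

theorem exists_covector_ode (hab : a ≤ b) (hB : IntervalIntegrable B volume a b) (ℓ : F →L[ℝ] ℝ) :
    ∃ μ : ℝ → F →L[ℝ] ℝ, HasACDeriv μ (fun t ↦ -(μ t ∘L B t)) a b ∧ μ b = ℓ := by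
  have h1 : NormedIntegrable
      (fun t ↦ (-(ContinuousLinearMap.compL ℝ F F ℝ).flip) (B t)) a b := by
    unfold NormedIntegrable
    rw [intervalIntegrable_iff_integrableOn_Icc_of_le hab] at *
    exact (-(ContinuousLinearMap.compL ℝ F F ℝ).flip).integrable_comp hB
  obtain ⟨μ, hμ, hμb⟩ := exists_linear_ode hab h1 (intervalIntegrable_const (c := 0))
    ⟨hab, le_rfl⟩ ℓ
  exact ⟨μ, hμ.congr_fun hab (fun _ _ ↦ rfl) fun t _ ↦ add_zero _, hμb⟩

/-- The equation is linear and homogeneous, so a zero at one time would propagate to the final time.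
-/
theorem covector_ne_zero (hab : a ≤ b) (hB : IntervalIntegrable B volume a b)
    (hμ : HasACDeriv μ (fun t ↦ -(μ t ∘L B t)) a b) (hμb : μ b ≠ 0) : ∀ t ∈ Icc a b, μ t ≠ 0 :=
  fun t ht h0 ↦ hμb (eq_zero_of_norm_deriv_le hab hμ hB.norm (.of_forall fun s ↦ by
    rw [norm_neg, mul_comm]; exact ContinuousLinearMap.opNorm_comp_le _ _) ht h0 b ⟨hab, le_rfl⟩)

theorem eq_zero_of_integral_sq_norm {G : Type*} [NormedAddCommGroup G] {f : ℝ → G} (hab : a < b)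
    (hf : ContinuousOn f (Icc a b)) (h : ∫ t in a..b, ‖f t‖ ^ 2 = 0) : ∀ t ∈ Icc a b, f t = 0 := by
  have hc : ContinuousOn (fun t ↦ ‖f t‖ ^ 2) (Icc a b) := hf.norm.pow 2
  have hi : IntervalIntegrable (fun t ↦ ‖f t‖ ^ 2) volume a b := by
    rw [← uIcc_of_le hab.le] at hc
    exact hc.intervalIntegrable
  rw [intervalIntegral.integral_eq_zero_iff_of_le_of_nonneg_ae hab.le
    (.of_forall fun _ ↦ by positivity) hi] at h
  have h2 : (fun t ↦ ‖f t‖ ^ 2) =ᵐ[volume.restrict (Icc a b)] fun _ ↦ 0 := by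
    rw [← Measure.restrict_congr_set Ioc_ae_eq_Icc]
    exact h
  intro t ht
  have h3 := Measure.eqOn_Icc_of_ae_eq volume hab.ne h2 hc continuousOn_const ht
  simpa using h3

/-- If the endpoint map is singular then a covector that is transported backwards annihilates `E`. -/
theorem exists_covector (hT : 0 < T) (hι : Function.Injective ι) (hE : HolonomyPreserves cov ι)
    (hσ : ∀ j, ContinuousOn (σ j) (Icc 0 T))
    (hA : ∀ t ∈ Icc 0 T, Function.Surjective (covariance σ t))
    (h : IsDevelopment cov u (fun t ↦ controlMap ι σ t (η₀ t)) γ P 0 T) (h0 : γ 0 = o)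
    (hP0 : P 0 = ContinuousLinearMap.id ℝ F)
    (hB : IntervalIntegrable B volume 0 T) (hC : NormedIntegrable C 0 T)
    (htr : TransportsVariation cov u (controlMap ι σ) o η₀ γ P B C 0 T)
    {A : CameronMartin T 𝔢 →ₗ[ℝ] F} (hns : ¬ Function.Surjective A)
    (hAk : ∀ k z K, IsVariation (controlMap ι σ) η₀ B C k z K 0 T → z 0 = 0 → K 0 = 0 →
      A k = z T) :
    ∃ μ : ℝ → F →L[ℝ] ℝ, HasACDeriv μ (fun t ↦ -(μ t ∘L B t)) 0 T ∧ (∀ t ∈ Icc 0 T, μ t ≠ 0) ∧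
      ∀ t ∈ Icc 0 T, ∀ s ∈ modelE ι, μ t s = 0 := by
  -- A nonzero functional that vanishes on the image of the differential serves as the final value
  -- of the covector.
  obtain ⟨ℓ, hℓ, hker⟩ := Submodule.exists_le_ker_of_lt_top (LinearMap.range A)
    (lt_top_iff_ne_top.2 fun h ↦ hns (LinearMap.range_eq_top.1 h))
  obtain ⟨μ, hμ, hμT⟩ := exists_covector_ode hT.le hB (LinearMap.toContinuousLinearMap ℓ)
  have hμT0 : μ T ≠ 0 := by
    rw [hμT]
    exact fun h ↦ hℓ (LinearMap.ext fun v ↦ DFunLike.congr_fun h v)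
  refine ⟨μ, hμ, covector_ne_zero hT.le hB hμ hμT0, ?_⟩
  let ι' : 𝔢 →L[ℝ] F := ι
  obtain ⟨ρ₀, hρ₀⟩ := LinearMap.exists_leftInverse_of_injective (ι' : 𝔢 →ₗ[ℝ] F)
    (LinearMap.ker_eq_bot.2 hι)
  let ρ : F →L[ℝ] 𝔢 := LinearMap.toContinuousLinearMap ρ₀
  have hρ : ∀ v, ρ (ι' v) = v := fun v ↦ LinearMap.congr_fun hρ₀ v
  have hμc := hμ.continuousOn hT.le
  -- The Riesz vector of the restriction of `μ t` to `𝔢`. Steering with `v = m` makes `d/dt μ(z) =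
  -- ‖m‖ ^ 2`.
  let m : ℝ → 𝔢 := fun t ↦ (InnerProductSpace.toDual ℝ 𝔢).symm (μ t ∘L ι')
  have hm : ContinuousOn m (Icc 0 T) :=
    (InnerProductSpace.toDual ℝ 𝔢).symm.continuous.comp_continuousOn (hμc.clm_comp continuousOn_const)
  have hmv : ∀ t v, inner ℝ (m t) v = μ t (ι' v) := fun t v ↦
    InnerProductSpace.toDual_symm_apply
  have hα := intervalIntegrable_control (ι := ι) (η := η₀) hT.le hσ
  have hιm : IntervalIntegrable (fun t ↦ ι' (m t)) volume 0 T := by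
    have := ι'.continuous.comp_continuousOn hm
    rw [← uIcc_of_le hT.le] at this
    exact this.intervalIntegrable
  -- The control `k` has to cancel `K α`, but `K` itself depends on `k`. To break the circle, solve
  -- first with `K α` replaced by its part `(1 - ι ρ) K α`, which no control can produce. Then read
  -- off `k = Σ^{-1/2} (m - ρ K α)`. This gives a genuine variation, so `K` preserves `ι(𝔢)` and the
  -- leftover part is zero.
  obtain ⟨z, K, hz, hK, hz0, hK0⟩ := exists_variation_ode hT.le hα hB hC hιm
    (ContinuousLinearMap.id ℝ F - ι' ∘L ρ)
  obtain ⟨I, hI, hI'⟩ := exists_inverse_sqrtCovariance hσ hA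
  have hKc := hK.continuousOn hT.le
  have hk1 : MemLp (fun t ↦ m t - ρ (K t (controlMap ι σ t (η₀ t)))) 2
      (volume.restrict (Icc 0 T)) := by
    refine (memLp_of_continuousOn hm).sub ?_
    obtain ⟨_, -, h1, -⟩ := memLp_clm_apply (B := fun t ↦ ρ ∘L K t)
      (continuousOn_const.clm_comp hKc) (memLp_control (ι := ι) (η := η₀) hσ)
    exact h1
  obtain ⟨_, -, hk2, -⟩ := memLp_clm_apply hI hk1
  have hvar : IsVariation (controlMap ι σ) η₀ B C hk2.toLp z K 0 T := by
    refine ⟨hz.congr hT.le (fun _ _ ↦ rfl) ?_, hK⟩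
    filter_upwards [hk2.coeFn_toLp, ae_restrict_mem measurableSet_Icc] with t ht htm
    rw [ht]
    change _ = ι' (sqrtCovariance σ t (I t _)) + _ + _
    rw [(hI' t htm _).1]
    simp only [_root_.sub_apply, ContinuousLinearMap.comp_apply, map_sub,
      ContinuousLinearMap.id_apply]
    abel
  have hKE : ∀ t ∈ Icc 0 T, ∀ s ∈ modelE ι, K t s ∈ modelE ι := fun t ht s hs ↦
    hvar.apply_mem hE h h0 hP0 htr hz0 hK0 ht hs
  have hzT : μ T (z T) = 0 := by
    rw [← hAk _ z K hvar hz0 hK0, hμT]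
    exact hker ⟨_, rfl⟩
  -- The terms with `B` cancel by the equation of `μ`, and `(1 - ι ρ) K α` vanishes since `K α` is
  -- in `ι(𝔢)`. As `μ(z)` is zero at both ends, `∫ ‖m‖ ^ 2 = 0`.
  have hder := (hμ.apply hT.le hz).congr_fun (g := fun t ↦ μ t (z t))
    (g' := fun t ↦ ‖m t‖ ^ 2) hT.le (fun _ _ ↦ rfl) fun t ht ↦ by
      obtain ⟨w, hw⟩ := hKE t ht _ (controlMap_mem (ι := ι) (σ := σ) t (η₀ t))
      have hw' : K t (controlMap ι σ t (η₀ t)) = ι' w := hw.symm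
      simp only [hw', _root_.sub_apply, ContinuousLinearMap.comp_apply, hρ,
        ContinuousLinearMap.id_apply, sub_self, add_zero, map_add, _root_.neg_apply]
      rw [← hmv, real_inner_self_eq_norm_sq]
      ring
  have hint : ∫ t in (0 : ℝ)..T, ‖m t‖ ^ 2 = 0 := by
    have h1 := hder.2 T ⟨hT.le, le_rfl⟩
    simpa [hz0, hzT] using h1.symm
  intro t ht s hs
  obtain ⟨v, rfl⟩ := hs
  have h1 := hmv t v
  rw [eq_zero_of_integral_sq_norm hT hm hint t ht, inner_zero_left] at h1
  exact h1.symm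

end Covector

/-! ### One-forms along the curve and recovery of the control -/

section Singular

set_option linter.unusedSectionVars false
set_option synthInstance.maxHeartbeats 200000

variable {F : Type*} [NormedAddCommGroup F] [NormedSpace ℝ F] [FiniteDimensional ℝ F]
  {M : Type*} [TopologicalSpace M] [ChartedSpace F M] [IsManifold 𝓘(ℝ, F) ∞ M] [T2Space M]
  {cov : CovariantDerivative 𝓘(ℝ, F) F (TangentSpace 𝓘(ℝ, F) : M → Type _)}
  [CovariantDerivative.ContMDiffCovariantDerivative cov ∞]
  {𝔢 : Type*} [NormedAddCommGroup 𝔢] [InnerProductSpace ℝ 𝔢] [FiniteDimensional ℝ 𝔢]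
  {T : ℝ} {u : ℝ → ∀ x : M, TangentSpace 𝓘(ℝ, F) x} {o : M}
  {γ : ℝ → M} {P : ℝ → F →L[ℝ] F} {a b t : ℝ} {B : ℝ → F →L[ℝ] F} {μ : ℝ → F →L[ℝ] ℝ}
  {ι : 𝔢 →L[ℝ] TangentSpace 𝓘(ℝ, F) o} {J : ℕ} {σ : Fin J → ℝ → 𝔢}

/-- A linear functional on the model space, as a covector. -/
def asCovector (x : M) (ℓ : F →L[ℝ] ℝ) : TangentSpace 𝓘(ℝ, F) x →L[ℝ] ℝ := ℓ

/-- A covector, as a linear functional on the model space. -/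
def ofCovector {x : M} (ℓ : TangentSpace 𝓘(ℝ, F) x →L[ℝ] ℝ) : F →L[ℝ] ℝ := ℓ

theorem inverse_apply_of_injective {p : F →L[ℝ] F} (hp : Function.Injective p) (v : F) :
    p (p.inverse v) = v ∧ p.inverse (p v) = v :=
  (continuousOn_inverse (s := {()}) (p := fun _ ↦ p) continuousOn_const fun _ _ ↦ hp).2 () rfl v

theorem IsTransport.mem_fiberE_iff (hE : HolonomyPreserves cov ι) (hP : IsTransport cov γ P 0 T)
    (h0 : γ 0 = o) (hP0 : P 0 = ContinuousLinearMap.id ℝ F) (ht : t ∈ Icc 0 T)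
    {z : TangentSpace 𝓘(ℝ, F) (γ t)} : z ∈ fiberE cov ι (γ t) ↔ ∃ s ∈ modelE ι, P t s = vec z :=
  have hT0 : (0 : ℝ) ∈ Icc 0 T := ⟨le_rfl, ht.1.trans ht.2⟩
  ((hP.mono hT0 ht).mapsToE hE ht.1 h0 hP0).mem_fiberE_iff hE
    (hP.injective hT0 ht (by rw [hP0]; exact Function.injective_id))

/-- The one-form along `γ` with components `μ` in the moving frame. -/
theorem exists_oneForm (hT : 0 < T) (hE : HolonomyPreserves cov ι) (hP : IsTransport cov γ P 0 T)
    (h0 : γ 0 = o) (hP0 : P 0 = ContinuousLinearMap.id ℝ F)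
    (hPB : ∀ᵐ t ∂(volume.restrict (Icc 0 T)), ∀ w, P t (B t w) = jacobiField cov u γ t (P t w))
    (hμ : HasACDeriv μ (fun t ↦ -(μ t ∘L B t)) 0 T) (hμ0 : ∀ t ∈ Icc 0 T, μ t ≠ 0)
    (hμE : ∀ t ∈ Icc 0 T, ∀ s ∈ modelE ι, μ t s = 0) :
    ∃ lam Dlam : ∀ t, TangentSpace 𝓘(ℝ, F) (γ t) →L[ℝ] ℝ,
      HasCovariantDerivAlong cov o T γ lam Dlam ∧ (∀ t ∈ Icc 0 T, lam t ≠ 0) ∧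
      (∀ t ∈ Icc 0 T, ∀ z ∈ fiberE cov ι (γ t), lam t z = 0) ∧
      ∀ᵐ t ∂(volume.restrict (Icc 0 T)),
        Dlam t + (lam t) ∘L (cov (u t) (γ t)) +
          (lam t) ∘L (cov.torsion (γ t) (velocity γ t)) = 0 := by
  have hinj : ∀ t ∈ Icc 0 T, Function.Injective (P t) := fun t ht ↦
    hP.injective ⟨le_rfl, hT.le⟩ ht (by rw [hP0]; exact Function.injective_id)
  have hinv := fun t ht ↦ inverse_apply_of_injective (hinj t ht)
  let lam : ℝ → F →L[ℝ] ℝ := fun t ↦ μ t ∘L (P t).inverse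
  let Dlam : ℝ → F →L[ℝ] ℝ := fun t ↦ -(μ t ∘L B t) ∘L (P t).inverse
  have hlam : ∀ t ∈ Icc 0 T, ∀ v, lam t (P t v) = μ t v := fun t ht v ↦ by
    change μ t ((P t).inverse (P t v)) = _
    rw [(hinv t ht v).2]
  have hDlam : ∀ t ∈ Icc 0 T, ∀ v, Dlam t (P t v) = -μ t (B t v) := fun t ht v ↦ by
    change (-(μ t ∘L B t)) ((P t).inverse (P t v)) = _
    rw [(hinv t ht v).2]
    rfl
  refine ⟨fun t ↦ asCovector (γ t) (lam t), fun t ↦ asCovector (γ t) (Dlam t),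
    ⟨ofAsModel o γ P, hP.isParallelTransport h0 hP0, fun v ↦ ?_⟩, fun t ht h ↦ ?_,
    fun t ht z hz ↦ ?_, ?_⟩
  · have h1 : HasACDeriv (fun t ↦ lam t (P t v)) (fun t ↦ Dlam t (P t v)) 0 T :=
      (hμ.clm_comp (ContinuousLinearMap.apply ℝ ℝ v)).congr_fun hT.le
        (fun t ht ↦ (hlam t ht v).symm) fun t ht ↦ (hDlam t ht v).symm
    exact ⟨h1.ac hT.le, h1.ae_hasDerivAt⟩
  · exact hμ0 t ht (ContinuousLinearMap.ext fun v ↦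
      (hlam t ht v).symm.trans (DFunLike.congr_fun h (P t v)))
  · obtain ⟨s, hs, e⟩ := (hP.mem_fiberE_iff hE h0 hP0 ht).1 hz
    change lam t (vec z) = 0
    rw [← e, hlam t ht, hμE t ht s hs]
  · filter_upwards [hPB, ae_restrict_mem measurableSet_Icc] with t hBt ht
    refine ContinuousLinearMap.ext fun w ↦ ?_
    have e1 := hDlam t ht ((P t).inverse (vec w))
    have e2 := hlam t ht (B t ((P t).inverse (vec w)))
    have e3 := hBt ((P t).inverse (vec w))
    rw [(hinv t ht _).1] at e1 e3
    rw [e3] at e2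
    have e4 : lam t (jacobiField cov u γ t (vec w)) =
      lam t (vec (cov (u t) (γ t) w)) + lam t (vec (cov.torsion (γ t) (velocity γ t) w)) :=
      map_add (lam t) _ _
    change Dlam t (vec w) + lam t (vec (cov (u t) (γ t) w)) +
      lam t (vec (cov.torsion (γ t) (velocity γ t) w)) = 0
    rw [add_assoc, ← e4, e1, e2]
    ring

/-- The components in a moving frame of a one-form that solves the adjoint equation. -/
theorem hasACDeriv_components (hT : 0 < T)
    (hB : IntervalIntegrable B volume 0 T)
    (hPB : ∀ᵐ t ∂(volume.restrict (Icc 0 T)), ∀ w, P t (B t w) = jacobiField cov u γ t (P t w))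
    {lam Dlam : ∀ t, TangentSpace 𝓘(ℝ, F) (γ t) →L[ℝ] ℝ}
    (hlam : ∀ v : F, AbsolutelyContinuousOnInterval (fun t ↦ ofCovector (lam t) (P t v)) 0 T ∧
      ∀ᵐ t ∂(volume.restrict (Icc 0 T)),
        HasDerivAt (fun s ↦ ofCovector (lam s) (P s v)) (ofCovector (Dlam t) (P t v)) t)
    (heq : ∀ᵐ t ∂(volume.restrict (Icc 0 T)),
      Dlam t + (lam t) ∘L (cov (u t) (γ t)) +
        (lam t) ∘L (cov.torsion (γ t) (velocity γ t)) = 0) :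
    HasACDeriv (fun t ↦ ofCovector (lam t) ∘L P t)
      (fun t ↦ -((ofCovector (lam t) ∘L P t) ∘L B t)) 0 T := by
  set μ : ℝ → F →L[ℝ] ℝ := fun t ↦ ofCovector (lam t) ∘L P t with hμ
  -- The hypothesis gives continuity of each component, which suffices in finite dimension and makes
  -- `μ ∘ B` integrable.
  have hμc : ContinuousOn μ (Icc 0 T) := by
    refine continuousOn_clm_apply.2 fun v ↦ ?_
    have := (hlam v).1.continuousOn
    rwa [uIcc_of_le hT.le] at this
  have hint : IntervalIntegrable (fun t ↦ -(μ t ∘L B t)) volume 0 T :=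
    (intervalIntegrable_clm_apply (B := fun t ↦ ContinuousLinearMap.compL ℝ F F ℝ (μ t)) hT.le
      ((ContinuousLinearMap.compL ℝ F F ℝ).continuous.comp_continuousOn hμc) hB).neg
  refine HasACDeriv.of_clm_apply hint fun v ↦ HasACDeriv.of_ac hT.le (hlam v).1 ?_ ?_
  · rw [intervalIntegrable_iff_integrableOn_Icc_of_le hT.le] at *
    exact (ContinuousLinearMap.apply ℝ ℝ v : (F →L[ℝ] ℝ) →L[ℝ] ℝ).integrable_comp hint
  · filter_upwards [(hlam v).2, hPB, heq] with t h1 h2 h3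
    refine h1.congr_deriv ?_
    have h4 := DFunLike.congr_fun h3 (unvec (γ t) (P t v))
    have e4 : ofCovector (lam t) (jacobiField cov u γ t (P t v)) =
      ofCovector (lam t) (vec (cov (u t) (γ t) (unvec (γ t) (P t v)))) +
        ofCovector (lam t) (vec (cov.torsion (γ t) (velocity γ t) (unvec (γ t) (P t v)))) :=
      map_add (ofCovector (lam t)) _ _
    have h5 : ofCovector (Dlam t) (P t v) + ofCovector (lam t) (jacobiField cov u γ t (P t v)) = 0 := by
      rw [e4, ← add_assoc]
      exact h4
    change _ = -(ofCovector (lam t) (P t (B t v)))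
    rw [h2]
    linarith

/-- The velocity of a curve in `H¹` is square integrable in a moving frame. -/
theorem memLp_frame_velocity (hT : 0 < T)
    (hu : ContMDiffOn (𝓘(ℝ, ℝ).prod 𝓘(ℝ, F)) 𝓘(ℝ, F).tangent ∞
      (fun p : ℝ × M ↦ (⟨p.2, u p.1 p.2⟩ : TangentBundle 𝓘(ℝ, F) M)) (Icc 0 T ×ˢ univ))
    (hγ : IsH1Curve F γ 0 T) (hP : IsTransport cov γ P 0 T)
    (hinj : ∀ t ∈ Icc 0 T, Function.Injective (P t)) :
    MemLp (fun t ↦ (P t).inverse (vec (velocity (F := F) γ t) - vec (u t (γ t)))) 2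
      (volume.restrict (Icc 0 T)) := by
  have hinv := fun t ht ↦ inverse_apply_of_injective (hinj t ht)
  refine interval_induction_chart F (p := fun c d ↦ MemLp (fun t ↦ (P t).inverse
    (vec (velocity (F := F) γ t) - vec (u t (γ t)))) 2 (volume.restrict (Icc c d))) hγ.1 hT.le
    (fun x₀ c d hcd hc hd hmap ↦ ?_) fun c m d hcm hmd _ _ h1 h2 ↦ memLp_glue h1 h2 hcm hmd
  have hsub : Icc c d ⊆ Icc 0 T := Icc_subset_Icc hc.1 hd.2
  have hyc := (hP.hasACDeriv hcd hc hd hmap).continuousOn hcd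
  have hp : ContinuousOn (fun t ↦ (chartState x₀ γ P t).2) (Icc c d) :=
    continuous_snd.comp_continuousOn hyc
  obtain ⟨hq, hpq⟩ := continuousOn_inverse hp fun t ht ↦
    (coordMap_injective (hmap ht)).comp (hinj t (hsub ht))
  have hU := continuousOn_fieldCoord_curve hu (hγ.1.mono hsub) hsub hmap
  obtain ⟨_, -, h1, -⟩ := memLp_clm_apply hq
    ((hγ.2 x₀ c d hcd hsub hmap).2.sub (memLp_of_continuousOn hU))
  refine h1.ae_eq ?_
  filter_upwards [(hP.isACCurve.2 x₀ c d hcd hsub hmap).ae_hasDerivAt, ae_mem_Ioo c d] with t ht htm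
  have htc := Ioo_subset_Icc_self htm
  refine ((coordMap_injective (hmap htc)).comp (hinj t (hsub htc))) ?_
  have e1 := (hpq t htc (deriv (fun t ↦ chartAt F x₀ (γ t)) t -
    fieldCoord (u t) x₀ (chartAt F x₀ (γ t)))).1
  refine e1.trans ?_
  rw [Function.comp_apply, (hinv t (hsub htc) _).1, map_sub, coordMap_field (u t) (hmap htc),
    coordMap_velocity (hmap htc) (hγ.1.continuousAt (mem_of_superset
      (Icc_mem_nhds htm.1 htm.2) hsub)) ht]

/-- A curve whose velocity lies in `E`, up to `u`, is the solution for some control. -/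
theorem exists_isDevelopment (hT : 0 < T)
    (hu : ContMDiffOn (𝓘(ℝ, ℝ).prod 𝓘(ℝ, F)) 𝓘(ℝ, F).tangent ∞
      (fun p : ℝ × M ↦ (⟨p.2, u p.1 p.2⟩ : TangentBundle 𝓘(ℝ, F) M)) (Icc 0 T ×ˢ univ))
    (hι : Function.Injective ι) (hσ : ∀ j, ContinuousOn (σ j) (Icc 0 T))
    (hA : ∀ t ∈ Icc 0 T, Function.Surjective (covariance σ t)) (hE : HolonomyPreserves cov ι)
    (hγ : IsH1Curve F γ 0 T) (h0 : γ 0 = o) (hP : IsTransport cov γ P 0 T)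
    (hP0 : P 0 = ContinuousLinearMap.id ℝ F)
    (hv : ∀ᵐ t ∂(volume.restrict (Icc 0 T)), velocity γ t - u t (γ t) ∈ fiberE cov ι (γ t)) :
    ∃ η : CameronMartin T 𝔢, IsDevelopment cov u (fun t ↦ controlMap ι σ t (η t)) γ P 0 T := by
  have hinj : ∀ t ∈ Icc 0 T, Function.Injective (P t) := fun t ht ↦
    hP.injective ⟨le_rfl, hT.le⟩ ht (by rw [hP0]; exact Function.injective_id)
  have hinv := fun t ht ↦ inverse_apply_of_injective (hinj t ht)
  let ι' : 𝔢 →L[ℝ] F := ι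
  obtain ⟨ρ₀, hρ₀⟩ := LinearMap.exists_leftInverse_of_injective (ι' : 𝔢 →ₗ[ℝ] F)
    (LinearMap.ker_eq_bot.2 hι)
  let ρ : F →L[ℝ] 𝔢 := LinearMap.toContinuousLinearMap ρ₀
  have hρ : ∀ v, ρ (ι' v) = v := fun v ↦ LinearMap.congr_fun hρ₀ v
  obtain ⟨I, hI, hI'⟩ := exists_inverse_sqrtCovariance hσ hA
  -- The control is `Σ^{-1/2} ρ P⁻¹ (γ' - u)`. The choice of the left inverse `ρ` of `ι` is
  -- immaterial, because `P⁻¹ (γ' - u)` lies in `ι(𝔢)` almost everywhere.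
  obtain ⟨_, -, hη, -⟩ := memLp_clm_apply (B := fun t ↦ I t ∘L ρ) (hI.clm_comp continuousOn_const)
    (memLp_frame_velocity hT hu hγ hP hinj)
  refine ⟨hη.toLp, hP.isDevelopment ?_⟩
  filter_upwards [hη.coeFn_toLp, hv, ae_restrict_mem measurableSet_Icc] with t ht hvt htm
  obtain ⟨_, ⟨w, rfl⟩, e⟩ := (hP.mem_fiberE_iff hE h0 hP0 htm).1 hvt
  have e' : P t (ι' w) = vec (velocity (F := F) γ t) - vec (u t (γ t)) := e
  rw [ht, ← e', (hinv t htm _).2]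
  change _ = P t (ι' (sqrtCovariance σ t (I t (ρ (ι' w))))) + _
  rw [hρ, (hI' t htm w).1, e', sub_add_cancel]

end Singular

end AffineDev

end

/-! ### Singular curves and the adjoint equation -/

theorem mainTheorem2
    {F : Type*} [NormedAddCommGroup F] [NormedSpace ℝ F] [FiniteDimensional ℝ F]
    {M : Type*} [TopologicalSpace M] [ChartedSpace F M] [IsManifold 𝓘(ℝ, F) ∞ M] [T2Space M]
    (cov : CovariantDerivative 𝓘(ℝ, F) F (TangentSpace 𝓘(ℝ, F) : M → Type _))
    [CovariantDerivative.ContMDiffCovariantDerivative cov ∞]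
    (o : M) (T : ℝ) (hT : 0 < T)
    (u : ℝ → ∀ x : M, TangentSpace 𝓘(ℝ, F) x)
    (hu : ContMDiffOn (𝓘(ℝ, ℝ).prod 𝓘(ℝ, F)) 𝓘(ℝ, F).tangent ∞
      (fun p : ℝ × M ↦ (⟨p.2, u p.1 p.2⟩ : TangentBundle 𝓘(ℝ, F) M)) (Icc 0 T ×ˢ univ))
    {𝔢 : Type*} [NormedAddCommGroup 𝔢] [InnerProductSpace ℝ 𝔢] [FiniteDimensional ℝ 𝔢]
    (ι : 𝔢 →L[ℝ] TangentSpace 𝓘(ℝ, F) o) (hι : Function.Injective ι)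
    {J : ℕ} (σ : Fin J → ℝ → 𝔢) (hσ : ∀ j, ContDiffOn ℝ ∞ (σ j) (Icc 0 T))
    (hA : ∀ t ∈ Icc 0 T, Function.Surjective (AffineDev.covariance σ t))
    (hB : AffineDev.HolonomyPreserves cov ι)
    (γ : ℝ → M) (hγ : AffineDev.IsH1Curve F γ 0 T) (hγ₀ : γ 0 = o) :
    AffineDev.IsSingularCurve cov ι σ u T γ ↔
      (∀ᵐ t ∂(volume.restrict (Icc 0 T)),
        AffineDev.velocity γ t - u t (γ t) ∈ AffineDev.fiberE cov ι (γ t)) ∧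
      ∃ lam Dlam : ∀ t, TangentSpace 𝓘(ℝ, F) (γ t) →L[ℝ] ℝ,
        AffineDev.HasCovariantDerivAlong cov o T γ lam Dlam ∧
        (∀ t ∈ Icc 0 T, lam t ≠ 0) ∧
        (∀ t ∈ Icc 0 T, ∀ z ∈ AffineDev.fiberE cov ι (γ t), lam t z = 0) ∧
        ∀ᵐ t ∂(volume.restrict (Icc 0 T)),
          Dlam t + (lam t) ∘L (cov (u t) (γ t))
            + (lam t) ∘L (cov.torsion (γ t) (AffineDev.velocity γ t)) = 0 := by
  have hσ' : ∀ j, ContinuousOn (σ j) (Icc 0 T) := fun j ↦ (hσ j).continuousOn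
  have hT0 : (0 : ℝ) ∈ Icc 0 T := ⟨le_rfl, hT.le⟩
  constructor
  · rintro ⟨η, hsol, hreg⟩
    obtain ⟨P, hP, -, hP0⟩ := hsol.exists_isDevelopment
    have hPt := hP.isTransport
    obtain ⟨B, hBi, hPB⟩ := AffineDev.exists_jacobiOperator cov hT hu hPt fun t ht ↦
      hPt.injective hT0 ht (by rw [hP0]; exact Function.injective_id)
    obtain ⟨C, hC, htr⟩ := AffineDev.exists_transportsVariation (o := o) hT hu
      (AffineDev.continuousOn_controlMap hσ') hP (fun t ht ↦
        hPt.injective hT0 ht (by rw [hP0]; exact Function.injective_id)) hPB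
    obtain ⟨A, hA1, hA2⟩ := AffineDev.exists_endpointDerivative hT hu hσ' hP hγ₀ hP0 htr
    -- The endpoint map is always differentiable at a control with a solution, so failure of
    -- regularity means failure of surjectivity.
    obtain ⟨μ, hμ, hμ0, hμE⟩ := AffineDev.exists_covector hT hι hB hσ' hA hP hγ₀ hP0 hBi hC htr
      (fun h ↦ hreg (hA1.2 h)) hA2
    refine ⟨?_, AffineDev.exists_oneForm hT hB hPt hγ₀ hP0 hPB hμ hμ0 hμE⟩
    filter_upwards [hP.ae_velocity hT.le, ae_restrict_mem measurableSet_Icc] with t ht htm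
    exact (hPt.mem_fiberE_iff hB hγ₀ hP0 htm).2
      ⟨_, AffineDev.controlMap_mem t (η t), eq_sub_of_add_eq ht.symm⟩
  · rintro ⟨hv, lam, Dlam, ⟨P', hP', hlam⟩, hlam0, hlamE, heq⟩
    obtain ⟨hPt, hP0⟩ := AffineDev.IsTransport.of_isParallelTransport hγ.isACCurve hP'
    set P := AffineDev.asModel P'
    obtain ⟨η, hP⟩ := AffineDev.exists_isDevelopment hT hu hι hσ' hA hB hγ hγ₀ hPt hP0 hv
    refine ⟨η, hP.isSolution hu hT.le hσ' hγ₀ hP0, fun hreg ↦ ?_⟩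
    have hinj : ∀ t ∈ Icc 0 T, Function.Injective (P t) := fun t ht ↦
      hPt.injective hT0 ht (by rw [hP0]; exact Function.injective_id)
    obtain ⟨B, hBi, hPB⟩ := AffineDev.exists_jacobiOperator cov hT hu hPt hinj
    obtain ⟨C, hC, htr⟩ := AffineDev.exists_transportsVariation (o := o) hT hu
      (AffineDev.continuousOn_controlMap hσ') hP hinj hPB
    obtain ⟨A, hA1, hA2⟩ := AffineDev.exists_endpointDerivative hT hu hσ' hP hγ₀ hP0 htr
    have hμ := AffineDev.hasACDeriv_components hT hBi hPB hlam heq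
    have hTm : T ∈ Icc 0 T := ⟨hT.le, le_rfl⟩
    -- If the control were regular, every `P_T⁻¹ w` would be the final value `z T` of some
    -- variation, and the backward covector kills those. So `lam T` would vanish on every `w`.
    refine hlam0 T hTm (ContinuousLinearMap.ext fun w ↦ ?_)
    obtain ⟨k, hk⟩ := hA1.1 hreg ((P T).inverse (AffineDev.vec w))
    obtain ⟨z, K, hz, hK, hz0, hK0⟩ := AffineDev.exists_variation_ode hT.le
      (AffineDev.intervalIntegrable_control (ι := ι) (η := η) hT.le hσ') hBi hC
      (AffineDev.intervalIntegrable_control (ι := ι) (η := k) hT.le hσ')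
      (ContinuousLinearMap.id ℝ F)
    have hvar : AffineDev.IsVariation (AffineDev.controlMap ι σ) η B C k z K 0 T := ⟨hz, hK⟩
    have h1 := hvar.covector_apply_eq_zero hT.le AffineDev.controlMap_mem
      (fun t ht s hs ↦ hvar.apply_mem hB hP hγ₀ hP0 htr hz0 hK0 ht hs) hz0 hμ
      fun t ht s hs ↦ hlamE t ht _ ((hPt.mem_fiberE_iff hB hγ₀ hP0 ht).2 ⟨s, hs, rfl⟩)
    rw [← hA2 k z K hvar hz0 hK0, hk, ContinuousLinearMap.comp_apply,
      (AffineDev.inverse_apply_of_injective (hinj T hTm) _).1] at h1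
    exact h1
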